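/- Let $D$ be an oriented link diagram in the annulus $A=\mathbb R^2\setminus\{0\}$, with $n_+$ positive and $n_-$ negative crossings, and fix an ordering of its crossings. For a set $\alpha$ of crossings let $D_\alpha$ be the complete resolution in which the crossings in $\alpha$ are $1$-resolved and the others $0$-resolved. The rational Khovanov complex $CKh(D)$ has as basis the pairs $(\alpha,\varepsilon)$, where $\varepsilon$ labels every cycle of $D_\alpha$ by $v_+$ or $v_-$. Such a generator has homological grading $|\alpha|-n_-$, Euler (quantum) grading $\#v_+-\#v_-+|\alpha|+n_+-2n_-$, and annular grading equal to the number of $v_+$ minus the number of $v_-$ among the labels of the cycles of $D_\alpha$ that enclose the puncture $0$. Let $d_{Kh}$ be the Khovanov differential, i.e. the signed sum over the edges of the cube of resolutions of the maps induced by $v_+v_+=v_+$, $v_+v_-=v_-v_+=v_-$, $v_-v_-=0$ (merging two cycles) and $\Delta v_+=v_+\otimes v_-+v_-\otimes v_+$, $\Delta v_-=v_-\otimes v_-$ (splitting a cycle). Let $d_{Kh}^{0}$ and $d_{Kh}^{-2}$ be the parts of $d_{Kh}$ that change the annular grading by $0$ and by $-2$. Let $\beta$ be a variable of homological and Euler grading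 $0$ and annular grading $+2$. Then: (1) $d_{Kh}=d_{Kh}^{0}+d_{Kh}^{-2}$, and $\tilde d=d_{Kh}^{0}+\beta\, d_{Kh}^{-2}$ makes $CKh(D)\otimes_{\mathbb Q}\mathbb Q[\beta]$ a complex of free graded $\mathbb Q[\beta]$-modules: $\tilde d^2=0$, and $\tilde d$ is $\mathbb Q[\beta]$-linear, raises the homological grading by $1$ and preserves the Euler and annular gradings. (2) The homotopy type of this complex is an invariant of oriented annular links: if $D$ and $D'$ are related by planar isotopies of $A$ and Reidemeister moves in $A$ (that is, they represent isotopic oriented links in the thickened annulus), then $(CKh(D)\otimes\mathbb Q[\beta],\tilde d)$ and $(CKh(D')\otimes\mathbb Q[\beta],\tilde d)$ are chain homotopy equivalent over $\mathbb Q[\beta]$, by chain maps that preserve all three gradings and homotopies that lower the homological grading by $1$ and preserve the other two. -/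

import Mathlib

open Polynomial

/-! ## Oriented annular link diagrams

The annulus is the plane minus the marked point.  It is cut open along a ray from the marked point
to infinity, and a diagram in general position with respect to the angular coordinate is read as a
stack of elementary pieces on parallel strands, whose top is glued to its bottom.  The upward
direction is counterclockwise, and the strands at a given angle are numbered from left to right,
strand `0` being the one closest to the marked point.  At a given angle, the diagram is recorded by
the list of the directions of its strands (`true` is upward). -/

/-- The elementary pieces: a local minimum, which creates two strands, the left one having direction
`a` and the right one the opposite direction; a local maximum, which joins two strands; a crossing of
two strands, in which the strand from the lower left to the upper right is the overstrand if `o` is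
`true` and the understrand if `o` is `false`. -/
inductive PieceKind where
  | cup (a : Bool)
  | cap
  | cross (o : Bool)
deriving DecidableEq

/-- Number of strands that enter an elementary piece from below. -/
def PieceKind.inn : PieceKind → ℕ
  | cup _ => 0
  | cap => 2
  | cross _ => 2

/-- Number of strands that leave an elementary piece at the top. -/
def PieceKind.out : PieceKind → ℕ
  | cup _ => 2
  | cap => 0
  | cross _ => 2

/-- Whether an elementary piece is a crossing. -/
def PieceKind.isCross : PieceKind → Bool
  | cup _ => false
  | cap => false
  | cross _ => true

/-- A horizontal slice of a diagram: one elementary piece with `pos` vertical strands on its left,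
and any number of vertical strands on its right. -/
structure Slice where
  pos : ℕ
  kind : PieceKind

/-- The slice can be put on top of strands with directions `s`. -/
def Slice.Admissible (e : Slice) (s : List Bool) : Prop :=
  match e.kind with
  | .cup _ => e.pos ≤ s.length
  | .cap => ∃ a : Bool, s[e.pos]? = some a ∧ s[e.pos + 1]? = some (!a)
  | .cross _ => e.pos + 1 < s.length

/-- The directions of the strands above the slice, in terms of those below. -/
def Slice.next (e : Slice) (s : List Bool) : List Bool :=
  match e.kind with
  | .cup a => s.take e.pos ++ a :: (!a) :: s.drop e.pos
  | .cap => s.take e.pos ++ s.drop (e.pos + 2)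
  | .cross _ => s.take e.pos ++ ((s.drop e.pos).take 2).reverse ++ s.drop (e.pos + 2)

/-- The directions of the strands above a stack of slices. -/
def runSlices (w : List Slice) (s : List Bool) : List Bool :=
  w.foldl (fun s e => e.next s) s

/-- An oriented link diagram in the annulus. -/
structure AnnularDiagram where
  /-- the directions of the strands along the cutting ray -/
  base : List Bool
  /-- the slices, from bottom to top -/
  word : List Slice
  admissible : ∀ k (hk : k < word.length), word[k].Admissible (runSlices (word.take k) base)
  closed : runSlices word base = base

/-! ## Annular isotopy -/

/-- Local moves between stacks of slices: the planar isotopies (exchange of distant pieces,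
cancellation of a minimum with a maximum, passing a strand across a minimum or a maximum) and the
three Reidemeister moves, for all directions of the strands. -/
inductive LocalMove : List Slice → List Slice → Prop
  | exchange (i d : ℕ) (S T : PieceKind) :
      LocalMove [⟨i + S.inn + d, T⟩, ⟨i, S⟩] [⟨i, S⟩, ⟨i + S.out + d, T⟩]
  | zigzag_left (i : ℕ) (a : Bool) : LocalMove [⟨i + 1, .cup a⟩, ⟨i, .cap⟩] []
  | zigzag_right (i : ℕ) (a : Bool) : LocalMove [⟨i, .cup a⟩, ⟨i + 1, .cap⟩] []
  | slide_cup (i : ℕ) (a o : Bool) :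
      LocalMove [⟨i, .cup a⟩, ⟨i + 1, .cross o⟩] [⟨i + 1, .cup a⟩, ⟨i, .cross (!o)⟩]
  | slide_cap (i : ℕ) (o : Bool) :
      LocalMove [⟨i + 1, .cross o⟩, ⟨i, .cap⟩] [⟨i, .cross (!o)⟩, ⟨i + 1, .cap⟩]
  | reidemeister_one_right (i : ℕ) (a o : Bool) :
      LocalMove [⟨i + 1, .cup a⟩, ⟨i, .cross o⟩, ⟨i + 1, .cap⟩] []
  | reidemeister_one_left (i : ℕ) (a o : Bool) :
      LocalMove [⟨i, .cup a⟩, ⟨i + 1, .cross o⟩, ⟨i, .cap⟩] []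
  | reidemeister_two (i : ℕ) (o : Bool) : LocalMove [⟨i, .cross o⟩, ⟨i, .cross (!o)⟩] []
  /- The condition says that the three strands lie at three different heights, that is, that
  the relation of passing over is not cyclic. -/
  | reidemeister_three (i : ℕ) (o₁ o₂ o₃ : Bool) (h : o₂ = o₁ ∨ o₂ = o₃) :
      LocalMove [⟨i, .cross o₁⟩, ⟨i + 1, .cross o₂⟩, ⟨i, .cross o₃⟩]
        [⟨i + 1, .cross o₃⟩, ⟨i, .cross o₂⟩, ⟨i + 1, .cross o₁⟩]

namespace AnnularDiagram

/-- A move between annular diagrams: a local move, away from the cutting ray and the marked point, or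
a rotation of the annulus, which moves some slices across the cutting ray. -/
inductive Move : AnnularDiagram → AnnularDiagram → Prop
  | localMove (D D' : AnnularDiagram) (p u u' r : List Slice) (h : LocalMove u u')
      (hbase : D'.base = D.base) (hD : D.word = p ++ u ++ r) (hD' : D'.word = p ++ u' ++ r) :
      Move D D'
  | rotate (D D' : AnnularDiagram) (p r : List Slice) (hD : D.word = p ++ r)
      (hD' : D'.word = r ++ p) (hbase : D'.base = runSlices p D.base) : Move D D'

/-- Two diagrams represent isotopic oriented annular links: they are related by a finite sequence of
planar isotopies of the annulus and annular Reidemeister moves. -/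
def Isotopic : AnnularDiagram → AnnularDiagram → Prop :=
  Relation.EqvGen Move

/-! ## Complete resolutions and their cycles -/

variable (D : AnnularDiagram)

/-- The directions of the strands below the `k`-th slice. -/
def level (k : ℕ) : List Bool := runSlices (D.word.take k) D.base

/-- The points where the strands of the diagram meet the horizontal lines between the slices;
those at the top height `D.word.length` are glued to those at height `0` below. -/
abbrev Point : Type := Σ k : Fin (D.word.length + 1), Fin (D.level k).length

/-- The crossings of the diagram, ordered from bottom to top. -/
abbrev Crossing : Type := {k : Fin D.word.length // D.word[k].kind.isCross = true}

end AnnularDiagram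

/-- The pairs of boundary points that are joined inside a slice whose elementary piece has kind `e`
and position `i`.  The point `(false, j)` is the `j`-th one at the bottom of the slice and `(true, j)`
the `j`-th one at its top.  A crossing is replaced by its `0`-resolution if `ρ` is `false` and by its
`1`-resolution if `ρ` is `true`; if the overstrand goes from the lower left to the upper right, the
`0`-resolution consists of two vertical arcs and the `1`-resolution of two horizontal ones. -/
inductive Joins (i : ℕ) : PieceKind → Bool → Bool × ℕ → Bool × ℕ → Prop
  | left (e : PieceKind) (ρ : Bool) (j : ℕ) (hj : j < i) : Joins i e ρ (false, j) (true, j)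
  | right (e : PieceKind) (ρ : Bool) (d : ℕ) :
      Joins i e ρ (false, i + e.inn + d) (true, i + e.out + d)
  | cup (a ρ : Bool) : Joins i (.cup a) ρ (true, i) (true, i + 1)
  | cap (ρ : Bool) : Joins i .cap ρ (false, i) (false, i + 1)
  | vertical_left (o : Bool) : Joins i (.cross o) (!o) (false, i) (true, i)
  | vertical_right (o : Bool) : Joins i (.cross o) (!o) (false, i + 1) (true, i + 1)
  | horizontal_bottom (o : Bool) : Joins i (.cross o) o (false, i) (false, i + 1)
  | horizontal_top (o : Bool) : Joins i (.cross o) o (true, i) (true, i + 1)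

namespace AnnularDiagram

/-- Adjacency of points in the complete resolution in which the crossings in `α` are `1`-resolved and
the other ones `0`-resolved. -/
def Adj (D : AnnularDiagram) (α : Finset D.Crossing) (p q : D.Point) : Prop :=
  (∃ (k : Fin D.word.length) (b b' : Bool),
      (p.1 : ℕ) = k + b.toNat ∧ (q.1 : ℕ) = k + b'.toNat ∧
      Joins D.word[k].pos D.word[k].kind (decide (∃ c ∈ α, c.1 = k))
        (b, (p.2 : ℕ)) (b', (q.2 : ℕ))) ∨
  ((p.1 : ℕ) = D.word.length ∧ (q.1 : ℕ) = 0 ∧ (p.2 : ℕ) = q.2)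

/-- The cycles of a complete resolution. -/
def Cycle (D : AnnularDiagram) (α : Finset D.Crossing) : Type := Quot (D.Adj α)

/-- The cycle through a point. -/
def cycleOf (D : AnnularDiagram) (α : Finset D.Crossing) (p : D.Point) : D.Cycle α :=
  Quot.mk _ p

noncomputable instance (D : AnnularDiagram) (α : Finset D.Crossing) : Fintype (D.Cycle α) :=
  have : Finite (D.Cycle α) := inferInstanceAs (Finite (Quot (D.Adj α)))
  Fintype.ofFinite _

/-- A cycle is nontrivial if it encloses the marked point; for a simple closed curve this means that
it meets the cutting ray in an odd number of points. -/
def Nontriv (D : AnnularDiagram) {α : Finset D.Crossing} (z : D.Cycle α) : Prop :=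
  Odd (Nat.card {p : D.Point // (p.1 : ℕ) = 0 ∧ D.cycleOf α p = z})

/-! ## The Khovanov complex with its three gradings -/

/-- The standard generators of the Khovanov complex: a complete resolution together with a label
`v₊` (`true`) or `v₋` (`false`) on each of its cycles. -/
def Gen (D : AnnularDiagram) : Type := Σ α : Finset D.Crossing, (D.Cycle α → Bool)

noncomputable instance (D : AnnularDiagram) : Fintype D.Gen :=
  have : Finite D.Gen :=
    inferInstanceAs (Finite (Σ α : Finset D.Crossing, (D.Cycle α → Bool)))
  Fintype.ofFinite _

/-- A crossing is positive if its overstrand has to be turned counterclockwise (through less than a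
half turn) to get the direction of its understrand. -/
def Positive (D : AnnularDiagram) (c : D.Crossing) : Prop :=
  D.word[c.1].kind = .cross true ↔
    (D.level c.1)[D.word[c.1].pos]? = (D.level c.1)[D.word[c.1].pos + 1]?

/-- Number of positive crossings. -/
noncomputable def nPlus (D : AnnularDiagram) : ℤ := Nat.card {c : D.Crossing // D.Positive c}

/-- Number of negative crossings. -/
noncomputable def nMinus (D : AnnularDiagram) : ℤ := Nat.card {c : D.Crossing // ¬ D.Positive c}

/-- The contribution of a label to the gradings. -/
def labelDeg (b : Bool) : ℤ := if b then 1 else -1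

/-- Homological grading. -/
noncomputable def hDeg (D : AnnularDiagram) (g : D.Gen) : ℤ := g.1.card - D.nMinus

/-- Euler (quantum) grading. -/
noncomputable def qDeg (D : AnnularDiagram) (g : D.Gen) : ℤ :=
  ∑ z, labelDeg (g.2 z) + g.1.card + D.nPlus - 2 * D.nMinus

open Classical in
/-- Annular grading. -/
noncomputable def aDeg (D : AnnularDiagram) (g : D.Gen) : ℤ :=
  ∑ z, if D.Nontriv z then labelDeg (g.2 z) else 0

/-- The triple of gradings (homological, Euler, annular). -/
noncomputable def deg (D : AnnularDiagram) (g : D.Gen) : ℤ × ℤ × ℤ :=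
  (D.hDeg g, D.qDeg g, D.aDeg g)

theorem _root_.Slice.length_next_of_isCross {e : Slice} (h : e.kind.isCross = true)
    (s : List Bool) : (e.next s).length = s.length := by
  obtain ⟨i, k⟩ := e
  cases k with
  | cup a => cases h
  | cap => cases h
  | cross o =>
    simp only [Slice.next, List.length_append, List.length_take, List.length_reverse,
      List.length_drop]
    omega

theorem cross_pos_lt (D : AnnularDiagram) (c : D.Crossing) :
    D.word[c.1].pos + 1 < (D.level c.1).length := by
  have h := D.admissible c.1 c.1.isLt
  have hc := c.2
  simp only [Fin.getElem_fin] at hc ⊢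
  unfold Slice.Admissible at h
  unfold level
  cases hk : D.word[(c.1 : ℕ)].kind <;> simp_all [PieceKind.isCross]

theorem cross_pos_lt_succ (D : AnnularDiagram) (c : D.Crossing) :
    D.word[c.1].pos + 1 < (D.level (c.1 + 1)).length := by
  have h := D.cross_pos_lt c
  have hl : D.level (c.1 + 1) = D.word[c.1].next (D.level c.1) := by
    unfold level runSlices
    rw [List.take_add_one, List.foldl_append, List.getElem?_eq_getElem c.1.isLt]
    rfl
  rw [hl, Slice.length_next_of_isCross c.2]
  exact h

/-- The lower left one of the four points around a crossing. -/
def lowerLeft (D : AnnularDiagram) (c : D.Crossing) : D.Point :=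
  ⟨⟨c.1, by omega⟩, ⟨D.word[c.1].pos, by have := D.cross_pos_lt c; simp only; omega⟩⟩

/-- The upper right one of the four points around a crossing.  In both resolutions of the crossing,
`lowerLeft` and `upperRight` lie on the two different arcs. -/
def upperRight (D : AnnularDiagram) (c : D.Crossing) : D.Point :=
  ⟨⟨c.1 + 1, by omega⟩, ⟨D.word[c.1].pos + 1, D.cross_pos_lt_succ c⟩⟩

end AnnularDiagram

/-- The coefficient of `c` in the product `a * b`: `v₊ v₊ = v₊`, `v₊ v₋ = v₋ v₊ = v₋`,
`v₋ v₋ = 0`. -/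
def mulCoeff : Bool → Bool → Bool → ℚ
  | true, true, true => 1
  | true, false, false => 1
  | false, true, false => 1
  | _, _, _ => 0

/-- The coefficient of `b ⊗ c` in the coproduct of `a`: `Δ v₊ = v₊ ⊗ v₋ + v₋ ⊗ v₊`,
`Δ v₋ = v₋ ⊗ v₋`. -/
def comulCoeff : Bool → Bool → Bool → ℚ
  | true, true, false => 1
  | true, false, true => 1
  | false, false, false => 1
  | _, _, _ => 0

namespace AnnularDiagram

open Classical in
/-- The coefficient of `g'` in the image of `g` under the map of the cube of resolutions that changes
the crossing `c` from its `0`-resolution to its `1`-resolution: two cycles are merged or one is split,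
the labels of the other cycles do not change, and the sign counts the `1`-resolved crossings
before `c`. -/
noncomputable def edgeCoeff (D : AnnularDiagram) (c : D.Crossing) (g' g : D.Gen) : ℚ :=
  if c ∉ g.1 ∧ g'.1 = insert c g.1 ∧
      ∀ p : D.Point, D.cycleOf g.1 p ≠ D.cycleOf g.1 (D.lowerLeft c) →
        D.cycleOf g.1 p ≠ D.cycleOf g.1 (D.upperRight c) →
        g'.2 (D.cycleOf g'.1 p) = g.2 (D.cycleOf g.1 p)
  then (-1) ^ (g.1.filter (· < c)).card *
    (if D.cycleOf g.1 (D.lowerLeft c) = D.cycleOf g.1 (D.upperRight c) then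
      comulCoeff (g.2 (D.cycleOf g.1 (D.lowerLeft c)))
        (g'.2 (D.cycleOf g'.1 (D.lowerLeft c))) (g'.2 (D.cycleOf g'.1 (D.upperRight c)))
    else
      mulCoeff (g.2 (D.cycleOf g.1 (D.lowerLeft c))) (g.2 (D.cycleOf g.1 (D.upperRight c)))
        (g'.2 (D.cycleOf g'.1 (D.lowerLeft c))))
  else 0

/-- The matrix of the Khovanov differential in the standard generators (columns are sources). -/
noncomputable def dKh (D : AnnularDiagram) : Matrix D.Gen D.Gen ℚ :=
  Matrix.of fun g' g => ∑ c, D.edgeCoeff c g' g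

/-- The part of the Khovanov differential that changes the annular grading by `s`. -/
noncomputable def dKhPart (D : AnnularDiagram) (s : ℤ) : Matrix D.Gen D.Gen ℚ :=
  Matrix.of fun g' g => if D.aDeg g' = D.aDeg g + s then D.dKh g' g else 0

/-- The free `ℚ[β]`-module on the standard generators; the variable `β` is `X`. -/
abbrev Chain (D : AnnularDiagram) : Type := D.Gen → ℚ[X]

/-- The deformed differential `d⁰ + β d⁻²`. -/
noncomputable def dTilde (D : AnnularDiagram) : D.Chain →ₗ[ℚ[X]] D.Chain :=
  Matrix.mulVecLin ((D.dKhPart 0).map C + (X : ℚ[X]) • (D.dKhPart (-2)).map C)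

/-- The elements of degree `t`: the `ℚ`-combinations of the `β ^ n • g` with `deg g + (0, 0, 2 n) = t`,
as `β` has homological and Euler grading `0` and annular grading `2`. -/
noncomputable def homogeneous (D : AnnularDiagram) (t : ℤ × ℤ × ℤ) : Submodule ℚ D.Chain where
  carrier := {x | ∀ (g : D.Gen) (n : ℕ), (x g).coeff n ≠ 0 → D.deg g + (0, 0, 2 * (n : ℤ)) = t}
  add_mem' := by
    intro x y hx hy g n h
    by_cases hxn : (x g).coeff n = 0
    · exact hy g n fun hyn => h (by simp [hxn, hyn])
    · exact hx g n hxn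
  zero_mem' := by
    intro g n h
    simp at h
  smul_mem' := by
    intro r x hx g n h
    exact hx g n fun hxn => h (by simp [hxn])

end AnnularDiagram

/-! ## Graded complexes of free `ℚ[β]`-modules and their homotopy equivalences -/

section GradedComplex

variable {M N : Type} [AddCommGroup M] [Module ℚ[X] M] [Module ℚ M]
  [AddCommGroup N] [Module ℚ[X] N] [Module ℚ N]

/-- A `ℚ[β]`-linear map is homogeneous of degree `s`. -/
def HomogeneousMap (𝒜 : ℤ × ℤ × ℤ → Submodule ℚ M) (ℬ : ℤ × ℤ × ℤ → Submodule ℚ N)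
    (s : ℤ × ℤ × ℤ) (f : M →ₗ[ℚ[X]] N) : Prop :=
  ∀ t, ∀ x ∈ 𝒜 t, f x ∈ ℬ (t + s)

/-- `M`, with homogeneous parts `𝒜 (h, q, a)` for the homological, Euler and annular gradings, is a
free graded `ℚ[β]`-module, where `β` has degree `(0, 0, 2)`, and `d` is a differential on it that
raises the homological grading by one and preserves the other two gradings. -/
structure IsGradedComplex (𝒜 : ℤ × ℤ × ℤ → Submodule ℚ M) (d : M →ₗ[ℚ[X]] M) : Prop where
  isInternal : DirectSum.IsInternal 𝒜
  smul_mem : ∀ t, ∀ x ∈ 𝒜 t, (X : ℚ[X]) • x ∈ 𝒜 (t + (0, 0, 2))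
  free : ∃ (ι : Type) (b : Module.Basis ι ℚ[X] M) (deg : ι → ℤ × ℤ × ℤ), ∀ i, b i ∈ 𝒜 (deg i)
  homogeneous : HomogeneousMap 𝒜 𝒜 (1, 0, 0) d
  sq_zero : d ∘ₗ d = 0

/-- Chain homotopy equivalence of graded complexes: the chain maps preserve all gradings, and the
homotopies lower the homological grading by one and preserve the other two gradings. -/
def GradedHomotopyEquivalent (𝒜 : ℤ × ℤ × ℤ → Submodule ℚ M) (d : M →ₗ[ℚ[X]] M)
    (ℬ : ℤ × ℤ × ℤ → Submodule ℚ N) (d' : N →ₗ[ℚ[X]] N) : Prop :=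
  ∃ (f : M →ₗ[ℚ[X]] N) (g : N →ₗ[ℚ[X]] M) (H : M →ₗ[ℚ[X]] M) (H' : N →ₗ[ℚ[X]] N),
    HomogeneousMap 𝒜 ℬ 0 f ∧ HomogeneousMap ℬ 𝒜 0 g ∧
    HomogeneousMap 𝒜 𝒜 (-1, 0, 0) H ∧ HomogeneousMap ℬ ℬ (-1, 0, 0) H' ∧
    f ∘ₗ d = d' ∘ₗ f ∧ g ∘ₗ d' = d ∘ₗ g ∧
    g ∘ₗ f - LinearMap.id = d ∘ₗ H + H ∘ₗ d ∧
    f ∘ₗ g - LinearMap.id = d' ∘ₗ H' + H' ∘ₗ d'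

end GradedComplex

/-! An edge of the cube of resolutions merges two cycles or splits one. Nontriviality of a cycle is
the parity of its intersection with the cutting ray, and this parity is additive under merging.
Running through the labels, every term of the Khovanov differential lowers the annular grading by
`0` or `2` (`Cube.saddle_deg`). The rational complex is therefore filtered, and `dTilde` is its Rees
construction, in which an entry of annular drop `2n` is multiplied by `β ^ n`
(`AnnularDiagram.dTilde_eq`). Rees matrices respect sums and products of filtered matrices
(`rees_mul`), so `d ^ 2 = 0` gives the same for `dTilde`, and a filtered homotopy equivalence over
`ℚ` gives a graded one over `ℚ[β]`. What remains is the filtered invariance of the rational complex.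

The algebra is done for partitions of a finite set of points, the classes being the cycles. The map
of a saddle commutes with multiplication by `v₋` at every point, so it is determined by the image of
the labelling that is `v₊` everywhere (`matrix_ext_of_dot`). This makes the faces of the cube
commute (`saddleMatrix_comm`), and the signs then give `d ^ 2 = 0`. That the two resolutions of a
crossing do differ by a saddle uses the alternating orientation of the strands at each angle, up and
down in turn: it orients all curves of all resolutions consistently, the passage to the next point
is a permutation whose cycles are the curves, and the change of a resolution composes it with a
transposition (`RWord.saddle_conn`).

For the Reidemeister moves, circles are cancelled. In the disc of a move, a resolution contains at
most one closed curve. It misses the cutting ray, so it is trivial, and the birth of such a circle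
with label `v₋` or its death with label `v₊` is, up to sign, a bijection of generators that
preserves the Euler and annular gradings exactly. Gaussian elimination along these edges is a
filtered homotopy equivalence (`FComplex.HEquiv.reduced`, `Cube.Matching.pivot`). For the first two
moves, the remaining generators form the complex of the simpler diagram
(`Cube.Matching.hEquiv_rest`). For the third move both sides are reduced; the elimination creates
additional arrows on each side, and these correspond to ordinary edges on the other side
(`Cube.restCoeff_third`).

The geometric input is local. Outside of the disc, connectivity depends on the inside only through
the way in which the boundary points are joined (`RWord.conn_outer_iff`). For each local move except
the exchange of distant pieces this is a finite computation on at most three strands, which carries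
over to any number of strands on both sides (`RWord.SameExit.sameBd`); the exchange is treated by
hand. A rotation changes only the cutting ray and the order of the crossings. The order does not
matter up to signs (`edgeSign_reorder`), and a cycle meets all horizontal lines with the same parity
(`AnnularDiagram.odd_onLine`). -/

/-! ## Filtered complexes -/

section FilteredComplexes

open scoped Classical

/-- A rational matrix is filtered of degree `s` if its entries preserve the first two gradings up to
`s` and lower the third one by an even natural number, up to `s`. -/
def Filt {G H : Type} (dg : G → ℤ × ℤ × ℤ) (dh : H → ℤ × ℤ × ℤ) (s : ℤ × ℤ × ℤ)
    (M : Matrix H G ℚ) : Prop :=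
  ∀ i j, M i j ≠ 0 → ∃ n : ℕ, dh i + (0, 0, 2 * (n : ℤ)) = dg j + s

namespace Filt

variable {G H K : Type} {dg : G → ℤ × ℤ × ℤ} {dh : H → ℤ × ℤ × ℤ} {dk : K → ℤ × ℤ × ℤ}
  {s t : ℤ × ℤ × ℤ}

theorem zero : Filt dg dh s (0 : Matrix H G ℚ) := fun _ _ h => absurd rfl h

theorem one [Fintype G] : Filt dg dg 0 (1 : Matrix G G ℚ) := by
  intro i j h
  have : i = j := by
    by_contra hij
    exact h (Matrix.one_apply_ne hij)
  subst this
  exact ⟨0, by simp⟩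

theorem add {M N : Matrix H G ℚ} (hM : Filt dg dh s M) (hN : Filt dg dh s N) :
    Filt dg dh s (M + N) := by
  intro i j h
  by_cases h0 : M i j = 0
  · exact hN i j fun h1 => h (by simp [h0, h1])
  · exact hM i j h0

theorem neg {M : Matrix H G ℚ} (hM : Filt dg dh s M) : Filt dg dh s (-M) := by
  intro i j h
  exact hM i j fun h0 => h (by simp [h0])

theorem sub {M N : Matrix H G ℚ} (hM : Filt dg dh s M) (hN : Filt dg dh s N) :
    Filt dg dh s (M - N) := by
  rw [sub_eq_add_neg]
  exact hM.add hN.neg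

theorem mul [Fintype H] {M : Matrix K H ℚ} {N : Matrix H G ℚ} (hM : Filt dh dk s M)
    (hN : Filt dg dh t N) : Filt dg dk (t + s) (M * N) := by
  intro i j h
  rw [Matrix.mul_apply] at h
  obtain ⟨l, -, hl⟩ := Finset.exists_ne_zero_of_sum_ne_zero h
  obtain ⟨n, hn⟩ := hM i l (left_ne_zero_of_mul hl)
  obtain ⟨m, hm⟩ := hN l j (right_ne_zero_of_mul hl)
  refine ⟨n + m, ?_⟩
  have e : dk i + (0, 0, 2 * ((n + m : ℕ) : ℤ)) = (dk i + (0, 0, 2 * (n : ℤ))) +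
      (0, 0, 2 * (m : ℤ)) := by
    rw [add_assoc]; congr 1; ext <;> simp; ring
  rw [e, hn, ← add_assoc, ← hm]
  abel

theorem mul' [Fintype H] {M : Matrix K H ℚ} {N : Matrix H G ℚ} {r : ℤ × ℤ × ℤ}
    (hM : Filt dh dk s M) (hN : Filt dg dh t N) (h : t + s = r) : Filt dg dk r (M * N) :=
  h ▸ hM.mul hN

end Filt

/-- A filtered complex of rational vector spaces with a finite graded basis. -/
structure FComplex where
  G : Type
  [fin : Fintype G]
  deg : G → ℤ × ℤ × ℤ
  d : Matrix G G ℚ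
  filt : Filt deg deg (1, 0, 0) d
  sq : d * d = 0

namespace FComplex

attribute [instance] FComplex.fin

/-- Filtered chain homotopy equivalence. -/
def HEquiv (A B : FComplex) : Prop :=
  ∃ (f : Matrix B.G A.G ℚ) (g : Matrix A.G B.G ℚ) (H : Matrix A.G A.G ℚ) (H' : Matrix B.G B.G ℚ),
    Filt A.deg B.deg 0 f ∧ Filt B.deg A.deg 0 g ∧
    Filt A.deg A.deg (-1, 0, 0) H ∧ Filt B.deg B.deg (-1, 0, 0) H' ∧
    f * A.d = B.d * f ∧ g * B.d = A.d * g ∧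
    g * f - 1 = A.d * H + H * A.d ∧ f * g - 1 = B.d * H' + H' * B.d

theorem HEquiv.symm {A B : FComplex} : A.HEquiv B → B.HEquiv A := by
  rintro ⟨f, g, H, H', h1, h2, h3, h4, h5, h6, h7, h8⟩
  exact ⟨g, f, H', H, h2, h1, h4, h3, h6, h5, h8, h7⟩

theorem HEquiv.trans {A B E : FComplex} : A.HEquiv B → B.HEquiv E → A.HEquiv E := by
  rintro ⟨f, g, H, H', h1, h2, h3, h4, h5, h6, h7, h8⟩
  rintro ⟨f₁, g₁, K, K', k1, k2, k3, k4, k5, k6, k7, k8⟩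
  refine ⟨f₁ * f, g * g₁, H + g * K * f, K' + f₁ * H' * g₁, k1.mul' h1 (by simp),
    h2.mul' k2 (by simp), h3.add ((h2.mul' k3 (add_zero _)).mul' h1 (by simp)),
    k4.add ((k1.mul' h4 (add_zero _)).mul' k2 (by simp)), ?_, ?_, ?_, ?_⟩
  · rw [Matrix.mul_assoc, h5, ← Matrix.mul_assoc, k5, Matrix.mul_assoc]
  · rw [Matrix.mul_assoc, k6, ← Matrix.mul_assoc, h6, Matrix.mul_assoc]
  · have e : g * g₁ * (f₁ * f) - 1 = g * (g₁ * f₁ - 1) * f + (g * f - 1) := by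
      simp only [Matrix.mul_sub, Matrix.sub_mul, Matrix.mul_one, Matrix.mul_assoc]
      abel
    rw [e, k7, h7]
    have e1 : g * (B.d * K) * f = A.d * (g * K * f) := by
      rw [← Matrix.mul_assoc, h6]; simp only [Matrix.mul_assoc]
    have e2 : g * (K * B.d) * f = g * K * f * A.d := by
      simp only [Matrix.mul_assoc]; rw [h5]
    rw [Matrix.mul_add, Matrix.add_mul, e1, e2, Matrix.mul_add, Matrix.add_mul]
    abel
  · have e : f₁ * f * (g * g₁) - 1 = f₁ * (f * g - 1) * g₁ + (f₁ * g₁ - 1) := by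
      simp only [Matrix.mul_sub, Matrix.sub_mul, Matrix.mul_one, Matrix.mul_assoc]
      abel
    rw [e, k8, h8]
    have e1 : f₁ * (B.d * H') * g₁ = E.d * (f₁ * H' * g₁) := by
      rw [← Matrix.mul_assoc, k5]; simp only [Matrix.mul_assoc]
    have e2 : f₁ * (H' * B.d) * g₁ = f₁ * H' * g₁ * E.d := by
      simp only [Matrix.mul_assoc]; rw [k6]
    rw [Matrix.mul_add, Matrix.add_mul, e1, e2, Matrix.mul_add, Matrix.add_mul]
    abel

/-- Signed bijections of graded bases that are compatible with the differentials are
equivalences. -/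
theorem HEquiv.of_signed_equiv {A B : FComplex} (e : A.G ≃ B.G) (η : A.G → ℚ)
    (hη : ∀ i, η i * η i = 1) (hdeg : ∀ i, B.deg (e i) = A.deg i)
    (hd : ∀ i j, B.d (e i) (e j) = η i * η j * A.d i j) : A.HEquiv B := by
  have hfi : ∀ j k, (Matrix.of fun (i : B.G) (j : A.G) => if i = e j then η j else 0) (e j) k =
      if j = k then η j else 0 := by
    intro j k
    by_cases h : j = k
    · simp [h]
    · simp [h]
  refine ⟨Matrix.of fun i j => if i = e j then η j else 0,
    Matrix.of fun j i => if i = e j then η j else 0, 0, 0, ?_, ?_, Filt.zero, Filt.zero,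
    ?_, ?_, ?_, ?_⟩
  · intro i j h
    have : i = e j := by
      by_contra h'
      simp [h'] at h
    exact ⟨0, by simp [this, hdeg]⟩
  · intro j i h
    have : i = e j := by
      by_contra h'
      simp [h'] at h
    exact ⟨0, by simp [this, hdeg]⟩
  · ext i k
    obtain ⟨j, rfl⟩ := e.surjective i
    simp only [Matrix.mul_apply, hfi, ite_mul, zero_mul, Finset.sum_ite_eq, Finset.mem_univ,
      if_true, Matrix.of_apply, mul_ite, mul_zero, Finset.sum_ite_eq']
    rw [hd]
    linear_combination -(η j * A.d j k) * hη k
  · ext j i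
    obtain ⟨k, rfl⟩ := e.surjective i
    have : ∀ l, (if e k = e l then η l else (0 : ℚ)) = if k = l then η l else 0 := by
      intro l; simp
    simp only [Matrix.mul_apply, ite_mul, zero_mul, Finset.sum_ite_eq, Finset.mem_univ,
      if_true, Matrix.of_apply, mul_ite, mul_zero, Finset.sum_ite_eq', this]
    rw [hd]
    linear_combination (η k * A.d j k) * hη j
  · ext j k
    simp only [Matrix.sub_apply, Matrix.mul_apply, Matrix.of_apply, ite_mul, zero_mul,
      Finset.sum_ite_eq', Finset.mem_univ, if_true, Matrix.one_apply]
    by_cases h : j = k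
    · simp [h, hη]
    · simp [h]
  · ext i l
    obtain ⟨j, rfl⟩ := e.surjective i
    obtain ⟨k, rfl⟩ := e.surjective l
    simp only [Matrix.sub_apply, Matrix.mul_apply, hfi, ite_mul, zero_mul, Finset.sum_ite_eq,
      Finset.mem_univ, if_true, Matrix.of_apply, Matrix.one_apply]
    by_cases h : j = k
    · simp [h, hη]
    · simp [h, Ne.symm h]

/-! ### Gaussian elimination -/

/-- The block of the differential from `S` to `T` is a signed permutation matrix that respects the
gradings. -/
structure Pivot (A : FComplex) (S T : A.G → Prop) : Prop where
  disjoint : ∀ i, S i → ¬ T i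
  col : ∀ s, S s → ∃ t, T t ∧ A.d t s * A.d t s = 1 ∧ ∀ t', T t' → t' ≠ t → A.d t' s = 0
  row : ∀ t, T t → ∃ s, S s ∧ A.d t s * A.d t s = 1 ∧ ∀ s', S s' → s' ≠ s → A.d t s' = 0
  deg : ∀ s t, S s → T t → A.d t s ≠ 0 → A.deg t = A.deg s + (1, 0, 0)

section Elimination

variable (A : FComplex) (S T : A.G → Prop)

/-- The inverse of the pivot block. -/
noncomputable def pivotInv : Matrix A.G A.G ℚ :=
  -- The pivot block is a signed permutation matrix, so its inverse is its transpose.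
  Matrix.of fun s t => if S s ∧ T t then A.d t s else 0

/-- The basis elements that are not eliminated. -/
abbrev Rest : Type := {i : A.G // ¬ S i ∧ ¬ T i}

/-- Inclusion of the rest. -/
noncomputable def restIncl : Matrix A.G (A.Rest S T) ℚ :=
  Matrix.of fun i k => if i = k.1 then 1 else 0

/-- Projection to the rest. -/
noncomputable def restProj : Matrix (A.Rest S T) A.G ℚ :=
  Matrix.of fun k i => if i = k.1 then 1 else 0

/-- The diagonal projection to a set of basis elements. -/
noncomputable def diagProj (P : A.G → Prop) : Matrix A.G A.G ℚ :=
  Matrix.diagonal fun i => if P i then 1 else 0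

theorem restProj_mul_restIncl : A.restProj S T * A.restIncl S T = 1 := by
  ext k l
  simp only [restProj, restIncl, Matrix.mul_apply, Matrix.of_apply, ite_mul, one_mul, zero_mul,
    Finset.sum_ite_eq', Finset.mem_univ, if_true, Matrix.one_apply, Subtype.ext_iff]

theorem pivotInv_mul_diagProj : A.pivotInv S T * A.diagProj T = A.pivotInv S T := by
  ext i j
  rw [diagProj, Matrix.mul_diagonal]
  by_cases hj : T j <;> simp [pivotInv, hj]

variable {A S T}

namespace Pivot

variable (P : A.Pivot S T)
include P

theorem restIncl_mul_restProj :
    A.restIncl S T * A.restProj S T = 1 - A.diagProj S - A.diagProj T := by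
  ext i j
  have : (A.restIncl S T * A.restProj S T) i j = if i = j ∧ ¬ S i ∧ ¬ T i then 1 else 0 := by
    simp only [restProj, restIncl, Matrix.mul_apply, Matrix.of_apply]
    by_cases hi : ¬ S i ∧ ¬ T i
    · rw [Finset.sum_eq_single (⟨i, hi⟩ : A.Rest S T)]
      · by_cases hij : i = j
        · simp [hij]; exact hij ▸ hi
        · simp [hij, Ne.symm hij]
      · rintro ⟨b, hb⟩ - hne
        have : ¬ i = b := fun h => hne (Subtype.ext h.symm)
        simp [this]
      · simp
    · rw [if_neg (fun h => hi h.2)]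
      apply Finset.sum_eq_zero
      rintro ⟨b, hb⟩ -
      have : ¬ i = b := fun h => hi (h ▸ hb)
      simp [this]
  rw [this]
  simp only [diagProj, Matrix.sub_apply, Matrix.one_apply, Matrix.diagonal_apply]
  have := P.disjoint i
  by_cases hij : i = j <;> by_cases hS : S i <;> by_cases hT : T i <;> simp_all

omit P in
theorem pivotInv_mul_pivotInv (hdis : ∀ i, S i → ¬ T i) :
    A.pivotInv S T * A.pivotInv S T = 0 := by
  ext i j
  rw [Matrix.mul_apply]
  apply Finset.sum_eq_zero
  intro k _
  simp only [pivotInv, Matrix.of_apply]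
  by_cases hT : T k
  · have : ¬ S k := fun h => hdis k h hT
    simp [this]
  · simp [hT]

/-- Only indices in `T` contribute to the middle sum, so an entry is the inner product of two
columns of the signed permutation block. -/
theorem pivotInv_mul_d_mul_diagProj :
    A.pivotInv S T * A.d * A.diagProj S = A.diagProj S := by
  ext i j
  rw [diagProj, Matrix.mul_diagonal, Matrix.diagonal_apply, Matrix.mul_apply]
  by_cases hj : S j
  · simp only [hj, if_true, mul_one]
    by_cases hi : S i
    · simp only [pivotInv, Matrix.of_apply, hi, true_and, ite_mul, zero_mul]
      obtain ⟨t, ht, h1, h2⟩ := P.col j hj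
      rw [Finset.sum_eq_single t]
      · rw [if_pos ht]
        by_cases hij : i = j
        · subst hij; simp [h1]
        · obtain ⟨s, hs, h3, h4⟩ := P.row t ht
          have hjs : j = s := by
            by_contra hne
            rw [h4 j hj hne] at h1; simp at h1
          have : A.d t i = 0 := h4 i hi (by rw [← hjs]; exact hij)
          simp [this, hij]
      · intro b _ hb
        by_cases hTb : T b
        · simp [h2 b hTb hb]
        · simp [hTb]
      · simp
    · have : ¬ i = j := fun h => hi (h ▸ hj)
      simp [pivotInv, hi, this]
  · simp only [hj, if_false, mul_zero]
    by_cases hij : i = j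
    · subst hij; simp [hj]
    · simp [hij]

theorem diagProj_mul_d_mul_pivotInv :
    A.diagProj T * (A.d * A.pivotInv S T) = A.diagProj T := by
  ext i j
  rw [diagProj, Matrix.diagonal_mul, Matrix.diagonal_apply, Matrix.mul_apply]
  by_cases hi : T i
  · simp only [hi, if_true, one_mul]
    by_cases hj : T j
    · simp only [pivotInv, Matrix.of_apply, hj, and_true, mul_ite, mul_zero]
      obtain ⟨s, hs, h1, h2⟩ := P.row i hi
      rw [Finset.sum_eq_single s]
      · rw [if_pos hs]
        by_cases hij : i = j
        · subst hij; simp [h1]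
        · obtain ⟨t, ht, h3, h4⟩ := P.col s hs
          have hjs : i = t := by
            by_contra hne
            rw [h4 i hi hne] at h1; simp at h1
          have : A.d j s = 0 := h4 j hj (by rw [← hjs]; exact Ne.symm hij)
          simp [this, hij]
      · intro b _ hb
        by_cases hSb : S b
        · simp [h2 b hSb hb]
        · simp [hSb]
      · simp
    · have : ¬ i = j := fun h => hj (h ▸ hi)
      simp [pivotInv, hj, this]
  · simp [hi]

omit P in
theorem pivotInv_mul_restIncl : A.pivotInv S T * A.restIncl S T = 0 := by
  ext i k
  simp only [pivotInv, restIncl, Matrix.mul_apply, Matrix.of_apply, mul_ite, mul_one, mul_zero,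
    Finset.sum_ite_eq', Finset.mem_univ, if_true]
  simp [k.2.2]

omit P in
theorem restProj_mul_pivotInv : A.restProj S T * A.pivotInv S T = 0 := by
  ext k i
  simp only [pivotInv, restProj, Matrix.mul_apply, Matrix.of_apply, ite_mul, one_mul, zero_mul,
    Finset.sum_ite_eq', Finset.mem_univ, if_true]
  simp [k.2.1]

/-- With `h = pivotInv`, this is the side condition `h d h = h`, by which `h d` and `d h` are
idempotent; all cancellations in the elimination rest on it and on `d ^ 2 = 0`. -/
theorem pivotInv_mul_d_mul_pivotInv :
    A.pivotInv S T * (A.d * A.pivotInv S T) = A.pivotInv S T := by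
  have h := P.diagProj_mul_d_mul_pivotInv
  have h2 := A.pivotInv_mul_diagProj S T
  calc A.pivotInv S T * (A.d * A.pivotInv S T)
      = A.pivotInv S T * (A.diagProj T * (A.d * A.pivotInv S T)) := by
        rw [← Matrix.mul_assoc _ (A.diagProj T), h2]
    _ = A.pivotInv S T := by rw [h, h2]

theorem filt_pivotInv : Filt A.deg A.deg (-1, 0, 0) (A.pivotInv S T) := by
  intro s t h
  simp only [pivotInv, Matrix.of_apply] at h
  have h1 : S s ∧ T t := by
    by_contra h'
    simp [h'] at h
  rw [if_pos h1] at h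
  refine ⟨0, ?_⟩
  rw [P.deg s t h1.1 h1.2 h]
  ext <;> simp

end Pivot

/-- The differential of the reduced complex. -/
noncomputable def reducedD (A : FComplex) (S T : A.G → Prop) :
    Matrix (A.Rest S T) (A.Rest S T) ℚ :=
  A.restProj S T * (A.d - A.d * A.pivotInv S T * A.d) * A.restIncl S T

theorem reducedD_apply (A : FComplex) (S T : A.G → Prop) (k l : A.Rest S T) :
    A.reducedD S T k l = A.d k.1 l.1 -
      ∑ s, ∑ t, if S s ∧ T t then A.d k.1 s * A.d t s * A.d t l.1 else 0 := by
  simp only [reducedD, Matrix.mul_apply, restProj, restIncl, Matrix.of_apply, ite_mul, one_mul,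
    zero_mul, mul_ite, mul_one, mul_zero, Finset.sum_ite_eq', Finset.mem_univ, if_true,
    Matrix.sub_apply, pivotInv, Finset.sum_mul]
  congr 1
  rw [Finset.sum_comm]

theorem filt_restIncl : Filt (fun k : A.Rest S T => A.deg k.1) A.deg 0 (A.restIncl S T) := by
  intro i k h
  have : i = k.1 := by
    by_contra h'
    simp [restIncl, h'] at h
  exact ⟨0, by simp [this]⟩

theorem filt_restProj : Filt A.deg (fun k : A.Rest S T => A.deg k.1) 0 (A.restProj S T) := by
  intro k i h
  have : i = k.1 := by
    by_contra h'
    simp [restProj, h'] at h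
  exact ⟨0, by simp [this]⟩

variable (P : A.Pivot S T)
include P

theorem filt_reducedD : Filt (fun k : A.Rest S T => A.deg k.1) (fun k : A.Rest S T => A.deg k.1)
    (1, 0, 0) (A.reducedD S T) :=
  have h : Filt A.deg A.deg 0 (A.d * A.pivotInv S T) := A.filt.mul' P.filt_pivotInv (by simp)
  (filt_restProj.mul' (A.filt.sub (h.mul' A.filt (add_zero _))) (add_zero _)).mul' filt_restIncl
    (zero_add _)

/-- The factors `1 - h d` and `1 - d h` annihilate the diagonal projections to `S` and to `T`, so
the projection to the rest may be replaced by the identity; the term `h d d h` vanishes. -/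
theorem reduced_aux :
    ((1 - A.pivotInv S T * A.d) * A.restIncl S T) * (A.restProj S T * (1 - A.d * A.pivotInv S T)) =
      1 - A.d * A.pivotInv S T - A.pivotInv S T * A.d := by
  set h := A.pivotInv S T with hh
  have e1 : (1 - h * A.d) * A.diagProj S = 0 := by
    rw [sub_mul, one_mul, P.pivotInv_mul_d_mul_diagProj, sub_self]
  have e2 : A.diagProj T * (1 - A.d * h) = 0 := by
    rw [mul_sub, mul_one, P.diagProj_mul_d_mul_pivotInv, sub_self]
  calc _ = (1 - h * A.d) * (A.restIncl S T * A.restProj S T) * (1 - A.d * h) := by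
        simp only [Matrix.mul_assoc]
    _ = (1 - h * A.d) * (1 - A.d * h) - ((1 - h * A.d) * A.diagProj S) * (1 - A.d * h)
        - (1 - h * A.d) * (A.diagProj T * (1 - A.d * h)) := by
        rw [P.restIncl_mul_restProj]; noncomm_ring
    _ = (1 - h * A.d) * (1 - A.d * h) := by rw [e1, e2]; simp
    _ = 1 - A.d * h - h * A.d + h * (A.d * A.d) * h := by noncomm_ring
    _ = _ := by rw [A.sq]; simp

/-- The differential `d - d h d` is what results from `d` by transfer along the two comparison maps:
of the three correction terms, two cancel because of `h d h = h`. -/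
theorem reducedD_eq : A.reducedD S T = A.restProj S T * (1 - A.d * A.pivotInv S T) * A.d *
    ((1 - A.pivotInv S T * A.d) * A.restIncl S T) := by
  set h := A.pivotInv S T with hh
  have : (1 - A.d * h) * A.d * (1 - h * A.d) = A.d - A.d * h * A.d := by
    have e : (1 - A.d * h) * A.d * (1 - h * A.d) = A.d - A.d * h * A.d - A.d * h * A.d +
      A.d * h * (A.d * (h * A.d)) := by noncomm_ring
    have e3 : h * (A.d * h) = h := P.pivotInv_mul_d_mul_pivotInv
    have e2 : A.d * h * (A.d * (h * A.d)) = A.d * (h * (A.d * h)) * A.d := by noncomm_ring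
    rw [e, e2, e3]; abel
  rw [reducedD, ← this]
  simp only [Matrix.mul_assoc]

/-- The complex obtained by Gaussian elimination. -/
noncomputable def reduced : FComplex where
  G := A.Rest S T
  deg k := A.deg k.1
  d := A.reducedD S T
  filt := filt_reducedD P
  sq := by
    rw [reducedD_eq P]
    have := reduced_aux P
    set h := A.pivotInv S T
    set f := A.restProj S T * (1 - A.d * h)
    set g := (1 - h * A.d) * A.restIncl S T
    calc f * A.d * g * (f * A.d * g) = f * (A.d * (g * f) * A.d) * g := by
          simp only [Matrix.mul_assoc]
      _ = f * ((A.d * A.d) - (A.d * A.d) * h * A.d - A.d * h * (A.d * A.d)) * g := by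
          rw [this]; congr 2; noncomm_ring
      _ = 0 := by rw [A.sq]; simp

/-- The comparison maps are the projection composed with `1 - d h` and `1 - h d` composed with the
inclusion. One composite is the identity on the nose, the other one differs from it by the homotopy
`-h`. The pivot preserves gradings strictly, so `h` is filtered. -/
theorem HEquiv.reduced : A.HEquiv (reduced P) := by
  have key := reduced_aux P
  have hd := reducedD_eq P
  have hdh := P.pivotInv_mul_d_mul_pivotInv
  have hF := P.filt_pivotInv
  have hfg0 : A.restProj S T * (1 - A.d * A.pivotInv S T) *
      ((1 - A.pivotInv S T * A.d) * A.restIncl S T) = 1 := by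
    have e : (1 - A.d * A.pivotInv S T) * (1 - A.pivotInv S T * A.d) =
        1 - A.d * A.pivotInv S T - A.pivotInv S T * A.d +
        A.d * (A.pivotInv S T * A.pivotInv S T) * A.d := by noncomm_ring
    calc _ = A.restProj S T * ((1 - A.d * A.pivotInv S T) * (1 - A.pivotInv S T * A.d)) *
          A.restIncl S T := by simp only [Matrix.mul_assoc]
      _ = A.restProj S T * A.restIncl S T - A.restProj S T * A.d *
          (A.pivotInv S T * A.restIncl S T) -
          (A.restProj S T * A.pivotInv S T) * A.d * A.restIncl S T := by
          rw [e, Pivot.pivotInv_mul_pivotInv P.disjoint]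
          simp only [Matrix.mul_zero, Matrix.zero_mul, add_zero, Matrix.mul_sub, Matrix.sub_mul,
            Matrix.mul_one, Matrix.mul_assoc]
      _ = 1 := by
          rw [Pivot.pivotInv_mul_restIncl, Pivot.restProj_mul_pivotInv, restProj_mul_restIncl]
          simp
  have hf : A.restProj S T * (1 - A.d * A.pivotInv S T) * A.d =
      A.reducedD S T * (A.restProj S T * (1 - A.d * A.pivotInv S T)) := by
    rw [hd]
    set h := A.pivotInv S T
    set f := A.restProj S T * (1 - A.d * h) with hf
    set g := (1 - h * A.d) * A.restIncl S T
    have e : (1 - A.d * h) * (A.d * (1 - A.d * h - h * A.d)) =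
      (1 - A.d * h) * A.d - (1 - A.d * h) * (A.d * A.d) * h - A.d * h * A.d
        + A.d * (h * (A.d * h)) * A.d := by noncomm_ring
    calc f * A.d = A.restProj S T * ((1 - A.d * h) * (A.d * (1 - A.d * h - h * A.d))) := by
          rw [e, A.sq, hdh, hf, Matrix.mul_assoc]; simp
      _ = f * (A.d * (g * f)) := by rw [key, hf, Matrix.mul_assoc]
      _ = _ := by simp only [Matrix.mul_assoc]
  have hg : (1 - A.pivotInv S T * A.d) * A.restIncl S T * A.reducedD S T =
      A.d * ((1 - A.pivotInv S T * A.d) * A.restIncl S T) := by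
    rw [hd]
    set h := A.pivotInv S T
    set f := A.restProj S T * (1 - A.d * h)
    set g := (1 - h * A.d) * A.restIncl S T with hg
    have e : (1 - A.d * h - h * A.d) * A.d * (1 - h * A.d) =
      A.d * (1 - h * A.d) - h * (A.d * A.d) * (1 - h * A.d) - A.d * h * A.d
        + A.d * (h * (A.d * h)) * A.d := by noncomm_ring
    calc g * (f * A.d * g) = (g * f) * A.d * (1 - h * A.d) * A.restIncl S T := by
          rw [hg]; simp only [Matrix.mul_assoc]
      _ = A.d * (1 - h * A.d) * A.restIncl S T := by
          rw [key, e, A.sq, hdh]; simp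
      _ = _ := by rw [hg, Matrix.mul_assoc]
  have hgf : ((1 - A.pivotInv S T * A.d) * A.restIncl S T) *
      (A.restProj S T * (1 - A.d * A.pivotInv S T)) - 1 =
      A.d * (-A.pivotInv S T) + (-A.pivotInv S T) * A.d := by
    rw [key]; noncomm_ring
  -- The identity matrix in `HEquiv` is formed with a decidability instance that need not be the one
  -- found for the subtype, so the equation is proved for every instance.
  have hfg : ∀ inst : DecidableEq (A.Rest S T), A.restProj S T * (1 - A.d * A.pivotInv S T) *
      ((1 - A.pivotInv S T * A.d) * A.restIncl S T) - 1 =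
      A.reducedD S T * 0 + 0 * A.reducedD S T := by
    intro inst
    rw [hfg0, Subsingleton.elim inst fun a b => Subtype.instDecidableEq a b]
    simp
  exact ⟨A.restProj S T * (1 - A.d * A.pivotInv S T),
    (1 - A.pivotInv S T * A.d) * A.restIncl S T, -A.pivotInv S T, 0,
    filt_restProj.mul' (Filt.one.sub (A.filt.mul' hF (by simp))) (by simp),
    (Filt.one.sub (hF.mul' A.filt (by simp))).mul' filt_restIncl (by simp), hF.neg, Filt.zero,
    hf, hg, hgf, hfg _⟩

end Elimination

end FComplex

end FilteredComplexes

/-! ## The Rees construction -/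

section Rees

open scoped Classical

/-- The homogeneous matrix over `ℚ[β]` that corresponds to a filtered rational matrix. -/
noncomputable def rees {G H : Type} (dg : G → ℤ × ℤ × ℤ) (dh : H → ℤ × ℤ × ℤ)
    (M : Matrix H G ℚ) : Matrix H G ℚ[X] :=
  Matrix.of fun i j => C (M i j) * X ^ (((dg j).2.2 - (dh i).2.2) / 2).toNat

section

variable {G H K : Type} {dg : G → ℤ × ℤ × ℤ} {dh : H → ℤ × ℤ × ℤ} {dk : K → ℤ × ℤ × ℤ}
  {s t : ℤ × ℤ × ℤ}

/-- On a nonzero entry the annular drop is even and nonnegative, so neither the division by `2` nor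
the truncation in the exponent of `rees` loses anything. -/
theorem Filt.exponent {M : Matrix H G ℚ} (hM : Filt dg dh s M) (hs : s.2.2 = 0) {i : H} {j : G}
    (h : M i j ≠ 0) : (dh i).2.2 + 2 * ((((dg j).2.2 - (dh i).2.2) / 2).toNat : ℤ) = (dg j).2.2 ∧
      dh i + (0, 0, 2 * ((((dg j).2.2 - (dh i).2.2) / 2).toNat : ℤ)) = dg j + s := by
  obtain ⟨n, hn⟩ := hM i j h
  have h3 : (dh i).2.2 + 2 * (n : ℤ) = (dg j).2.2 := by
    have := congrArg (fun x : ℤ × ℤ × ℤ => x.2.2) hn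
    simpa [hs] using this
  have : (((dg j).2.2 - (dh i).2.2) / 2).toNat = n := by omega
  rw [this]
  exact ⟨h3, hn⟩

theorem rees_add (M N : Matrix H G ℚ) : rees dg dh (M + N) = rees dg dh M + rees dg dh N := by
  refine Matrix.ext fun i j => ?_
  simp [rees, add_mul]

theorem rees_sub (M N : Matrix H G ℚ) : rees dg dh (M - N) = rees dg dh M - rees dg dh N := by
  refine Matrix.ext fun i j => ?_
  simp [rees, sub_mul]

theorem rees_one : rees dg dg (1 : Matrix G G ℚ) = 1 := by
  refine Matrix.ext fun i j => ?_
  by_cases h : i = j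
  · subst h; simp [rees]
  · simp [rees, h]

theorem rees_zero : rees dg dh (0 : Matrix H G ℚ) = 0 := by
  refine Matrix.ext fun i j => ?_
  simp [rees]

/-- Annular drops add along every path with nonzero entries, hence so do the exponents of `β`; the
conditions on `s` and `t` exclude a shift of the annular grading. -/
theorem rees_mul [Fintype H] {M : Matrix K H ℚ} {N : Matrix H G ℚ} (hM : Filt dh dk s M)
    (hN : Filt dg dh t N) (hs : s.2.2 = 0) (ht : t.2.2 = 0) :
    rees dg dk (M * N) = rees dh dk M * rees dg dh N := by
  refine Matrix.ext fun i j => ?_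
  simp only [rees, Matrix.mul_apply, Matrix.of_apply, map_sum, Finset.sum_mul, map_mul]
  refine Finset.sum_congr rfl fun l _ => ?_
  by_cases h1 : M i l = 0
  · simp [h1]
  by_cases h2 : N l j = 0
  · simp [h2]
  have e1 := (hM.exponent hs h1).1
  have e2 := (hN.exponent ht h2).1
  have : (((dg j).2.2 - (dk i).2.2) / 2).toNat =
      (((dh l).2.2 - (dk i).2.2) / 2).toNat + (((dg j).2.2 - (dh l).2.2) / 2).toNat := by omega
  rw [this, pow_add]
  ring

end

namespace AnnularDiagram

variable {D D' : AnnularDiagram}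

/-- The power of `β` gives back exactly the annular degree that the entry loses. -/
theorem homogeneousMap_rees {s : ℤ × ℤ × ℤ} (hs : s.2.2 = 0) {M : Matrix D'.Gen D.Gen ℚ}
    (hM : Filt D.deg D'.deg s M) :
    HomogeneousMap D.homogeneous D'.homogeneous s (Matrix.mulVecLin (rees D.deg D'.deg M)) := by
  intro t x hx i n h
  simp only [Matrix.mulVecLin_apply, Matrix.mulVec, dotProduct, finsetSum_coeff] at h
  obtain ⟨j, -, hj⟩ := Finset.exists_ne_zero_of_sum_ne_zero h
  simp only [rees, Matrix.of_apply, mul_assoc, coeff_C_mul, coeff_X_pow_mul'] at hj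
  have h1 := left_ne_zero_of_mul hj
  have h2 := right_ne_zero_of_mul hj
  have e := (hM.exponent hs h1).2
  set k := ((((D.deg j).2.2 - (D'.deg i).2.2) / 2).toNat) with hk
  by_cases hkn : k ≤ n
  · rw [if_pos hkn] at h2
    have e2 := hx j (n - k) h2
    rw [← e2]
    have e3 : ((0, 0, 2 * (n : ℤ)) : ℤ × ℤ × ℤ) = (0, 0, 2 * (k : ℤ)) +
        (0, 0, 2 * ((n - k : ℕ) : ℤ)) := by
      ext <;> simp; omega
    rw [e3, ← add_assoc, e]
    abel
  · rw [if_neg hkn] at h2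
    exact absurd rfl h2

theorem isInternal_homogeneous (D : AnnularDiagram) : DirectSum.IsInternal D.homogeneous := by
  rw [DirectSum.isInternal_submodule_iff_iSupIndep_and_iSup_eq_top]
  constructor
  · intro t
    -- The elements without a component of degree `t`. This submodule contains all other homogeneous
    -- parts and meets the one of degree `t` only in zero.
    let W : Submodule ℚ D.Chain :=
      { carrier := {x | ∀ (g : D.Gen) (n : ℕ), (x g).coeff n ≠ 0 →
          D.deg g + (0, 0, 2 * (n : ℤ)) ≠ t}
        add_mem' := by
          intro x y hx hy g n h
          by_cases hxn : (x g).coeff n = 0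
          · exact hy g n fun hyn => h (by simp [hxn, hyn])
          · exact hx g n hxn
        zero_mem' := by
          intro g n h
          simp at h
        smul_mem' := by
          intro r x hx g n h
          exact hx g n fun hxn => h (by simp [hxn]) }
    have hW : (⨆ j, ⨆ (_ : j ≠ t), D.homogeneous j) ≤ W := by
      refine iSup_le fun j => iSup_le fun hj x hx g n h => ?_
      rw [hx g n h]
      exact hj
    refine Disjoint.mono_right hW ?_
    rw [Submodule.disjoint_def]
    intro x hx hx'
    funext g
    ext n
    by_contra h
    exact hx' g n h (hx g n h)
  · rw [eq_top_iff]
    intro x _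
    have hx : x = ∑ g, ∑ n ∈ (x g).support,
        Pi.single (M := fun _ : D.Gen => ℚ[X]) g (monomial n ((x g).coeff n)) := by
      conv_lhs => rw [← Finset.univ_sum_single x]
      refine Finset.sum_congr rfl fun g _ => ?_
      conv_lhs => rw [(x g).as_sum_support]
      exact map_sum (AddMonoidHom.single (fun _ : D.Gen => ℚ[X]) g) _ _
    rw [hx]
    refine Submodule.sum_mem _ fun g _ => Submodule.sum_mem _ fun n _ => ?_
    refine Submodule.mem_iSup_of_mem (D.deg g + (0, 0, 2 * (n : ℤ))) ?_
    intro g' m h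
    by_cases hg : g' = g
    · subst hg
      rw [Pi.single_eq_same, coeff_monomial] at h
      have : n = m := by
        by_contra hne
        simp [hne] at h
      rw [this]
    · rw [Pi.single_eq_of_ne hg] at h
      simp at h

/-- The part of the differential that changes the annular grading by `0` or `-2` is all of it. -/
theorem dKh_eq_add (h : ∀ g' g, D.dKh g' g ≠ 0 → D.aDeg g' = D.aDeg g ∨
    D.aDeg g' = D.aDeg g + -2) : D.dKh = D.dKhPart 0 + D.dKhPart (-2) := by
  ext g' g
  simp only [dKhPart, Matrix.add_apply, Matrix.of_apply, add_zero]
  by_cases h0 : D.dKh g' g = 0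
  · simp [h0]
  · rcases h g' g h0 with h1 | h1 <;> simp [h1]

/-- Half of the annular drop is `0` on the entries of `dKhPart 0` and `1` on those of `dKhPart
(-2)`. -/
theorem dTilde_eq (h : ∀ g' g, D.dKh g' g ≠ 0 → D.aDeg g' = D.aDeg g ∨
    D.aDeg g' = D.aDeg g + -2) : D.dTilde = Matrix.mulVecLin (rees D.deg D.deg D.dKh) := by
  rw [dTilde]
  congr 1
  refine Matrix.ext fun g' g => ?_
  simp only [dKhPart, Matrix.add_apply, Matrix.map_apply, Matrix.of_apply, add_zero, rees,
    Matrix.smul_apply, smul_eq_mul, deg]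
  by_cases h0 : D.dKh g' g = 0
  · simp [h0]
  · rcases h g' g h0 with h1 | h1
    · simp [h1]
    · rw [h1, if_neg (by omega), if_pos rfl, show (D.aDeg g - (D.aDeg g + -2)) / 2 = 1 by omega]
      rw [Int.toNat_one, pow_one, map_zero, zero_add, mul_comm]

/-- The basis of the chain module given by the standard generators. -/
theorem exists_homogeneous_basis (D : AnnularDiagram) :
    ∃ (ι : Type) (b : Module.Basis ι ℚ[X] D.Chain) (deg : ι → ℤ × ℤ × ℤ),
      ∀ i, b i ∈ D.homogeneous (deg i) := by
  refine ⟨D.Gen, Pi.basisFun ℚ[X] D.Gen, D.deg, fun g g' n h => ?_⟩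
  rw [Pi.basisFun_apply] at h
  by_cases hg : g' = g
  · subst hg
    rw [Pi.single_eq_same, coeff_one] at h
    have : n = 0 := by
      by_contra hne
      simp [hne] at h
    subst this
    simp
  · rw [Pi.single_eq_of_ne hg] at h
    simp at h

theorem isGradedComplex (h : ∀ g' g, D.dKh g' g ≠ 0 → D.aDeg g' = D.aDeg g ∨
    D.aDeg g' = D.aDeg g + -2) (hF : Filt D.deg D.deg (1, 0, 0) D.dKh)
    (hsq : D.dKh * D.dKh = 0) : IsGradedComplex D.homogeneous D.dTilde where
  isInternal := D.isInternal_homogeneous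
  smul_mem := by
    intro t x hx g n hn
    cases n with
    | zero => simp at hn
    | succ n =>
      simp only [Pi.smul_apply, smul_eq_mul, coeff_X_mul] at hn
      rw [← hx g n hn, add_assoc]
      simp [mul_add]
  free := D.exists_homogeneous_basis
  homogeneous := by
    rw [dTilde_eq h]
    exact homogeneousMap_rees rfl hF
  sq_zero := by
    rw [dTilde_eq h, ← Matrix.mulVecLin_mul, ← rees_mul hF hF rfl rfl, hsq, rees_zero,
      Matrix.mulVecLin_zero]

/-- The filtered Khovanov complex of a diagram. -/
noncomputable def khComplex (D : AnnularDiagram) (hF : Filt D.deg D.deg (1, 0, 0) D.dKh)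
    (hsq : D.dKh * D.dKh = 0) : FComplex where
  G := D.Gen
  deg := D.deg
  d := D.dKh
  filt := hF
  sq := hsq

/-- All the matrices of a filtered equivalence preserve the annular degree up to a drop, so the Rees
construction carries each of the four identities over to `ℚ[β]`. -/
theorem gradedHomotopyEquivalent (h : ∀ g' g, D.dKh g' g ≠ 0 → D.aDeg g' = D.aDeg g ∨
    D.aDeg g' = D.aDeg g + -2) (hF : Filt D.deg D.deg (1, 0, 0) D.dKh)
    (hsq : D.dKh * D.dKh = 0) (h' : ∀ g' g, D'.dKh g' g ≠ 0 → D'.aDeg g' = D'.aDeg g ∨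
    D'.aDeg g' = D'.aDeg g + -2) (hF' : Filt D'.deg D'.deg (1, 0, 0) D'.dKh)
    (hsq' : D'.dKh * D'.dKh = 0) (he : (D.khComplex hF hsq).HEquiv (D'.khComplex hF' hsq')) :
    GradedHomotopyEquivalent D.homogeneous D.dTilde D'.homogeneous D'.dTilde := by
  have key : ∃ (f : Matrix D'.Gen D.Gen ℚ)
      (g : Matrix D.Gen D'.Gen ℚ) (H : Matrix D.Gen D.Gen ℚ) (H' : Matrix D'.Gen D'.Gen ℚ),
      Filt D.deg D'.deg 0 f ∧ Filt D'.deg D.deg 0 g ∧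
      Filt D.deg D.deg (-1, 0, 0) H ∧ Filt D'.deg D'.deg (-1, 0, 0) H' ∧
      f * D.dKh = D'.dKh * f ∧ g * D'.dKh = D.dKh * g ∧
      g * f - 1 = D.dKh * H + H * D.dKh ∧ f * g - 1 = D'.dKh * H' + H' * D'.dKh := he
  obtain ⟨f, g, H, H', h1, h2, h3, h4, h5, h6, h7, h8⟩ := key
  rw [dTilde_eq h, dTilde_eq h']
  refine ⟨_, _, _, _, homogeneousMap_rees rfl h1, homogeneousMap_rees rfl h2,
    homogeneousMap_rees rfl h3, homogeneousMap_rees rfl h4, ?_, ?_, ?_, ?_⟩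
  · rw [← Matrix.mulVecLin_mul, ← Matrix.mulVecLin_mul, ← rees_mul h1 hF rfl rfl,
      ← rees_mul hF' h1 rfl rfl, h5]
  · rw [← Matrix.mulVecLin_mul, ← Matrix.mulVecLin_mul, ← rees_mul h2 hF' rfl rfl,
      ← rees_mul hF h2 rfl rfl, h6]
  · rw [← Matrix.mulVecLin_mul, ← Matrix.mulVecLin_mul, ← Matrix.mulVecLin_mul,
      ← rees_mul h2 h1 rfl rfl, ← rees_mul hF h3 rfl rfl, ← rees_mul h3 hF rfl rfl,
      ← Matrix.mulVecLin_one, ← rees_one (dg := D.deg), ← Matrix.mulVecLin_add, ← rees_add, ← h7,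
      rees_sub]
    ext
    simp
  · rw [← Matrix.mulVecLin_mul, ← Matrix.mulVecLin_mul, ← Matrix.mulVecLin_mul,
      ← rees_mul h1 h2 rfl rfl, ← rees_mul hF' h4 rfl rfl, ← rees_mul h4 hF' rfl rfl,
      ← Matrix.mulVecLin_one, ← rees_one (dg := D'.deg), ← Matrix.mulVecLin_add, ← rees_add, ← h8,
      rees_sub]
    ext
    simp

end AnnularDiagram

end Rees

/-! ## Saddles between set partitions -/

section Saddles

open scoped Classical

/-- The partition `E'` arises from `E` by merging the two different classes of `a` and `b`. -/
structure Merge {X : Type} (E E' : Setoid X) (a b : X) : Prop where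
  ne : ¬ E a b
  iff : ∀ p q, E' p q ↔ E p q ∨ ((E p a ∨ E p b) ∧ (E q a ∨ E q b))

/-- Two partitions differ by a saddle at `a` and `b`. -/
def Saddle {X : Type} (E E' : Setoid X) (a b : X) : Prop := Merge E E' a b ∨ Merge E' E a b

namespace Merge

variable {X : Type} {E E' : Setoid X} {a b : X} (h : Merge E E' a b)
include h

theorem le {p q : X} (hpq : E p q) : E' p q := (h.iff p q).2 (Or.inl hpq)

theorem rel : E' a b := (h.iff a b).2 (Or.inr ⟨Or.inl (E.refl a), Or.inr (E.refl b)⟩)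

theorem other {p : X} (ha : ¬ E p a) (hb : ¬ E p b) (q : X) : E' p q ↔ E p q := by
  rw [h.iff]; tauto

theorem rel_left_iff (p : X) : E' p a ↔ E p a ∨ E p b := by
  rw [h.iff]
  have := E.refl a
  tauto

theorem rel_right_iff (p : X) : E' p b ↔ E p a ∨ E p b := by
  rw [h.iff]
  have := E.refl b
  tauto

theorem swap : Merge E E' b a where
  ne hba := h.ne (E.symm hba)
  iff p q := by rw [h.iff]; tauto

end Merge

/-- Labels of the classes of a partition, `true` for `v₊` and `false` for `v₋`. -/
structure Lab {X : Type} (E : Setoid X) where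
  val : X → Bool
  resp : ∀ p q, E p q → val p = val q

namespace Lab

variable {X : Type} {E : Setoid X}

noncomputable instance [Finite X] : Fintype (Lab E) :=
  have : Finite (Lab E) := Finite.of_injective Lab.val fun l m h => by
    cases l; cases m; cases h; rfl
  Fintype.ofFinite _

/-- Change of the label of the class of `p`. -/
noncomputable def upd (l : Lab E) (p : X) (v : Bool) : Lab E :=
  ⟨fun q => if E q p then v else l.1 q, by
    intro q r hqr
    have h1 : E q p ↔ E r p := ⟨fun h => E.trans (E.symm hqr) h, fun h => E.trans hqr h⟩
    simp only [h1, l.2 q r hqr]⟩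

theorem upd_apply (l : Lab E) (p : X) (v : Bool) (q : X) :
    (l.upd p v).1 q = if E q p then v else l.1 q := rfl

theorem upd_self (l : Lab E) (p : X) (v : Bool) : (l.upd p v).1 p = v := by
  rw [upd_apply, if_pos (E.refl p)]

theorem upd_of_not (l : Lab E) {p q : X} (v : Bool) (h : ¬ E q p) : (l.upd p v).1 q = l.1 q := by
  rw [upd_apply, if_neg h]

theorem upd_of_rel (l : Lab E) {p q : X} (v : Bool) (h : E q p) : (l.upd p v).1 q = v := by
  rw [upd_apply, if_pos h]

/-- All labels are `v₊`. -/
def top (E : Setoid X) : Lab E := ⟨fun _ => true, fun _ _ _ => rfl⟩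

theorem top_apply (p : X) : (top E).1 p = true := rfl

theorem ext {l m : Lab E} (h : ∀ p, l.1 p = m.1 p) : l = m := by
  cases l; cases m; cases funext h; rfl

end Lab

/-- The coefficient of the labels `l'` in the image of `l` under the map of a saddle at `a`, `b`. -/
noncomputable def saddleCoeff {X : Type} (E : Setoid X) (a b : X) (l l' : X → Bool) : ℚ :=
  if ∀ p, ¬ E p a → ¬ E p b → l' p = l p then
    if E a b then comulCoeff (l a) (l' a) (l' b) else mulCoeff (l a) (l b) (l' a)
  else 0

section

variable {X : Type} {E : Setoid X} {a b : X} {l l' : X → Bool}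

theorem saddleCoeff_of_not_agree (h : ¬ ∀ p, ¬ E p a → ¬ E p b → l' p = l p) :
    saddleCoeff E a b l l' = 0 := if_neg h

theorem saddleCoeff_of_merge (hab : ¬ E a b) (h : ∀ p, ¬ E p a → ¬ E p b → l' p = l p) :
    saddleCoeff E a b l l' = mulCoeff (l a) (l b) (l' a) := by
  rw [saddleCoeff, if_pos h, if_neg hab]

theorem saddleCoeff_of_split (hab : E a b) (h : ∀ p, ¬ E p a → ¬ E p b → l' p = l p) :
    saddleCoeff E a b l l' = comulCoeff (l a) (l' a) (l' b) := by
  rw [saddleCoeff, if_pos h, if_pos hab]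

end

/-- The matrix of the map of a saddle. -/
noncomputable def saddleMatrix {X : Type} (E E' : Setoid X) (a b : X) :
    Matrix (Lab E') (Lab E) ℚ :=
  Matrix.of fun m l => saddleCoeff E a b l.1 m.1

/-- The matrix of the multiplication by `v₋` on the class of `p`. -/
noncomputable def dotMatrix {X : Type} (E : Setoid X) (p : X) : Matrix (Lab E) (Lab E) ℚ :=
  Matrix.of fun l' l => if l.1 p = true ∧ l' = l.upd p false then 1 else 0

variable {X : Type} {E E' : Setoid X} {a b : X}

section

variable [Finite X]

theorem mul_dotMatrix_apply {K : Type} (M : Matrix K (Lab E) ℚ) (p : X) (k : K) (l : Lab E) :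
    (M * dotMatrix E p) k l = if l.1 p = true then M k (l.upd p false) else 0 := by
  rw [Matrix.mul_apply]
  by_cases h : l.1 p = true
  · simp [dotMatrix, h]
  · simp [dotMatrix, h]

theorem dotMatrix_mul_apply {K : Type} (M : Matrix (Lab E) K ℚ) (p : X) (k : K) (l : Lab E) :
    (dotMatrix E p * M) l k = if l.1 p = false then M (l.upd p true) k else 0 := by
  rw [Matrix.mul_apply]
  by_cases h : l.1 p = false
  · rw [if_pos h, Finset.sum_eq_single (l.upd p true)]
    · have : l = (l.upd p true).upd p false := by
        apply Lab.ext
        intro q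
        by_cases hq : E q p
        · rw [Lab.upd_of_rel _ _ hq, l.2 q p hq, h]
        · rw [Lab.upd_of_not _ _ hq, Lab.upd_of_not _ _ hq]
      rw [dotMatrix, Matrix.of_apply, if_pos ⟨Lab.upd_self _ _ _, this⟩, one_mul]
    · intro m _ hm
      rw [dotMatrix, Matrix.of_apply, if_neg, zero_mul]
      rintro ⟨h1, h2⟩
      apply hm
      apply Lab.ext
      intro q
      by_cases hq : E q p
      · rw [Lab.upd_of_rel _ _ hq, m.2 q p hq, h1]
      · rw [Lab.upd_of_not _ _ hq, h2, Lab.upd_of_not _ _ hq]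
    · simp
  · rw [if_neg h]
    apply Finset.sum_eq_zero
    intro m _
    rw [dotMatrix, Matrix.of_apply, if_neg, zero_mul]
    rintro ⟨h1, h2⟩
    exact h (by rw [h2, Lab.upd_self])

end

/-- Product and coproduct are symmetric. The hypotheses concern the label of the class before a
split or after a merge, which is read at `a` in one expression and at `b` in the other. -/
theorem saddleCoeff_swap {E : Setoid X} (l l' : X → Bool) (hl : E a b → l a = l b)
    (h : ¬ E a b → l' a = l' b) :
    saddleCoeff E b a l l' = saddleCoeff E a b l l' := by
  have e : E b a ↔ E a b := ⟨E.symm, E.symm⟩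
  simp only [saddleCoeff, e]
  have : (∀ p, ¬ E p b → ¬ E p a → l' p = l p) ↔ ∀ p, ¬ E p a → ¬ E p b → l' p = l p := by
    constructor <;> intro h p h1 h2 <;> exact h p h2 h1
  simp only [this]
  congr 1
  by_cases hab : E a b
  · simp only [hab, if_true, hl hab]
    cases l b <;> cases l' a <;> cases l' b <;> rfl
  · simp only [hab, if_false, h hab]
    cases l a <;> cases l b <;> cases l' b <;> rfl

/-- Multiplication at a class that does not take part in the saddle. -/
theorem saddleCoeff_dot_other (l : Lab E) (l' : Lab E') {p : X} (ha : ¬ E p a) (hb : ¬ E p b)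
    (hp : ∀ q, E' q p ↔ E q p) (ha' : ¬ E' p a) (hb' : ¬ E' p b) :
    (if l.1 p = true then saddleCoeff E a b (l.upd p false).1 l'.1 else 0) =
      if l'.1 p = false then saddleCoeff E a b l.1 (l'.upd p true).1 else 0 := by
  have e1 : ∀ v, (l.upd p v).1 a = l.1 a := fun v => l.upd_of_not v fun h => ha (E.symm h)
  have e2 : ∀ v, (l.upd p v).1 b = l.1 b := fun v => l.upd_of_not v fun h => hb (E.symm h)
  have e3 : ∀ v, (l'.upd p v).1 a = l'.1 a := fun v => l'.upd_of_not v fun h => ha' (E'.symm h)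
  have e4 : ∀ v, (l'.upd p v).1 b = l'.1 b := fun v => l'.upd_of_not v fun h => hb' (E'.symm h)
  simp only [saddleCoeff, e1, e2, e3, e4, ← ite_and]
  congr 1
  rw [eq_iff_iff]
  constructor
  · rintro ⟨h1, h2⟩
    refine ⟨by rw [h2 p ha hb, Lab.upd_self], fun q hqa hqb => ?_⟩
    by_cases hq : E q p
    · rw [Lab.upd_of_rel _ _ ((hp q).2 hq), l.2 q p hq, h1]
    · rw [Lab.upd_of_not _ _ (fun h => hq ((hp q).1 h)), h2 q hqa hqb, Lab.upd_of_not _ _ hq]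
  · rintro ⟨h1, h2⟩
    refine ⟨by rw [← h2 p ha hb, Lab.upd_self], fun q hqa hqb => ?_⟩
    by_cases hq : E q p
    · rw [Lab.upd_of_rel _ _ hq, l'.2 q p ((hp q).2 hq), h1]
    · rw [Lab.upd_of_not _ _ hq, ← h2 q hqa hqb, Lab.upd_of_not _ _ (fun h => hq ((hp q).1 h))]

/-- Multiplication at a class that takes part in the saddle. -/
theorem saddleCoeff_dot_left (h : Saddle E E' a b) (l : Lab E) (l' : Lab E') {p : X}
    (ha : E p a) (ha' : E' p a) :
    (if l.1 p = true then saddleCoeff E a b (l.upd p false).1 l'.1 else 0) =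
      if l'.1 p = false then saddleCoeff E a b l.1 (l'.upd p true).1 else 0 := by
  rw [l.2 p a ha, l'.2 p a ha']
  have e1 : ∀ v, (l.upd p v).1 a = v := fun v => l.upd_of_rel v (E.symm ha)
  have e3 : ∀ v, (l'.upd p v).1 a = v := fun v => l'.upd_of_rel v (E'.symm ha')
  have e5 : (∀ q, ¬ E q a → ¬ E q b → l'.1 q = (l.upd p false).1 q) ↔
      ∀ q, ¬ E q a → ¬ E q b → l'.1 q = l.1 q := by
    refine forall_congr' fun q => imp_congr_right fun h1 => imp_congr_right fun h2 => ?_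
    rw [Lab.upd_of_not]
    exact fun h => h1 (E.trans h ha)
  have e6 : (∀ q, ¬ E q a → ¬ E q b → (l'.upd p true).1 q = l.1 q) ↔
      ∀ q, ¬ E q a → ¬ E q b → l'.1 q = l.1 q := by
    refine forall_congr' fun q => imp_congr_right fun h1 => imp_congr_right fun h2 => ?_
    rw [Lab.upd_of_not]
    intro hqp
    rcases h with h | h
    · have := (h.rel_left_iff q).1 (E'.trans hqp ha')
      tauto
    · exact h1 (h.le (E'.trans hqp ha'))
  simp only [saddleCoeff, e1, e3, e5, e6]
  by_cases hoth : ∀ q, ¬ E q a → ¬ E q b → l'.1 q = l.1 q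
  swap
  · simp [hoth]
  simp only [if_pos hoth]
  rcases h with h | h
  · have e2 : (l.upd p false).1 b = l.1 b :=
      l.upd_of_not _ fun hb => h.ne (E.symm (E.trans hb ha))
    simp only [h.ne, if_false, e2]
    -- Associativity: multiplying a factor by `v₋` before the merge equals multiplying the product
    -- by `v₋` after it.
    cases l.1 a <;> cases l.1 b <;> cases l'.1 a <;> simp [mulCoeff]
  · have e2 : (l'.upd p true).1 b = l'.1 b :=
      l'.upd_of_not _ fun hb => h.ne (E'.symm (E'.trans hb ha'))
    simp only [h.rel, if_true, e2]
    -- The coproduct is a map of modules: multiplication by `v₋` before the split equals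
    -- multiplication of one tensor factor after it.
    cases l.1 a <;> cases l'.1 b <;> cases l'.1 a <;> simp [comulCoeff]

theorem Saddle.swap (h : Saddle E E' a b) : Saddle E E' b a := Or.imp Merge.swap Merge.swap h

theorem Saddle.symm (h : Saddle E E' a b) : Saddle E' E a b := Or.symm h

theorem Saddle.coeff_swap (h : Saddle E E' a b) (l : Lab E) (l' : Lab E') :
    saddleCoeff E b a l.1 l'.1 = saddleCoeff E a b l.1 l'.1 := by
  refine saddleCoeff_swap _ _ (l.2 a b) fun hab => ?_
  rcases h with h | h
  · exact l'.2 a b h.rel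
  · exact absurd h.rel hab

section

variable [Finite X]

/-- The map of a saddle is linear over the algebra of the points. -/
theorem saddleMatrix_mul_dotMatrix (h : Saddle E E' a b) (p : X) :
    saddleMatrix E E' a b * dotMatrix E p = dotMatrix E' p * saddleMatrix E E' a b := by
  refine Matrix.ext fun l' l => ?_
  rw [mul_dotMatrix_apply, dotMatrix_mul_apply]
  simp only [saddleMatrix, Matrix.of_apply]
  by_cases hoth : ¬ E p a ∧ ¬ E p b
  · obtain ⟨ha, hb⟩ := hoth
    have hp : ∀ q, E' p q ↔ E p q := by
      intro q
      rcases h with h | h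
      · exact h.other ha hb q
      · exact (h.other (fun h' => ha (h.le h')) (fun h' => hb (h.le h')) q).symm
    refine saddleCoeff_dot_other l l' ha hb (fun q => ?_) ?_ ?_
    · rw [E'.comm', hp, E.comm']
    · rwa [hp]
    · rwa [hp]
  -- A point of a class that takes part lies with `a` in both partitions or with `b` in both, so up
  -- to exchanging `a` and `b` the module property at `a` suffices.
  · have key : (E p a ∧ E' p a) ∨ (E p b ∧ E' p b) := by
      rcases h with h | h
      · by_cases ha : E p a
        · exact Or.inl ⟨ha, h.le ha⟩
        · have hb : E p b := by tauto
          exact Or.inr ⟨hb, h.le hb⟩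
      · have : E' p a ∨ E' p b := by
          have h1 := h.rel_left_iff p
          have h2 := h.rel_right_iff p
          tauto
        rcases this with h1 | h1
        · exact Or.inl ⟨h.le h1, h1⟩
        · exact Or.inr ⟨h.le h1, h1⟩
    rcases key with ⟨h1, h2⟩ | ⟨h1, h2⟩
    · exact saddleCoeff_dot_left h l l' h1 h2
    · have := saddleCoeff_dot_left h.swap l l' h1 h2
      rwa [h.coeff_swap, h.coeff_swap] at this

/-- Maps that are linear over the algebra of the points are determined by the image of `1`. -/
theorem matrix_ext_of_dot {M N : Matrix (Lab E') (Lab E) ℚ}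
    (hM : ∀ p, M * dotMatrix E p = dotMatrix E' p * M)
    (hN : ∀ p, N * dotMatrix E p = dotMatrix E' p * N)
    (h : ∀ l', M l' (Lab.top E) = N l' (Lab.top E)) : M = N := by
  -- Induction on the number of points with label `v₋`: labels with `v₋` at `p` arise from those
  -- with `v₊` at `p` by multiplication at `p`.
  have key : ∀ (n : ℕ) (l : Lab E), {p | l.1 p = false}.ncard = n → ∀ l', M l' l = N l' l := by
    intro n
    induction n using Nat.strong_induction_on with
    | _ n ih =>
      intro l hl l'
      by_cases hex : ∃ p, l.1 p = false
      · obtain ⟨p, hp⟩ := hex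
        have e : l = (l.upd p true).upd p false := by
          apply Lab.ext
          intro q
          by_cases hq : E q p
          · rw [Lab.upd_of_rel _ _ hq, l.2 q p hq, hp]
          · rw [Lab.upd_of_not _ _ hq, Lab.upd_of_not _ _ hq]
        have hlt : {q | (l.upd p true).1 q = false}.ncard < n := by
          rw [← hl]
          have : ({q | (l.upd p true).1 q = false} : Set X) ⊂ {q | l.1 q = false} := by
            refine ⟨fun q hq => ?_, fun hsub => ?_⟩
            · by_contra hne
              have hqp : ¬ E q p := by
                intro hqp
                simp [Lab.upd_of_rel _ _ hqp] at hq
              rw [Set.mem_ofPred_eq, Lab.upd_of_not _ _ hqp] at hq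
              exact hne hq
            · have := hsub hp
              rw [Set.mem_ofPred_eq, Lab.upd_self] at this
              cases this
          exact Set.ncard_lt_ncard this (Set.toFinite _)
        have ihl := ih _ hlt (l.upd p true) rfl
        have h1 := congrFun (congrFun (hM p) l') (l.upd p true)
        have h2 := congrFun (congrFun (hN p) l') (l.upd p true)
        rw [mul_dotMatrix_apply, dotMatrix_mul_apply, if_pos (Lab.upd_self _ _ _), ← e] at h1 h2
        rw [h1, h2]
        simp only [ihl]
      · have : l = Lab.top E := by
          apply Lab.ext
          intro p
          rw [Lab.top_apply]
          by_contra hne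
          exact hex ⟨p, by simpa using hne⟩
        rw [this, h]
  exact Matrix.ext fun l' l => key _ l rfl _

end

/-- The image of `1` under a merge. -/
theorem Merge.saddleMatrix_top (h : Merge E E' a b) (l' : Lab E') :
    saddleMatrix E E' a b l' (Lab.top E) = if l' = Lab.top E' then 1 else 0 := by
  rw [saddleMatrix, Matrix.of_apply]
  by_cases h1 : ∀ p, ¬ E p a → ¬ E p b → l'.1 p = (Lab.top E).1 p
  · rw [saddleCoeff_of_merge h.ne h1, Lab.top_apply, Lab.top_apply]
    cases ha : l'.1 a
    · rw [if_neg]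
      · rfl
      · rintro rfl
        cases ha
    · rw [if_pos]
      · rfl
      · apply Lab.ext
        intro p
        by_cases hp : E p a ∨ E p b
        · rw [l'.2 p a ((h.rel_left_iff p).2 hp), ha]; rfl
        · exact h1 p (fun h' => hp (Or.inl h')) (fun h' => hp (Or.inr h'))
  · rw [saddleCoeff_of_not_agree h1, if_neg]
    rintro rfl
    exact h1 fun _ _ _ => rfl

/-- The image of `1` under a split. -/
theorem Merge.saddleMatrix_top_split (h : Merge E' E a b) (l' : Lab E') :
    saddleMatrix E E' a b l' (Lab.top E) =
      (if l' = (Lab.top E').upd a false then 1 else 0) +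
        (if l' = (Lab.top E').upd b false then 1 else 0) := by
  have hne : (Lab.top E').upd a false ≠ (Lab.top E').upd b false := by
    intro he
    have := congrArg (fun l : Lab E' => l.1 a) he
    simp only [Lab.upd_self, Lab.upd_of_not _ _ h.ne] at this
    cases this
  have hgen : ∀ c d : X, Merge E' E c d →
      (∀ p, ¬ E p c → ¬ E p d → l'.1 p = true) → l'.1 c = false → l'.1 d = true →
      l' = (Lab.top E').upd c false := by
    intro c d hcd h1 hc hd
    apply Lab.ext
    intro p
    by_cases hpc : E' p c
    · rw [l'.2 p c hpc, hc, Lab.upd_of_rel _ _ hpc]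
    · rw [Lab.upd_of_not _ _ hpc]
      by_cases hpd : E' p d
      · rw [l'.2 p d hpd, hd]; rfl
      · refine h1 p ?_ ?_
        · rw [hcd.rel_left_iff]; tauto
        · rw [hcd.rel_right_iff]; tauto
  rw [saddleMatrix, Matrix.of_apply]
  by_cases h1 : l' = (Lab.top E').upd a false
  · rw [if_pos h1, if_neg (by rw [h1]; exact hne), saddleCoeff_of_split h.rel, h1, Lab.upd_self,
      Lab.upd_of_not _ _ (fun hba => h.ne (E'.symm hba))]
    · simp [Lab.top_apply, comulCoeff]
    · intro p hp _
      rw [h1, Lab.upd_of_not _ _ (fun hpa => hp (h.le hpa))]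
      rfl
  by_cases h2 : l' = (Lab.top E').upd b false
  · rw [if_neg (by rw [h2]; exact hne.symm), if_pos h2, saddleCoeff_of_split h.rel, h2,
      Lab.upd_self, Lab.upd_of_not _ _ h.ne]
    · simp [Lab.top_apply, comulCoeff]
    · intro p _ hp
      rw [h2, Lab.upd_of_not _ _ (fun hpa => hp (h.le hpa))]
      rfl
  rw [if_neg h1, if_neg h2, add_zero]
  by_cases h3 : ∀ p, ¬ E p a → ¬ E p b → l'.1 p = (Lab.top E).1 p
  · rw [saddleCoeff_of_split h.rel h3, Lab.top_apply]
    cases ha : l'.1 a <;> cases hb : l'.1 b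
    · rfl
    · exact absurd (hgen a b h h3 ha hb) h1
    · exact absurd (hgen b a h.swap (fun p hp hq => h3 p hq hp) hb ha) h2
    · rfl
  · rw [saddleCoeff_of_not_agree h3]

section

variable [Finite X] {E₁ E₂ E₁₂ : Setoid X} {c d : X}

theorem mul_apply_top_of_merge {K : Type} (M : Matrix K (Lab E') ℚ) (h : Merge E E' a b) (k : K) :
    (M * saddleMatrix E E' a b) k (Lab.top E) = M k (Lab.top E') := by
  simp [Matrix.mul_apply, h.saddleMatrix_top]

theorem mul_apply_top_of_split {K : Type} (M : Matrix K (Lab E') ℚ) (h : Merge E' E a b) (k : K) :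
    (M * saddleMatrix E E' a b) k (Lab.top E) =
      (M * dotMatrix E' a) k (Lab.top E') + (M * dotMatrix E' b) k (Lab.top E') := by
  rw [mul_dotMatrix_apply, mul_dotMatrix_apply, if_pos (Lab.top_apply a), if_pos (Lab.top_apply b)]
  simp [Matrix.mul_apply, h.saddleMatrix_top_split, mul_add, Finset.sum_add_distrib]

omit [Finite X] in
theorem dotMatrix_congr {p q : X} (h : E p q) : dotMatrix E p = dotMatrix E q := by
  refine Matrix.ext fun l' l => ?_
  have e : l.upd p false = l.upd q false := by
    apply Lab.ext
    intro r
    have : E r p ↔ E r q := ⟨fun h' => E.trans h' h, fun h' => E.trans h' (E.symm h)⟩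
    simp only [Lab.upd_apply, this]
  simp only [dotMatrix, Matrix.of_apply, l.2 p q h, e]

/-- The image of `1` under a split followed by a merge. -/
theorem apply_top_split_merge (h₁ : Merge E₁ E a b) (h₂ : Merge E₁ E₁₂ c d) (k : Lab E₁₂) :
    (saddleMatrix E₁ E₁₂ c d * saddleMatrix E E₁ a b) k (Lab.top E) =
      dotMatrix E₁₂ a k (Lab.top E₁₂) + dotMatrix E₁₂ b k (Lab.top E₁₂) := by
  rw [mul_apply_top_of_split _ h₁, saddleMatrix_mul_dotMatrix (Or.inl h₂),
    saddleMatrix_mul_dotMatrix (Or.inl h₂), mul_apply_top_of_merge _ h₂,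
    mul_apply_top_of_merge _ h₂]

/-- The image of `1` under a merge followed by a split. -/
theorem apply_top_merge_split (h₁ : Merge E E₁ a b) (h₂ : Merge E₁₂ E₁ c d) (k : Lab E₁₂) :
    (saddleMatrix E₁ E₁₂ c d * saddleMatrix E E₁ a b) k (Lab.top E) =
      dotMatrix E₁₂ c k (Lab.top E₁₂) + dotMatrix E₁₂ d k (Lab.top E₁₂) := by
  rw [mul_apply_top_of_merge _ h₁]
  have := mul_apply_top_of_split 1 h₂ k
  simpa using this

/-- The image of `1` under two splits. -/
theorem apply_top_split_split (h₁ : Merge E₁ E a b) (h₂ : Merge E₁₂ E₁ c d) (k : Lab E₁₂) :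
    (saddleMatrix E₁ E₁₂ c d * saddleMatrix E E₁ a b) k (Lab.top E) =
      ((dotMatrix E₁₂ a + dotMatrix E₁₂ b) * (dotMatrix E₁₂ c + dotMatrix E₁₂ d)) k
        (Lab.top E₁₂) := by
  rw [mul_apply_top_of_split _ h₁, saddleMatrix_mul_dotMatrix (Or.inr h₂),
    saddleMatrix_mul_dotMatrix (Or.inr h₂), mul_apply_top_of_split _ h₂,
    mul_apply_top_of_split _ h₂]
  simp only [add_mul, mul_add, Matrix.add_apply]
  ring

theorem dotMatrix_mul_comm (p q : X) :
    dotMatrix E p * dotMatrix E q = dotMatrix E q * dotMatrix E p := by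
  refine Matrix.ext fun l' l => ?_
  rw [mul_dotMatrix_apply, mul_dotMatrix_apply]
  by_cases h : E p q
  · rw [dotMatrix_congr h, l.2 p q h]
    have : l.upd p false = l.upd q false := by
      apply Lab.ext
      intro r
      have : E r p ↔ E r q := ⟨fun h' => E.trans h' h, fun h' => E.trans h' (E.symm h)⟩
      simp only [Lab.upd_apply, this]
    rw [this]
  · have h' : ¬ E q p := fun h' => h (E.symm h')
    simp only [dotMatrix, Matrix.of_apply, Lab.upd_of_not _ _ h, Lab.upd_of_not _ _ h']
    have : (l.upd p false).upd q false = (l.upd q false).upd p false := by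
      apply Lab.ext
      intro r
      simp only [Lab.upd_apply]
      split_ifs <;> rfl
    rw [this]
    split_ifs <;> simp_all

/-- The faces of the cube of resolutions commute. -/
theorem saddleMatrix_comm (h₁ : Saddle E E₁ a b) (h₂ : Saddle E E₂ c d)
    (h₁₂ : Saddle E₁ E₁₂ c d) (h₂₁ : Saddle E₂ E₁₂ a b) :
    saddleMatrix E₁ E₁₂ c d * saddleMatrix E E₁ a b =
      saddleMatrix E₂ E₁₂ a b * saddleMatrix E E₂ c d := by
  -- Both composites commute with multiplication at all points, so it suffices to compare the images
  -- of the labelling that is `v₊` everywhere.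
  refine matrix_ext_of_dot (fun p => ?_) (fun p => ?_) fun k => ?_
  · rw [Matrix.mul_assoc, saddleMatrix_mul_dotMatrix h₁, ← Matrix.mul_assoc,
      saddleMatrix_mul_dotMatrix h₁₂, Matrix.mul_assoc]
  · rw [Matrix.mul_assoc, saddleMatrix_mul_dotMatrix h₂, ← Matrix.mul_assoc,
      saddleMatrix_mul_dotMatrix h₂₁, Matrix.mul_assoc]
  -- Each of the four saddles is a merge or a split. Ten of the sixteen combinations are
  -- contradictory, because a merge only adds relations. In the other six, the image is a unit, a
  -- sum of two multiplications by `v₋`, or a product of two such sums.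
  rcases h₁ with h₁ | h₁ <;> rcases h₁₂ with h₁₂ | h₁₂ <;> rcases h₂ with h₂ | h₂ <;>
    rcases h₂₁ with h₂₁ | h₂₁
  · rw [mul_apply_top_of_merge _ h₁, mul_apply_top_of_merge _ h₂, h₁₂.saddleMatrix_top,
      h₂₁.saddleMatrix_top]
  · exact absurd (h₁₂.le h₁.rel) h₂₁.ne
  · exact absurd (h₁.le h₂.rel) h₁₂.ne
  · exact absurd (h₁.le h₂.rel) h₁₂.ne
  · exact absurd (h₂₁.le h₂.rel) h₁₂.ne
  · rw [apply_top_merge_split h₁ h₁₂, apply_top_merge_split h₂ h₂₁]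
    have hab := (h₁₂.iff a b).1 h₁.rel
    have h0 := h₂₁.ne
    -- The class of `c` and `d` in `E₁` falls apart in `E₁₂`. As `a` and `b` are related in `E₁` but
    -- not in `E₁₂`, they lie in the two different parts.
    have : (E₁₂ a c ∧ E₁₂ b d) ∨ (E₁₂ a d ∧ E₁₂ b c) := by
      rcases hab with h | ⟨h | h, h' | h'⟩
      · exact absurd h h0
      · exact absurd (E₁₂.trans h (E₁₂.symm h')) h0
      · exact Or.inl ⟨h, h'⟩
      · exact Or.inr ⟨h, h'⟩
      · exact absurd (E₁₂.trans h (E₁₂.symm h')) h0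
    rcases this with ⟨h, h'⟩ | ⟨h, h'⟩
    · rw [dotMatrix_congr h, dotMatrix_congr h']
    · rw [dotMatrix_congr h, dotMatrix_congr h', add_comm]
  · rw [apply_top_merge_split h₁ h₁₂, apply_top_split_merge h₂ h₂₁]
  · exact absurd (h₂.le h₂₁.rel) h₁.ne
  · exact absurd (h₂.le h₁.rel) h₂₁.ne
  · rw [apply_top_split_merge h₁ h₁₂, apply_top_merge_split h₂ h₂₁]
  · rw [apply_top_split_merge h₁ h₁₂, apply_top_split_merge h₂ h₂₁]
    have h3 : E₁₂ a b := h₂₁.rel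
    have h4 : E₁₂ c d := h₁₂.rel
    -- Here a class is split and joined again on both paths, so all four points are in one class at
    -- the end and both composites are twice the multiplication by `v₋` there.
    have h5 : E₁₂ a c := by
      rcases (h₁₂.iff a b).1 h3 with h | ⟨h | h, _⟩
      · exact absurd h h₁.ne
      · exact h₁₂.le h
      · exact E₁₂.trans (h₁₂.le h) (E₁₂.symm h4)
    rw [← dotMatrix_congr h3, ← dotMatrix_congr h4, dotMatrix_congr h5]
  · exact absurd (h₂₁.le h₁₂.rel) h₂.ne
  · exact absurd (h₂.le h₁.rel) h₂₁.ne
  · exact absurd (h₁.le h₁₂.rel) h₂.ne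
  · exact absurd (h₁₂.le h₂₁.rel) h₁.ne
  · rw [apply_top_split_split h₁ h₁₂, apply_top_split_split h₂ h₂₁]
    simp only [add_mul, mul_add, dotMatrix_mul_comm c, dotMatrix_mul_comm d, Matrix.add_apply]
    ring

end

end Saddles

/-! ## Sums over the classes of a partition -/

section ClassSums

open scoped Classical

/-- The sum over all classes of the values of a function that is constant on classes. -/
noncomputable def classSum {X : Type} [Finite X] (E : Setoid X) (F : X → ℤ) : ℤ :=
  letI := Fintype.ofFinite (Quotient E)
  ∑ z : Quotient E, F z.out

theorem classSum_eq {X Z : Type} [Finite X] [Fintype Z] {E : Setoid X} {F : X → ℤ}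
    (hF : ∀ p q, E p q → F p = F q) (π : X → Z) (hπ : Function.Surjective π)
    (h : ∀ p q, π p = π q ↔ E p q) (G : Z → ℤ) (hG : ∀ p, G (π p) = F p) :
    classSum E F = ∑ z, G z := by
  let _ := Fintype.ofFinite (Quotient E)
  let f : Quotient E → Z := Quotient.lift π fun p q hpq => (h p q).2 hpq
  refine Fintype.sum_bijective f ⟨?_, ?_⟩ _ _ ?_
  · intro x y
    induction x using Quotient.inductionOn with | _ x => ?_
    induction y using Quotient.inductionOn with | _ y => ?_
    intro hxy
    exact Quotient.sound ((h x y).1 hxy)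
  · intro z
    obtain ⟨x, rfl⟩ := hπ z
    exact ⟨Quotient.mk E x, rfl⟩
  · intro x
    induction x using Quotient.inductionOn with | _ x => ?_
    change _ = G (π x)
    rw [hG]
    exact hF _ _ (Quotient.mk_out x)

theorem classSum_comap {X O : Type} [Finite X] [Finite O] {E : Setoid X} {F : X → ℤ}
    (hF : ∀ p q, E p q → F p = F q) (φ : O → X) (hs : ∀ x, ∃ o, E x (φ o)) :
    classSum E F = classSum (E.comap φ) (F ∘ φ) := by
  let _ := Fintype.ofFinite (Quotient E)
  rw [classSum_eq hF (Quotient.mk E) Quotient.mk_surjective (fun p q => Quotient.eq)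
    (fun z => F z.out) (fun p => hF _ _ (Quotient.mk_out p))]
  symm
  refine classSum_eq (E := E.comap φ) (F := F ∘ φ) (fun p q hpq => hF _ _ hpq) (fun o => Quotient.mk E (φ o)) ?_ ?_ _ ?_
  · intro z
    induction z using Quotient.inductionOn with | _ x => ?_
    obtain ⟨o, ho⟩ := hs x
    exact ⟨o, Quotient.sound (E.symm ho)⟩
  · intro p q
    exact Quotient.eq
  · intro o
    exact hF _ _ (Quotient.mk_out (φ o))

/-- All classes but the one of `y` are represented by points of `O`, so a sum over classes splits
off the term of `y`. This is the tool for isolating the classes that take part in a saddle. -/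
theorem classSum_eq_add {X O : Type} [Finite X] [Finite O] {E : Setoid X} {F : X → ℤ}
    (hF : ∀ p q, E p q → F p = F q) (φ : O → X) (y : X) (hy : ∀ o, ¬ E (φ o) y)
    (hs : ∀ x, E x y ∨ ∃ o, E x (φ o)) :
    classSum E F = F y + classSum (E.comap φ) (F ∘ φ) := by
  let _ := Fintype.ofFinite (Quotient (E.comap φ))
  -- The value `none` stands for the class of `y`.
  let π : X → Option (Quotient (E.comap φ)) := fun x =>
    if h : E x y then none else some (Quotient.mk _ ((hs x).resolve_left h).choose)
  have hspec : ∀ x (h : ¬ E x y), E x (φ ((hs x).resolve_left h).choose) := fun x h =>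
    ((hs x).resolve_left h).choose_spec
  have hnone : ∀ x, E x y → π x = none := fun x h => dif_pos h
  have hsome : ∀ x, ¬ E x y → ∃ o, E x (φ o) ∧ π x = some (Quotient.mk _ o) := fun x h =>
    ⟨_, hspec x h, dif_neg h⟩
  rw [classSum_eq hF π ?_ ?_ (fun z => z.elim (F y) fun w => (F ∘ φ) w.out), Fintype.sum_option]
  · rfl
  · intro p
    by_cases h : E p y
    · rw [hnone p h]
      exact (hF _ _ h).symm
    · obtain ⟨o, ho, e⟩ := hsome p h
      rw [e]
      refine (hF _ _ ?_).symm
      refine E.trans ho ?_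
      exact (E.comap φ).symm (Quotient.mk_out o)
  · intro z
    cases z with
    | none => exact ⟨y, hnone y (E.refl y)⟩
    | some w =>
      induction w using Quotient.inductionOn with | _ o => ?_
      obtain ⟨o', ho', e⟩ := hsome (φ o) (hy o)
      exact ⟨φ o, e.trans (congrArg some (Quotient.sound (E.symm ho')))⟩
  · intro p q
    by_cases hp : E p y <;> by_cases hq : E q y
    · simp only [hnone p hp, hnone q hq, true_iff]
      exact E.trans hp (E.symm hq)
    · obtain ⟨o, ho, e⟩ := hsome q hq
      rw [hnone p hp, e]
      simp only [reduceCtorEq, false_iff]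
      exact fun h => hq (E.trans (E.symm h) hp)
    · obtain ⟨o, ho, e⟩ := hsome p hp
      rw [hnone q hq, e]
      simp only [reduceCtorEq, false_iff]
      exact fun h => hp (E.trans h hq)
    · obtain ⟨o, ho, e⟩ := hsome p hp
      obtain ⟨o', ho', e'⟩ := hsome q hq
      rw [e, e', Option.some_inj, Quotient.eq]
      change E (φ o) (φ o') ↔ _
      exact ⟨fun h => E.trans ho (E.trans h (E.symm ho')),
        fun h => E.trans (E.symm ho) (E.trans h ho')⟩

/-- Away from `a` and `b` both partitions have the same classes with the same contributions; once
the classes that take part are removed, the same sum is left on both sides. -/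
theorem Merge.classSum {X : Type} [Finite X] {E E' : Setoid X} {a b : X} (h : Merge E E' a b)
    {F F' : X → ℤ} (hF : ∀ p q, E p q → F p = F q) (hF' : ∀ p q, E' p q → F' p = F' q)
    (hoth : ∀ p, ¬ E p a → ¬ E p b → F' p = F p) :
    classSum E' F' - F' a = classSum E F - F a - F b := by
  let O : Type := {x // ¬ E x a}
  let φ : O → X := Subtype.val
  let O' : Type := {x : O // ¬ E x.1 b}
  let ψ : O' → O := Subtype.val
  have e1 : _root_.classSum E F = F a + _root_.classSum (E.comap φ) (F ∘ φ) := by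
    refine classSum_eq_add hF φ a (fun o => o.2) fun x => ?_
    by_cases hx : E x a
    · exact Or.inl hx
    · exact Or.inr ⟨⟨x, hx⟩, E.refl x⟩
  have hba : ¬ E b a := fun h' => h.ne (E.symm h')
  have e2 : _root_.classSum (E.comap φ) (F ∘ φ) =
      F b + _root_.classSum ((E.comap φ).comap ψ) ((F ∘ φ) ∘ ψ) := by
    refine classSum_eq_add (E := E.comap φ) (F := F ∘ φ) (fun p q hpq => hF _ _ hpq) ψ ⟨b, hba⟩ (fun o => o.2) fun x => ?_
    by_cases hx : E x.1 b
    · exact Or.inl hx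
    · exact Or.inr ⟨⟨x, hx⟩, E.refl x.1⟩
  have e3 : _root_.classSum E' F' = F' a + _root_.classSum (E'.comap (φ ∘ ψ)) (F' ∘ (φ ∘ ψ)) := by
    refine classSum_eq_add hF' (φ ∘ ψ) a (fun o ho => ?_) fun x => ?_
    · rcases (h.rel_left_iff _).1 ho with h1 | h1
      · exact o.1.2 h1
      · exact o.2 h1
    · by_cases hx : E' x a
      · exact Or.inl hx
      · rw [h.rel_left_iff] at hx
        exact Or.inr ⟨⟨⟨x, fun h' => hx (Or.inl h')⟩, fun h' => hx (Or.inr h')⟩, E'.refl x⟩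
  have e4 : E'.comap (φ ∘ ψ) = (E.comap φ).comap ψ := by
    ext p q
    exact h.other p.1.2 p.2 _
  have e5 : F' ∘ (φ ∘ ψ) = (F ∘ φ) ∘ ψ := by
    funext p
    exact hoth _ p.1.2 p.2
  rw [e3, e1, e2, e4, e5]
  ring

end ClassSums

/-! ## Cubes of resolutions -/

/-- An abstract cube of resolutions: a partition of a finite set of points for each set of
crossings, such that neighbouring partitions differ by saddles.  The points in `W` are those on
the cutting ray. -/
structure Cube (C : Type) [DecidableEq C] where
  X : Type
  [finX : Finite X]
  E : Finset C → Setoid X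
  a : C → X
  b : C → X
  W : X → Prop
  hs : ℤ
  qs : ℤ
  saddle : ∀ α c, c ∉ α → Saddle (E α) (E (insert c α)) (a c) (b c)

attribute [instance] Cube.finX

/-- The sign of an edge of the cube, for the order of the crossings given by `r`. -/
def edgeSign {C : Type} (r : C → ℕ) (α : Finset C) (c : C) : ℚ :=
  (-1) ^ (α.filter (r · < r c)).card

theorem edgeSign_mul_self {C : Type} (r : C → ℕ) (α : Finset C) (c : C) :
    edgeSign r α c * edgeSign r α c = 1 := by
  rw [edgeSign, ← mul_pow]; simp

theorem edgeSign_insert {C : Type} [DecidableEq C] (r : C → ℕ) {α : Finset C} {c e : C}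
    (hc : c ∉ α) :
    edgeSign r (insert c α) e = (if r c < r e then -1 else 1) * edgeSign r α e := by
  rw [edgeSign, edgeSign, Finset.filter_insert]
  split_ifs with h
  · rw [Finset.card_insert_of_notMem (by simp [hc]), pow_succ]
    ring
  · simp

namespace Cube

open scoped Classical

variable {C : Type} [DecidableEq C] (K : Cube C)

/-- A class is nontrivial if it contains an odd number of points of the cutting ray. -/
def Nt (α : Finset C) (p : K.X) : Prop := Odd (Nat.card {x // K.W x ∧ K.E α x p})

theorem nt_congr {α : Finset C} {p q : K.X} (h : K.E α p q) : K.Nt α p ↔ K.Nt α q := by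
  have : ∀ x, K.E α x p ↔ K.E α x q := fun x =>
    ⟨fun h' => (K.E α).trans h' h, fun h' => (K.E α).trans h' ((K.E α).symm h)⟩
  simp only [Nt, this]

/-- The generators of the complex of a cube. -/
abbrev Gen : Type := Σ α : Finset C, Lab (K.E α)

/-- The degree of labels on a resolution. -/
noncomputable def labDeg (α : Finset C) (l : K.X → Bool) : ℤ × ℤ × ℤ :=
  (α.card + K.hs,
    classSum (K.E α) (fun x => AnnularDiagram.labelDeg (l x)) + α.card + K.qs,
    classSum (K.E α) (fun x => if K.Nt α x then AnnularDiagram.labelDeg (l x) else 0))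

/-- The degree of a generator. -/
noncomputable def deg (g : K.Gen) : ℤ × ℤ × ℤ := K.labDeg g.1 g.2.1

/-- The coefficients of the differential, for the order of the crossings given by `r`. -/
noncomputable def d [Fintype C] (r : C → ℕ) : Matrix K.Gen K.Gen ℚ :=
  Matrix.of fun g' g => ∑ c, if c ∉ g.1 ∧ g'.1 = insert c g.1 then
    edgeSign r g.1 c * saddleCoeff (K.E g.1) (K.a c) (K.b c) g.2.1 g'.2.1 else 0

variable [Fintype C]

theorem d_apply (r : C → ℕ) (g' g : K.Gen) {c : C} (hc : c ∉ g.1) (h : g'.1 = insert c g.1) :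
    K.d r g' g = edgeSign r g.1 c * saddleCoeff (K.E g.1) (K.a c) (K.b c) g.2.1 g'.2.1 := by
  rw [d, Matrix.of_apply, Finset.sum_eq_single c]
  · rw [if_pos ⟨hc, h⟩]
  · intro e _ hne
    rw [if_neg]
    rintro ⟨he, h'⟩
    apply hne
    have : e ∈ insert c g.1 := by rw [← h, h']; exact Finset.mem_insert_self e _
    rcases Finset.mem_insert.1 this with h1 | h1
    · exact h1
    · exact absurd h1 he
  · simp

theorem exists_of_d_ne_zero {r : C → ℕ} {g' g : K.Gen} (h : K.d r g' g ≠ 0) :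
    ∃ c, c ∉ g.1 ∧ g'.1 = insert c g.1 := by
  rw [d, Matrix.of_apply] at h
  obtain ⟨c, -, hc⟩ := Finset.exists_ne_zero_of_sum_ne_zero h
  by_contra h'
  push Not at h'
  exact hc (if_neg fun h1 => h' c h1.1 h1.2)

theorem d_eq_zero {r : C → ℕ} {g' g : K.Gen} (h : ∀ c, c ∉ g.1 → g'.1 ≠ insert c g.1) :
    K.d r g' g = 0 := by
  by_contra h'
  obtain ⟨c, hc, e⟩ := K.exists_of_d_ne_zero h'
  exact h c hc e

-- Of the two insertions, exactly one changes the sign of the other crossing, namely that of the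
-- earlier crossing.
omit [Fintype C] in
theorem edgeSign_anticomm {r : C → ℕ} (hr : Function.Injective r) {α : Finset C} {c e : C}
    (hc : c ∉ α) (he : e ∉ α) (hce : c ≠ e) :
    edgeSign r α c * edgeSign r (insert c α) e = -(edgeSign r α e * edgeSign r (insert e α) c) := by
  rw [edgeSign_insert r hc, edgeSign_insert r he]
  have : r c ≠ r e := fun h => hce (hr h)
  rcases lt_or_gt_of_ne this with h | h
  · rw [if_pos h, if_neg h.asymm]; ring
  · rw [if_neg h.asymm, if_pos h]; ring

omit [Fintype C] in
/-- The contribution of a path of two edges to the square of the differential. -/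
theorem path_anticomm {r : C → ℕ} (hr : Function.Injective r) {α β : Finset C} (c e : C)
    (l : Lab (K.E α)) (m : Lab (K.E β)) :
    (if c ∉ α ∧ e ∉ insert c α ∧ β = insert e (insert c α) then
      edgeSign r α c * edgeSign r (insert c α) e *
        (saddleMatrix (K.E (insert c α)) (K.E β) (K.a e) (K.b e) *
          saddleMatrix (K.E α) (K.E (insert c α)) (K.a c) (K.b c)) m l else 0) =
    -(if e ∉ α ∧ c ∉ insert e α ∧ β = insert c (insert e α) then
      edgeSign r α e * edgeSign r (insert e α) c *
        (saddleMatrix (K.E (insert e α)) (K.E β) (K.a c) (K.b c) *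
          saddleMatrix (K.E α) (K.E (insert e α)) (K.a e) (K.b e)) m l else 0) := by
  by_cases h : c ∉ α ∧ e ∉ insert c α ∧ β = insert e (insert c α)
  · obtain ⟨h1, h2, h3⟩ := h
    have hce : c ≠ e := fun h => h2 (by rw [h]; exact Finset.mem_insert_self _ _)
    have he : e ∉ α := fun h => h2 (Finset.mem_insert_of_mem h)
    have h4 : c ∉ insert e α := by simp [hce, h1]
    have h5 : β = insert c (insert e α) := by rw [h3, Finset.insert_comm]
    rw [if_pos ⟨h1, h2, h3⟩, if_pos ⟨he, h4, h5⟩, edgeSign_anticomm hr h1 he hce,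
      saddleMatrix_comm (K.saddle α c h1) (K.saddle α e he) (h3 ▸ K.saddle _ e h2)
        (h5 ▸ K.saddle _ c h4)]
    ring
  · rw [if_neg h, if_neg, neg_zero]
    rintro ⟨h1, h2, h3⟩
    have hce : e ≠ c := fun h => h2 (by rw [h]; exact Finset.mem_insert_self _ _)
    exact h ⟨fun h => h2 (Finset.mem_insert_of_mem h), by simp [hce, h1],
      by rw [h3, Finset.insert_comm]⟩

/-- An entry of the square is a sum over ordered pairs of crossings. Exchanging the two crossings
changes the sign of each summand, so the sum equals its own negative. -/
theorem d_mul_d {r : C → ℕ} (hr : Function.Injective r) : K.d r * K.d r = 0 := by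
  refine Matrix.ext fun g' g => ?_
  obtain ⟨β, m⟩ := g'
  obtain ⟨α, l⟩ := g
  have key : (K.d r * K.d r) ⟨β, m⟩ ⟨α, l⟩ = ∑ c, ∑ e,
      if c ∉ α ∧ e ∉ insert c α ∧ β = insert e (insert c α) then
      edgeSign r α c * edgeSign r (insert c α) e *
        (saddleMatrix (K.E (insert c α)) (K.E β) (K.a e) (K.b e) *
          saddleMatrix (K.E α) (K.E (insert c α)) (K.a c) (K.b c)) m l else 0 := by
    rw [Matrix.mul_apply, ← Finset.univ_sigma_univ, Finset.sum_sigma]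
    have e1 : ∀ γ : Finset C, ∀ n : Lab (K.E γ), K.d r ⟨β, m⟩ ⟨γ, n⟩ * K.d r ⟨γ, n⟩ ⟨α, l⟩ =
        ∑ c, if c ∉ α ∧ γ = insert c α then edgeSign r α c *
          saddleCoeff (K.E α) (K.a c) (K.b c) l.1 n.1 * K.d r ⟨β, m⟩ ⟨γ, n⟩ else 0 := by
      intro γ n
      conv_lhs => rw [d, Matrix.of_apply, Matrix.of_apply, mul_comm, Finset.sum_mul]
      refine Finset.sum_congr rfl fun c _ => ?_
      simp only [ite_mul, zero_mul]
      rfl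
    simp only [e1]
    have e2 : ∀ γ : Finset C, (∑ n : Lab (K.E γ), ∑ c, if c ∉ α ∧ γ = insert c α then
          edgeSign r α c * saddleCoeff (K.E α) (K.a c) (K.b c) l.1 n.1 * K.d r ⟨β, m⟩ ⟨γ, n⟩
          else 0) = ∑ c, if γ = insert c α then (if c ∉ α then ∑ n : Lab (K.E γ),
          edgeSign r α c * saddleCoeff (K.E α) (K.a c) (K.b c) l.1 n.1 * K.d r ⟨β, m⟩ ⟨γ, n⟩
          else 0) else 0 := by
      intro γ
      rw [Finset.sum_comm]
      refine Finset.sum_congr rfl fun c _ => ?_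
      by_cases h1 : c ∉ α <;> by_cases h2 : γ = insert c α <;> simp [h1, h2]
    simp only [e2]
    rw [Finset.sum_comm]
    refine Finset.sum_congr rfl fun c _ => ?_
    rw [Finset.sum_ite_eq', if_pos (Finset.mem_univ _)]
    by_cases hc : c ∉ α
    swap
    · simp [hc]
    rw [if_pos hc]
    simp only [d, Matrix.of_apply, Finset.mul_sum, hc]
    rw [Finset.sum_comm]
    refine Finset.sum_congr rfl fun e _ => ?_
    by_cases h : e ∉ insert c α ∧ β = insert e (insert c α)
    · simp only [not_false_eq_true, true_and, if_pos h, Matrix.mul_apply, Finset.mul_sum, saddleMatrix, Matrix.of_apply]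
      refine Finset.sum_congr rfl fun n _ => ?_
      ring
    · simp only [not_false_eq_true, true_and, if_neg h, mul_zero, Finset.sum_const_zero]
  rw [key, Matrix.zero_apply]
  have h2 := Finset.sum_comm (s := (Finset.univ : Finset C)) (t := (Finset.univ : Finset C))
    (f := fun c e => if c ∉ α ∧ e ∉ insert c α ∧ β = insert e (insert c α) then
      edgeSign r α c * edgeSign r (insert c α) e *
        (saddleMatrix (K.E (insert c α)) (K.E β) (K.a e) (K.b e) *
          saddleMatrix (K.E α) (K.E (insert c α)) (K.a c) (K.b c)) m l else (0 : ℚ))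
  have h3 : ∀ x : ℚ, x = -x → x = 0 := fun x hx => by linarith
  apply h3
  conv_lhs => rw [h2]
  rw [← Finset.sum_neg_distrib]
  refine Finset.sum_congr rfl fun c _ => ?_
  rw [← Finset.sum_neg_distrib]
  exact Finset.sum_congr rfl fun e _ => K.path_anticomm hr _ _ _ _

-- The points of the ray on the merged class are the disjoint union of those on the two old classes,
-- so the parities add: the merged cycle is nontrivial exactly if one of the two is.
omit [Fintype C] in
theorem _root_.Merge.nt {α β : Finset C} {a b : K.X} (h : Merge (K.E α) (K.E β) a b) :
    (K.Nt β a ↔ ¬ (K.Nt α a ↔ K.Nt α b)) ∧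
      ∀ p, ¬ K.E α p a → ¬ K.E α p b → (K.Nt β p ↔ K.Nt α p) := by
  constructor
  · have e : {x | K.W x ∧ K.E β x a} = {x | K.W x ∧ K.E α x a} ∪ {x | K.W x ∧ K.E α x b} := by
      ext x
      simp only [Set.mem_ofPred_eq, Set.mem_union, h.rel_left_iff]
      tauto
    have hd : Disjoint {x | K.W x ∧ K.E α x a} {x | K.W x ∧ K.E α x b} := by
      rw [Set.disjoint_left]
      rintro x ⟨_, h1⟩ ⟨_, h2⟩
      exact h.ne ((K.E α).trans ((K.E α).symm h1) h2)
    have hc : Nat.card {x // K.W x ∧ K.E β x a} =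
        Nat.card {x // K.W x ∧ K.E α x a} + Nat.card {x // K.W x ∧ K.E α x b} := by
      have := Set.ncard_union_eq hd
      rw [← e] at this
      exact this
    rw [Nt, Nt, Nt, hc, Nat.odd_add]
    rw [← Nat.not_odd_iff_even]
    tauto
  · intro p ha hb
    have : ∀ x, K.E β x p ↔ K.E α x p := fun x => by
      rw [(K.E β).comm', (K.E α).comm']
      exact h.other ha hb x
    simp only [Nt, this]

theorem mulCoeff_ne_zero {x y z : Bool} (h : mulCoeff x y z ≠ 0) :
    (x = true ∧ y = true ∧ z = true) ∨ (x = true ∧ y = false ∧ z = false) ∨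
      (x = false ∧ y = true ∧ z = false) := by
  cases x <;> cases y <;> cases z <;> simp_all [mulCoeff]

theorem comulCoeff_ne_zero {x y z : Bool} (h : comulCoeff x y z ≠ 0) :
    (x = true ∧ y = true ∧ z = false) ∨ (x = true ∧ y = false ∧ z = true) ∨
      (x = false ∧ y = false ∧ z = false) := by
  cases x <;> cases y <;> cases z <;> simp_all [comulCoeff]

omit [Fintype C] in
/-- The gradings of the terms of the map of a saddle. -/
theorem saddle_deg {α β : Finset C} {a b : K.X} (h : Saddle (K.E α) (K.E β) a b)
    (l : Lab (K.E α)) (m : Lab (K.E β)) (hne : saddleCoeff (K.E α) a b l.1 m.1 ≠ 0) :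
    classSum (K.E β) (fun x => AnnularDiagram.labelDeg (m.1 x)) =
        classSum (K.E α) (fun x => AnnularDiagram.labelDeg (l.1 x)) - 1 ∧
      (((K.labDeg β m.1).2.2 = (K.labDeg α l.1).2.2) ∨
        ((K.labDeg β m.1).2.2 = (K.labDeg α l.1).2.2 + -2)) := by
  have hoth : ∀ p, ¬ K.E α p a → ¬ K.E α p b → m.1 p = l.1 p := by
    by_contra h'
    exact hne (saddleCoeff_of_not_agree h')
  have hF : ∀ (γ : Finset C) (n : Lab (K.E γ)) (p q : K.X), K.E γ p q →
      AnnularDiagram.labelDeg (n.1 p) = AnnularDiagram.labelDeg (n.1 q) := by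
    intro γ n p q hpq
    rw [n.2 p q hpq]
  have hA : ∀ (γ : Finset C) (n : Lab (K.E γ)) (p q : K.X), K.E γ p q →
      (if K.Nt γ p then AnnularDiagram.labelDeg (n.1 p) else 0) =
        (if K.Nt γ q then AnnularDiagram.labelDeg (n.1 q) else 0) := by
    intro γ n p q hpq
    simp only [n.2 p q hpq, K.nt_congr hpq]
  rcases h with h | h
  · rw [saddleCoeff_of_merge h.ne hoth] at hne
    have e1 := h.classSum (hF α l) (hF β m) fun p hp hq => by rw [hoth p hp hq]
    have e2 := h.classSum (hA α l) (hA β m) fun p hp hq => by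
      simp only [hoth p hp hq, (h.nt).2 p hp hq]
    have e3 := h.nt.1
    simp only [labDeg]
    -- A finite check over the nonzero products and the nontriviality of the two cycles. The annular
    -- grading drops by `2`, for instance, if two nontrivial cycles with labels `v₊` merge into a
    -- trivial one.
    rcases mulCoeff_ne_zero hne with ⟨h1, h2, h3⟩ | ⟨h1, h2, h3⟩ | ⟨h1, h2, h3⟩ <;>
      by_cases hna : K.Nt α a <;> by_cases hnb : K.Nt α b <;>
      simp only [h1, h2, h3, hna, hnb, e3, AnnularDiagram.labelDeg, if_true, if_false, iff_self,
        not_true_eq_false, not_false_eq_true, iff_true, iff_false,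
        Bool.false_eq_true] at e1 e2 ⊢ <;>
      omega
  · rw [saddleCoeff_of_split h.rel hoth] at hne
    have hoth' : ∀ p, ¬ K.E β p a → ¬ K.E β p b → l.1 p = m.1 p := by
      intro p hp hq
      refine (hoth p ?_ ?_).symm
      · rw [h.rel_left_iff]; tauto
      · rw [h.rel_right_iff]; tauto
    have e1 := h.classSum (hF β m) (hF α l) fun p hp hq => by rw [hoth' p hp hq]
    have e2 := h.classSum (hA β m) (hA α l) fun p hp hq => by
      simp only [hoth' p hp hq, (h.nt).2 p hp hq]
    have e3 := h.nt.1
    simp only [labDeg]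
    rcases comulCoeff_ne_zero hne with ⟨h1, h2, h3⟩ | ⟨h1, h2, h3⟩ | ⟨h1, h2, h3⟩ <;>
      by_cases hna : K.Nt β a <;> by_cases hnb : K.Nt β b <;>
      simp only [h1, h2, h3, hna, hnb, e3, AnnularDiagram.labelDeg, if_true, if_false, iff_self,
        not_true_eq_false, not_false_eq_true, iff_true, iff_false,
        Bool.false_eq_true] at e1 e2 ⊢ <;>
      omega

theorem d_annular {r : C → ℕ} {g' g : K.Gen} (h : K.d r g' g ≠ 0) :
    (K.deg g').2.2 = (K.deg g).2.2 ∨ (K.deg g').2.2 = (K.deg g).2.2 + -2 := by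
  obtain ⟨c, hc, e⟩ := K.exists_of_d_ne_zero h
  rw [K.d_apply r g' g hc e] at h
  have hs := K.saddle g.1 c hc
  rw [← e] at hs
  exact (K.saddle_deg hs g.2 g'.2 (right_ne_zero_of_mul h)).2

theorem filt_d (r : C → ℕ) : Filt K.deg K.deg (1, 0, 0) (K.d r) := by
  intro g' g h
  have h0 := h
  obtain ⟨c, hc, e⟩ := K.exists_of_d_ne_zero h
  rw [K.d_apply r g' g hc e] at h
  have hs := K.saddle g.1 c hc
  rw [← e] at hs
  have h1 := (K.saddle_deg hs g.2 g'.2 (right_ne_zero_of_mul h)).1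
  have hcard : g'.1.card = g.1.card + 1 := by rw [e, Finset.card_insert_of_notMem hc]
  have h2 : (K.deg g').1 = (K.deg g).1 + 1 := by
    simp only [deg, labDeg, hcard]; push_cast; ring
  have h3 : (K.deg g').2.1 = (K.deg g).2.1 := by
    simp only [deg, labDeg, hcard, h1]; push_cast; ring
  rcases K.d_annular h0 with h4 | h4
  · refine ⟨0, ?_⟩
    ext <;> simp [h2, h3, h4]
  · refine ⟨1, ?_⟩
    ext <;> simp [h2, h3, h4]

/-- The filtered complex of a cube, for the order of the crossings given by `r`. -/
noncomputable def complex (r : C → ℕ) (hr : Function.Injective r) : FComplex where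
  G := K.Gen
  deg := K.deg
  d := K.d r
  filt := K.filt_d r
  sq := K.d_mul_d hr

end Cube

/-! ## Comparison of cubes -/

section Comparison

open scoped Classical

/-! ### Maps of saddles for different choices of points -/

section SaddleComparison

variable {X Y O : Type} {E E' : Setoid X} {F F' : Setoid Y} {a b c d : X}

theorem Saddle.other (h : Saddle E E' a b) {p : X} (ha : ¬ E p a) (hb : ¬ E p b) (q : X) :
    E' p q ↔ E p q := by
  rcases h with h | h
  · exact h.other ha hb q
  · exact (h.other (fun h' => ha (h.le h')) (fun h' => hb (h.le h')) q).symm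

theorem saddleCoeff_congr (l : Lab E) (l' : Lab E') (h1 : E a c) (h2 : E b d) (h3 : E' a c)
    (h4 : E' b d) : saddleCoeff E a b l.1 l'.1 = saddleCoeff E c d l.1 l'.1 := by
  have e1 : ∀ p, E p a ↔ E p c := fun p =>
    ⟨fun h => E.trans h h1, fun h => E.trans h (E.symm h1)⟩
  have e2 : ∀ p, E p b ↔ E p d := fun p =>
    ⟨fun h => E.trans h h2, fun h => E.trans h (E.symm h2)⟩
  have e3 : E a b ↔ E c d := by
    rw [e2, E.comm', e1, E.comm']
  have e4 : (∀ p, ¬ E p a → ¬ E p b → l'.1 p = l.1 p) ↔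
      ∀ p, ¬ E p c → ¬ E p d → l'.1 p = l.1 p :=
    forall_congr' fun p => by rw [e1, e2]
  simp only [saddleCoeff, e4, e3, l.2 a c h1, l.2 b d h2, l'.2 a c h3, l'.2 b d h4]

/-- The map of a saddle does not depend on the choice of the points. -/
theorem Saddle.coeff_eq (h : Saddle E E' a b) (h' : Saddle E E' c d) (l : Lab E) (l' : Lab E') :
    saddleCoeff E a b l.1 l'.1 = saddleCoeff E c d l.1 l'.1 := by
  -- The unordered pair of merged classes is determined by the two partitions.
  have key : ∀ {G G' : Setoid X}, Merge G G' a b → Merge G G' c d →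
      (G a c ∧ G b d) ∨ (G a d ∧ G b c) := by
    intro G G' k k'
    rcases (k'.iff a b).1 k.rel with h1 | ⟨h1 | h1, h2 | h2⟩
    · exact absurd h1 k.ne
    · exact absurd (G.trans h1 (G.symm h2)) k.ne
    · exact Or.inl ⟨h1, h2⟩
    · exact Or.inr ⟨h1, h2⟩
    · exact absurd (G.trans h1 (G.symm h2)) k.ne
  rcases h with k | k <;> rcases h' with k' | k'
  · rcases key k k' with ⟨h1, h2⟩ | ⟨h1, h2⟩
    · exact saddleCoeff_congr l l' h1 h2 (k.le h1) (k.le h2)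
    · rw [saddleCoeff_congr l l' h1 h2 (k.le h1) (k.le h2)]
      exact Saddle.coeff_swap (Or.inl k') l l'
  · exact absurd (k.le k'.rel) k'.ne
  · exact absurd (k'.le k.rel) k.ne
  · rcases key k k' with ⟨h1, h2⟩ | ⟨h1, h2⟩
    · exact saddleCoeff_congr l l' (k.le h1) (k.le h2) h1 h2
    · rw [saddleCoeff_congr l l' (k.le h1) (k.le h2) h1 h2]
      have hs : Saddle E E' c d := Or.inr k'
      exact hs.coeff_swap l _

/-- Restriction of labels. -/
def Lab.comap (l : Lab E) (φ : O → X) : Lab (E.comap φ) :=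
  ⟨fun o => l.1 (φ o), fun _ _ h => l.2 _ _ h⟩

/-- The map of a saddle can be computed on a subset of the points that meets all classes but those
that do not take part in the saddle. -/
theorem Saddle.comap (h : Saddle E E' a b) (φ : O → X) (l : Lab E) (l' : Lab E')
    (hs : ∀ x, (∃ o, E x (φ o)) ∨ (¬ E x a ∧ ¬ E x b ∧ l'.1 x = l.1 x))
    (hs' : ∀ x, (∃ o, E' x (φ o)) ∨ (¬ E' x a ∧ ¬ E' x b)) :
    ∃ oa ob, Saddle (E.comap φ) (E'.comap φ) oa ob ∧ saddleCoeff E a b l.1 l'.1 =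
      saddleCoeff (E.comap φ) oa ob (l.comap φ).1 (l'.comap φ).1 := by
  have key : ∃ oa ob, E a (φ oa) ∧ E b (φ ob) ∧ E' a (φ oa) ∧ E' b (φ ob) := by
    rcases h with h | h
    · obtain ⟨oa, ha⟩ := (hs a).resolve_right fun h' => h'.1 (E.refl a)
      obtain ⟨ob, hb⟩ := (hs b).resolve_right fun h' => h'.2.1 (E.refl b)
      exact ⟨oa, ob, ha, hb, h.le ha, h.le hb⟩
    · obtain ⟨oa, ha⟩ := (hs' a).resolve_right fun h' => h'.1 (E'.refl a)
      obtain ⟨ob, hb⟩ := (hs' b).resolve_right fun h' => h'.2 (E'.refl b)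
      exact ⟨oa, ob, h.le ha, h.le hb, ha, hb⟩
  obtain ⟨oa, ob, h1, h2, h3, h4⟩ := key
  have hm : ∀ {G G' : Setoid X}, Merge G G' a b → G a (φ oa) → G b (φ ob) →
      Merge (G.comap φ) (G'.comap φ) oa ob := by
    intro G G' k ka kb
    have e1 : ∀ p, G p a ↔ G p (φ oa) := fun p =>
      ⟨fun h => G.trans h ka, fun h => G.trans h (G.symm ka)⟩
    have e2 : ∀ p, G p b ↔ G p (φ ob) := fun p =>
      ⟨fun h => G.trans h kb, fun h => G.trans h (G.symm kb)⟩
    refine ⟨fun h' => k.ne (G.trans ka (G.trans h' (G.symm kb))), fun p q => ?_⟩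
    change G' (φ p) (φ q) ↔ _
    rw [k.iff, e1, e1, e2, e2]
    rfl
  refine ⟨oa, ob, h.imp (fun k => hm k h1 h2) (fun k => hm k h3 h4), ?_⟩
  rw [saddleCoeff_congr l l' h1 h2 h3 h4]
  have hcond : (∀ p, ¬ E p (φ oa) → ¬ E p (φ ob) → l'.1 p = l.1 p) ↔
      ∀ o, ¬ (E.comap φ) o oa → ¬ (E.comap φ) o ob → (l'.comap φ).1 o = (l.comap φ).1 o := by
    constructor
    · intro hp o ho ho'
      exact hp (φ o) ho ho'
    · intro ho p hp hp'
      rcases hs p with ⟨o, hpo⟩ | hp0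
      · have h5 : ¬ E p a := fun h' => hp (E.trans h' h1)
        have h6 : ¬ E p b := fun h' => hp' (E.trans h' h2)
        have h7 : E' p (φ o) := (h.other h5 h6 _).2 hpo
        rw [l.2 _ _ hpo, l'.2 _ _ h7]
        exact ho o (fun h' => hp (E.trans hpo h')) (fun h' => hp' (E.trans hpo h'))
      · exact hp0.2.2
  unfold saddleCoeff
  simp only [hcond]
  rfl

/-- Transport of the map of a saddle along a common set of points. -/
theorem Saddle.transport {c d : Y} (h : Saddle E E' a b) (k : Saddle F F' c d) (φ : O → X)
    (ψ : O → Y) (hE : ∀ o o', E (φ o) (φ o') ↔ F (ψ o) (ψ o'))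
    (hE' : ∀ o o', E' (φ o) (φ o') ↔ F' (ψ o) (ψ o'))
    (l : Lab E) (l' : Lab E') (m : Lab F) (m' : Lab F')
    (hl : ∀ o, l.1 (φ o) = m.1 (ψ o)) (hl' : ∀ o, l'.1 (φ o) = m'.1 (ψ o))
    (hs : ∀ x, (∃ o, E x (φ o)) ∨ (¬ E x a ∧ ¬ E x b ∧ l'.1 x = l.1 x))
    (hs' : ∀ x, (∃ o, E' x (φ o)) ∨ (¬ E' x a ∧ ¬ E' x b))
    (ks : ∀ y, ∃ o, F y (ψ o)) (ks' : ∀ y, ∃ o, F' y (ψ o)) :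
    saddleCoeff E a b l.1 l'.1 = saddleCoeff F c d m.1 m'.1 := by
  obtain ⟨oa, ob, h1, e1⟩ := h.comap φ l l' hs hs'
  obtain ⟨oc, od, k1, e2⟩ := k.comap ψ m m' (fun y => Or.inl (ks y)) (fun y => Or.inl (ks' y))
  have hEF : E.comap φ = F.comap ψ := Setoid.ext hE
  have hEF' : E'.comap φ = F'.comap ψ := Setoid.ext hE'
  have hlm : (l.comap φ).1 = (m.comap ψ).1 := funext hl
  have hlm' : (l'.comap φ).1 = (m'.comap ψ).1 := funext hl'
  rw [hEF, hEF'] at h1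
  rw [e1, e2, hlm, hlm', hEF]
  exact h1.coeff_eq k1 (m.comap ψ) (m'.comap ψ)

end SaddleComparison

/-- Two partitions that are determined by their restrictions to a common set of points, which are
equal. -/
structure SMatch {X Y O : Type} (E : Setoid X) (F : Setoid Y) (φ : O → X) (ψ : O → Y) : Prop where
  surj : ∀ x, ∃ o, E x (φ o)
  surj' : ∀ y, ∃ o, F y (ψ o)
  rel : ∀ o o', E (φ o) (φ o') ↔ F (ψ o) (ψ o')

namespace SMatch

variable {X Y O : Type} {E : Setoid X} {F : Setoid Y} {φ : O → X} {ψ : O → Y}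

theorem symm (h : SMatch E F φ ψ) : SMatch F E ψ φ :=
  ⟨h.surj', h.surj, fun o o' => (h.rel o o').symm⟩

/-- Transport of labels. -/
noncomputable def lab (h : SMatch E F φ ψ) (l : Lab E) : Lab F :=
  ⟨fun y => l.1 (φ (h.surj' y).choose), fun p q hpq => l.2 _ _ ((h.rel _ _).2
    (F.trans (F.symm (h.surj' p).choose_spec) (F.trans hpq (h.surj' q).choose_spec)))⟩

theorem lab_apply (h : SMatch E F φ ψ) (l : Lab E) (o : O) : (h.lab l).1 (ψ o) = l.1 (φ o) :=
  l.2 _ _ ((h.rel _ _).2 (F.symm (h.surj' (ψ o)).choose_spec))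

/-- Labels are determined by their values on the common points. -/
theorem lab_ext {l m : Lab E} (hs : ∀ x, ∃ o, E x (φ o)) (h : ∀ o, l.1 (φ o) = m.1 (φ o)) :
    l = m := by
  apply Lab.ext
  intro x
  obtain ⟨o, ho⟩ := hs x
  rw [l.2 _ _ ho, m.2 _ _ ho, h]

/-- Transport of labels is a bijection. -/
noncomputable def equiv (h : SMatch E F φ ψ) : Lab E ≃ Lab F where
  toFun := h.lab
  invFun := h.symm.lab
  left_inv l := lab_ext h.surj fun o => by rw [h.symm.lab_apply, h.lab_apply]
  right_inv l := lab_ext h.surj' fun o => by rw [h.lab_apply, h.symm.lab_apply]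

theorem equiv_apply (h : SMatch E F φ ψ) (l : Lab E) (o : O) :
    (h.equiv l).1 (ψ o) = l.1 (φ o) := h.lab_apply l o

theorem classSum_eq [Finite X] [Finite Y] [Finite O] (h : SMatch E F φ ψ) {G : X → ℤ} {H : Y → ℤ}
    (hG : ∀ p q, E p q → G p = G q) (hH : ∀ p q, F p q → H p = H q)
    (hGH : ∀ o, G (φ o) = H (ψ o)) : classSum E G = classSum F H := by
  rw [classSum_comap hG φ h.surj, classSum_comap hH ψ h.surj']
  have e1 : E.comap φ = F.comap ψ := Setoid.ext h.rel
  have e2 : G ∘ φ = H ∘ ψ := funext hGH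
  rw [e1, e2]

end SMatch

/-! ### Change of the order of the crossings -/

section Reorder

variable {C C' : Type}

theorem edgeSign_eq_prod (r : C → ℕ) (α : Finset C) (c : C) :
    edgeSign r α c = ∏ x ∈ α, if r x < r c then (-1 : ℚ) else 1 := by
  rw [edgeSign, Finset.prod_ite]
  simp

/-- The sign of the change of the order of the crossings. -/
noncomputable def reorderSign (r s : C → ℕ) (α : Finset C) : ℚ :=
  -- The parity of the number of inversions between the two orders on `α`.
  ∏ x ∈ α, ∏ y ∈ α, if r x < r y ∧ s y < s x then (-1 : ℚ) else 1

theorem reorderSign_mul_self (r s : C → ℕ) (α : Finset C) :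
    reorderSign r s α * reorderSign r s α = 1 := by
  rw [reorderSign, ← Finset.prod_mul_distrib]
  refine Finset.prod_eq_one fun x _ => ?_
  rw [← Finset.prod_mul_distrib]
  refine Finset.prod_eq_one fun y _ => ?_
  split_ifs <;> norm_num

/-- The inversions that `c` adds to those of `α` are the crossings of `α` that precede `c` in one of
the orders but not in the other, and these account for the quotient of the two edge signs. -/
theorem edgeSign_reorder [DecidableEq C] {r s : C → ℕ} (hr : Function.Injective r)
    (hs : Function.Injective s) {α : Finset C} {c : C} (hc : c ∉ α) :
    edgeSign s α c = reorderSign r s (insert c α) * reorderSign r s α * edgeSign r α c := by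
  have h1 : reorderSign r s (insert c α) = (∏ y ∈ α, if r c < r y ∧ s y < s c then (-1 : ℚ) else 1) *
      ((∏ x ∈ α, if r x < r c ∧ s c < s x then (-1 : ℚ) else 1) * reorderSign r s α) := by
    rw [reorderSign, Finset.prod_insert hc, Finset.prod_insert hc]
    simp only [Finset.prod_insert hc, Finset.prod_mul_distrib, reorderSign]
    simp
  have h2 := reorderSign_mul_self r s α
  have h3 : edgeSign s α c = (∏ y ∈ α, if r c < r y ∧ s y < s c then (-1 : ℚ) else 1) *
      (∏ x ∈ α, if r x < r c ∧ s c < s x then (-1 : ℚ) else 1) * edgeSign r α c := by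
    rw [edgeSign_eq_prod, edgeSign_eq_prod, ← Finset.prod_mul_distrib, ← Finset.prod_mul_distrib]
    refine Finset.prod_congr rfl fun x hx => ?_
    have hxc : x ≠ c := fun h => hc (h ▸ hx)
    have h4 : r x ≠ r c := fun h => hxc (hr h)
    have h5 : s x ≠ s c := fun h => hxc (hs h)
    rcases lt_or_gt_of_ne h4 with h6 | h6 <;> rcases lt_or_gt_of_ne h5 with h7 | h7 <;>
      simp [h6, h7, h6.asymm, h7.asymm]
  rw [h3, h1]
  linear_combination (-(∏ y ∈ α, if r c < r y ∧ s y < s c then (-1 : ℚ) else 1) *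
      (∏ x ∈ α, if r x < r c ∧ s c < s x then (-1 : ℚ) else 1) * edgeSign r α c) * h2

end Reorder

namespace Cube

variable {C C' : Type} [DecidableEq C'] [DecidableEq C]

/-- Two resolutions that are determined by their restrictions to a common set of points, which are
equal. -/
structure Match (K : Cube C) (α : Finset C) (K' : Cube C') (α' : Finset C') {O : Type} (φ : O → K.X)
    (ψ : O → K'.X) : Prop extends SMatch (K.E α) (K'.E α') φ ψ where
  nt : ∀ o, K.Nt α (φ o) ↔ K'.Nt α' (ψ o)

theorem Match.deg_eq {K : Cube C} {α : Finset C} {K' : Cube C'} {α' : Finset C'} {O : Type}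
    [Finite O] {φ : O → K.X} {ψ : O → K'.X} (h : Match K α K' α' φ ψ) (l : Lab (K.E α))
    (l' : Lab (K'.E α')) (hl : ∀ o, l.1 (φ o) = l'.1 (ψ o)) :
    (classSum (K.E α) fun x => AnnularDiagram.labelDeg (l.1 x)) =
        (classSum (K'.E α') fun x => AnnularDiagram.labelDeg (l'.1 x)) ∧
      (K.labDeg α l.1).2.2 = (K'.labDeg α' l'.1).2.2 := by
  constructor
  · refine h.toSMatch.classSum_eq (fun p q hpq => ?_) (fun p q hpq => ?_) fun o => ?_
    · rw [l.2 p q hpq]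
    · rw [l'.2 p q hpq]
    · rw [hl]
  · simp only [labDeg]
    refine h.toSMatch.classSum_eq (fun p q hpq => ?_) (fun p q hpq => ?_) fun o => ?_
    · simp only [l.2 p q hpq, K.nt_congr hpq]
    · simp only [l'.2 p q hpq, K'.nt_congr hpq]
    · simp only [hl, h.nt]

/-- Cubes with the same partitions, up to the names of the crossings and of the points, and up to the
order of the crossings, have equivalent complexes. -/
theorem hEquiv_of_match [Fintype C] [Fintype C'] (K : Cube C) (K' : Cube C') (r : C → ℕ)
    (r' : C' → ℕ) (hr : Function.Injective r) (hr' : Function.Injective r') (e : C ≃ C')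
    {O : Type} [Finite O] (φ : O → K.X) (ψ : O → K'.X)
    (h : ∀ α, Match K α K' (α.map e.toEmbedding) φ ψ) (hhs : K.hs = K'.hs) (hqs : K.qs = K'.qs) :
    (K.complex r hr).HEquiv (K'.complex r' hr') := by
  let e₁ : K.Gen ≃ K'.Gen :=
    Equiv.sigmaCongr e.finsetCongr fun α => (h α).toSMatch.equiv
  have he₁ : ∀ g, (e₁ g).1 = g.1.map e.toEmbedding := fun g => rfl
  have he₂ : ∀ g o, g.2.1 (φ o) = (e₁ g).2.1 (ψ o) := fun g o =>
    ((h g.1).toSMatch.equiv_apply g.2 o).symm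
  have hdeg : ∀ g : K.Gen, K'.deg (e₁ g) = K.deg g := by
    intro g
    obtain ⟨h1, h2⟩ := (h g.1).deg_eq g.2 (e₁ g).2 (he₂ g)
    have hcard : (e₁ g).1.card = g.1.card := by rw [he₁, Finset.card_map]
    ext
    · change ((e₁ g).1.card : ℤ) + K'.hs = g.1.card + K.hs
      rw [hcard, hhs]
    · change (classSum (K'.E (e₁ g).1) fun x => AnnularDiagram.labelDeg ((e₁ g).2.1 x)) +
        (e₁ g).1.card + K'.qs = _
      rw [hcard, ← hqs]
      change _ = (classSum (K.E g.1) fun x => AnnularDiagram.labelDeg (g.2.1 x)) + g.1.card + K.qs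
      rw [h1]
      rfl
    · exact h2.symm
  have hd : ∀ g' g : K.Gen, K'.d r' (e₁ g') (e₁ g) =
      reorderSign r (r' ∘ e) g'.1 * reorderSign r (r' ∘ e) g.1 * K.d r g' g := by
    intro g' g
    have hiff : ∀ c, (e c ∉ (e₁ g).1 ∧ (e₁ g').1 = insert (e c) (e₁ g).1) ↔
        c ∉ g.1 ∧ g'.1 = insert c g.1 := by
      intro c
      rw [he₁, he₁]
      have : insert (e c) (g.1.map e.toEmbedding) = (insert c g.1).map e.toEmbedding := by
        rw [Finset.map_insert]; rfl
      rw [this, Finset.map_inj]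
      simp
    by_cases hex : ∃ c, c ∉ g.1 ∧ g'.1 = insert c g.1
    · obtain ⟨c, hc, hg⟩ := hex
      obtain ⟨hc', hg'⟩ := (hiff c).2 ⟨hc, hg⟩
      rw [K.d_apply r g' g hc hg, K'.d_apply r' (e₁ g') (e₁ g) hc' hg']
      have e2 : edgeSign r' (e₁ g).1 (e c) = edgeSign (r' ∘ e) g.1 c := by
        rw [edgeSign_eq_prod, edgeSign_eq_prod, he₁, Finset.prod_map]
        rfl
      have hsad := K.saddle g.1 c hc
      have hsad' := K'.saddle (e₁ g).1 (e c) hc'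
      rw [← hg] at hsad
      rw [← hg'] at hsad'
      have e3 := hsad.transport hsad' φ ψ (h g.1).rel (h g'.1).rel g.2 g'.2 (e₁ g).2 (e₁ g').2
        (he₂ g) (he₂ g') (fun x => Or.inl ((h g.1).surj x)) (fun x => Or.inl ((h g'.1).surj x))
        (h g.1).surj' (h g'.1).surj'
      have e4 : reorderSign r (r' ∘ e) g'.1 = reorderSign r (r' ∘ e) (insert c g.1) := by rw [hg]
      rw [e2, ← e3, edgeSign_reorder hr (hr'.comp e.injective) hc, e4]
      ring
    · rw [K.d_eq_zero fun c hc hg => hex ⟨c, hc, hg⟩, K'.d_eq_zero, mul_zero]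
      intro c' hc hg
      obtain ⟨c, rfl⟩ := e.surjective c'
      exact hex ⟨c, (hiff c).1 ⟨hc, hg⟩⟩
  exact FComplex.HEquiv.of_signed_equiv (A := K.complex r hr) (B := K'.complex r' hr') e₁
    (fun g => reorderSign r (r' ∘ e) g.1) (fun g => reorderSign_mul_self _ _ _) hdeg hd

end Cube

end Comparison

/-! ## Cubes seen from outside a disc -/

section Views

open scoped Classical

/-- The version of `FComplex.HEquiv.of_signed_equiv` for a correspondence. Generators of different
cubes will be compared by their resolutions and outer labels, for which a relation is easier to give
than a map. -/
theorem FComplex.HEquiv.of_signed_rel {A B : FComplex} (ρ : A.G → B.G → Prop)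
    (h₁ : ∀ i, ∃ j, ρ i j) (h₂ : ∀ j, ∃ i, ρ i j) (h₃ : ∀ i j j', ρ i j → ρ i j' → j = j')
    (h₄ : ∀ i i' j, ρ i j → ρ i' j → i = i') (η : A.G → ℚ) (hη : ∀ i, η i * η i = 1)
    (hdeg : ∀ i j, ρ i j → B.deg j = A.deg i)
    (hd : ∀ i i' j j', ρ i j → ρ i' j' → B.d j j' = η i * η i' * A.d i i') : A.HEquiv B := by
  choose f hf using h₁
  have hb : Function.Bijective f := by
    constructor
    · intro i i' h
      exact h₄ i i' (f i) (hf i) (h ▸ hf i')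
    · intro j
      obtain ⟨i, hi⟩ := h₂ j
      exact ⟨i, h₃ i _ _ (hf i) hi⟩
  exact FComplex.HEquiv.of_signed_equiv (Equiv.ofBijective f hb) η hη (fun i => hdeg _ _ (hf i))
    fun i j => hd _ _ _ _ (hf i) (hf j)

section

variable {X O : Type}

/-- The coefficient of the map of a saddle between two partitions, for any choice of the points. -/
noncomputable def relCoeff (A B : Setoid O) (u v : O → Bool) : ℚ :=
  if h : ∃ p : O × O, Saddle A B p.1 p.2 then saddleCoeff A h.choose.1 h.choose.2 u v else 0

theorem relCoeff_eq {A B : Setoid O} {a b : O} (h : Saddle A B a b) (u : Lab A) (v : Lab B) :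
    relCoeff A B u.1 v.1 = saddleCoeff A a b u.1 v.1 := by
  have hex : ∃ p : O × O, Saddle A B p.1 p.2 := ⟨(a, b), h⟩
  rw [relCoeff, dif_pos hex]
  exact hex.choose_spec.coeff_eq h u v

/-- The class of `y` is the only one that does not meet the image of `φ`. -/
structure Isolated (E : Setoid X) (φ : O → X) (y : X) : Prop where
  not_rel : ∀ o, ¬ E (φ o) y
  cover : ∀ x, E x y ∨ ∃ o, E x (φ o)

variable {E E' : Setoid X} {φ : O → X} {y a b : X}

/-- If the isolated class took part in the merge, it would be joined to a class that meets the image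
of `φ` and would not be isolated any more. -/
theorem Merge.not_rel_of_isolated (h : Merge E E' a b) (hy : Isolated E φ y)
    (hy' : ∀ o, ¬ E' (φ o) y) : ¬ E y a ∧ ¬ E y b := by
  have key : ∀ {a b : X}, Merge E E' a b → ¬ E y a := by
    intro a b h ha
    rcases hy.cover b with hb | ⟨o, ho⟩
    · exact h.ne (E.symm (E.trans hb ha))
    · refine hy' o (E'.trans (E'.symm (h.le ho)) (E'.trans (E'.symm h.rel) ?_))
      exact E'.symm (h.le ha)
  exact ⟨key h, key h.swap⟩

theorem Saddle.not_rel_of_isolated (h : Saddle E E' a b) (hy : Isolated E φ y)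
    (hy' : Isolated E' φ y) : (¬ E y a ∧ ¬ E y b) ∧ ¬ E' y a ∧ ¬ E' y b := by
  rcases h with h | h
  · have h1 := h.not_rel_of_isolated hy hy'.1
    refine ⟨h1, ?_⟩
    rw [h.rel_left_iff, h.rel_right_iff]
    tauto
  · have h1 := h.not_rel_of_isolated hy' hy.1
    refine ⟨?_, h1⟩
    rw [h.rel_left_iff, h.rel_right_iff]
    tauto

/-- A saddle between partitions without isolated classes. -/
theorem Saddle.coeff_eq_relCoeff (h : Saddle E E' a b) (hf : ∀ x, ∃ o, E x (φ o))
    (hf' : ∀ x, ∃ o, E' x (φ o)) (l : Lab E) (l' : Lab E') :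
    saddleCoeff E a b l.1 l'.1 =
      relCoeff (E.comap φ) (E'.comap φ) (l.1 ∘ φ) (l'.1 ∘ φ) := by
  obtain ⟨oa, ob, h1, e1⟩ := h.comap φ l l' (fun x => Or.inl (hf x)) (fun x => Or.inl (hf' x))
  rw [e1]
  exact (relCoeff_eq h1 (l.comap φ) (l'.comap φ)).symm

/-- A saddle between partitions with an isolated class. -/
theorem Saddle.coeff_eq_relCoeff_of_isolated (h : Saddle E E' a b) (hy : Isolated E φ y)
    (hy' : Isolated E' φ y) (l : Lab E) (l' : Lab E') :
    saddleCoeff E a b l.1 l'.1 = if l'.1 y = l.1 y then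
      relCoeff (E.comap φ) (E'.comap φ) (l.1 ∘ φ) (l'.1 ∘ φ) else 0 := by
  obtain ⟨⟨h1, h2⟩, h3, h4⟩ := h.not_rel_of_isolated hy hy'
  by_cases hl : l'.1 y = l.1 y
  swap
  · rw [if_neg hl, saddleCoeff_of_not_agree]
    exact fun h' => hl (h' y h1 h2)
  rw [if_pos hl]
  have hs : ∀ x, (∃ o, E x (φ o)) ∨ (¬ E x a ∧ ¬ E x b ∧ l'.1 x = l.1 x) := by
    intro x
    refine (hy.cover x).symm.imp id fun hx => ⟨fun h' => h1 (E.trans (E.symm hx) h'),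
      fun h' => h2 (E.trans (E.symm hx) h'), ?_⟩
    have hx' : E' y x := (h.other h1 h2 x).2 (E.symm hx)
    rw [l.2 x y hx, ← l'.2 y x hx', hl]
  have hs' : ∀ x, (∃ o, E' x (φ o)) ∨ (¬ E' x a ∧ ¬ E' x b) := fun x =>
    (hy'.cover x).symm.imp id fun hx => ⟨fun h' => h3 (E'.trans (E'.symm hx) h'),
      fun h' => h4 (E'.trans (E'.symm hx) h')⟩
  obtain ⟨oa, ob, k1, e1⟩ := h.comap φ l l' hs hs'
  rw [e1]
  exact (relCoeff_eq k1 (l.comap φ) (l'.comap φ)).symm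

/-- If the isolated class disappears in a merge, then it takes part in it. -/
theorem Merge.rel_of_isolated (h : Merge E E' a b) (hy : Isolated E φ y)
    (hf : ∀ x, ∃ o, E' x (φ o)) : E y a ∨ E y b := by
  by_contra h'
  push Not at h'
  obtain ⟨o, ho⟩ := hf y
  exact hy.1 o (E.symm ((h.other h'.1 h'.2 _).1 ho))

/-- A saddle in which an isolated class disappears, the others being unchanged. -/
theorem Saddle.merge_of_isolated (h : Saddle E E' a b) (hy : Isolated E φ y)
    (hf : ∀ x, ∃ o, E' x (φ o)) : Merge E E' a b := by
  refine h.resolve_right fun k => ?_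
  obtain ⟨o, ho⟩ := hf y
  exact hy.1 o (E.symm (k.le ho))

/-- Merging an isolated class does not change the partition of the image of `φ`. -/
theorem Merge.comap_eq_of_isolated (h : Merge E E' a b) (hy : Isolated E φ y)
    (hb : E y a ∨ E y b) : E.comap φ = E'.comap φ := by
  have key : ∀ {a b : X}, Merge E E' a b → E y b → E.comap φ = E'.comap φ := by
    intro a b h hb
    have hn : ∀ o, ¬ E (φ o) b := fun o ho => hy.1 o (E.trans ho (E.symm hb))
    refine Setoid.ext fun o o' => ?_
    change E (φ o) (φ o') ↔ E' (φ o) (φ o')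
    rw [h.iff]
    have : E (φ o) a → E (φ o') a → E (φ o) (φ o') := fun h1 h2 => E.trans h1 (E.symm h2)
    have := hn o
    have := hn o'
    tauto
  exact hb.elim (key h.swap) (key h)

/-- The circle of `y` is swallowed by the class of `a`. If it acts as a unit, then nothing is
required beyond the old labels at `a` and elsewhere, and these are exactly the labels of the outer
points. -/
theorem Merge.agree_iff_of_isolated (h : Merge E E' a b) (hy : Isolated E φ y) (hb : E y b)
    (l : Lab E) (l' : Lab E') :
    (l.1 a = l'.1 a ∧ ∀ p, ¬ E p a → ¬ E p b → l'.1 p = l.1 p) ↔ l.1 ∘ φ = l'.1 ∘ φ := by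
  have hn : ∀ o, ¬ E (φ o) b := fun o ho => hy.1 o (E.trans ho (E.symm hb))
  constructor
  · rintro ⟨h1, h2⟩
    funext o
    by_cases ho : E (φ o) a
    · rw [Function.comp_apply, Function.comp_apply, l.2 _ _ ho, l'.2 _ _ (h.le ho), h1]
    · exact (h2 _ ho (hn o)).symm
  · intro h1
    have h2 : ∀ p, ¬ E p b → l.1 p = l'.1 p := by
      intro p hp
      obtain ⟨o, ho⟩ := (hy.cover p).resolve_left fun h' => hp (E.trans h' hb)
      rw [l.2 _ _ ho, l'.2 _ _ (h.le ho)]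
      exact congrFun h1 o
    exact ⟨h2 a h.ne, fun p _ hp => (h2 p hp).symm⟩

/-- An isolated class with label `v₊` is merged with another class. -/
theorem Saddle.coeff_death (h : Saddle E E' a b) (hy : Isolated E φ y)
    (hf : ∀ x, ∃ o, E' x (φ o)) (l : Lab E) (l' : Lab E') (hl : l.1 y = true) :
    saddleCoeff E a b l.1 l'.1 = if l.1 ∘ φ = l'.1 ∘ φ then 1 else 0 := by
  have key : ∀ {a b : X}, Merge E E' a b → E y b →
      saddleCoeff E a b l.1 l'.1 = if l.1 ∘ φ = l'.1 ∘ φ then 1 else 0 := by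
    intro a b h hb
    have h1 := h.agree_iff_of_isolated hy hb l l'
    have hlb : l.1 b = true := by rw [← l.2 y b hb, hl]
    by_cases h2 : ∀ p, ¬ E p a → ¬ E p b → l'.1 p = l.1 p
    · rw [saddleCoeff_of_merge h.ne h2, hlb]
      rw [← if_congr ((and_iff_left h2).symm.trans h1) rfl rfl]
      cases l.1 a <;> cases l'.1 a <;> rfl
    · rw [saddleCoeff_of_not_agree h2, if_neg fun h3 => h2 (h1.2 h3).2]
  have hm := h.merge_of_isolated hy hf
  rcases hm.rel_of_isolated hy hf with ha | hb
  · rw [← h.coeff_swap]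
    exact key hm.swap ha
  · exact key hm hb

/-- An isolated class with label `v₋` is split off. -/
theorem Saddle.coeff_birth (h : Saddle E' E a b) (hy : Isolated E φ y)
    (hf : ∀ x, ∃ o, E' x (φ o)) (l : Lab E) (l' : Lab E') (hl : l.1 y = false) :
    saddleCoeff E' a b l'.1 l.1 = if l.1 ∘ φ = l'.1 ∘ φ then 1 else 0 := by
  have key : ∀ {a b : X}, Merge E E' a b → E y b →
      saddleCoeff E' a b l'.1 l.1 = if l.1 ∘ φ = l'.1 ∘ φ then 1 else 0 := by
    intro a b h hb
    have h1 := h.agree_iff_of_isolated hy hb l l'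
    have hlb : l.1 b = false := by rw [← l.2 y b hb, hl]
    have h3 : (∀ p, ¬ E' p a → ¬ E' p b → l.1 p = l'.1 p) ↔
        ∀ p, ¬ E p a → ¬ E p b → l'.1 p = l.1 p := by
      refine forall_congr' fun p => ?_
      rw [h.rel_left_iff, h.rel_right_iff, eq_comm (a := l.1 p)]
      tauto
    by_cases h2 : ∀ p, ¬ E p a → ¬ E p b → l'.1 p = l.1 p
    · rw [saddleCoeff_of_split h.rel (h3.2 h2), hlb]
      rw [← if_congr ((and_iff_left h2).symm.trans h1) rfl rfl]
      cases l.1 a <;> cases l'.1 a <;> rfl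
    · rw [saddleCoeff_of_not_agree (fun h4 => h2 (h3.1 h4)), if_neg fun h3 => h2 (h1.2 h3).2]
  have hm := h.symm.merge_of_isolated hy hf
  rcases hm.rel_of_isolated hy hf with ha | hb
  · rw [← h.coeff_swap]
    exact key hm.swap ha
  · exact key hm hb

/-- Extension of labels from the image of `φ`. -/
noncomputable def Lab.extend (E : Setoid X) (φ : O → X) (u : Lab (E.comap φ)) (v : Bool) : Lab E :=
  ⟨fun x => if h : ∃ o, E x (φ o) then u.1 h.choose else v, by
    intro p q hpq
    have h1 : (∃ o, E p (φ o)) ↔ ∃ o, E q (φ o) :=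
      exists_congr fun o => ⟨fun h => E.trans (E.symm hpq) h, fun h => E.trans hpq h⟩
    by_cases h : ∃ o, E p (φ o)
    · have h' := h1.1 h
      simp only [dif_pos h, dif_pos h']
      exact u.2 _ _ (E.trans (E.symm h.choose_spec) (E.trans hpq h'.choose_spec))
    · have h' : ¬ ∃ o, E q (φ o) := fun h' => h (h1.2 h')
      simp only [dif_neg h, dif_neg h']⟩

theorem Lab.extend_apply (u : Lab (E.comap φ)) (v : Bool) (o : O) :
    (Lab.extend E φ u v).1 (φ o) = u.1 o := by
  have h : ∃ o', E (φ o) (φ o') := ⟨o, E.refl _⟩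
  simp only [Lab.extend, dif_pos h]
  exact u.2 _ _ (E.symm h.choose_spec)

theorem Lab.extend_isolated (hy : Isolated E φ y) (u : Lab (E.comap φ)) (v : Bool) :
    (Lab.extend E φ u v).1 y = v := by
  have h : ¬ ∃ o', E y (φ o') := fun ⟨o, ho⟩ => hy.1 o (E.symm ho)
  simp only [Lab.extend, dif_neg h]

end

/-- A view of a cube from a set `O` of points: in each resolution, every cycle meets `O`, except for
one additional cycle in the resolutions of type `circ`; the points of the cutting ray come from the
set `R`. -/
structure Cube.View {C : Type} [DecidableEq C] (K : Cube C) (O : Type) (R : O → Prop) where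
  φ : O → K.X
  circ : Finset C → Prop
  -- The point is the same for all resolutions with the additional cycle, and none is required if
  -- there are no such resolutions; the cube might have no points at all.
  y : (∃ α, circ α) → K.X
  full : ∀ α, ¬ circ α → ∀ x, ∃ o, K.E α x (φ o)
  isolated : ∀ α (h : circ α), Isolated (K.E α) φ (y ⟨α, h⟩)
  ray : ∀ x, K.W x ↔ ∃ o, R o ∧ φ o = x
  ray_inj : ∀ o p, R o → R p → φ o = φ p → o = p

/-- The sum of the degrees of labels. -/
noncomputable def viewQ {O : Type} [Finite O] (A : Setoid O) (u : O → Bool) : ℤ :=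
  classSum A fun o => AnnularDiagram.labelDeg (u o)

/-- The annular degree of labels. -/
noncomputable def viewA {O : Type} [Finite O] (R : O → Prop) (A : Setoid O) (u : O → Bool) : ℤ :=
  classSum A fun o =>
    if Odd (Nat.card {o' // R o' ∧ A o' o}) then AnnularDiagram.labelDeg (u o) else 0

namespace Cube.View

variable {C : Type} [DecidableEq C] {K : Cube C} {O : Type} {R : O → Prop} (V : K.View O R)

/-- The partition of the outer points. -/
def A (α : Finset C) : Setoid O := (K.E α).comap V.φ

/-- The labels of the outer points. -/
def u (g : K.Gen) : O → Bool := g.2.1 ∘ V.φ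

/-- The label of the additional cycle. -/
noncomputable def v (g : K.Gen) : Bool := if h : V.circ g.1 then g.2.1 (V.y ⟨_, h⟩) else false

theorem v_eq {g : K.Gen} (h : V.circ g.1) : V.v g = g.2.1 (V.y ⟨_, h⟩) := dif_pos h

/-- The default label `v₋` in the absence of the additional cycle lets `gen_ext` and `Cube.Target`
treat both kinds of resolutions alike. -/
theorem v_of_not {g : K.Gen} (h : ¬ V.circ g.1) : V.v g = false := dif_neg h

theorem u_resp (g : K.Gen) (o o' : O) (h : V.A g.1 o o') : V.u g o = V.u g o' := g.2.2 _ _ h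

theorem gen_ext {g g' : K.Gen} (h₁ : g.1 = g'.1) (h₂ : V.u g = V.u g') (h₃ : V.v g = V.v g') :
    g = g' := by
  obtain ⟨α, l⟩ := g
  obtain ⟨α', l'⟩ := g'
  obtain rfl : α = α' := h₁
  have : l = l' := by
    apply Lab.ext
    intro x
    have key : ∀ o, K.E α x (V.φ o) → l.1 x = l'.1 x := by
      intro o ho
      rw [l.2 _ _ ho, l'.2 _ _ ho]
      exact congrFun h₂ o
    by_cases h : V.circ α
    · rw [V.v_eq (g := ⟨α, l⟩) h, V.v_eq (g := ⟨α, l'⟩) h] at h₃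
      rcases (V.isolated α h).cover x with hx | ⟨o, ho⟩
      · rw [l.2 _ _ hx, l'.2 _ _ hx]
        exact h₃
      · exact key o ho
    · obtain ⟨o, ho⟩ := V.full α h x
      exact key o ho
  rw [this]

theorem exists_gen (α : Finset C) (u : O → Bool) (hu : ∀ o o', V.A α o o' → u o = u o') (v : Bool)
    (hv : ¬ V.circ α → v = false) : ∃ g : K.Gen, g.1 = α ∧ V.u g = u ∧ V.v g = v := by
  refine ⟨⟨α, Lab.extend (K.E α) V.φ ⟨u, hu⟩ v⟩, rfl, ?_, ?_⟩
  · funext o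
    exact Lab.extend_apply ⟨u, hu⟩ v o
  · by_cases h : V.circ α
    · rw [V.v_eq h]
      exact Lab.extend_isolated (V.isolated α h) _ _
    · rw [V.v_of_not h, hv h]

theorem nt_iff (α : Finset C) (x : K.X) :
    K.Nt α x ↔ Odd (Nat.card {o' // R o' ∧ K.E α (V.φ o') x}) := by
  have : Nat.card {x' // K.W x' ∧ K.E α x' x} = Nat.card {o' // R o' ∧ K.E α (V.φ o') x} := by
    symm
    refine Nat.card_eq_of_bijective
      (fun o' => ⟨V.φ o'.1, (V.ray _).2 ⟨o'.1, o'.2.1, rfl⟩, o'.2.2⟩) ⟨?_, ?_⟩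
    · rintro ⟨o, ho, _⟩ ⟨o', ho', _⟩ h
      have := V.ray_inj o o' ho ho' (congrArg Subtype.val h)
      subst this
      rfl
    · rintro ⟨x', hx, hx'⟩
      obtain ⟨o, ho, rfl⟩ := (V.ray x').1 hx
      exact ⟨⟨o, ho, hx'⟩, rfl⟩
  rw [Cube.Nt, this]

variable [Finite O]

/-- The points of the cutting ray come from `O`, so the additional cycle misses the ray and is
trivial: it contributes to the Euler grading but not to the annular one. For this reason cancelling
circles is compatible with the annular filtration. -/
theorem deg_eq (g : K.Gen) : K.deg g = (g.1.card + K.hs,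
    viewQ (V.A g.1) (V.u g) + (if V.circ g.1 then AnnularDiagram.labelDeg (V.v g) else 0) +
      g.1.card + K.qs, viewA R (V.A g.1) (V.u g)) := by
  have hF : ∀ p q, K.E g.1 p q →
      AnnularDiagram.labelDeg (g.2.1 p) = AnnularDiagram.labelDeg (g.2.1 q) := fun p q hpq => by
    rw [g.2.2 p q hpq]
  have hA : ∀ p q, K.E g.1 p q →
      (if K.Nt g.1 p then AnnularDiagram.labelDeg (g.2.1 p) else 0) =
        (if K.Nt g.1 q then AnnularDiagram.labelDeg (g.2.1 q) else 0) := fun p q hpq => by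
    simp only [g.2.2 p q hpq, K.nt_congr hpq]
  have e1 : (fun x => if K.Nt g.1 x then AnnularDiagram.labelDeg (g.2.1 x) else 0) ∘ V.φ =
      fun o => if Odd (Nat.card {o' // R o' ∧ V.A g.1 o' o}) then
        AnnularDiagram.labelDeg (V.u g o) else 0 := by
    funext o
    simp only [Function.comp_apply, V.nt_iff]
    rfl
  by_cases h : V.circ g.1
  · have hy := V.isolated g.1 h
    have hnt : ¬ K.Nt g.1 (V.y ⟨_, h⟩) := by
      rw [V.nt_iff]
      have : IsEmpty {o' // R o' ∧ K.E g.1 (V.φ o') (V.y ⟨_, h⟩)} := ⟨fun o => hy.1 _ o.2.2⟩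
      simp
    simp only [Cube.deg, Cube.labDeg]
    rw [classSum_eq_add hF V.φ _ hy.1 hy.2, classSum_eq_add hA V.φ _ hy.1 hy.2, if_neg hnt, e1,
      zero_add, if_pos h, V.v_eq h, add_comm (AnnularDiagram.labelDeg _)]
    rfl
  · simp only [Cube.deg, Cube.labDeg]
    rw [classSum_comap hF V.φ (V.full _ h), classSum_comap hA V.φ (V.full _ h), e1, if_neg h,
      add_zero]
    rfl

omit [Finite O]
variable [Fintype C] (r : C → ℕ) {g g' : K.Gen} {c : C}

theorem d_full (hc : c ∉ g.1) (h : g'.1 = insert c g.1) (hg : ¬ V.circ g.1) (hg' : ¬ V.circ g'.1) :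
    K.d r g' g = edgeSign r g.1 c * relCoeff (V.A g.1) (V.A g'.1) (V.u g) (V.u g') := by
  rw [K.d_apply r g' g hc h]
  have hs := K.saddle g.1 c hc
  rw [← h] at hs
  rw [hs.coeff_eq_relCoeff (V.full _ hg) (V.full _ hg')]
  rfl

theorem d_circ (hc : c ∉ g.1) (h : g'.1 = insert c g.1) (hg : V.circ g.1) (hg' : V.circ g'.1) :
    K.d r g' g = edgeSign r g.1 c *
      if V.v g' = V.v g then relCoeff (V.A g.1) (V.A g'.1) (V.u g) (V.u g') else 0 := by
  rw [K.d_apply r g' g hc h]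
  have hs := K.saddle g.1 c hc
  rw [← h] at hs
  rw [hs.coeff_eq_relCoeff_of_isolated (V.isolated _ hg) (V.isolated _ hg'), V.v_eq hg, V.v_eq hg']
  rfl

theorem d_death (hc : c ∉ g.1) (h : g'.1 = insert c g.1) (hg : V.circ g.1) (hg' : ¬ V.circ g'.1)
    (hv : V.v g = true) :
    K.d r g' g = edgeSign r g.1 c * if V.u g = V.u g' then 1 else 0 := by
  rw [K.d_apply r g' g hc h]
  have hs := K.saddle g.1 c hc
  rw [← h] at hs
  rw [V.v_eq hg] at hv
  rw [hs.coeff_death (V.isolated _ hg) (V.full _ hg') g.2 g'.2 hv]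
  rfl

theorem d_birth (hc : c ∉ g.1) (h : g'.1 = insert c g.1) (hg : ¬ V.circ g.1) (hg' : V.circ g'.1)
    (hv : V.v g' = false) :
    K.d r g' g = edgeSign r g.1 c * if V.u g' = V.u g then 1 else 0 := by
  rw [K.d_apply r g' g hc h]
  have hs := K.saddle g.1 c hc
  rw [← h] at hs
  rw [V.v_eq hg'] at hv
  rw [hs.coeff_birth (V.isolated _ hg') (V.full _ hg) g'.2 g.2 hv]
  rfl

omit [Fintype C] in
/-- The additional cycle does not change the partition of the outer points. -/
theorem A_insert {α : Finset C} (hc : c ∉ α) (h : ¬ (V.circ α ↔ V.circ (insert c α))) :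
    V.A (insert c α) = V.A α := by
  have hs := K.saddle α c hc
  by_cases hα : V.circ α
  · have hβ : ¬ V.circ (insert c α) := by tauto
    have hm := hs.merge_of_isolated (V.isolated _ hα) (V.full _ hβ)
    exact (hm.comap_eq_of_isolated (V.isolated _ hα)
      (hm.rel_of_isolated (V.isolated _ hα) (V.full _ hβ))).symm
  · have hβ : V.circ (insert c α) := by tauto
    have hm := hs.symm.merge_of_isolated (V.isolated _ hβ) (V.full _ hα)
    exact hm.comap_eq_of_isolated (V.isolated _ hβ)
      (hm.rel_of_isolated (V.isolated _ hβ) (V.full _ hα))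

end Cube.View

end Views

/-! ## Elimination of circles -/

section CircleElimination

open scoped Classical

namespace Cube

variable {C : Type} [DecidableEq C] {K : Cube C} {O : Type} {R : O → Prop}

/-- A matching of resolutions by edges of the cube along which the additional cycle of a view is split
off or merged. -/
structure Matching (V : K.View O R) (M : Finset C → Finset C → Prop) : Prop where
  edge : ∀ {α β}, M α β → ∃ x, x ∉ α ∧ β = insert x α
  circ : ∀ {α β}, M α β → (V.circ β ↔ ¬ V.circ α)
  right_unique : ∀ {α β β'}, M α β → M α β' → β = β'
  left_unique : ∀ {α α' β}, M α β → M α' β → α = α'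
  -- An unmatched edge from a matched source to a matched target must join two resolutions with the
  -- circle. Such an edge keeps the label of the circle and thus has no entry from `v₊` to `v₋`.
  other : ∀ {α β α' β' x}, M α β' → M α' β → x ∉ α → β = insert x α →
    M α β ∨ (V.circ α ∧ V.circ β)
  -- A resolution may be a source and a target of the matching only if it has the circle, whose
  -- label then separates the two roles.
  disjoint : ∀ {α β γ}, M α β → M β γ → V.circ β

/-- The sources of the matched generators. -/
def Source (V : K.View O R) (M : Finset C → Finset C → Prop) (g : K.Gen) : Prop :=
  (∃ β, M g.1 β) ∧ (V.circ g.1 → V.v g = true)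

/-- The targets of the matched generators. -/
def Target (V : K.View O R) (M : Finset C → Finset C → Prop) (g : K.Gen) : Prop :=
  (∃ α, M α g.1) ∧ V.v g = false

namespace Matching

variable {V : K.View O R} {M : Finset C → Finset C → Prop} (m : Matching V M) [Fintype C]
  (r : C → ℕ)
include m

omit [Fintype C] in
theorem A_eq {α β : Finset C} (h : M α β) : V.A β = V.A α := by
  obtain ⟨x, hx, rfl⟩ := m.edge h
  refine V.A_insert hx ?_
  have := m.circ h
  tauto

theorem d_eq {s t : K.Gen} (hs : Source V M s) (ht : Target V M t) (h : M s.1 t.1) :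
    ∃ x, K.d r t s = edgeSign r s.1 x * if V.u t = V.u s then 1 else 0 := by
  obtain ⟨x, hx, e⟩ := m.edge h
  refine ⟨x, ?_⟩
  by_cases hc : V.circ s.1
  · rw [V.d_death r hx e hc (by rw [m.circ h]; tauto) (hs.2 hc)]
    simp only [eq_comm]
  · rw [V.d_birth r hx e hc (by rw [m.circ h]; tauto) ht.2]

theorem link {s t : K.Gen} (hs : Source V M s) (ht : Target V M t) (h : K.d r t s ≠ 0) :
    M s.1 t.1 ∧ V.u t = V.u s := by
  obtain ⟨x, hx, e⟩ := K.exists_of_d_ne_zero h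
  obtain ⟨⟨β, hβ⟩, hv⟩ := hs
  obtain ⟨⟨α, hα⟩, hv'⟩ := ht
  rcases m.other hβ hα hx e with h1 | ⟨h1, h2⟩
  · refine ⟨h1, ?_⟩
    obtain ⟨x', e'⟩ := m.d_eq r ⟨⟨β, hβ⟩, hv⟩ ⟨⟨α, hα⟩, hv'⟩ h1
    by_contra h2
    rw [e', if_neg h2, mul_zero] at h
    exact h rfl
  · exfalso
    apply h
    rw [V.d_circ r hx e h1 h2, hv', hv h1]
    simp

theorem sq_eq_one {s t : K.Gen} (hs : Source V M s) (ht : Target V M t) (h : M s.1 t.1)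
    (hu : V.u t = V.u s) : K.d r t s * K.d r t s = 1 := by
  obtain ⟨x, e⟩ := m.d_eq r hs ht h
  rw [e, if_pos hu, mul_one, edgeSign_mul_self]

omit [Fintype C] in
theorem exists_target {s : K.Gen} (hs : Source V M s) :
    ∃ t, Target V M t ∧ M s.1 t.1 ∧ V.u t = V.u s := by
  obtain ⟨⟨β, hβ⟩, hv⟩ := hs
  obtain ⟨t, h1, h2, h3⟩ := V.exists_gen β (V.u s)
    (fun o o' h => V.u_resp s o o' (m.A_eq hβ ▸ h)) false fun _ => rfl
  subst h1
  exact ⟨t, ⟨⟨_, hβ⟩, h3⟩, hβ, h2⟩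

omit [Fintype C] in
theorem exists_source {t : K.Gen} (ht : Target V M t) :
    ∃ s, Source V M s ∧ M s.1 t.1 ∧ V.u t = V.u s := by
  obtain ⟨⟨α, hα⟩, hv⟩ := ht
  obtain ⟨s, h1, h2, h3⟩ := V.exists_gen α (V.u t)
    (fun o o' h => V.u_resp t o o' ((m.A_eq hα).symm ▸ h)) (decide (V.circ α)) fun h => by simp [h]
  subst h1
  exact ⟨s, ⟨⟨_, hα⟩, fun h => by rw [h3]; simp [h]⟩, hα, h2.symm⟩

omit [Fintype C] in
theorem target_unique {s t t' : K.Gen} (ht : Target V M t) (ht' : Target V M t') (h : M s.1 t.1)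
    (h' : M s.1 t'.1) (hu : V.u t = V.u s) (hu' : V.u t' = V.u s) : t' = t :=
  V.gen_ext (m.right_unique h' h) (hu'.trans hu.symm) (ht'.2.trans ht.2.symm)

omit [Fintype C] in
theorem source_unique {s s' t : K.Gen} (hs : Source V M s) (hs' : Source V M s') (h : M s.1 t.1)
    (h' : M s'.1 t.1) (hu : V.u t = V.u s) (hu' : V.u t = V.u s') : s' = s := by
  have e := m.left_unique h' h
  refine V.gen_ext e (hu'.symm.trans hu) ?_
  by_cases hc : V.circ s.1
  · rw [hs.2 hc, hs'.2 (e ▸ hc)]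
  · rw [V.v_of_not hc, V.v_of_not (e ▸ hc)]

theorem pivot [Finite O] (hr : Function.Injective r) :
    FComplex.Pivot (K.complex r hr) (Source V M) (Target V M) where
  disjoint := by
    intro g hs ht
    obtain ⟨⟨β, hβ⟩, hv⟩ := hs
    obtain ⟨⟨α, hα⟩, hv'⟩ := ht
    have := hv (m.disjoint hα hβ)
    rw [hv'] at this
    cases this
  col := by
    intro s hs
    obtain ⟨t, ht, h, hu⟩ := m.exists_target hs
    refine ⟨t, ht, m.sq_eq_one r hs ht h hu, fun t' ht' hne => ?_⟩
    by_contra h0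
    obtain ⟨h1, h2⟩ := m.link r hs ht' h0
    exact hne (m.target_unique ht ht' h h1 hu h2)
  row := by
    intro t ht
    obtain ⟨s, hs, h, hu⟩ := m.exists_source ht
    refine ⟨s, hs, m.sq_eq_one r hs ht h hu, fun s' hs' hne => ?_⟩
    by_contra h0
    obtain ⟨h1, h2⟩ := m.link r hs' ht h0
    exact hne (m.source_unique hs hs' h h1 hu h2)
  -- A circle that dies with label `v₊` or is born with label `v₋` lowers the sum of the labels by
  -- one, and the additional crossing in the set makes up for this. The annular grading is not
  -- affected. So the pivot preserves gradings strictly and its inverse is filtered.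
  deg := by
    intro s t hs ht h0
    obtain ⟨h1, h2⟩ := m.link r hs ht h0
    obtain ⟨x, hx, e⟩ := m.edge h1
    have hcard : t.1.card = s.1.card + 1 := by rw [e, Finset.card_insert_of_notMem hx]
    have hc := m.circ h1
    change K.deg t = K.deg s + (1, 0, 0)
    rw [V.deg_eq t, V.deg_eq s, h2, m.A_eq h1, hcard]
    by_cases hs' : V.circ s.1
    · have ht' : ¬ V.circ t.1 := by tauto
      rw [if_pos hs', if_neg ht', hs.2 hs']
      simp only [AnnularDiagram.labelDeg, Prod.mk_add_mk, if_true]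
      push_cast
      ext <;> dsimp only <;> ring
    · have ht' : V.circ t.1 := by tauto
      rw [if_neg hs', if_pos ht', ht.2]
      simp only [AnnularDiagram.labelDeg, Prod.mk_add_mk]
      push_cast
      ext <;> simp <;> ring

/-- Only one path contributes to an entry of the reduced differential. -/
theorem correction_eq {k l s t : K.Gen} (hs : Source V M s) (ht : Target V M t) (h : M s.1 t.1)
    (hu : V.u t = V.u s) (ht' : ∀ t', Target V M t' → K.d r t' l ≠ 0 → t' = t) :
    (∑ s', ∑ t', if Source V M s' ∧ Target V M t' then K.d r k s' * K.d r t' s' * K.d r t' l else 0)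
      = K.d r k s * K.d r t s * K.d r t l := by
  rw [Finset.sum_eq_single s, Finset.sum_eq_single t]
  · rw [if_pos ⟨hs, ht⟩]
  · intro t' _ hne
    split_ifs with h1
    · by_cases h2 : K.d r t' l = 0
      · rw [h2, mul_zero]
      · exact absurd (ht' t' h1.2 h2) hne
    · rfl
  · simp
  · intro s' _ hne
    refine Finset.sum_eq_zero fun t' _ => ?_
    split_ifs with h1
    · by_cases h2 : K.d r t' l = 0
      · rw [h2, mul_zero]
      · obtain rfl := ht' t' h1.2 h2
        by_cases h3 : K.d r t' s' = 0
        · rw [h3, mul_zero, zero_mul]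
        · obtain ⟨h4, h5⟩ := m.link r h1.1 h1.2 h3
          exact absurd (m.source_unique hs h1.1 h h4 hu h5) hne
    · rfl
  · simp

end Matching

/-- The generators that are not matched. -/
abbrev RestGen (V : K.View O R) (M : Finset C → Finset C → Prop) : Type :=
  {g : K.Gen // ¬ Source V M g ∧ ¬ Target V M g}

/-- The differential on the generators that are not matched. -/
noncomputable def restCoeff [Fintype C] (V : K.View O R) (M : Finset C → Finset C → Prop)
    (r : C → ℕ) (k l : K.Gen) : ℚ :=
  K.d r k l - ∑ s, ∑ t,
    if Source V M s ∧ Target V M t then K.d r k s * K.d r t s * K.d r t l else 0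

/-- The complex on the generators that are not matched. -/
theorem Matching.exists_rest [Fintype C] [Finite O] {V : K.View O R}
    {M : Finset C → Finset C → Prop} (m : Matching V M) (r : C → ℕ) (hr : Function.Injective r) :
    ∃ B : FComplex, (K.complex r hr).HEquiv B ∧ ∃ e : B.G ≃ RestGen V M,
      (∀ k, B.deg k = K.deg (e k).1) ∧ ∀ k l, B.d k l = restCoeff V M r (e k).1 (e l).1 :=
  ⟨FComplex.reduced (m.pivot r hr), FComplex.HEquiv.reduced (m.pivot r hr),
    Equiv.refl (RestGen V M), fun _ => rfl,
    fun k l => FComplex.reducedD_apply (K.complex r hr) (Source V M) (Target V M) k l⟩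

/-- The complex of a cube does not depend on the order of the crossings. -/
theorem hEquiv_rank [Fintype C] (K : Cube C) (r s : C → ℕ) (hr : Function.Injective r)
    (hs : Function.Injective s) : (K.complex r hr).HEquiv (K.complex s hs) := by
  refine K.hEquiv_of_match K r s hr hs (Equiv.refl C) (O := K.X) id id (fun α => ?_) rfl rfl
  have : α.map (Equiv.refl C).toEmbedding = α := by simp
  rw [this]
  exact ⟨⟨fun x => ⟨x, (K.E α).refl x⟩, fun x => ⟨x, (K.E α).refl x⟩, fun _ _ => Iff.rfl⟩,
    fun _ => Iff.rfl⟩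

/-- Extension of an order of crossings by additional crossings at the end. -/
theorem exists_rank {C C' : Type} [Fintype C] [Fintype C'] (e : C' ↪ C) (r : C' → ℕ)
    (hr : Function.Injective r) : ∃ s : C → ℕ, Function.Injective s ∧ (∀ z, s (e z) = r z) ∧
      ∀ x, (∀ z, e z ≠ x) → ∀ z, r z < s x := by
  let N := (Finset.univ.sup r) + 1
  have hN : ∀ z, r z < N := fun z => Nat.lt_succ_of_le (Finset.le_sup (Finset.mem_univ z))
  let s : C → ℕ := fun x => if h : ∃ z, e z = x then r h.choose else N + Fintype.equivFin C x
  have h1 : ∀ z, s (e z) = r z := by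
    intro z
    have h : ∃ z', e z' = e z := ⟨z, rfl⟩
    simp only [s, dif_pos h]
    rw [e.injective h.choose_spec]
  have h2 : ∀ x, (∀ z, e z ≠ x) → s x = N + Fintype.equivFin C x := by
    intro x hx
    exact dif_neg fun ⟨z, hz⟩ => hx z hz
  refine ⟨s, ?_, h1, fun x hx z => ?_⟩
  · intro x y hxy
    by_cases hx : ∃ z, e z = x <;> by_cases hy : ∃ z, e z = y
    · obtain ⟨z, rfl⟩ := hx
      obtain ⟨w, rfl⟩ := hy
      rw [h1, h1] at hxy
      rw [hr hxy]
    · obtain ⟨z, rfl⟩ := hx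
      push Not at hy
      rw [h1, h2 y hy] at hxy
      have := hN z
      omega
    · obtain ⟨w, rfl⟩ := hy
      push Not at hx
      rw [h1, h2 x hx] at hxy
      have := hN w
      omega
    · push Not at hx hy
      rw [h2 x hx, h2 y hy] at hxy
      exact (Fintype.equivFin C).injective (Fin.ext (by omega))
  · rw [h2 x hx]
    have := hN z
    omega

/-- After the elimination, the rest is the complex of a smaller cube. -/
theorem Matching.hEquiv_rest {C' : Type} [DecidableEq C'] [Fintype C] [Fintype C'] [Finite O]
    {K' : Cube C'} {V : K.View O R} {M : Finset C → Finset C → Prop} (m : Matching V M)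
    (V' : K'.View O R) (hV' : ∀ α', ¬ V'.circ α') (e : C' ↪ C) (B : Finset C)
    (hB : ∀ z, e z ∉ B) (v₀ : Bool)
    (hrest : ∀ g, (¬ Source V M g ∧ ¬ Target V M g) ↔
      (∃ α' : Finset C', g.1 = α'.map e ∪ B) ∧ V.v g = v₀)
    (hA : ∀ α' : Finset C', V.A (α'.map e ∪ B) = V'.A α')
    (hcirc : (∀ α' : Finset C', V.circ (α'.map e ∪ B)) ∨
      (∀ α' : Finset C', ¬ V.circ (α'.map e ∪ B)) ∧ v₀ = false)
    -- No zigzag through cancelled generators joins two remaining ones, so the reduced differential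
    -- is the restriction of the old one.
    (hcor : ∀ (r : C → ℕ) (s t k l : K.Gen), Source V M s → Target V M t → M s.1 t.1 →
      (¬ Source V M k ∧ ¬ Target V M k) → (¬ Source V M l ∧ ¬ Target V M l) →
      K.d r k s = 0 ∨ K.d r t l = 0)
    (hhs : K'.hs = K.hs + B.card)
    (hqs : K'.qs = K.qs + B.card +
      if V.circ B then AnnularDiagram.labelDeg v₀ else 0)
    (r : C → ℕ) (hr : Function.Injective r) (r' : C' → ℕ) (hr' : Function.Injective r') :
    (K.complex r hr).HEquiv (K'.complex r' hr') := by
  -- In this order the crossings of the smaller cube come first, so the crossings in `B` do not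
  -- enter the signs of the remaining edges.
  obtain ⟨s, hs, hs1, hs2⟩ := exists_rank e r' hr'
  have hinj : ∀ {α β : Finset C'}, α.map e ∪ B = β.map e ∪ B → α = β := by
    intro α β h
    ext z
    have := congrArg (fun γ => e z ∈ γ) h
    simpa [hB z] using this
  have hins : ∀ {α β : Finset C'} {x : C}, x ∉ α.map e ∪ B → β.map e ∪ B = insert x (α.map e ∪ B) →
      ∃ z, x = e z ∧ z ∉ α ∧ β = insert z α := by
    intro α β x hx h
    have hx' : x ∈ β.map e ∪ B := by rw [h]; exact Finset.mem_insert_self _ _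
    obtain ⟨z, hz, rfl⟩ : ∃ z ∈ β, e z = x := by
      rcases Finset.mem_union.1 hx' with h1 | h1
      · simpa using h1
      · exact absurd (Finset.mem_union_right _ h1) hx
    refine ⟨z, rfl, fun h' => hx ?_, hinj ?_⟩
    · simp [h']
    · rw [h, Finset.map_insert, Finset.insert_union]
  have hsign : ∀ (α : Finset C') z, edgeSign s (α.map e ∪ B) (e z) = edgeSign r' α z := by
    intro α z
    have hd : Disjoint (α.map e) B := by
      rw [Finset.disjoint_left]
      intro x hx hxB
      obtain ⟨w, -, rfl⟩ := Finset.mem_map.1 hx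
      exact hB w hxB
    rw [edgeSign_eq_prod, edgeSign_eq_prod, Finset.prod_union hd, Finset.prod_map]
    have : ∏ x ∈ B, (if s x < s (e z) then (-1 : ℚ) else 1) = 1 := by
      refine Finset.prod_eq_one fun x hx => ?_
      have := hs2 x (fun w hw => hB w (hw ▸ hx)) z
      rw [if_neg]
      rw [hs1]
      omega
    rw [this, mul_one]
    simp only [hs1]
  have hred : ∀ k l : RestGen V M, restCoeff V M s k.1 l.1 = K.d s k.1 l.1 := by
    intro k l
    rw [restCoeff, Finset.sum_eq_zero, sub_zero]
    intro s' _
    refine Finset.sum_eq_zero fun t' _ => ?_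
    split_ifs with h
    · by_cases h0 : K.d s t' s' = 0
      · rw [h0, mul_zero, zero_mul]
      rcases hcor s s' t' k.1 l.1 h.1 h.2 (m.link s h.1 h.2 h0).1 k.2 l.2 with h1 | h1
      · exact mul_eq_zero_of_left (mul_eq_zero_of_left h1 _) _
      · exact mul_eq_zero_of_right _ h1
    · rfl
  have hcirc' : ∀ α : Finset C', V.circ (α.map e ∪ B) ↔ V.circ B := by
    intro α
    have e0 : (∅ : Finset C').map e ∪ B = B := by simp
    rcases hcirc with h | ⟨h, -⟩
    · have := h α
      have := h ∅
      rw [e0] at this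
      tauto
    · have := h α
      have := h ∅
      rw [e0] at this
      tauto
  let ρ : K'.Gen → RestGen V M → Prop := fun g' g =>
    g.1.1 = g'.1.map e ∪ B ∧ V.u g.1 = V'.u g'
  have h₁ : ∀ i, ∃ j, ρ i j := by
    intro g'
    obtain ⟨g, h1, h2, h3⟩ := V.exists_gen (g'.1.map e ∪ B) (V'.u g')
      (fun o o' h => V'.u_resp g' o o' (hA g'.1 ▸ h)) v₀
      (fun h => (hcirc.resolve_left fun h' => h (h' _)).2)
    exact ⟨⟨g, (hrest g).2 ⟨⟨_, h1⟩, h3⟩⟩, h1, h2⟩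
  have h₂ : ∀ j, ∃ i, ρ i j := by
    rintro ⟨g, hg⟩
    obtain ⟨⟨α, h1⟩, h2⟩ := (hrest g).1 hg
    obtain ⟨g', h3, h4, -⟩ := V'.exists_gen α (V.u g)
      (fun o o' h => V.u_resp g o o' (by rw [h1, hA]; exact h)) false fun _ => rfl
    subst h3
    exact ⟨g', h1, h4.symm⟩
  have h₃ : ∀ i j j', ρ i j → ρ i j' → j = j' := by
    rintro i ⟨g, hg⟩ ⟨g', hg'⟩ ⟨h1, h2⟩ ⟨h3, h4⟩
    refine Subtype.ext (V.gen_ext (h1.trans h3.symm) (h2.trans h4.symm) ?_)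
    exact ((hrest g).1 hg).2.trans ((hrest g').1 hg').2.symm
  have h₄ : ∀ i i' j, ρ i j → ρ i' j → i = i' := by
    rintro i i' j ⟨h1, h2⟩ ⟨h3, h4⟩
    refine V'.gen_ext (hinj (h1.symm.trans h3)) (h2.symm.trans h4) ?_
    rw [V'.v_of_not (hV' _), V'.v_of_not (hV' _)]
  have hdeg : ∀ i j, ρ i j → K.deg j.1 = K'.deg i := by
    rintro i ⟨g, hg⟩ ⟨h1, h2⟩
    have h3 := ((hrest g).1 hg).2
    rw [V.deg_eq, V'.deg_eq]
    change ((g.1.card : ℤ) + K.hs, viewQ (V.A g.1) (V.u g) + _ + (g.1.card : ℤ) + K.qs, viewA R (V.A g.1) (V.u g)) = _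
    have h1' : g.1 = i.1.map e ∪ B := h1
    have h2' : V.u g = V'.u i := h2
    have hcard : g.1.card = i.1.card + B.card := by
      rw [h1', Finset.card_union_of_disjoint, Finset.card_map]
      rw [Finset.disjoint_left]
      intro x hx hxB
      obtain ⟨w, -, rfl⟩ := Finset.mem_map.1 hx
      exact hB w hxB
    rw [h2', hcard, if_neg (hV' _), hhs, hqs, h3]
    have hA' : V.A g.1 = V'.A i.1 := by rw [h1', hA]
    have hc : V.circ g.1 ↔ V.circ B := by rw [h1', hcirc']
    rw [hA', if_congr hc rfl rfl]
    push_cast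
    ext <;> dsimp only <;> ring
  have hd : ∀ i i' j j', ρ i j → ρ i' j' → K.d s j.1 j'.1 = 1 * 1 * K'.d r' i i' := by
    rintro i i' ⟨g, hg⟩ ⟨g', hg'⟩ ⟨h1, h2⟩ ⟨h3, h4⟩
    have hv1 := ((hrest g).1 hg).2
    have hv2 := ((hrest g').1 hg').2
    rw [one_mul, one_mul]
    change K.d s g g' = _
    change g.1 = _ at h1
    change g'.1 = _ at h3
    change V.u g = _ at h2
    change V.u g' = _ at h4
    by_cases hex : ∃ z, z ∉ i'.1 ∧ i.1 = insert z i'.1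
    · obtain ⟨z, hz, ez⟩ := hex
      have hz' : e z ∉ g'.1 := by rw [h3]; simp [hz, hB z]
      have ez' : g.1 = insert (e z) g'.1 := by
        rw [h1, h3, ez, Finset.map_insert, Finset.insert_union]
      have hA1 : V.A g.1 = V'.A i.1 := by rw [h1, hA]
      have hA2 : V.A g'.1 = V'.A i'.1 := by rw [h3, hA]
      have hsg : edgeSign s g'.1 (e z) = edgeSign r' i'.1 z := by rw [h3, hsign]
      rw [V'.d_full r' hz ez (hV' _) (hV' _)]
      by_cases hc : V.circ g.1
      · have hc' : V.circ g'.1 := by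
          rw [h3, hcirc']
          rwa [h1, hcirc'] at hc
        rw [V.d_circ s hz' ez' hc' hc, hv1, hv2, if_pos rfl, hA1, hA2, h2, h4, hsg]
      · have hc' : ¬ V.circ g'.1 := by
          rw [h3, hcirc']
          rwa [h1, hcirc'] at hc
        rw [V.d_full s hz' ez' hc' hc, hA1, hA2, h2, h4, hsg]
    · rw [K'.d_eq_zero fun c hc h => hex ⟨c, hc, h⟩, K.d_eq_zero]
      intro x hx h
      rw [h3] at hx
      rw [h1, h3] at h
      obtain ⟨z, -, hz, ez⟩ := hins hx h
      exact hex ⟨z, hz, ez⟩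
  obtain ⟨B, hB1, f, hf1, hf2⟩ := m.exists_rest s hs
  refine (K.hEquiv_rank r s hr hs).trans (hB1.trans (FComplex.HEquiv.symm ?_))
  refine FComplex.HEquiv.of_signed_rel (A := K'.complex r' hr') (B := B) (fun i j => ρ i (f j))
    (fun i => ?_) (fun j => h₂ (f j)) (fun i j j' h h' => f.injective (h₃ i _ _ h h'))
    (fun i i' j h h' => h₄ i i' _ h h') (fun _ => 1) (fun _ => one_mul 1)
    (fun i j h => (hf1 j).trans (hdeg i _ h)) fun i i' j j' h h' => ?_
  · obtain ⟨j, hj⟩ := h₁ i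
    exact ⟨f.symm j, by rwa [Equiv.apply_symm_apply]⟩
  · exact (hf2 j j').trans ((hred _ _).trans (hd i i' _ _ h h'))

end Cube

end CircleElimination

/-! ### The first and the second Reidemeister move for abstract cubes -/

section Reidemeister

open scoped Classical

namespace Cube

variable {C C' O : Type} [DecidableEq C] [DecidableEq C'] {K : Cube C} {K' : Cube C'}
  {R : O → Prop}

omit [DecidableEq C'] in
theorem exists_map_eq {e : C' ↪ C} {B α : Finset C} [Fintype C'] (hB : B ⊆ α)
    (h : ∀ x ∈ α, x ∉ B → ∃ z, e z = x) : ∃ α' : Finset C', α = α'.map e ∪ B := by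
  refine ⟨Finset.univ.filter (e · ∈ α), ?_⟩
  ext x
  simp only [Finset.mem_union, Finset.mem_map, Finset.mem_filter, Finset.mem_univ, true_and]
  constructor
  · intro hx
    by_cases hxB : x ∈ B
    · exact Or.inr hxB
    · obtain ⟨z, rfl⟩ := h x hx hxB
      exact Or.inl ⟨z, hx, rfl⟩
  · rintro (⟨z, hz, rfl⟩ | hx)
    · exact hz
    · exact hB hx

/-- Exactly one of the two resolutions of `c` has the circle, so all edges in direction `c` can be
cancelled. `P` tells the two cases apart: the circle is in the `1`-resolution if `P` holds and in
the `0`-resolution otherwise. -/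
theorem matching_one (V : K.View O R) {c : C} {P : Prop}
    (h : ∀ α, V.circ α ↔ (c ∈ α ↔ P)) : Matching V fun α β => c ∉ α ∧ β = insert c α where
  edge := fun ⟨h1, h2⟩ => ⟨c, h1, h2⟩
  circ := by
    rintro α β ⟨h1, rfl⟩
    rw [h, h]
    simp only [Finset.mem_insert_self, h1]
    tauto
  right_unique := by
    rintro α β β' ⟨h1, rfl⟩ ⟨h2, rfl⟩
    rfl
  left_unique := by
    rintro α α' β ⟨h1, rfl⟩ ⟨h2, h3⟩
    rw [← Finset.erase_insert h1, h3, Finset.erase_insert h2]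
  other := by
    rintro α β α' β' x ⟨h1, rfl⟩ ⟨h2, rfl⟩ h3 h4
    have : c ∈ insert x α := by rw [← h4]; exact Finset.mem_insert_self _ _
    rcases Finset.mem_insert.1 this with rfl | h5
    · exact Or.inl ⟨h1, h4⟩
    · exact absurd h5 h1
  disjoint := by
    rintro α β γ ⟨h1, rfl⟩ ⟨h2, h3⟩
    exact absurd (Finset.mem_insert_self _ _) h2

/-- The first Reidemeister move, if the additional cycle is in the `0`-resolution. -/
theorem reidemeister_one_merge [Fintype C] [Fintype C'] [Finite O] (V : K.View O R)
    (V' : K'.View O R) (hV' : ∀ α', ¬ V'.circ α') (e : C' ↪ C) (c : C)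
    (he : ∀ x, (∃ z, e z = x) ↔ x ≠ c) (h : ∀ α, V.circ α ↔ c ∉ α)
    (hA : ∀ α' : Finset C', V.A (α'.map e) = V'.A α') (hhs : K'.hs = K.hs)
    (hqs : K'.qs = K.qs - 1) (r : C → ℕ) (hr : Function.Injective r) (r' : C' → ℕ)
    (hr' : Function.Injective r') : (K.complex r hr).HEquiv (K'.complex r' hr') := by
  have hec : ∀ z, e z ≠ c := fun z => (he _).1 ⟨z, rfl⟩
  have m := matching_one V (c := c) (P := False) (fun α => by rw [h]; tauto)
  have hS : ∀ g, Source V (fun α β => c ∉ α ∧ β = insert c α) g ↔ c ∉ g.1 ∧ V.v g = true := by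
    intro g
    simp only [Source, h]
    constructor
    · rintro ⟨⟨_, h1, _⟩, h2⟩
      exact ⟨h1, h2 h1⟩
    · rintro ⟨h1, h2⟩
      exact ⟨⟨_, h1, rfl⟩, fun _ => h2⟩
  have hT : ∀ g, Target V (fun α β => c ∉ α ∧ β = insert c α) g ↔ c ∈ g.1 := by
    intro g
    constructor
    · rintro ⟨⟨α, h1, h2⟩, -⟩
      rw [h2]
      exact Finset.mem_insert_self _ _
    · intro hc
      exact ⟨⟨g.1.erase c, Finset.notMem_erase _ _, (Finset.insert_erase hc).symm⟩,
        V.v_of_not (by rw [h]; tauto)⟩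
  -- The remaining generators have a circle with label `v₋` in the `0`-resolution of `c`; this label
  -- explains the shift of `qs` by `-1`.
  have hR : ∀ g, (¬ Source V (fun α β => c ∉ α ∧ β = insert c α) g ∧
      ¬ Target V (fun α β => c ∉ α ∧ β = insert c α) g) ↔ c ∉ g.1 ∧ V.v g = false := by
    intro g
    rw [hS, hT]
    cases V.v g <;> simp
  refine m.hEquiv_rest V' hV' e ∅ (fun z => Finset.notMem_empty _) false (fun g => ?_)
    (fun α' => by rw [Finset.union_empty, hA]) (Or.inl fun α' => ?_) ?_ (by simp [hhs]) ?_ r hr r' hr'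
  · rw [hR]
    refine and_congr_left fun _ => ⟨fun hc => ?_, ?_⟩
    · exact exists_map_eq (Finset.empty_subset _) fun x hx _ => (he x).2 fun h' => hc (h' ▸ hx)
    · rintro ⟨α', h1⟩
      rw [h1]
      simp [hec]
  · rw [h]
    simp [hec]
  -- Edges between resolutions with the circle keep its label, so none leads from `v₊` at a source
  -- to `v₋` at a remaining generator.
  · intro r s t k l hs ht hst hk hl
    rw [hR] at hk
    rw [hS] at hs
    left
    by_contra h0
    obtain ⟨x, hx, e⟩ := K.exists_of_d_ne_zero h0
    rw [V.d_circ r hx e ((h _).2 hs.1) ((h _).2 hk.1), hs.2, hk.2] at h0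
    simp at h0
  · rw [hqs, if_pos ((h _).2 (Finset.notMem_empty _))]
    simp [AnnularDiagram.labelDeg]
    ring

/-- The first Reidemeister move, if the additional cycle is in the `1`-resolution. -/
theorem reidemeister_one_split [Fintype C] [Fintype C'] [Finite O] (V : K.View O R)
    (V' : K'.View O R) (hV' : ∀ α', ¬ V'.circ α') (e : C' ↪ C) (c : C)
    (he : ∀ x, (∃ z, e z = x) ↔ x ≠ c) (h : ∀ α, V.circ α ↔ c ∈ α)
    (hA : ∀ α' : Finset C', V.A (insert c (α'.map e)) = V'.A α') (hhs : K'.hs = K.hs + 1)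
    (hqs : K'.qs = K.qs + 2) (r : C → ℕ) (hr : Function.Injective r) (r' : C' → ℕ)
    (hr' : Function.Injective r') : (K.complex r hr).HEquiv (K'.complex r' hr') := by
  have hec : ∀ z, e z ≠ c := fun z => (he _).1 ⟨z, rfl⟩
  have m := matching_one V (c := c) (P := True) (fun α => by rw [h]; tauto)
  have hS : ∀ g, Source V (fun α β => c ∉ α ∧ β = insert c α) g ↔ c ∉ g.1 := by
    intro g
    simp only [Source, h]
    constructor
    · rintro ⟨⟨_, h1, _⟩, h2⟩
      exact h1
    · intro h1
      exact ⟨⟨_, h1, rfl⟩, fun h2 => absurd h2 h1⟩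
  have hT : ∀ g, Target V (fun α β => c ∉ α ∧ β = insert c α) g ↔ c ∈ g.1 ∧ V.v g = false := by
    intro g
    constructor
    · rintro ⟨⟨α, h1, h2⟩, h3⟩
      rw [h2]
      exact ⟨Finset.mem_insert_self _ _, h3⟩
    · rintro ⟨hc, h3⟩
      exact ⟨⟨g.1.erase c, Finset.notMem_erase _ _, (Finset.insert_erase hc).symm⟩, h3⟩
  -- The remaining generators have a circle with label `v₊` in the `1`-resolution of `c`; the label
  -- and the crossing in the set shift `qs` by one each.
  have hR : ∀ g, (¬ Source V (fun α β => c ∉ α ∧ β = insert c α) g ∧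
      ¬ Target V (fun α β => c ∉ α ∧ β = insert c α) g) ↔ c ∈ g.1 ∧ V.v g = true := by
    intro g
    rw [hS, hT]
    cases V.v g <;> simp
  have hU : ∀ α' : Finset C', α'.map e ∪ {c} = insert c (α'.map e) := fun α' => by
    rw [Finset.union_comm]; rfl
  refine m.hEquiv_rest V' hV' e {c} (fun z => by simp [hec]) true (fun g => ?_)
    (fun α' => by rw [hU, hA]) (Or.inl fun α' => ?_) ?_ (by simp [hhs]) ?_ r hr r' hr'
  · rw [hR]
    refine and_congr_left fun _ => ⟨fun hc => ?_, ?_⟩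
    · exact exists_map_eq (by simpa using hc) fun x hx hxc => (he x).2 (by simpa using hxc)
    · rintro ⟨α', h1⟩
      rw [h1]
      simp
  · rw [h]
    simp
  · intro r s t k l hs ht hst hk hl
    rw [hR] at hl
    rw [hT] at ht
    right
    by_contra h0
    obtain ⟨x, hx, e⟩ := K.exists_of_d_ne_zero h0
    rw [V.d_circ r hx e ((h _).2 hl.1) ((h _).2 ht.1), ht.2, hl.2] at h0
    simp at h0
  · rw [hqs, if_pos ((h _).2 (Finset.mem_singleton_self _))]
    simp [AnnularDiagram.labelDeg]
    ring

/-- The matching of the resolutions in which the additional cycle can be eliminated in a square face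
of the cube. -/
def FaceMatch (c c' : C) (Q : Finset C → Prop) (α β : Finset C) : Prop :=
  Q α ∧ c ∉ α ∧ ((c' ∉ α ∧ β = insert c' α) ∨ (c' ∈ α ∧ β = insert c α))

/-- The condition `Q` does not depend on the crossings `c` and `c'`. -/
structure FaceCondition (c c' : C) (Q : Finset C → Prop) : Prop where
  ne : c ≠ c'
  left : ∀ α, Q (insert c α) ↔ Q α
  right : ∀ α, Q (insert c' α) ↔ Q α

section Face

variable {c c' : C} {Q : Finset C → Prop} (f : FaceCondition c c' Q) {V : K.View O R}
  (h : ∀ α, V.circ α ↔ Q α ∧ c' ∈ α ∧ c ∉ α)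
include f

omit f in
theorem exists_faceMatch_right {α : Finset C} : (∃ β, FaceMatch c c' Q α β) ↔ Q α ∧ c ∉ α := by
  constructor
  · rintro ⟨β, h1, h2, _⟩
    exact ⟨h1, h2⟩
  · rintro ⟨h1, h2⟩
    by_cases h3 : c' ∈ α
    · exact ⟨_, h1, h2, Or.inr ⟨h3, rfl⟩⟩
    · exact ⟨_, h1, h2, Or.inl ⟨h3, rfl⟩⟩

theorem exists_faceMatch_left {β : Finset C} : (∃ α, FaceMatch c c' Q α β) ↔ Q β ∧ c' ∈ β := by
  constructor
  · rintro ⟨α, h1, h2, ⟨h3, rfl⟩ | ⟨h3, rfl⟩⟩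
    · exact ⟨(f.right α).2 h1, Finset.mem_insert_self _ _⟩
    · exact ⟨(f.left α).2 h1, Finset.mem_insert_of_mem h3⟩
  · rintro ⟨h1, h2⟩
    by_cases h3 : c ∈ β
    · refine ⟨β.erase c, (f.left _).1 (by rwa [Finset.insert_erase h3]), Finset.notMem_erase _ _,
        Or.inr ⟨Finset.mem_erase.2 ⟨f.ne.symm, h2⟩, (Finset.insert_erase h3).symm⟩⟩
    · refine ⟨β.erase c', (f.right _).1 (by rwa [Finset.insert_erase h2]),
        fun h' => h3 (Finset.mem_of_mem_erase h'),
        Or.inl ⟨Finset.notMem_erase _ _, (Finset.insert_erase h2).symm⟩⟩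

include h

/-- In the face of `c` and `c'` the circle occurs at the corner with only `c'` in the set. Its label
`v₋` is cancelled against the corner with neither crossing, where the circle is born, and its label
`v₊` against the corner with both, where it dies. Only the corner with `c` alone survives. -/
theorem matching_face : Matching V (FaceMatch c c' Q) where
  edge := by
    rintro α β ⟨-, h1, ⟨h2, rfl⟩ | ⟨h2, rfl⟩⟩
    · exact ⟨c', h2, rfl⟩
    · exact ⟨c, h1, rfl⟩
  circ := by
    rintro α β ⟨hQ, h1, ⟨h2, rfl⟩ | ⟨h2, rfl⟩⟩
    · rw [h, h, f.right]
      simp [hQ, h1, h2, f.ne]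
    · rw [h, h]
      simp [hQ, h1, h2]
  right_unique := by
    rintro α β β' ⟨-, h1, ⟨h2, rfl⟩ | ⟨h2, rfl⟩⟩ ⟨-, h3, ⟨h4, rfl⟩ | ⟨h4, rfl⟩⟩
    · rfl
    · exact absurd h4 h2
    · exact absurd h2 h4
    · rfl
  left_unique := by
    rintro α α' β ⟨-, h1, ⟨h2, rfl⟩ | ⟨h2, rfl⟩⟩ ⟨-, h3, ⟨h4, h5⟩ | ⟨h4, h5⟩⟩
    · rw [← Finset.erase_insert h2, h5, Finset.erase_insert h4]
    · have : c ∈ insert c' α := by rw [h5]; exact Finset.mem_insert_self _ _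
      simp [f.ne, h1] at this
    · have : c ∈ insert c' α' := by rw [← h5]; exact Finset.mem_insert_self _ _
      simp [f.ne, h3] at this
    · rw [← Finset.erase_insert h1, h5, Finset.erase_insert h3]
  other := by
    rintro α β α' β' x h1 h2 hx rfl
    obtain ⟨hQ, hc⟩ := (exists_faceMatch_right).1 ⟨_, h1⟩
    obtain ⟨hQ', hc'⟩ := (exists_faceMatch_left f).1 ⟨_, h2⟩
    by_cases h3 : c' ∈ α
    · by_cases h4 : x = c
      · exact Or.inl ⟨hQ, hc, Or.inr ⟨h3, by rw [h4]⟩⟩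
      · refine Or.inr ⟨(h _).2 ⟨hQ, h3, hc⟩, (h _).2 ⟨hQ', hc', ?_⟩⟩
        simp [hc, Ne.symm h4]
    · have : x = c' := by
        rcases Finset.mem_insert.1 hc' with h4 | h4
        · exact h4.symm
        · exact absurd h4 h3
      exact Or.inl ⟨hQ, hc, Or.inl ⟨h3, by rw [this]⟩⟩
  disjoint := by
    intro α β γ h1 h2
    obtain ⟨hQ, hc⟩ := (exists_faceMatch_right).1 ⟨_, h2⟩
    obtain ⟨hQ', hc'⟩ := (exists_faceMatch_left f).1 ⟨_, h1⟩
    exact (h _).2 ⟨hQ, hc', hc⟩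

omit f in
theorem source_face (g : K.Gen) : Source V (FaceMatch c c' Q) g ↔
    Q g.1 ∧ c ∉ g.1 ∧ (c' ∈ g.1 → V.v g = true) := by
  rw [Source, exists_faceMatch_right, h]
  tauto

omit h in
theorem target_face (g : K.Gen) : Target V (FaceMatch c c' Q) g ↔
    Q g.1 ∧ c' ∈ g.1 ∧ V.v g = false := by
  rw [Target, exists_faceMatch_left f]
  tauto

theorem rest_face (g : K.Gen) : (¬ Source V (FaceMatch c c' Q) g ∧
    ¬ Target V (FaceMatch c c' Q) g) ↔ (Q g.1 → c ∈ g.1 ∧ c' ∉ g.1) := by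
  rw [source_face h, target_face f]
  have h1 : c ∈ g.1 → V.v g = false := fun hc => V.v_of_not (by rw [h]; tauto)
  cases hv : V.v g
  · simp only [Bool.false_eq_true]
    tauto
  · rw [hv] at h1
    simp only [Bool.true_eq_false] at h1 ⊢
    tauto

end Face

/-- The second Reidemeister move. -/
theorem reidemeister_two [Fintype C] [Fintype C'] [Finite O] (V : K.View O R)
    (V' : K'.View O R) (hV' : ∀ α', ¬ V'.circ α') (e : C' ↪ C) (c c' : C) (hcc : c ≠ c')
    (he : ∀ x, (∃ z, e z = x) ↔ x ≠ c ∧ x ≠ c') (h : ∀ α, V.circ α ↔ c' ∈ α ∧ c ∉ α)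
    (hA : ∀ α' : Finset C', V.A (insert c (α'.map e)) = V'.A α') (hhs : K'.hs = K.hs + 1)
    (hqs : K'.qs = K.qs + 1) (r : C → ℕ) (hr : Function.Injective r) (r' : C' → ℕ)
    (hr' : Function.Injective r') : (K.complex r hr).HEquiv (K'.complex r' hr') := by
  have hec : ∀ z, e z ≠ c := fun z => ((he _).1 ⟨z, rfl⟩).1
  have hec' : ∀ z, e z ≠ c' := fun z => ((he _).1 ⟨z, rfl⟩).2
  have f : FaceCondition c c' (fun _ => True) := ⟨hcc, fun _ => Iff.rfl, fun _ => Iff.rfl⟩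
  have h' : ∀ α, V.circ α ↔ True ∧ c' ∈ α ∧ c ∉ α := fun α => by rw [h, true_and]
  have hU : ∀ α' : Finset C', α'.map e ∪ {c} = insert c (α'.map e) := fun α' => by
    rw [Finset.union_comm]; rfl
  refine (matching_face f h').hEquiv_rest V' hV' e {c} (fun z => by simp [hec]) false (fun g => ?_)
    (fun α' => by rw [hU, hA]) (Or.inr ⟨fun α' => ?_, rfl⟩) ?_ (by simp [hhs]) ?_ r hr r' hr'
  · rw [rest_face f h']
    constructor
    · intro h1
      obtain ⟨h2, h3⟩ := h1 trivial
      refine ⟨exists_map_eq (by simpa using h2) fun x hx hxc => (he x).2 ⟨by simpa using hxc,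
        fun h4 => h3 (h4 ▸ hx)⟩, V.v_of_not (by rw [h]; tauto)⟩
    · rintro ⟨⟨α', h1⟩, -⟩ -
      rw [h1]
      simp [hec', hcc.symm]
  · rw [h]
    simp
  -- A source with an arrow to a remaining generator does not have `c'`, so it is at the corner with
  -- neither crossing and its partner `t` lacks `c`; but an arrow from a remaining generator to `t`
  -- would give `t` the crossing `c`.
  · intro r s t k l hs ht hst hk hl
    rw [rest_face f h'] at hk hl
    rw [source_face h'] at hs
    rw [target_face f] at ht
    by_contra h0
    push Not at h0
    obtain ⟨x, hx, e⟩ := K.exists_of_d_ne_zero h0.1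
    by_cases hc' : c' ∈ s.1
    · exact (hk trivial).2 (by rw [e]; exact Finset.mem_insert_of_mem hc')
    · obtain ⟨x', hx', e'⟩ := K.exists_of_d_ne_zero h0.2
      have h1 : c ∈ t.1 := by rw [e']; exact Finset.mem_insert_of_mem (hl trivial).1
      obtain ⟨-, h2, ⟨-, h3⟩ | ⟨h3, -⟩⟩ := hst
      · rw [h3] at h1
        simp [hcc, h2] at h1
      · exact hc' h3
  · rw [hqs, if_neg (by rw [h]; simp)]
    simp

end Cube

end Reidemeister

/-! ### Combinatorics and signs of the third Reidemeister move -/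

section ReidemeisterThree

open scoped Classical

namespace Cube

variable {C O : Type} [DecidableEq C] {R : O → Prop}

/-- Only one path contributes to an entry of the reduced differential. -/
theorem Matching.correction_eq' {K : Cube C} {V : K.View O R} {M : Finset C → Finset C → Prop}
    (m : Matching V M) [Fintype C] (r : C → ℕ) {k l s t : K.Gen} (hs : Source V M s)
    (ht : Target V M t) (h : M s.1 t.1) (hu : V.u t = V.u s)
    (hs' : ∀ s', Source V M s' → K.d r k s' ≠ 0 → s' = s) :
    (∑ s', ∑ t', if Source V M s' ∧ Target V M t' then K.d r k s' * K.d r t' s' * K.d r t' l else 0)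
      = K.d r k s * K.d r t s * K.d r t l := by
  rw [Finset.sum_eq_single s, Finset.sum_eq_single t]
  · rw [if_pos ⟨hs, ht⟩]
  · intro t' _ hne
    split_ifs with h1
    · by_cases h3 : K.d r t' s = 0
      · rw [h3, mul_zero, zero_mul]
      · obtain ⟨h4, h5⟩ := m.link r h1.1 h1.2 h3
        exact absurd (m.target_unique ht h1.2 h h4 hu h5) hne
    · rfl
  · simp
  · intro s' _ hne
    refine Finset.sum_eq_zero fun t' _ => ?_
    split_ifs with h1
    · by_cases h2 : K.d r k s' = 0
      · rw [h2, zero_mul, zero_mul]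
      · exact absurd (hs' s' h1.1 h2) hne
    · rfl
  · simp

/-- The resolutions of the third crossing in which the first two crossings can form a circle. -/
def ThirdCond (c₃ : C) (o : Bool) (α : Finset C) : Prop := c₃ ∈ α ↔ o = true

/-- The pairs of resolutions between which the elimination of circles creates a map. -/
def Special (c c' c₃ : C) (o : Bool) (α β : Finset C) : Prop :=
  c₃ ∉ α ∧ if o = true then c' ∈ α ∧ c ∉ α ∧ β = insert c ((insert c₃ α).erase c')
    else c ∈ α ∧ c' ∉ α ∧ β = insert c₃ ((insert c' α).erase c)

/-- The correspondence of the resolutions on the two sides of the third Reidemeister move. -/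
def ThirdRel (c c' c₃ : C) (o : Bool) (α β : Finset C) : Prop :=
  (∀ x, x ≠ c → x ≠ c' → (x ∈ α ↔ x ∈ β)) ∧
    if ThirdCond c₃ o α then c ∈ α ∧ c' ∉ α ∧ c ∈ β ∧ c' ∉ β
    else (c ∈ α ↔ c' ∈ β) ∧ (c' ∈ α ↔ c ∈ β)

section

variable {c c' c₃ : C} {o : Bool}

theorem faceCondition_third (h₁ : c ≠ c') (h₂ : c ≠ c₃) (h₃ : c' ≠ c₃) :
    FaceCondition c c' (ThirdCond c₃ o) where
  ne := h₁
  left α := by simp [ThirdCond, h₂.symm]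
  right α := by simp [ThirdCond, h₃.symm]

omit [DecidableEq C] in
theorem ThirdRel.cond (h₂ : c ≠ c₃) (h₃ : c' ≠ c₃) {α β : Finset C}
    (h : ThirdRel c c' c₃ o α β) : ThirdCond c₃ o α ↔ ThirdCond c₃ o β := by
  rw [ThirdCond, ThirdCond, h.1 c₃ h₂.symm h₃.symm]

theorem ThirdRel.symm (h₂ : c ≠ c₃) (h₃ : c' ≠ c₃) {α β : Finset C}
    (h : ThirdRel c c' c₃ o α β) : ThirdRel c c' c₃ o β α := by
  have h1 := h.cond h₂ h₃
  refine ⟨fun x hx hx' => (h.1 x hx hx').symm, ?_⟩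
  have h2 := h.2
  rw [if_congr h1 rfl rfl] at h2
  split_ifs at h2 ⊢ <;> tauto

theorem ThirdRel.unique {α β β' : Finset C} (h : ThirdRel c c' c₃ o α β)
    (h' : ThirdRel c c' c₃ o α β') : β = β' := by
  ext x
  obtain ⟨h1, h2⟩ := h
  obtain ⟨h3, h4⟩ := h'
  by_cases hx : x = c
  · subst hx
    split_ifs at h2 h4 <;> tauto
  · by_cases hx' : x = c'
    · subst hx'
      split_ifs at h2 h4 <;> tauto
    · rw [← h1 x hx hx', h3 x hx hx']

theorem exists_thirdRel {α : Finset C}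
    (h : ThirdCond c₃ o α → c ∈ α ∧ c' ∉ α) : ∃ β, ThirdRel c c' c₃ o α β := by
  by_cases hQ : ThirdCond c₃ o α
  · exact ⟨α, fun _ _ _ => Iff.rfl, by rw [if_pos hQ]; have := h hQ; tauto⟩
  -- Where the third crossing is resolved the other way, no circle occurs and the move exchanges the
  -- roles of `c` and `c'`.
  · refine ⟨α.map (Equiv.swap c c').toEmbedding, fun x hx hx' => ?_, ?_⟩
    · simp [Finset.mem_map_equiv, Equiv.swap_apply_of_ne_of_ne hx hx']
    · rw [if_neg hQ]
      simp [Finset.mem_map_equiv]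

end

section Signs

variable (c c' c₃ : C)

/-- The part of a set of crossings outside the disc. -/
def outerPart (α : Finset C) : Finset C := α.filter fun x => x ≠ c ∧ x ≠ c' ∧ x ≠ c₃

variable {c c' c₃}

theorem prod_eq_outerPart (h₁ : c ≠ c') (h₂ : c ≠ c₃) (h₃ : c' ≠ c₃) (F : C → ℚ) (α : Finset C) :
    ∏ x ∈ α, F x = (∏ x ∈ outerPart c c' c₃ α, F x) * (if c ∈ α then F c else 1) *
      (if c' ∈ α then F c' else 1) * (if c₃ ∈ α then F c₃ else 1) := by
  have key : ∀ (β : Finset C) (z : C), ∏ x ∈ β, F x = (∏ x ∈ β.filter (· ≠ z), F x) *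
      if z ∈ β then F z else 1 := by
    intro β z
    rw [Finset.filter_ne' β z]
    split_ifs with h
    · rw [mul_comm, Finset.mul_prod_erase β F h]
    · rw [Finset.erase_eq_of_notMem h, mul_one]
  rw [key α c₃, key _ c', key _ c]
  have e : ((α.filter (· ≠ c₃)).filter (· ≠ c')).filter (· ≠ c) = outerPart c c' c₃ α := by
    ext x
    simp only [outerPart, Finset.mem_filter]
    tauto
  rw [e]
  simp [h₁, h₂, h₃]

/-- An order of the crossings in which the inner ones come last. -/
structure ThirdRank (c c' c₃ : C) (r : C → ℕ) : Prop where
  inj : Function.Injective r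
  lt : ∀ x, x ≠ c → x ≠ c' → x ≠ c₃ → r x < r c'
  lt' : r c' < r c
  lt₃ : r c < r c₃

theorem exists_thirdRank [Fintype C] (h₁ : c ≠ c') (h₂ : c ≠ c₃) (h₃ : c' ≠ c₃) :
    ∃ r, ThirdRank c c' c₃ r := by
  let N := Fintype.card C
  let f : C → ℕ := fun x => Fintype.equivFin C x
  have hf : ∀ x, f x < N := fun x => (Fintype.equivFin C x).2
  have hf' : ∀ x y, f x = f y → x = y := fun x y h =>
    (Fintype.equivFin C).injective (Fin.ext h)
  let r : C → ℕ := fun x => if x = c' then N else if x = c then N + 1 else if x = c₃ then N + 2 else f x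
  have e1 : r c' = N := by simp [r]
  have e2 : r c = N + 1 := by simp [r, h₁]
  have e3 : r c₃ = N + 2 := by simp [r, h₂.symm, h₃.symm]
  have e4 : ∀ x, x ≠ c → x ≠ c' → x ≠ c₃ → r x = f x := by
    intro x hx hx' hx3
    simp [r, hx, hx', hx3]
  refine ⟨r, ?_, fun x hx hx' hx3 => ?_, by omega, by omega⟩
  · intro x y hxy
    have key : ∀ z, (z = c ∧ r z = N + 1) ∨ (z = c' ∧ r z = N) ∨ (z = c₃ ∧ r z = N + 2) ∨
        (r z = f z) := by
      intro z
      by_cases hz : z = c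
      · exact Or.inl ⟨hz, hz ▸ e2⟩
      · by_cases hz' : z = c'
        · exact Or.inr (Or.inl ⟨hz', hz' ▸ e1⟩)
        · by_cases hz3 : z = c₃
          · exact Or.inr (Or.inr (Or.inl ⟨hz3, hz3 ▸ e3⟩))
          · exact Or.inr (Or.inr (Or.inr (e4 z hz hz' hz3)))
    have hx := hf x
    have hy := hf y
    rcases key x with ⟨h, h'⟩ | ⟨h, h'⟩ | ⟨h, h'⟩ | h' <;>
      rcases key y with ⟨k, k'⟩ | ⟨k, k'⟩ | ⟨k, k'⟩ | k' <;>
      first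
      | exact h.trans k.symm
      | exact hf' x y (by omega)
  · rw [e4 x hx hx' hx3, e1]
    exact hf x

/-- The sign of the crossings outside the disc. -/
def outerSign (c c' c₃ : C) (α : Finset C) : ℚ := ∏ _x ∈ outerPart c c' c₃ α, (-1)

variable {r : C → ℕ} (hr : ThirdRank c c' c₃ r)

theorem outerSign_mul_self (α : Finset C) : outerSign c c' c₃ α * outerSign c c' c₃ α = 1 := by
  rw [outerSign, ← Finset.prod_mul_distrib]
  simp

include hr

theorem ThirdRank.prod_outer {x : C} (h : r c' ≤ r x) (α : Finset C) :
    (∏ z ∈ outerPart c c' c₃ α, if r z < r x then (-1 : ℚ) else 1) = outerSign c c' c₃ α := by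
  refine Finset.prod_congr rfl fun z hz => ?_
  obtain ⟨-, h1, h2, h3⟩ := Finset.mem_filter.1 hz
  rw [if_pos]
  exact lt_of_lt_of_le (hr.lt z h1 h2 h3) h

theorem ThirdRank.sign_in (h₁ : c ≠ c') (h₂ : c ≠ c₃) (h₃ : c' ≠ c₃) (α : Finset C) :
    edgeSign r α c' = outerSign c c' c₃ α := by
  have h4 := hr.lt'
  have h5 := hr.lt₃
  rw [edgeSign_eq_prod, prod_eq_outerPart h₁ h₂ h₃, hr.prod_outer le_rfl]
  simp [not_lt.2 h4.le, not_lt.2 (h4.trans h5).le]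

theorem ThirdRank.sign_out (h₁ : c ≠ c') (h₂ : c ≠ c₃) (h₃ : c' ≠ c₃) (α : Finset C) :
    edgeSign r α c = outerSign c c' c₃ α * if c' ∈ α then -1 else 1 := by
  have h4 := hr.lt'
  have h5 := hr.lt₃
  rw [edgeSign_eq_prod, prod_eq_outerPart h₁ h₂ h₃, hr.prod_outer h4.le]
  simp [not_lt.2 h5.le, h4]

theorem ThirdRank.sign_third (h₁ : c ≠ c') (h₂ : c ≠ c₃) (h₃ : c' ≠ c₃) (α : Finset C) :
    edgeSign r α c₃ = outerSign c c' c₃ α * (if c ∈ α then -1 else 1) *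
      if c' ∈ α then -1 else 1 := by
  have h4 := hr.lt'
  have h5 := hr.lt₃
  rw [edgeSign_eq_prod, prod_eq_outerPart h₁ h₂ h₃, hr.prod_outer (h4.trans h5).le]
  simp [h5, h4.trans h5]

theorem ThirdRank.sign_outer (h₁ : c ≠ c') (h₂ : c ≠ c₃) (h₃ : c' ≠ c₃) {α β : Finset C}
    (h : outerPart c c' c₃ α = outerPart c c' c₃ β) {x : C} (hx : x ≠ c) (hx' : x ≠ c')
    (hx₃ : x ≠ c₃) : edgeSign r α x = edgeSign r β x := by
  have h4 := hr.lt'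
  have h5 := hr.lt₃
  have h6 := hr.lt x hx hx' hx₃
  rw [edgeSign_eq_prod, edgeSign_eq_prod, prod_eq_outerPart h₁ h₂ h₃,
    prod_eq_outerPart h₁ h₂ h₃ _ β, h]
  simp [not_lt.2 h6.le, not_lt.2 (h6.trans h4).le, not_lt.2 ((h6.trans h4).trans h5).le]

end Signs

end Cube

end ReidemeisterThree

/-! ### The reduced differential on one side of the third Reidemeister move -/

section ReidemeisterThreeMaps

open scoped Classical

namespace Cube

variable {C O : Type} [DecidableEq C] {R : O → Prop} {c c' c₃ : C} {o : Bool}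

/-- A zigzag between remaining resolutions goes up by an edge, back along the matching and up again.
As in the second move it cannot stay within the faces that contain circles, so one of its two edges
changes `c₃`: the first one if `o` is `true`, the second one if `o` is `false`. -/
theorem special_of_path (h₁ : c ≠ c') (h₂ : c ≠ c₃) (h₃ : c' ≠ c₃) {s t k l : Finset C} {x z : C}
    (hk : ThirdCond c₃ o k → c ∈ k ∧ c' ∉ k) (hl : ThirdCond c₃ o l → c ∈ l ∧ c' ∉ l)
    (hM : FaceMatch c c' (ThirdCond c₃ o) s t) (hx : x ∉ l) (ex : t = insert x l)
    (ez : k = insert z s) : Special c c' c₃ o l k := by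
  obtain ⟨hQ, hc, hM⟩ := hM
  subst ez
  unfold ThirdCond Special at *
  rcases hM with ⟨hc', e⟩ | ⟨hc', e⟩
  · have e1 : insert c' s = insert x l := e.symm.trans ex
    have e2 : ∀ w, w ∈ insert c' s ↔ w ∈ insert x l := fun w => by rw [e1]
    simp only [Finset.mem_insert] at hk e2
    have hcl : c ∉ l := by grind
    have hx3 : x = c₃ := by grind
    subst hx3
    have hz : z = c := by grind
    subst hz
    refine ⟨hx, ?_⟩
    rw [if_pos (by grind), ← e1, Finset.erase_insert hc']
    exact ⟨by grind, hcl, rfl⟩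
  · have e1 : insert c s = insert x l := e.symm.trans ex
    have e2 : ∀ w, w ∈ insert c s ↔ w ∈ insert x l := fun w => by rw [e1]
    simp only [Finset.mem_insert] at hk e2
    have hz3 : z = c₃ := by grind
    subst hz3
    have ho : ¬ o = true := by grind
    have hzl : z ∉ l := by grind
    have hl' := hl (by grind)
    have hx' : x = c' := by grind
    subst hx'
    refine ⟨hzl, ?_⟩
    rw [if_neg ho, ← e1, Finset.erase_insert hc]
    exact ⟨hl'.1, hl'.2, rfl⟩

section OneSide

variable [Fintype C] {K : Cube C} {V : K.View O R}
  (hV : ∀ α, V.circ α ↔ ThirdCond c₃ o α ∧ c' ∈ α ∧ c ∉ α)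
  (h₁ : c ≠ c') (h₂ : c ≠ c₃) (h₃ : c' ≠ c₃) (r : C → ℕ) {k l : K.Gen}
  (hk : ThirdCond c₃ o k.1 → c ∈ k.1 ∧ c' ∉ k.1) (hl : ThirdCond c₃ o l.1 → c ∈ l.1 ∧ c' ∉ l.1)
include hV h₁ h₂ h₃ hk hl

theorem restCoeff_of_not_special (h : ¬ Special c c' c₃ o l.1 k.1) :
    restCoeff V (FaceMatch c c' (ThirdCond c₃ o)) r k l = K.d r k l := by
  have f : FaceCondition c c' (ThirdCond c₃ o) := faceCondition_third h₁ h₂ h₃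
  have m := matching_face f hV
  rw [restCoeff, sub_eq_self]
  refine Finset.sum_eq_zero fun s _ => Finset.sum_eq_zero fun t _ => ?_
  split_ifs with hst
  swap
  · rfl
  by_contra h0
  have h01 : K.d r k s ≠ 0 := fun h' => h0 (by rw [h', zero_mul, zero_mul])
  have h02 : K.d r t s ≠ 0 := fun h' => h0 (by rw [h', mul_zero, zero_mul])
  have h03 : K.d r t l ≠ 0 := fun h' => h0 (by rw [h', mul_zero])
  obtain ⟨x, hx, ex⟩ := K.exists_of_d_ne_zero h03
  obtain ⟨z, -, ez⟩ := K.exists_of_d_ne_zero h01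
  exact h (special_of_path h₁ h₂ h₃ hk hl (m.link r hst.1 hst.2 h02).1 hx ex ez)

/-- There is only one zigzag. Two of its three arrows are births of a circle with label `v₋` (for `o
= true`) or deaths of one with label `v₊` (for `o = false`), which act as identities up to sign on
the outer labels. So the entry is, up to sign, the map of the remaining saddle. -/
theorem restCoeff_of_special (hr : ThirdRank c c' c₃ r) (h : Special c c' c₃ o l.1 k.1) :
    restCoeff V (FaceMatch c c' (ThirdCond c₃ o)) r k l =
      outerSign c c' c₃ l.1 * (if o = true then 1 else -1) *
        relCoeff (V.A l.1) (V.A k.1) (V.u l) (V.u k) := by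
  have f : FaceCondition c c' (ThirdCond c₃ o) := faceCondition_third h₁ h₂ h₃
  have m := matching_face f hV
  have hT := target_face (K := K) f (V := V)
  have hS := source_face (K := K) hV
  obtain ⟨h3, h⟩ := h
  -- The two resolutions differ at more than one crossing, so the original differential has no entry
  -- here.
  have hd0 : K.d r k l = 0 := by
    refine K.d_eq_zero fun x hx e => ?_
    have e2 : ∀ w, w ∈ k.1 ↔ w ∈ insert x l.1 := fun w => by rw [e]
    split_ifs at h with ho
    · obtain ⟨ha, hb, hk'⟩ := h
      have := e2 c'
      rw [hk'] at this
      simp [ha, h₁.symm] at this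
    · obtain ⟨ha, hb, hk'⟩ := h
      have := e2 c
      rw [hk'] at this
      simp [ha, h₂] at this
  rw [restCoeff, hd0, zero_sub]
  have hos : ∀ {α β : Finset C}, (∀ x, x ≠ c → x ≠ c' → x ≠ c₃ → (x ∈ α ↔ x ∈ β)) →
      outerSign c c' c₃ α = outerSign c c' c₃ β := by
    intro α β hab
    rw [outerSign, outerSign]
    congr 1
    ext x
    simp only [outerPart, Finset.mem_filter]
    have := hab x
    tauto
  by_cases ho : o = true
  · rw [if_pos ho] at h ⊢
    obtain ⟨ha, hb, hk'⟩ := h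
    have hQ : ThirdCond c₃ o (insert c₃ l.1) := by simp [ThirdCond, ho]
    have hQl : ¬ ThirdCond c₃ o l.1 := by simp [ThirdCond, ho, h3]
    have hct : V.circ (insert c₃ l.1) := by
      rw [hV]; exact ⟨hQ, by simp [ha], by simp [hb, h₂]⟩
    have hcl : ¬ V.circ l.1 := by rw [hV]; tauto
    obtain ⟨t, ht1, ht2, ht3⟩ := V.exists_gen (insert c₃ l.1) (V.u l)
      (fun p q hpq => V.u_resp l p q (by rwa [V.A_insert h3 (by tauto)] at hpq)) false fun _ => rfl
    have ht : Target V (FaceMatch c c' (ThirdCond c₃ o)) t := by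
      rw [hT, ht1]
      exact ⟨hQ, by simp [ha], ht3⟩
    obtain ⟨s, hs, hst, hus⟩ := m.exists_source ht
    have hst' := hst
    obtain ⟨-, hcs, ⟨hcs', est⟩ | ⟨-, est⟩⟩ := hst
    swap
    · exfalso
      have : c ∈ t.1 := by rw [est]; exact Finset.mem_insert_self _ _
      rw [ht1] at this
      simp [hb, h₂] at this
    have es : s.1 = (insert c₃ l.1).erase c' := by
      rw [← ht1, est, Finset.erase_insert hcs']
    rw [m.correction_eq r hs ht hst' hus]
    · have ek : k.1 = insert c s.1 := by rw [hk', es]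
      have hck : ¬ V.circ k.1 := by rw [hV, ek]; simp
      have hcs2 : ¬ V.circ s.1 := by rw [hV]; tauto
      have hct' : V.circ t.1 := by rwa [ht1]
      rw [V.d_full r hcs ek hcs2 hck, V.d_birth r hcs' est hcs2 hct' ht3,
        V.d_birth r h3 ht1 hcl hct' ht3, if_pos hus, if_pos ht2, ← hus, ht2]
      have eA : V.A s.1 = V.A l.1 := by
        rw [← m.A_eq hst', ht1, V.A_insert h3 (by tauto)]
      rw [eA, hr.sign_in h₁ h₂ h₃, hr.sign_out h₁ h₂ h₃, hr.sign_third h₁ h₂ h₃, if_neg hcs',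
        if_neg hb, if_pos ha]
      have e4 : outerSign c c' c₃ s.1 = outerSign c c' c₃ l.1 := by
        refine hos fun x hx hx' hx3 => ?_
        rw [es]
        simp [hx', hx3]
      rw [e4]
      have := outerSign_mul_self (c := c) (c' := c') (c₃ := c₃) l.1
      linear_combination (outerSign c c' c₃ l.1 * relCoeff (V.A l.1) (V.A k.1) (V.u l) (V.u k)) * this
    · intro t' ht' hd
      obtain ⟨x, hx, ex⟩ := K.exists_of_d_ne_zero hd
      rw [hT] at ht'
      have hx3 : x = c₃ := by
        have h5 := ht'.1
        rw [ex] at h5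
        unfold ThirdCond at h5 hQl
        simp only [Finset.mem_insert] at h5
        have : c₃ = x := by tauto
        exact this.symm
      subst hx3
      have hct2 : V.circ t'.1 := by rwa [ex]
      rw [V.d_birth r hx ex hcl hct2 ht'.2.2] at hd
      have hu : V.u t' = V.u l := by
        by_contra hu
        rw [if_neg hu, mul_zero] at hd
        exact hd rfl
      exact V.gen_ext (ex.trans ht1.symm) (hu.trans ht2.symm) (ht'.2.2.trans ht3.symm)
  · rw [if_neg ho] at h ⊢
    obtain ⟨ha, hb, hk'⟩ := h
    have hct : c ∈ insert c' l.1 := by simp [ha]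
    have h3s : c₃ ∉ (insert c' l.1).erase c := by simp [h3, h₃.symm]
    have hQ : ThirdCond c₃ o ((insert c' l.1).erase c) := by
      simp only [ThirdCond, h3s, ho]
      exact iff_of_false (by tauto) (by simp)
    have hcs : V.circ ((insert c' l.1).erase c) := by
      rw [hV]; exact ⟨hQ, by simp [h₁.symm], by simp⟩
    have hck : ¬ V.circ k.1 := by
      rw [hV, hk']; simp [ThirdCond, ho]
    obtain ⟨s, hs1, hs2, hs3⟩ := V.exists_gen ((insert c' l.1).erase c) (V.u k)
      (fun p q hpq => V.u_resp k p q (by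
        rw [hk', V.A_insert h3s]
        · exact hpq
        · rw [← hk']; tauto)) true (fun h' => absurd hcs h')
    have hs : Source V (FaceMatch c c' (ThirdCond c₃ o)) s := by
      rw [hS, hs1]
      exact ⟨hQ, by simp, fun _ => hs3⟩
    obtain ⟨t, ht, hst, hut⟩ := m.exists_target hs
    have hst' := hst
    obtain ⟨-, hcs0, ⟨hcs', est⟩ | ⟨-, est⟩⟩ := hst
    · exfalso
      rw [hs1] at hcs'
      simp [h₁.symm] at hcs'
    have et : t.1 = insert c' l.1 := by rw [est, hs1, Finset.insert_erase hct]
    rw [m.correction_eq' r hs ht hst' hut]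
    · have ek : k.1 = insert c₃ s.1 := by rw [hk', hs1]
      have h3s' : c₃ ∉ s.1 := by rw [hs1]; exact h3s
      have hcs2 : V.circ s.1 := by rwa [hs1]
      have hct2 : ¬ V.circ t.1 := by rw [hV, et]; simp [ha]
      have hcl : ¬ V.circ l.1 := by rw [hV]; tauto
      rw [V.d_death r h3s' ek hcs2 hck hs3, V.d_death r hcs0 est hcs2 hct2 hs3,
        V.d_full r hb et hcl hct2, if_pos hs2, if_pos hut.symm, hut, hs2]
      have eA : V.A t.1 = V.A k.1 := by
        rw [m.A_eq hst', ek, V.A_insert h3s']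
        rw [← ek]; tauto
      have hc's : c' ∈ s.1 := by rw [hs1]; simp [h₁.symm]
      rw [eA, hr.sign_in h₁ h₂ h₃, hr.sign_out h₁ h₂ h₃, hr.sign_third h₁ h₂ h₃, if_neg hcs0,
        if_pos hc's]
      have e4 : outerSign c c' c₃ s.1 = outerSign c c' c₃ l.1 := by
        refine hos fun x hx hx' hx3 => ?_
        rw [hs1]
        simp [hx', hx]
      rw [e4]
      have := outerSign_mul_self (c := c) (c' := c') (c₃ := c₃) l.1
      linear_combination (-outerSign c c' c₃ l.1 * relCoeff (V.A l.1) (V.A k.1) (V.u l) (V.u k)) * this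
    · intro s' hs' hd
      obtain ⟨x, hx, ex⟩ := K.exists_of_d_ne_zero hd
      rw [hS] at hs'
      have h3k : c₃ ∈ k.1 := by rw [hk']; exact Finset.mem_insert_self _ _
      have hx3 : x = c₃ := by
        have h5 := hs'.1
        rw [ex] at h3k
        unfold ThirdCond at h5
        have h6 := Finset.mem_insert.1 h3k
        have : c₃ = x := by tauto
        exact this.symm
      subst hx3
      have es' : s'.1 = (insert c' l.1).erase c := by
        rw [← Finset.erase_insert hx, ← ex, hk', Finset.erase_insert h3s]
      have hcs3 : V.circ s'.1 := by rwa [es']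
      have hv : V.v s' = true := hs'.2.2 (by rw [es']; simp [h₁.symm])
      rw [V.d_death r hx ex hcs3 hck hv] at hd
      have hu : V.u s' = V.u k := by
        by_contra hu
        rw [if_neg hu, mul_zero] at hd
        exact hd rfl
      exact V.gen_ext (es'.trans hs1.symm) (hu.trans hs2.symm) (hv.trans hs3.symm)

end OneSide

end Cube

end ReidemeisterThreeMaps

/-! ### Comparison of the two sides of the third Reidemeister move -/

section ReidemeisterThreeEquivalence

open scoped Classical

namespace Cube

variable {C O : Type} [DecidableEq C] {R : O → Prop} {c c' c₃ : C} {o : Bool}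

/-- Ordinary edges correspond to ordinary edges, with `c` and `c'` exchanged where no circle can
occur. The only exceptions are edges in direction `c₃` across which this exchange moves one end;
they become special pairs on the other side. -/
theorem ThirdRel.edge (h₁ : c ≠ c') (h₂ : c ≠ c₃) (h₃ : c' ≠ c₃) {α β α' β' : Finset C}
    (hα : ThirdRel c c' c₃ o α α') (hβ : ThirdRel c c' c₃ o β β')
    (hs : ¬ Special c c' c₃ o α' β') {x : C} (hx : x ∉ α) (e : β = insert x α) :
    (x ≠ c ∧ x ≠ c' ∧ x ≠ c₃ ∧ x ∉ α' ∧ β' = insert x α') ∨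
      (x = c ∧ ¬ ThirdCond c₃ o α ∧ c' ∉ α' ∧ β' = insert c' α') ∨
      (x = c' ∧ ¬ ThirdCond c₃ o α ∧ c ∉ α' ∧ β' = insert c α') := by
  subst e
  obtain ⟨ha, ha'⟩ := hα
  obtain ⟨hb, hb'⟩ := hβ
  unfold ThirdCond Special at *
  simp only [Finset.mem_insert] at hb hb'
  have a3 := ha c₃ h₂.symm h₃.symm
  have b3 := hb c₃ h₂.symm h₃.symm
  by_cases hxc : x = c
  · subst hxc
    right; left
    refine ⟨rfl, by grind, by grind, ?_⟩
    ext w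
    by_cases w1 : w = x <;> by_cases w2 : w = c' <;> grind
  by_cases hxc' : x = c'
  · subst hxc'
    right; right
    refine ⟨rfl, by grind, by grind, ?_⟩
    ext w
    by_cases w1 : w = x <;> by_cases w2 : w = c <;> grind
  by_cases hxc3 : x = c₃
  · subst hxc3
    exfalso
    apply hs
    refine ⟨by grind, ?_⟩
    by_cases ho : o = true
    · rw [if_pos ho]
      refine ⟨by grind, by grind, ?_⟩
      ext w
      by_cases w1 : w = c <;> by_cases w2 : w = c' <;> grind
    · rw [if_neg ho]
      refine ⟨by grind, by grind, ?_⟩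
      ext w
      by_cases w1 : w = c <;> by_cases w2 : w = c' <;> grind
  · left
    refine ⟨hxc, hxc', hxc3, by grind, ?_⟩
    ext w
    by_cases w1 : w = c <;> by_cases w2 : w = c' <;> grind

/-- The end of a special pair at which no circle can occur has only `c'` of the two crossings, which
the correspondence turns into `c` alone; the other end has `c` alone and keeps it. So on the other
side just `c₃` changes. -/
theorem ThirdRel.special (h₁ : c ≠ c') (h₂ : c ≠ c₃) (h₃ : c' ≠ c₃) {α β α' β' : Finset C}
    (hα : ThirdRel c c' c₃ o α α') (hβ : ThirdRel c c' c₃ o β β')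
    (hs : Special c c' c₃ o α β) : c₃ ∉ α' ∧ β' = insert c₃ α' ∧ c ∈ α' ∧ c' ∉ α' ∧
      (ThirdCond c₃ o α ↔ ¬ o = true) ∧ (ThirdCond c₃ o β ↔ o = true) ∧
      (o = true → c ∉ α) ∧ (¬ o = true → c ∉ β) := by
  obtain ⟨ha, ha'⟩ := hα
  obtain ⟨hb, hb'⟩ := hβ
  obtain ⟨hs3, hs⟩ := hs
  unfold ThirdCond at *
  have a3 := ha c₃ h₂.symm h₃.symm
  have b3 := hb c₃ h₂.symm h₃.symm
  by_cases ho : o = true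
  · rw [if_pos ho] at hs
    obtain ⟨h4, h5, rfl⟩ := hs
    simp only [Finset.mem_insert, Finset.mem_erase] at hb hb' b3
    refine ⟨by grind, ?_, by grind, by grind, by grind, by grind, by grind, by grind⟩
    ext w
    by_cases w1 : w = c <;> by_cases w2 : w = c' <;> grind
  · rw [if_neg ho] at hs
    obtain ⟨h4, h5, rfl⟩ := hs
    simp only [Finset.mem_insert, Finset.mem_erase] at hb hb' b3
    refine ⟨by grind, ?_, by grind, by grind, by grind, by grind, by grind, by grind⟩
    ext w
    by_cases w1 : w = c <;> by_cases w2 : w = c' <;> grind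

theorem ThirdRel.not_special (h₁ : c ≠ c') (h₂ : c ≠ c₃) (h₃ : c' ≠ c₃) {α β α' β' : Finset C}
    (hα : ThirdRel c c' c₃ o α α') (hβ : ThirdRel c c' c₃ o β β')
    (hs : Special c c' c₃ o α β) : ¬ Special c c' c₃ o α' β' := by
  obtain ⟨-, e, h4, h5, -⟩ := hα.special h₁ h₂ h₃ hβ hs
  rintro ⟨-, h⟩
  split_ifs at h
  · exact h5 h.1
  · have h6 : c ∈ β' := by rw [e]; exact Finset.mem_insert_of_mem h4
    rw [h.2.2] at h6
    simp [h₂] at h6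

theorem ThirdRel.outerPart_eq {α α' : Finset C} (h : ThirdRel c c' c₃ o α α') :
    outerPart c c' c₃ α = outerPart c c' c₃ α' := by
  ext x
  simp only [outerPart, Finset.mem_filter]
  have := h.1 x
  tauto

/-- The signs in the comparison of the two sides of the third Reidemeister move. -/
noncomputable def thirdSign (c c' c₃ : C) (o : Bool) (α : Finset C) : ℚ :=
  -- Outside of `ThirdCond`, exchanging `c` and `c'` costs a sign if both are in the set. Inside,
  -- the sign is the ratio between a special arrow and the edge in direction `c₃` that corresponds
  -- to it.
  if ThirdCond c₃ o α then (if o = true then -1 else 1) else if c ∈ α ∧ c' ∈ α then -1 else 1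

theorem thirdSign_mul_self (α : Finset C) :
    thirdSign c c' c₃ o α * thirdSign c c' c₃ o α = 1 := by
  unfold thirdSign
  split_ifs <;> norm_num

theorem ThirdRel.sign_eq (h₂ : c ≠ c₃) (h₃ : c' ≠ c₃) {α α' : Finset C}
    (h : ThirdRel c c' c₃ o α α') : thirdSign c c' c₃ o α' = thirdSign c c' c₃ o α := by
  have h1 := h.cond h₂ h₃
  have h2 := h.2
  unfold thirdSign
  by_cases hQ : ThirdCond c₃ o α
  · rw [if_pos hQ, if_pos (h1.1 hQ)]
  · rw [if_neg hQ] at h2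
    rw [if_neg hQ, if_neg (fun h' => hQ (h1.2 h'))]
    refine if_congr ?_ rfl rfl
    tauto

omit [DecidableEq C] in
theorem ThirdRel.left_cond {α α' : Finset C} (h : ThirdRel c c' c₃ o α α')
    (hQ : ThirdCond c₃ o α) : c ∈ α ∧ c' ∉ α := by
  have := h.2
  rw [if_pos hQ] at this
  exact ⟨this.1, this.2.1⟩

variable [Fintype C] {K K' : Cube C}

/-- By assumption the entry on the second side is an entry of the original differential. On the
first side it corresponds either to a zigzag, and then to an edge in direction `c₃` here, or to an
ordinary edge. The saddle maps agree because the outer partitions do, so only signs are left to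
compare. -/
theorem restCoeff_third (V : K.View O R) (V' : K'.View O R)
    (hV : ∀ α, V.circ α ↔ ThirdCond c₃ o α ∧ c' ∈ α ∧ c ∉ α)
    (hV' : ∀ α, V'.circ α ↔ ThirdCond c₃ o α ∧ c' ∈ α ∧ c ∉ α)
    (h₁ : c ≠ c') (h₂ : c ≠ c₃) (h₃ : c' ≠ c₃)
    (hA : ∀ α β, ThirdRel c c' c₃ o α β → V.A α = V'.A β) {r : C → ℕ}
    (hr : ThirdRank c c' c₃ r) {k l : K.Gen} {k' l' : K'.Gen} (hk : ThirdRel c c' c₃ o k.1 k'.1)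
    (hl : ThirdRel c c' c₃ o l.1 l'.1) (huk : V.u k = V'.u k') (hul : V.u l = V'.u l')
    (hs : ¬ Special c c' c₃ o l'.1 k'.1) :
    restCoeff V' (FaceMatch c c' (ThirdCond c₃ o)) r k' l' =
      thirdSign c c' c₃ o k.1 * thirdSign c c' c₃ o l.1 *
        restCoeff V (FaceMatch c c' (ThirdCond c₃ o)) r k l := by
  have hkc := hk.left_cond
  have hlc := hl.left_cond
  have hkc' := (hk.symm h₂ h₃).left_cond
  have hlc' := (hl.symm h₂ h₃).left_cond
  have hnk : ¬ V.circ k.1 := by rw [hV]; tauto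
  have hnl : ¬ V.circ l.1 := by rw [hV]; tauto
  have hnk' : ¬ V'.circ k'.1 := by rw [hV']; tauto
  have hnl' : ¬ V'.circ l'.1 := by rw [hV']; tauto
  rw [restCoeff_of_not_special hV' h₁ h₂ h₃ r hkc' hlc' hs]
  have hos : outerSign c c' c₃ l.1 = outerSign c c' c₃ l'.1 := by
    rw [outerSign, outerSign, hl.outerPart_eq]
  by_cases hs' : Special c c' c₃ o l.1 k.1
  · rw [restCoeff_of_special hV h₁ h₂ h₃ r hkc hlc hr hs']
    obtain ⟨a1, a2, a3, a4, a5, a6, a7, a8⟩ := hl.special h₁ h₂ h₃ hk hs'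
    rw [V'.d_full r a1 a2 hnl' hnk', hr.sign_third h₁ h₂ h₃, if_pos a3, if_neg a4, hA _ _ hl,
      hA _ _ hk, huk, hul, hos]
    unfold thirdSign
    by_cases ho : o = true
    · have a9 : ¬ (c ∈ l.1 ∧ c' ∈ l.1) := fun h' => a7 ho h'.1
      rw [if_pos (a6.2 ho), if_neg (fun h' => a5.1 h' ho), if_neg a9, if_pos ho, if_pos ho]
      ring
    · have a9 : ¬ (c ∈ k.1 ∧ c' ∈ k.1) := fun h' => a8 ho h'.1
      rw [if_neg (fun h' => ho (a6.1 h')), if_pos (a5.2 ho), if_neg a9, if_neg ho, if_neg ho]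
      ring
  · rw [restCoeff_of_not_special hV h₁ h₂ h₃ r hkc hlc hs']
    by_cases hex : ∃ x, x ∉ l.1 ∧ k.1 = insert x l.1
    · obtain ⟨x, hx, e⟩ := hex
      rw [V.d_full r hx e hnl hnk]
      have hrel : ∀ w, w ∈ k.1 ↔ w = x ∨ w ∈ l.1 := fun w => by rw [e, Finset.mem_insert]
      have hl2 := hl.2
      rcases hl.edge h₁ h₂ h₃ hk hs hx e with ⟨b1, b2, b3, b4, b5⟩ | ⟨b1, b2, b3, b4⟩ |
        ⟨b1, b2, b3, b4⟩
      · rw [V'.d_full r b4 b5 hnl' hnk', hA _ _ hl, hA _ _ hk, huk, hul,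
          hr.sign_outer h₁ h₂ h₃ hl.outerPart_eq b1 b2 b3]
        have e1 : thirdSign c c' c₃ o k.1 = thirdSign c c' c₃ o l.1 := by
          unfold thirdSign ThirdCond
          rw [e]
          simp [Ne.symm b1, Ne.symm b2, Ne.symm b3]
        rw [e1, thirdSign_mul_self, one_mul]
      · rw [V'.d_full r b3 b4 hnl' hnk', hA _ _ hl, hA _ _ hk, huk, hul, b1,
          hr.sign_in h₁ h₂ h₃, hr.sign_out h₁ h₂ h₃, hos]
        have hQk : ¬ ThirdCond c₃ o k.1 := by
          unfold ThirdCond at b2 ⊢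
          rw [e, b1]
          simpa [h₂.symm] using b2
        unfold thirdSign
        rw [if_neg hQk, if_neg b2, e]
        rw [b1] at hx ⊢
        by_cases hc' : c' ∈ l.1
        · simp [hc', hx]
        · simp [hc', h₁.symm]
      · rw [V'.d_full r b3 b4 hnl' hnk', hA _ _ hl, hA _ _ hk, huk, hul, b1,
          hr.sign_in h₁ h₂ h₃, hr.sign_out h₁ h₂ h₃, hos]
        have hQk : ¬ ThirdCond c₃ o k.1 := by
          unfold ThirdCond at b2 ⊢
          rw [e, b1]
          simpa [h₃.symm] using b2
        rw [if_neg b2] at hl2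
        unfold thirdSign
        rw [if_neg hQk, if_neg b2, e]
        rw [b1] at hx ⊢
        by_cases hc : c ∈ l.1
        · have := hl2.1.1 hc
          simp [hc, hx, this]
        · have : c' ∉ l'.1 := fun h' => hc (hl2.1.2 h')
          simp [hc, h₁, this]
    · rw [K.d_eq_zero fun x hx e => hex ⟨x, hx, e⟩, mul_zero]
      refine K'.d_eq_zero fun x hx e => hex ?_
      rcases (hl.symm h₂ h₃).edge h₁ h₂ h₃ (hk.symm h₂ h₃) hs' hx e with ⟨-, -, -, b4, b5⟩ |
        ⟨-, -, b3, b4⟩ | ⟨-, -, b3, b4⟩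
      · exact ⟨_, b4, b5⟩
      · exact ⟨_, b3, b4⟩
      · exact ⟨_, b3, b4⟩

/-- The third Reidemeister move. -/
theorem reidemeister_three [Finite O] (V : K.View O R) (V' : K'.View O R)
    (h₁ : c ≠ c') (h₂ : c ≠ c₃) (h₃ : c' ≠ c₃)
    (hV : ∀ α, V.circ α ↔ ThirdCond c₃ o α ∧ c' ∈ α ∧ c ∉ α)
    (hV' : ∀ α, V'.circ α ↔ ThirdCond c₃ o α ∧ c' ∈ α ∧ c ∉ α)
    (hA : ∀ α β, ThirdRel c c' c₃ o α β → V.A α = V'.A β) (hhs : K.hs = K'.hs)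
    (hqs : K.qs = K'.qs) (r r' : C → ℕ) (hr : Function.Injective r) (hr' : Function.Injective r') :
    (K.complex r hr).HEquiv (K'.complex r' hr') := by
  obtain ⟨s, hs⟩ := exists_thirdRank (C := C) h₁ h₂ h₃
  have f : FaceCondition c c' (ThirdCond c₃ o) := faceCondition_third h₁ h₂ h₃
  have m := matching_face f hV
  have m' := matching_face f hV'
  have hR := rest_face f hV
  have hR' := rest_face f hV'
  have hcard : ∀ {α β : Finset C}, ThirdRel c c' c₃ o α β → β.card = α.card := by
    intro α β h
    have hf : ∀ γ : Finset C, (γ.card : ℤ) = (outerPart c c' c₃ γ).card + (if c ∈ γ then 1 else 0) +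
        (if c' ∈ γ then 1 else 0) + (if c₃ ∈ γ then 1 else 0) := by
      intro γ
      -- The elements are counted by comparing exponents of `2` in a product of constants.
      have := prod_eq_outerPart h₁ h₂ h₃ (fun _ => (2 : ℚ)) γ
      simp only [Finset.prod_const] at this
      have e1 : (2 : ℚ) ^ γ.card = 2 ^ ((outerPart c c' c₃ γ).card + (if c ∈ γ then 1 else 0) +
        (if c' ∈ γ then 1 else 0) + (if c₃ ∈ γ then 1 else 0)) := by
        rw [this, pow_add, pow_add, pow_add]
        congr 1
        · congr 1
          · congr 1
            split_ifs <;> simp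
          · split_ifs <;> simp
        · split_ifs <;> simp
      have := pow_right_injective₀ (by norm_num : (0 : ℚ) < 2) (by norm_num) e1
      rw [this]
      push_cast
      rfl
    have ha := hf α
    have hb := hf β
    rw [← h.outerPart_eq] at hb
    have h3 := h.1 c₃ h₂.symm h₃.symm
    have h4 := h.2
    split_ifs at h4
    · simp only [h3, h4.1, h4.2.1, h4.2.2.1, h4.2.2.2, if_true, if_false] at ha hb
      omega
    · simp only [h3, h4.1, h4.2] at ha hb
      omega
  let ρ : RestGen V (FaceMatch c c' (ThirdCond c₃ o)) →
      RestGen V' (FaceMatch c c' (ThirdCond c₃ o)) → Prop := fun g g' =>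
    ThirdRel c c' c₃ o g.1.1 g'.1.1 ∧ V.u g.1 = V'.u g'.1
  have hnc : ∀ g : RestGen V (FaceMatch c c' (ThirdCond c₃ o)), ¬ V.circ g.1.1 := fun g => by
    have := (hR g.1).1 g.2
    rw [hV]; tauto
  have hnc' : ∀ g : RestGen V' (FaceMatch c c' (ThirdCond c₃ o)), ¬ V'.circ g.1.1 := fun g => by
    have := (hR' g.1).1 g.2
    rw [hV']; tauto
  have r₁ : ∀ i, ∃ j, ρ i j := by
    rintro ⟨g, hg⟩
    obtain ⟨β, hβ⟩ := exists_thirdRel ((hR g).1 hg)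
    obtain ⟨g', e1, e2, -⟩ := V'.exists_gen β (V.u g)
      (fun p q hpq => V.u_resp g p q (by rwa [hA _ _ hβ])) false fun _ => rfl
    subst e1
    exact ⟨⟨g', (hR' g').2 (hβ.symm h₂ h₃).left_cond⟩, hβ, e2.symm⟩
  have r₂ : ∀ j, ∃ i, ρ i j := by
    rintro ⟨g, hg⟩
    obtain ⟨β, hβ⟩ := exists_thirdRel ((hR' g).1 hg)
    have hβ' := hβ.symm h₂ h₃
    obtain ⟨g', e1, e2, -⟩ := V.exists_gen β (V'.u g)
      (fun p q hpq => V'.u_resp g p q (by rwa [← hA _ _ hβ'])) false fun _ => rfl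
    subst e1
    exact ⟨⟨g', (hR g').2 hβ'.left_cond⟩, hβ', e2⟩
  have r₃ : ∀ i j j', ρ i j → ρ i j' → j = j' := by
    rintro i j j' ⟨a1, a2⟩ ⟨b1, b2⟩
    refine Subtype.ext (V'.gen_ext (a1.unique b1) (a2.symm.trans b2) ?_)
    rw [V'.v_of_not (hnc' j), V'.v_of_not (hnc' j')]
  have r₄ : ∀ i i' j, ρ i j → ρ i' j → i = i' := by
    rintro i j j' ⟨a1, a2⟩ ⟨b1, b2⟩
    refine Subtype.ext (V.gen_ext ((a1.symm h₂ h₃).unique (b1.symm h₂ h₃)) (a2.trans b2.symm) ?_)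
    rw [V.v_of_not (hnc i), V.v_of_not (hnc j)]
  have hdeg : ∀ i j, ρ i j → K'.deg j.1 = K.deg i.1 := by
    rintro i j ⟨a1, a2⟩
    rw [V.deg_eq, V'.deg_eq, if_neg (hnc i), if_neg (hnc' j), a2, hA _ _ a1, hcard a1, hhs, hqs]
  have hd : ∀ i i' j j', ρ i j → ρ i' j' →
      restCoeff V' (FaceMatch c c' (ThirdCond c₃ o)) s j.1 j'.1 =
        thirdSign c c' c₃ o i.1.1 * thirdSign c c' c₃ o i'.1.1 *
          restCoeff V (FaceMatch c c' (ThirdCond c₃ o)) s i.1 i'.1 := by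
    rintro i i' j j' ⟨a1, a2⟩ ⟨b1, b2⟩
    -- Corresponding pairs are never special on both sides, so if the pair is special on the second
    -- side, the comparison is applied in the opposite direction and solved for the entry.
    by_cases hsp : Special c c' c₃ o j'.1.1 j.1.1
    · have hsp' : ¬ Special c c' c₃ o i'.1.1 i.1.1 :=
        (b1.symm h₂ h₃).not_special h₁ h₂ h₃ (a1.symm h₂ h₃) hsp
      rw [restCoeff_third V' V hV' hV h₁ h₂ h₃
        (fun α β h => (hA _ _ (h.symm h₂ h₃)).symm) hs (a1.symm h₂ h₃) (b1.symm h₂ h₃) a2.symm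
        b2.symm hsp', a1.sign_eq h₂ h₃, b1.sign_eq h₂ h₃]
      have e1 := thirdSign_mul_self (c := c) (c' := c') (c₃ := c₃) (o := o) i.1.1
      have e2 := thirdSign_mul_self (c := c) (c' := c') (c₃ := c₃) (o := o) i'.1.1
      linear_combination (-(restCoeff V' (FaceMatch c c' (ThirdCond c₃ o)) s j.1 j'.1) *
        (thirdSign c c' c₃ o i'.1.1 * thirdSign c c' c₃ o i'.1.1)) * e1 -
        (restCoeff V' (FaceMatch c c' (ThirdCond c₃ o)) s j.1 j'.1) * e2
    · exact restCoeff_third V V' hV hV' h₁ h₂ h₃ hA hs a1 b1 a2 b2 hsp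
  obtain ⟨B, hB, eB, hB1, hB2⟩ := m.exists_rest s hs.inj
  obtain ⟨B', hB', eB', hB1', hB2'⟩ := m'.exists_rest s hs.inj
  refine (K.hEquiv_rank r s hr hs.inj).trans (hB.trans (FComplex.HEquiv.trans ?_
    (hB'.symm.trans (K'.hEquiv_rank s r' hs.inj hr'))))
  refine FComplex.HEquiv.of_signed_rel (fun i j => ρ (eB i) (eB' j)) (fun i => ?_) (fun j => ?_)
    (fun i j j' h h' => eB'.injective (r₃ _ _ _ h h'))
    (fun i i' j h h' => eB.injective (r₄ _ _ _ h h'))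
    (fun i => thirdSign c c' c₃ o (eB i).1.1) (fun i => thirdSign_mul_self _)
    (fun i j h => by rw [hB1, hB1']; exact hdeg _ _ h)
    fun i i' j j' h h' => by rw [hB2, hB2']; exact hd _ _ _ _ h h'
  · obtain ⟨j, hj⟩ := r₁ (eB i)
    exact ⟨eB'.symm j, by rwa [Equiv.apply_symm_apply]⟩
  · obtain ⟨i, hi⟩ := r₂ (eB' j)
    exact ⟨eB.symm i, by rwa [Equiv.apply_symm_apply]⟩

end Cube

end ReidemeisterThreeEquivalence

/-! ## Resolved pieces -/

/-- The pieces of a complete resolution: a minimum, a maximum, two vertical arcs, two horizontal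
arcs. -/
inductive RPiece where
  | cup
  | cap
  | vert
  | hor
deriving DecidableEq

namespace RPiece

/-- Number of strands that enter from below. -/
def inn : RPiece → ℕ
  | cup => 0
  | cap => 2
  | vert => 2
  | hor => 2

/-- Number of strands that leave at the top. -/
def out : RPiece → ℕ
  | cup => 2
  | cap => 0
  | vert => 2
  | hor => 2

/-- The other end of the arc that starts at a boundary point of a slice with a resolved piece at
position `i`. -/
def partner (i : ℕ) (e : RPiece) (x : Bool × ℕ) : Bool × ℕ :=
  if x.2 < i then (!x.1, x.2)
  else if i + (if x.1 then e.out else e.inn) ≤ x.2 then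
    (!x.1, if x.1 then x.2 - e.out + e.inn else x.2 - e.inn + e.out)
  else if e = vert then (!x.1, x.2)
  else (x.1, if x.2 = i then i + 1 else i)

variable (i : ℕ) (e : RPiece)

theorem partner_of_lt {x : Bool × ℕ} (h : x.2 < i) : partner i e x = (!x.1, x.2) := if_pos h

theorem partner_right (b : Bool) (t : ℕ) :
    partner i e (b, i + (if b then e.out else e.inn) + t) =
      (!b, i + (if b then e.inn else e.out) + t) := by
  cases b <;> simp [partner, Nat.add_assoc] <;> omega

theorem partner_vert {j : ℕ} (b : Bool) : partner i vert (b, j) = (!b, j) := by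
  cases b <;> simp only [partner, inn, out] <;> split_ifs <;> simp_all <;> omega

theorem partner_hor (b s : Bool) : partner i hor (b, i + s.toNat) = (b, i + (!s).toNat) := by
  cases b <;> cases s <;> simp [partner, inn, out]

theorem partner_cup (s : Bool) : partner i cup (true, i + s.toNat) = (true, i + (!s).toNat) := by
  cases s <;> simp [partner, out]

theorem partner_cap (s : Bool) : partner i cap (false, i + s.toNat) = (false, i + (!s).toNat) := by
  cases s <;> simp [partner, inn]

/-- The position of a boundary point with respect to the piece. -/
theorem cases_point (x : Bool × ℕ) : x.2 < i ∨
    (∃ b t, x = (b, i + (if b then e.out else e.inn) + t)) ∨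
    (∃ b s : Bool, x = (b, i + s.toNat) ∧ (e = hor ∨ e = vert ∨ (e = cup ∧ b = true) ∨
      (e = cap ∧ b = false))) := by
  obtain ⟨b, j⟩ := x
  by_cases h1 : j < i
  · exact Or.inl h1
  by_cases h2 : i + (if b then e.out else e.inn) ≤ j
  · obtain ⟨t, rfl⟩ := Nat.exists_eq_add_of_le h2
    exact Or.inr (Or.inl ⟨b, t, rfl⟩)
  · refine Or.inr (Or.inr ⟨b, decide (j = i + 1), ?_, ?_⟩)
    · have h3 : (if b then e.out else e.inn) ≤ 2 := by
        cases b <;> cases e <;> simp [inn, out]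
      have h4 : j = i ∨ j = i + 1 := by omega
      rcases h4 with rfl | rfl <;> simp
    · cases b <;> cases e <;> simp_all [inn, out]

theorem partner_partner (x : Bool × ℕ) : partner i e (partner i e x) = x := by
  rcases cases_point i e x with h | ⟨b, t, rfl⟩ | ⟨b, s, rfl, rfl | rfl | ⟨rfl, rfl⟩ | ⟨rfl, rfl⟩⟩
  · obtain ⟨b, j⟩ := x
    rw [partner_of_lt i e h, partner_of_lt i e (x := (!b, j)) h]
    simp
  · rw [partner_right]
    have := partner_right i e (!b) t
    cases b <;> simpa using this
  · rw [partner_hor, partner_hor, Bool.not_not]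
  · rw [partner_vert, partner_vert, Bool.not_not]
  · rw [partner_cup, partner_cup, Bool.not_not]
  · rw [partner_cap, partner_cap, Bool.not_not]

theorem partner_ne (x : Bool × ℕ) : partner i e x ≠ x := by
  rcases cases_point i e x with h | ⟨b, t, rfl⟩ | ⟨b, s, rfl, rfl | rfl | ⟨rfl, rfl⟩ | ⟨rfl, rfl⟩⟩
  · obtain ⟨b, j⟩ := x
    rw [partner_of_lt i e h]
    cases b <;> simp
  · rw [partner_right]
    cases b <;> simp
  · rw [partner_hor]
    cases s <;> simp
  · rw [partner_vert]
    cases b <;> simp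
  · rw [partner_cup]
    cases s <;> simp
  · rw [partner_cap]
    cases s <;> simp

/-- The point enters the slice, for the orientation in which the strand `j` goes up if `j + ε` is
even. -/
def Enters (ε : ℕ) (x : Bool × ℕ) : Prop := (x.1 = false ↔ Even (x.2 + ε))

instance (ε : ℕ) (x : Bool × ℕ) : Decidable (Enters ε x) :=
  inferInstanceAs (Decidable (x.1 = false ↔ Even (x.2 + ε)))

/-- An arc either turns back to a neighbouring strand, of opposite parity, or goes through and
changes its number by an even amount, as pieces have an even number of ends at the bottom and at the
top. So the alternating orientation is consistent along every arc. -/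
theorem enters_partner (ε : ℕ) (x : Bool × ℕ) : Enters ε (partner i e x) ↔ ¬ Enters ε x := by
  simp only [Enters, Nat.even_iff]
  rcases cases_point i e x with h | ⟨b, t, rfl⟩ | ⟨b, s, rfl, rfl | rfl | ⟨rfl, rfl⟩ | ⟨rfl, rfl⟩⟩
  · obtain ⟨b, j⟩ := x
    rw [partner_of_lt i e h]
    cases b <;> simp
  · rw [partner_right]
    cases b <;> cases e <;> simp [inn, out] <;> omega
  · rw [partner_hor]
    cases b <;> cases s <;> simp <;> omega
  · rw [partner_vert]
    cases b <;> simp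
  · rw [partner_cup]
    cases s <;> simp <;> omega
  · rw [partner_cap]
    cases s <;> simp <;> omega

/-- The points at the bottom and at the top of a slice on `n` strands. -/
def InSlice (n : ℕ) (x : Bool × ℕ) : Prop := x.2 < if x.1 then n - e.inn + e.out else n

theorem inSlice_partner {n : ℕ} (h : i + e.inn ≤ n) (x : Bool × ℕ) :
    InSlice e n (partner i e x) ↔ InSlice e n x := by
  simp only [InSlice]
  rcases cases_point i e x with h' | ⟨b, t, rfl⟩ | ⟨b, s, rfl, rfl | rfl | ⟨rfl, rfl⟩ | ⟨rfl, rfl⟩⟩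
  · obtain ⟨b, j⟩ := x
    rw [partner_of_lt i e h']
    cases b <;> simp at h' ⊢ <;> omega
  · rw [partner_right]
    cases b <;> simp <;> omega
  · rw [partner_hor]
    cases b <;> cases s <;> simp [inn, out] at h ⊢ <;> omega
  · rw [partner_vert]
    cases b <;> cases s <;> simp [inn, out] at h ⊢ <;> omega
  · rw [partner_cup]
    cases s <;> simp [inn, out] at h ⊢ <;> omega
  · rw [partner_cap]
    cases s <;> simp [inn] at h ⊢ <;> omega

end RPiece

/-- The resolution of a piece. -/
def PieceKind.res : PieceKind → Bool → RPiece
  | cup _, _ => .cup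
  | cap, _ => .cap
  | cross o, ρ => if ρ = o then .hor else .vert

theorem PieceKind.inn_res (k : PieceKind) (ρ : Bool) : (k.res ρ).inn = k.inn := by
  cases k <;> simp only [PieceKind.res] <;> (try split_ifs) <;> rfl

theorem PieceKind.out_res (k : PieceKind) (ρ : Bool) : (k.res ρ).out = k.out := by
  cases k <;> simp only [PieceKind.res] <;> (try split_ifs) <;> rfl

theorem Joins.partner_eq {i : ℕ} {k : PieceKind} {ρ : Bool} {x y : Bool × ℕ}
    (h : Joins i k ρ x y) : RPiece.partner i (k.res ρ) x = y := by
  cases h with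
  | left _ _ j hj => rw [RPiece.partner_of_lt _ _ hj]; rfl
  | right _ _ d =>
    have := RPiece.partner_right i (k.res ρ) false d
    simpa [PieceKind.inn_res, PieceKind.out_res] using this
  | cup a => simp [PieceKind.res, RPiece.partner, RPiece.out]
  | cap => simp [PieceKind.res, RPiece.partner, RPiece.inn]
  | vertical_left o => simp [PieceKind.res, RPiece.partner_vert]
  | vertical_right o => simp [PieceKind.res, RPiece.partner_vert]
  | horizontal_bottom => simp [PieceKind.res, RPiece.partner, RPiece.inn]
  | horizontal_top => simp [PieceKind.res, RPiece.partner, RPiece.out]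

/-- `Joins` lists each arc in one direction only; the involution `RPiece.partner` is its symmetric
form. -/
theorem joins_or_joins_iff {i : ℕ} {k : PieceKind} {ρ : Bool} {x y : Bool × ℕ} :
    (Joins i k ρ x y ∨ Joins i k ρ y x) ↔ RPiece.partner i (k.res ρ) x = y := by
  constructor
  · rintro (h | h)
    · exact h.partner_eq
    · rw [← h.partner_eq, RPiece.partner_partner]
  · rintro rfl
    obtain ⟨b, j⟩ := x
    by_cases h1 : j < i
    · rw [RPiece.partner_of_lt _ _ h1]
      cases b
      · exact Or.inl (Joins.left k ρ j h1)
      · exact Or.inr (Joins.left k ρ j h1)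
    by_cases h2 : i + (if b then (k.res ρ).out else (k.res ρ).inn) ≤ j
    · obtain ⟨t, rfl⟩ := Nat.exists_eq_add_of_le h2
      rw [RPiece.partner_right]
      have := Joins.right (i := i) k ρ t
      cases b <;> simp only [PieceKind.inn_res, PieceKind.out_res] <;> simp [this]
    · cases k with
      | cup a =>
        cases b
        · simp [PieceKind.res, RPiece.inn] at h2; omega
        · have := Joins.cup (i := i) a ρ
          have h3 : j = i ∨ j = i + 1 := by simp [PieceKind.res, RPiece.out] at h2; omega
          rcases h3 with rfl | rfl
          · left; simpa [PieceKind.res, RPiece.partner, RPiece.out] using this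
          · right; simpa [PieceKind.res, RPiece.partner, RPiece.out] using this
      | cap =>
        cases b
        · have := Joins.cap (i := i) ρ
          have h3 : j = i ∨ j = i + 1 := by simp [PieceKind.res, RPiece.inn] at h2; omega
          rcases h3 with rfl | rfl
          · left; simpa [PieceKind.res, RPiece.partner, RPiece.inn] using this
          · right; simpa [PieceKind.res, RPiece.partner, RPiece.inn] using this
        · simp [PieceKind.res, RPiece.out] at h2; omega
      | cross o =>
        have h3 : j = i ∨ j = i + 1 := by
          rw [PieceKind.inn_res, PieceKind.out_res] at h2
          simp [PieceKind.inn, PieceKind.out] at h2; omega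
        by_cases hρ : ρ = o
        · subst hρ
          have e1 := Joins.horizontal_bottom (i := i) ρ
          have e2 := Joins.horizontal_top (i := i) ρ
          cases b <;> rcases h3 with rfl | rfl
          · left; simpa [PieceKind.res, RPiece.partner, RPiece.inn] using e1
          · right; simpa [PieceKind.res, RPiece.partner, RPiece.inn] using e1
          · left; simpa [PieceKind.res, RPiece.partner, RPiece.out] using e2
          · right; simpa [PieceKind.res, RPiece.partner, RPiece.out] using e2
        · obtain rfl : ρ = !o := by cases ρ <;> cases o <;> simp_all
          have e1 := Joins.vertical_left (i := i) o
          have e2 := Joins.vertical_right (i := i) o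
          cases b <;> rcases h3 with rfl | rfl
          · left; simpa [PieceKind.res, RPiece.partner_vert] using e1
          · left; simpa [PieceKind.res, RPiece.partner_vert] using e2
          · right; simpa [PieceKind.res, RPiece.partner_vert] using e1
          · right; simpa [PieceKind.res, RPiece.partner_vert] using e2

/-! ## Cycles of a permutation and a transposition -/

section SameCycle

open Equiv.Perm

variable {X : Type} [Finite X] (σ : Equiv.Perm X) {a b : X}

theorem Equiv.Perm.SameCycle.of_forall {R : X → X → Prop} (hr : ∀ x, R x x)
    (ht : ∀ x y z, R x y → R y z → R x z) (h : ∀ x, R x (σ x)) {x y : X}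
    (hxy : SameCycle σ x y) : R x y := by
  obtain ⟨n, -, rfl⟩ := hxy.exists_pow_eq'
  induction n with
  | zero => exact hr _
  | succ n ih =>
    rw [pow_succ', mul_apply]
    exact ht _ _ _ (ih ⟨n, by simp⟩) (h _)

variable [DecidableEq X]

theorem merge_sameCycle (h : ¬ SameCycle σ a b) :
    Merge (SameCycle.setoid σ) (SameCycle.setoid (σ * Equiv.swap a b)) a b := by
  set τ := σ * Equiv.swap a b with hτ
  have ta : τ a = σ b := by simp [hτ]
  have tb : τ b = σ a := by simp [hτ]
  have tx : ∀ x, x ≠ a → x ≠ b → τ x = σ x := fun x h1 h2 => by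
    simp [hτ, Equiv.swap_apply_of_ne_of_ne h1 h2]
  have hs : ∀ (ρ : Equiv.Perm X) x, SameCycle ρ x (ρ x) := fun ρ x => ⟨1, by simp⟩
  -- From `a`, the new permutation jumps to `σ b` and follows the old cycle of `b`, which does not
  -- contain `a`; when this cycle closes up, `b` is reached.
  have hab : SameCycle τ a b := by
    by_contra hn
    have key : ∀ k : ℕ, SameCycle τ a ((σ ^ (k + 1)) b) := by
      intro k
      induction k with
      | zero => simpa [← ta] using hs τ a
      | succ k ih =>
        rw [pow_succ', mul_apply]
        rw [← tx]
        · exact ih.trans (hs _ _)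
        · intro h'
          apply h
          rw [← h']
          exact SameCycle.symm ⟨(k + 1 : ℕ), by rw [zpow_natCast]⟩
        · intro h'
          rw [h'] at ih
          exact hn ih
    have h1 := key (orderOf σ - 1)
    rw [Nat.sub_add_cancel (orderOf_pos σ), pow_orderOf_eq_one] at h1
    exact hn h1
  have hle : ∀ p q, SameCycle σ p q → SameCycle τ p q := fun p q hpq => by
    refine SameCycle.of_forall σ (R := SameCycle τ) (fun x => SameCycle.refl _ _)
      (fun _ _ _ h1 h2 => h1.trans h2) (fun x => ?_) hpq
    by_cases h1 : x = a
    · subst h1; rw [← tb]; exact hab.trans (hs _ _)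
    by_cases h2 : x = b
    · subst h2; rw [← ta]; exact hab.symm.trans (hs _ _)
    rw [← tx x h1 h2]; exact hs _ _
  refine ⟨h, fun p q => ⟨fun hpq => ?_, ?_⟩⟩
  · change SameCycle τ p q at hpq
    change SameCycle σ p q ∨ ((SameCycle σ p a ∨ SameCycle σ p b) ∧
      (SameCycle σ q a ∨ SameCycle σ q b))
    refine SameCycle.of_forall τ (R := fun p q => SameCycle σ p q ∨
      ((SameCycle σ p a ∨ SameCycle σ p b) ∧ (SameCycle σ q a ∨ SameCycle σ q b)))
      (fun x => Or.inl (SameCycle.refl _ _)) ?_ ?_ hpq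
    · rintro x y z (h1 | ⟨h1, h1'⟩) (h2 | ⟨h2, h2'⟩)
      · exact Or.inl (h1.trans h2)
      · exact Or.inr ⟨h2.imp h1.trans h1.trans, h2'⟩
      · exact Or.inr ⟨h1, h1'.imp h2.symm.trans h2.symm.trans⟩
      · exact Or.inr ⟨h1, h2'⟩
    · intro x
      by_cases h1 : x = a
      · subst h1; rw [ta]
        exact Or.inr ⟨Or.inl (SameCycle.refl _ _), Or.inr (hs _ _).symm⟩
      by_cases h2 : x = b
      · subst h2; rw [tb]
        exact Or.inr ⟨Or.inr (SameCycle.refl _ _), Or.inl (hs _ _).symm⟩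
      rw [tx x h1 h2]; exact Or.inl (hs _ _)
  · rintro (h1 | ⟨h1, h2⟩)
    · exact hle _ _ h1
    · have e1 : SameCycle τ p a := h1.elim (hle _ _) fun h => (hle _ _ h).trans hab.symm
      have e2 : SameCycle τ q a := h2.elim (hle _ _) fun h => (hle _ _ h).trans hab.symm
      exact e1.trans e2.symm

/-- Let `σ ^ m` be the first positive power that takes `a` to `b`. The new orbit of `b` runs through
`σ a, …, σ ^ m a = b` and returns to `σ a`, so it never meets `a`. -/
theorem not_sameCycle_mul_swap (hab : a ≠ b) (h : SameCycle σ a b) :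
    ¬ SameCycle (σ * Equiv.swap a b) a b := by
  have hex : ∃ m : ℕ, (σ ^ m) a = b := by
    obtain ⟨m, -, hm⟩ := h.exists_pow_eq'
    exact ⟨m, hm⟩
  obtain ⟨m, hm, hmin⟩ : ∃ m : ℕ, (σ ^ m) a = b ∧ ∀ k < m, (σ ^ k) a ≠ b := by
    classical
    exact ⟨Nat.find hex, Nat.find_spec hex, fun k hk => Nat.find_min hex hk⟩
  have hm0 : m ≠ 0 := fun h0 => hab (by rw [h0] at hm; simpa using hm)
  have hna : ∀ k, 0 < k → k ≤ m → (σ ^ k) a ≠ a := fun k h0 h1 hk => by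
    refine hmin (m - k) (by omega) ?_
    rw [← hm]
    conv_rhs => rw [← Nat.sub_add_cancel h1, pow_add, mul_apply, hk]
  intro hs
  obtain ⟨n, hn⟩ : ∃ n : ℕ, ((σ * Equiv.swap a b) ^ n) b = a := by
    obtain ⟨n, -, hn⟩ := hs.symm.exists_pow_eq'
    exact ⟨n, hn⟩
  have key : ∀ n : ℕ, ∃ k, 0 < k ∧ k ≤ m ∧ ((σ * Equiv.swap a b) ^ n) b = (σ ^ k) a := by
    intro n
    induction n with
    | zero => exact ⟨m, by omega, le_rfl, by simp [hm]⟩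
    | succ n ih =>
      obtain ⟨k, h0, h1, hk⟩ := ih
      rw [pow_succ', mul_apply, hk]
      rcases eq_or_lt_of_le h1 with h1 | h1
      · exact ⟨1, by omega, by omega, by rw [h1, hm]; simp⟩
      · refine ⟨k + 1, by omega, by omega, ?_⟩
        rw [mul_apply, Equiv.swap_apply_of_ne_of_ne (hna k h0 h1.le) (hmin k h1), pow_succ',
          mul_apply]
  obtain ⟨k, h0, h1, hk⟩ := key n
  exact hna k h0 h1 (hk.symm.trans hn)

/-- Composition with a transposition merges two cycles or splits one. -/
theorem saddle_sameCycle (hab : a ≠ b) :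
    Saddle (SameCycle.setoid σ) (SameCycle.setoid (σ * Equiv.swap a b)) a b := by
  by_cases h : SameCycle σ a b
  · have := merge_sameCycle (σ * Equiv.swap a b) (not_sameCycle_mul_swap σ hab h)
    rw [mul_assoc, Equiv.swap_mul_self, mul_one] at this
    exact Or.inr this
  · exact Or.inl (merge_sameCycle σ h)

end SameCycle

/-! ## Words of resolved pieces -/

/-- A stack of resolved pieces with their positions. -/
abbrev RWord : Type := List (ℕ × RPiece)

namespace RWord

open RPiece

variable (w : RWord)

/-- Two points of the stack, given by height and number, are the ends of an arc of a slice. -/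
def Link (x y : ℕ × ℕ) : Prop :=
  ∃ (m : ℕ) (b c : Bool) (s : ℕ × RPiece), w[m]? = some s ∧ x.1 = m + b.toNat ∧
    y.1 = m + c.toNat ∧ s.2.partner s.1 (b, x.2) = (c, y.2)

/-- Arcs of the slices, and gluing of the top to the bottom. -/
def GLink (x y : ℕ × ℕ) : Prop := w.Link x y ∨ (x.1 = w.length ∧ y = (0, x.2))

/-- Connectivity in the closed stack. -/
def Conn : Setoid (ℕ × ℕ) := Relation.EqvGen.setoid w.GLink

variable {w}

theorem Link.symm {x y : ℕ × ℕ} (h : w.Link x y) : w.Link y x := by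
  obtain ⟨m, b, b', s, hs, hx, hy, h⟩ := h
  exact ⟨m, b', b, s, hs, hy, hx, by rw [← h, partner_partner]⟩

theorem GLink.conn {x y : ℕ × ℕ} (h : w.GLink x y) : w.Conn x y := Relation.EqvGen.rel _ _ h

theorem Link.conn {x y : ℕ × ℕ} (h : w.Link x y) : w.Conn x y := GLink.conn (Or.inl h)

theorem conn_glue (j : ℕ) : w.Conn (w.length, j) (0, j) := GLink.conn (Or.inr ⟨rfl, rfl⟩)

variable (w)

/-- The end of the arc that starts at a point of a slice. -/
def across (m : ℕ) (s : ℕ × RPiece) (x : Bool × ℕ) : ℕ × ℕ :=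
  (m + (s.2.partner s.1 x).1.toNat, (s.2.partner s.1 x).2)

/-- The next point on the curve, for the orientation in which the strand `j` goes up if `j + ε` is
even. -/
def nxt (ε : ℕ) (x : ℕ × ℕ) : ℕ × ℕ :=
  if Even (x.2 + ε) then
    match w[x.1]? with
    | some s => across x.1 s (false, x.2)
    | none => (0, x.2)
  else if x.1 = 0 then (w.length, x.2)
  else
    match w[x.1 - 1]? with
    | some s => across (x.1 - 1) s (true, x.2)
    | none => x

variable {w} {ε : ℕ}

theorem nxt_of_slice {m j : ℕ} {b : Bool} {s : ℕ × RPiece} (hs : w[m]? = some s)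
    (h : Enters ε (b, j)) : w.nxt ε (m + b.toNat, j) = across m s (b, j) := by
  cases b
  · have : Even (j + ε) := h.1 rfl
    simp [nxt, this, hs]
  · have : ¬ Even (j + ε) := fun h' => by simpa using h.2 h'
    simp only [nxt, this]
    simp [hs]

theorem nxt_top {j : ℕ} (h : Even (j + ε)) : w.nxt ε (w.length, j) = (0, j) := by
  simp [nxt, h]

theorem nxt_zero {j : ℕ} (h : ¬ Even (j + ε)) : w.nxt ε (0, j) = (w.length, j) := by
  simp [nxt, h]

theorem cases_nxt (ε : ℕ) {x : ℕ × ℕ} (hx : x.1 ≤ w.length) :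
    (∃ m b s, w[m]? = some s ∧ x = (m + b.toNat, x.2) ∧ Enters ε (b, x.2)) ∨
    (x = (w.length, x.2) ∧ Even (x.2 + ε)) ∨ (x = (0, x.2) ∧ ¬ Even (x.2 + ε)) := by
  obtain ⟨k, j⟩ := x
  by_cases h : Even (j + ε)
  · rcases Nat.lt_or_ge k w.length with hk | hk
    · exact Or.inl ⟨k, false, w[k], by simp [hk], by simp, by simp [Enters, h]⟩
    · exact Or.inr (Or.inl ⟨by simp at hx ⊢; omega, h⟩)
  · rcases k with - | k
    · exact Or.inr (Or.inr ⟨rfl, h⟩)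
    · exact Or.inl ⟨k, true, w[k]'(by simp at hx; omega), by simp, by simp, by simp [Enters, h]⟩

theorem enters_succ (x : Bool × ℕ) : Enters (ε + 1) x ↔ ¬ Enters ε x := by
  simp only [Enters, ← Nat.add_assoc, Nat.even_add_one]
  tauto

theorem link_across {m : ℕ} {s : ℕ × RPiece} (hs : w[m]? = some s) (b : Bool) (j : ℕ) :
    w.Link (m + b.toNat, j) (across m s (b, j)) :=
  ⟨m, b, _, s, hs, rfl, rfl, rfl⟩

theorem conn_nxt {x : ℕ × ℕ} (hx : x.1 ≤ w.length) : w.Conn x (w.nxt ε x) := by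
  rcases cases_nxt ε hx with ⟨m, b, s, hs, h, he⟩ | ⟨h, he⟩ | ⟨h, he⟩
  · rw [h, nxt_of_slice hs he]; exact (link_across hs b _).conn
  · rw [h, nxt_top he]; exact conn_glue _
  · rw [h, nxt_zero he]; exact w.Conn.symm (conn_glue _)

/-- Adding one to `ε` reverses the orientation of all strands, so the next point for `ε + 1` is the
previous point for `ε`. -/
theorem nxt_nxt {x : ℕ × ℕ} (hx : x.1 ≤ w.length) : w.nxt (ε + 1) (w.nxt ε x) = x := by
  rcases cases_nxt ε hx with ⟨m, b, s, hs, h, he⟩ | ⟨h, he⟩ | ⟨h, he⟩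
  · rw [h, nxt_of_slice hs he, across, nxt_of_slice hs, across, Prod.mk.eta, partner_partner]
    rw [enters_succ, Prod.mk.eta, enters_partner]
    exact not_not.2 he
  · rw [h, nxt_top he, nxt_zero]
    rwa [← Nat.add_assoc, Nat.even_add_one, not_not]
  · rw [h, nxt_zero he, nxt_top]
    rwa [← Nat.add_assoc, Nat.even_add_one]

theorem nxt_nxt' {x : ℕ × ℕ} (hx : x.1 ≤ w.length) : w.nxt ε (w.nxt (ε + 1) x) = x := by
  have h : ∀ y, w.nxt ε y = w.nxt (ε + 1 + 1) y := fun y => by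
    simp only [nxt, ← Nat.add_assoc, Nat.even_add_one, not_not]
  rw [h, nxt_nxt hx]

theorem GLink.nxt_eq (ε : ℕ) {x y : ℕ × ℕ} (h : w.GLink x y) : w.nxt ε x = y ∨ w.nxt ε y = x := by
  rcases h with ⟨m, b, b', s, hs, hx, hy, h⟩ | ⟨hx, rfl⟩
  · obtain ⟨k, j⟩ := x
    obtain ⟨k', j'⟩ := y
    simp only at hx hy h
    subst hx hy
    by_cases he : Enters ε (b, j)
    · left; rw [nxt_of_slice hs he, across, h]
    · right
      rw [nxt_of_slice hs, across, ← h, partner_partner]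
      rw [← h, enters_partner]; exact he
  · obtain ⟨k, j⟩ := x
    simp only at hx
    subst hx
    by_cases he : Even (j + ε)
    · left; exact nxt_top he
    · right; exact nxt_zero he

/-- A set of points that is closed under `nxt`. -/
structure Closed (V : ℕ × ℕ → Prop) : Prop where
  le : ∀ x, V x → x.1 ≤ w.length
  iff : ∀ x y, w.GLink x y → (V x ↔ V y)

theorem Closed.nxt {V : ℕ × ℕ → Prop} (hV : w.Closed V) (ε : ℕ) {x : ℕ × ℕ} (hx : V x) :
    V (w.nxt ε x) := by
  rcases cases_nxt ε (hV.le x hx) with ⟨m, b, s, hs, h, he⟩ | ⟨h, he⟩ | ⟨h, he⟩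
  · rw [h] at hx ⊢
    rw [nxt_of_slice hs he]
    exact (hV.iff _ _ (Or.inl (link_across hs b _))).1 hx
  · rw [h] at hx ⊢
    rw [nxt_top he]
    exact (hV.iff (w.length, x.2) _ (Or.inr ⟨rfl, rfl⟩)).1 hx
  · rw [h] at hx ⊢
    rw [nxt_zero he]
    exact (hV.iff _ _ (Or.inr ⟨rfl, rfl⟩)).2 hx

/-- The permutation of the points of a closed stack that moves every point to the next one. -/
def nxtPerm {V : ℕ × ℕ → Prop} (hV : w.Closed V) (ε : ℕ) : Equiv.Perm {x // V x} where
  toFun x := ⟨w.nxt ε x, hV.nxt ε x.2⟩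
  invFun x := ⟨w.nxt (ε + 1) x, hV.nxt (ε + 1) x.2⟩
  left_inv x := Subtype.ext (nxt_nxt (hV.le _ x.2))
  right_inv x := Subtype.ext (nxt_nxt' (hV.le _ x.2))

/-- Every arc and every gluing is a single step of the permutation, forward or backward, so its
cycles are the curves. For the converse, membership in `V` has to be carried along a chain that runs
through all pairs of numbers. -/
theorem sameCycle_nxtPerm {V : ℕ × ℕ → Prop} (hV : w.Closed V) [Finite {x // V x}] (ε : ℕ)
    (x y : {x // V x}) : (nxtPerm hV ε).SameCycle x y ↔ w.Conn x y := by
  constructor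
  · intro h
    refine Equiv.Perm.SameCycle.of_forall _ (R := fun x y : {x // V x} => w.Conn x y)
      (fun x => w.Conn.refl _) (fun _ _ _ => w.Conn.trans) (fun x => ?_) h
    exact conn_nxt (hV.le _ x.2)
  · obtain ⟨x, hx⟩ := x
    obtain ⟨y, hy⟩ := y
    intro h
    have hs : ∀ x, (nxtPerm hV ε).SameCycle x (nxtPerm hV ε x) := fun x => ⟨1, by simp⟩
    have key : ∀ x y, w.Conn x y → (V x ↔ V y) ∧
        ∀ hx hy, (nxtPerm hV ε).SameCycle ⟨x, hx⟩ ⟨y, hy⟩ := by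
      intro x y h
      induction h with
      | rel x y h =>
        refine ⟨hV.iff x y h, fun hx hy => ?_⟩
        rcases h.nxt_eq ε with h' | h'
        · have : nxtPerm hV ε ⟨x, hx⟩ = ⟨y, hy⟩ := Subtype.ext h'
          rw [← this]; exact hs _
        · have : nxtPerm hV ε ⟨y, hy⟩ = ⟨x, hx⟩ := Subtype.ext h'
          rw [← this]; exact (hs _).symm
      | refl x => exact ⟨Iff.rfl, fun _ _ => Equiv.Perm.SameCycle.refl _ _⟩
      | symm x y _ ih => exact ⟨ih.1.symm, fun hx hy => (ih.2 hy hx).symm⟩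
      | trans x y z _ _ ih1 ih2 =>
        exact ⟨ih1.1.trans ih2.1, fun hx hz =>
          (ih1.2 hx (ih1.1.1 hx)).trans (ih2.2 (ih1.1.1 hx) hz)⟩
    exact (key x y h).2 hx hy

/-- Two stacks that differ by the resolution of one crossing. -/
theorem saddle_conn {w' : RWord} {V : ℕ × ℕ → Prop} (hV : w.Closed V) (hV' : w'.Closed V)
    [Finite {x // V x}] {m i : ℕ} (hlen : w'.length = w.length) (hne : ∀ k, k ≠ m → w'[k]? = w[k]?)
    {e e' : RPiece} (hm : w[m]? = some (i, e)) (hm' : w'[m]? = some (i, e'))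
    (hee : (e = vert ∧ e' = hor) ∨ (e = hor ∧ e' = vert)) (h1 : V (m, i)) (h2 : V (m + 1, i + 1)) :
    Saddle (w.Conn.comap (Subtype.val : {x // V x} → _)) (w'.Conn.comap Subtype.val)
      ⟨(m, i), h1⟩ ⟨(m + 1, i + 1), h2⟩ := by
  classical
  -- For `ε = i` two opposite corners of the crossing, the lower left and the upper right one, enter
  -- it. Both resolutions lead from them to the other two corners, in the two possible ways, so the
  -- permutations differ by a transposition.
  have hσ : nxtPerm hV' i = nxtPerm hV i *
      Equiv.swap (⟨(m, i), h1⟩ : {x // V x}) ⟨(m + 1, i + 1), h2⟩ := by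
    have hp : ∀ x : {x // V x}, x ≠ ⟨(m, i), h1⟩ → x ≠ ⟨(m + 1, i + 1), h2⟩ →
        w'.nxt i x = w.nxt i x := by
      rintro ⟨x, hx⟩ n1 n2
      simp only [ne_eq, Subtype.mk.injEq] at n1 n2 ⊢
      rcases cases_nxt i (hV.le x hx) with ⟨k, b, s, hs, h, he⟩ | ⟨h, he⟩ | ⟨h, he⟩
      · by_cases hk : k = m
        · subst hk
          obtain rfl := Option.some.inj (hm.symm.trans hs)
          rw [h, nxt_of_slice hm' he, nxt_of_slice hm he]
          have hpe : partner i e' (b, x.2) = partner i e (b, x.2) := by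
            rcases cases_point i e (b, x.2) with h' | ⟨b', t, h'⟩ | ⟨b', s', h', -⟩
            · rw [partner_of_lt _ _ h', partner_of_lt _ _ h']
            · have hd : ∀ q : Bool, (if q then e.out else e.inn) = 2 ∧
                  (if q then e'.out else e'.inn) = 2 := by
                rcases hee with ⟨rfl, rfl⟩ | ⟨rfl, rfl⟩ <;> intro q <;> cases q <;> decide
              have e1 := partner_right i e b' t
              have e2 := partner_right i e' b' t
              have hd' : ∀ q : Bool, (if q then e.inn else e.out) = 2 ∧
                  (if q then e'.inn else e'.out) = 2 := by
                rcases hee with ⟨rfl, rfl⟩ | ⟨rfl, rfl⟩ <;> intro q <;> cases q <;> decide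
              rw [(hd _).1, (hd' _).1] at e1
              rw [(hd _).2, (hd' _).2] at e2
              rw [h', (hd _).1, e1, e2]
            -- The only corners that enter the crossing are the two that have been excluded.
            · exfalso
              obtain ⟨k', j⟩ := x
              simp only [Prod.mk.injEq] at h' h n1 n2
              obtain ⟨rfl, rfl⟩ := h'
              obtain ⟨rfl, -⟩ := h
              simp only [Enters, Nat.even_iff] at he
              cases b <;> cases s' <;> simp at he n1 n2 <;> omega
          rw [across, across]
          simp only
          rw [hpe]
        · rw [h, nxt_of_slice hs he, nxt_of_slice (by rw [hne k hk, hs]) he]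
      · rw [h]
        have := nxt_top (w := w') he
        rw [hlen] at this
        rw [this, nxt_top he]
      · rw [h, nxt_zero he, nxt_zero he, hlen]
    have en1 : Enters i (false, i) := by simp [Enters]
    have en2 : Enters i (true, i + 1) := by
      simp only [Enters, Nat.even_iff]; simp; omega
    have f1 := nxt_of_slice hm en1
    have f2 := nxt_of_slice hm en2
    have f1' := nxt_of_slice hm' en1
    have f2' := nxt_of_slice hm' en2
    simp only [Bool.toNat_false, Bool.toNat_true, Nat.add_zero] at f1 f2 f1' f2'
    have p1 := partner_hor i false false
    have p2 := partner_hor i true true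
    simp only [Bool.toNat_false, Bool.toNat_true, Nat.add_zero, Bool.not_false,
      Bool.not_true] at p1 p2
    ext x : 2
    by_cases n1 : x = ⟨(m, i), h1⟩
    · subst n1
      rw [Equiv.Perm.mul_apply, Equiv.swap_apply_left]
      change w'.nxt i (m, i) = w.nxt i (m + 1, i + 1)
      rw [f2, f1']
      rcases hee with ⟨rfl, rfl⟩ | ⟨rfl, rfl⟩ <;> simp only [across, partner_vert, p1, p2] <;> rfl
    by_cases n2 : x = ⟨(m + 1, i + 1), h2⟩
    · subst n2
      rw [Equiv.Perm.mul_apply, Equiv.swap_apply_right]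
      change w'.nxt i (m + 1, i + 1) = w.nxt i (m, i)
      rw [f1, f2']
      rcases hee with ⟨rfl, rfl⟩ | ⟨rfl, rfl⟩ <;> simp only [across, partner_vert, p1, p2] <;> rfl
    rw [Equiv.Perm.mul_apply, Equiv.swap_apply_of_ne_of_ne n1 n2]
    exact hp x n1 n2
  have h := saddle_sameCycle (nxtPerm hV i) (a := ⟨(m, i), h1⟩) (b := ⟨(m + 1, i + 1), h2⟩)
    (by simp)
  rw [← hσ] at h
  have e1 : Equiv.Perm.SameCycle.setoid (nxtPerm hV i) = w.Conn.comap Subtype.val := by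
    ext x y; exact sameCycle_nxtPerm hV i x y
  have e2 : Equiv.Perm.SameCycle.setoid (nxtPerm hV' i) = w'.Conn.comap Subtype.val := by
    ext x y; exact sameCycle_nxtPerm hV' i x y
  rwa [e1, e2] at h

end RWord

/-! ## The cube of a diagram -/

theorem Slice.Admissible.le {e : Slice} {s : List Bool} (h : e.Admissible s) :
    e.pos + e.kind.inn ≤ s.length := by
  unfold Slice.Admissible at h
  cases hk : e.kind <;> simp only [hk, PieceKind.inn] at h ⊢
  · omega
  · obtain ⟨a, -, h⟩ := h
    have := (List.getElem?_eq_some_iff.1 h).1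
    omega
  · omega

theorem Slice.Admissible.length_next {e : Slice} {s : List Bool} (h : e.Admissible s) :
    (e.next s).length = s.length - e.kind.inn + e.kind.out := by
  have h := h.le
  obtain ⟨i, k⟩ := e
  cases k <;> simp [Slice.next, PieceKind.inn, PieceKind.out] at h ⊢ <;> omega

namespace AnnularDiagram

open scoped Classical

variable (D : AnnularDiagram)

theorem level_succ {k : ℕ} (hk : k < D.word.length) :
    D.level (k + 1) = D.word[k].next (D.level k) := by
  unfold level runSlices
  rw [List.take_add_one, List.foldl_append, List.getElem?_eq_getElem hk]
  rfl

theorem admissible_level {k : ℕ} (hk : k < D.word.length) :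
    D.word[k].Admissible (D.level k) := D.admissible k hk

theorem level_length : D.level D.word.length = D.level 0 := by
  have := D.closed
  simpa [level, runSlices] using this

/-- The points of a diagram, given by height and number. -/
def Valid (x : ℕ × ℕ) : Prop := x.1 ≤ D.word.length ∧ x.2 < (D.level x.1).length

/-- The resolution that a set of crossings prescribes for a slice. -/
noncomputable def res (α : Finset D.Crossing) (k : ℕ) : Bool :=
  decide (∃ c ∈ α, (c.1 : ℕ) = k)

/-- The complete resolution of a diagram. -/
noncomputable def rword (α : Finset D.Crossing) : RWord :=
  D.word.mapIdx fun k s => (s.pos, s.kind.res (D.res α k))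

@[simp] theorem length_rword (α : Finset D.Crossing) : (D.rword α).length = D.word.length := by
  simp [rword]

theorem getElem?_rword (α : Finset D.Crossing) (k : ℕ) : (D.rword α)[k]? =
    (D.word[k]?).map fun s => (s.pos, s.kind.res (D.res α k)) := by
  simp [rword]

theorem valid_iff_inSlice {k : ℕ} (hk : k < D.word.length) (ρ b : Bool) (j : ℕ) :
    D.Valid (k + b.toNat, j) ↔
      RPiece.InSlice (D.word[k].kind.res ρ) (D.level k).length (b, j) := by
  have h := (D.admissible_level hk).length_next
  cases b
  · simp [Valid, RPiece.InSlice, hk.le]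
  · simp only [Valid, RPiece.InSlice, Bool.toNat_true, D.level_succ hk, h, if_true,
      PieceKind.inn_res, PieceKind.out_res]
    simp only [and_iff_right_iff_imp]
    omega

theorem closed_valid (α : Finset D.Crossing) : (D.rword α).Closed D.Valid where
  le x hx := by rw [length_rword]; exact hx.1
  iff := by
    rintro ⟨k, j⟩ ⟨k', j'⟩ (⟨m, b, b', s, hs, hx, hy, h⟩ | ⟨hx, hy⟩)
    · simp only at hx hy h
      subst hx hy
      rw [getElem?_rword] at hs
      have hm : m < D.word.length := by
        by_contra hm
        simp [List.getElem?_eq_none (not_lt.1 hm)] at hs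
      simp only [List.getElem?_eq_getElem hm, Option.map_some, Option.some.injEq] at hs
      subst hs
      rw [D.valid_iff_inSlice hm (D.res α m), D.valid_iff_inSlice hm (D.res α m), ← h,
        RPiece.inSlice_partner]
      rw [PieceKind.inn_res]
      exact (D.admissible_level hm).le
    · simp only [length_rword, Prod.mk.injEq] at hx hy
      obtain ⟨rfl, rfl⟩ := hy
      subst hx
      simp [Valid, D.level_length]

/-- The points of a diagram as a subset of the plane. -/
def ptEquiv : D.Point ≃ {x // D.Valid x} where
  toFun p := ⟨(p.1, p.2), by have := p.1.2; omega, p.2.2⟩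
  invFun x := ⟨⟨x.1.1, by have := x.2.1; omega⟩, ⟨x.1.2, x.2.2⟩⟩
  left_inv _ := rfl
  right_inv _ := rfl

instance : Finite {x // D.Valid x} := Finite.of_equiv _ D.ptEquiv

theorem glink_of_adj {α : Finset D.Crossing} {p q : D.Point} (h : D.Adj α p q) :
    (D.rword α).GLink (D.ptEquiv p).1 (D.ptEquiv q).1 := by
  rcases h with ⟨k, b, b', hp, hq, h⟩ | ⟨h1, h2, h3⟩
  · refine Or.inl ⟨k, b, b', (D.word[k].pos, D.word[k].kind.res (D.res α k)), ?_, hp, hq, ?_⟩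
    · rw [getElem?_rword]
      simp
    · have e : decide (∃ c ∈ α, c.1 = k) = D.res α k := by
        simp only [res, Fin.ext_iff]
      rw [e] at h
      exact h.partner_eq
  · refine Or.inr ⟨?_, ?_⟩
    · rw [length_rword]; exact h1
    · exact Prod.ext h2 h3.symm

theorem adj_of_glink {α : Finset D.Crossing} {p q : D.Point}
    (h : (D.rword α).GLink (D.ptEquiv p).1 (D.ptEquiv q).1) : D.Adj α p q ∨ D.Adj α q p := by
  rcases h with ⟨m, b, b', s, hs, hp, hq, h⟩ | ⟨h1, h2⟩
  · rw [getElem?_rword] at hs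
    have hm : m < D.word.length := by
      by_contra hm
      simp [List.getElem?_eq_none (not_lt.1 hm)] at hs
    simp only [List.getElem?_eq_getElem hm, Option.map_some, Option.some.injEq] at hs
    subst hs
    have e : D.res α m = decide (∃ c ∈ α, c.1 = (⟨m, hm⟩ : Fin D.word.length)) := by
      simp only [res, Fin.ext_iff]
    simp only [e] at h
    rcases joins_or_joins_iff.2 h with h | h
    · exact Or.inl (Or.inl ⟨⟨m, hm⟩, b, b', hp, hq, h⟩)
    · exact Or.inr (Or.inl ⟨⟨m, hm⟩, b', b, hq, hp, h⟩)
  · rw [length_rword] at h1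
    have e1 := congrArg Prod.fst h2
    have e2 := congrArg Prod.snd h2
    exact Or.inl (Or.inr ⟨h1, e1, e2.symm⟩)

/-- `Conn` lives on all pairs of numbers, so going back from a chain of links to the points of the
diagram requires that validity is preserved by each link. -/
theorem cycleOf_eq_iff (α : Finset D.Crossing) (p q : D.Point) :
    D.cycleOf α p = D.cycleOf α q ↔ (D.rword α).Conn (D.ptEquiv p) (D.ptEquiv q) := by
  constructor
  · intro h
    have h' := Quot.eqvGen_exact h
    clear h
    induction h' with
    | rel p q h => exact (D.glink_of_adj h).conn
    | refl p => exact Setoid.refl' _ _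
    | symm p q _ ih => exact Setoid.symm' _ ih
    | trans p q r _ _ ih1 ih2 => exact Setoid.trans' _ ih1 ih2
  · intro h
    have key : ∀ x y, (D.rword α).Conn x y → (D.Valid x ↔ D.Valid y) ∧
        ∀ hx hy, D.cycleOf α (D.ptEquiv.symm ⟨x, hx⟩) = D.cycleOf α (D.ptEquiv.symm ⟨y, hy⟩) := by
      intro x y h
      induction h with
      | rel x y h =>
        refine ⟨(D.closed_valid α).iff x y h, fun hx hy => ?_⟩
        rcases D.adj_of_glink (p := D.ptEquiv.symm ⟨x, hx⟩) (q := D.ptEquiv.symm ⟨y, hy⟩) h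
          with h | h
        · exact Quot.sound h
        · exact (Quot.sound h).symm
      | refl x => exact ⟨Iff.rfl, fun _ _ => rfl⟩
      | symm x y _ ih => exact ⟨ih.1.symm, fun hx hy => (ih.2 hy hx).symm⟩
      | trans x y z _ _ ih1 ih2 =>
        exact ⟨ih1.1.trans ih2.1, fun hx hz =>
          (ih1.2 hx (ih1.1.1 hx)).trans (ih2.2 (ih1.1.1 hx) hz)⟩
    exact (key _ _ h).2 (D.ptEquiv p).2 (D.ptEquiv q).2

theorem res_insert (α : Finset D.Crossing) (c : D.Crossing) (k : ℕ) :
    D.res (insert c α) k = if k = c.1 then true else D.res α k := by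
  unfold res
  split_ifs with h
  · simp [h]
  · have : (c.1 : ℕ) ≠ k := fun h' => h h'.symm
    simp [this]

theorem res_of_notMem {α : Finset D.Crossing} {c : D.Crossing} (hc : c ∉ α) :
    D.res α c.1 = false := by
  unfold res
  rw [decide_eq_false_iff_not]
  rintro ⟨c', hc', h⟩
  have : c' = c := Subtype.ext (Fin.ext h)
  exact hc (this ▸ hc')

theorem saddle_rword (α : Finset D.Crossing) (c : D.Crossing) (hc : c ∉ α) :
    Saddle ((D.rword α).Conn.comap (Subtype.val : {x // D.Valid x} → _))
      ((D.rword (insert c α)).Conn.comap Subtype.val)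
      (D.ptEquiv (D.lowerLeft c)) (D.ptEquiv (D.upperRight c)) := by
  have hk : (c.1 : ℕ) < D.word.length := c.1.2
  refine RWord.saddle_conn (D.closed_valid α) (D.closed_valid (insert c α)) (m := c.1)
    (i := D.word[c.1].pos) (by simp) (fun k hk => ?_) (e := D.word[c.1].kind.res false)
    (e' := D.word[c.1].kind.res true) ?_ ?_ ?_ (D.ptEquiv (D.lowerLeft c)).2
    (D.ptEquiv (D.upperRight c)).2
  · rw [getElem?_rword, getElem?_rword, res_insert, if_neg hk]
  · rw [getElem?_rword, D.res_of_notMem hc]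
    simp
  · rw [getElem?_rword, res_insert]
    simp
  · have := c.2
    cases h : D.word[c.1].kind with
    | cup => rw [h] at this; cases this
    | cap => rw [h] at this; cases this
    | cross o => cases o <;> simp [PieceKind.res]

/-- The cube of resolutions of a diagram. -/
noncomputable def cube : Cube D.Crossing where
  X := {x // D.Valid x}
  E α := (D.rword α).Conn.comap Subtype.val
  a c := D.ptEquiv (D.lowerLeft c)
  b c := D.ptEquiv (D.upperRight c)
  W x := x.1.1 = 0
  hs := - D.nMinus
  qs := D.nPlus - 2 * D.nMinus
  saddle := D.saddle_rword

/-- The order of the crossings. -/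
def rank (c : D.Crossing) : ℕ := c.1

theorem rank_injective : Function.Injective D.rank :=
  fun _ _ h => Subtype.ext (Fin.ext h)

/-- The filtered complex of a diagram. -/
noncomputable def cubeComplex : FComplex := D.cube.complex D.rank D.rank_injective

/-- The points of the diagram as points of its cube. -/
def pt : D.Point ≃ D.cube.X := D.ptEquiv

theorem cycleOf_eq_iff_E (α : Finset D.Crossing) (p q : D.Point) :
    D.cycleOf α p = D.cycleOf α q ↔ D.cube.E α (D.pt p) (D.pt q) := D.cycleOf_eq_iff α p q

/-- Labels of cycles as labels of points. -/
noncomputable def genEquiv : D.Gen ≃ D.cube.Gen where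
  toFun g := ⟨g.1, ⟨fun x => g.2 (D.cycleOf g.1 (D.pt.symm x)), fun p q h =>
    congrArg g.2 ((D.cycleOf_eq_iff_E g.1 _ _).2 (by simpa using h))⟩⟩
  invFun g := ⟨g.1, Quot.lift (fun p => g.2.1 (D.pt p)) fun p q h =>
    g.2.2 _ _ (D.glink_of_adj h).conn⟩
  left_inv g := by
    obtain ⟨α, l⟩ := g
    refine congrArg (Sigma.mk α) (funext fun z => ?_)
    induction z using Quot.inductionOn with | _ p => ?_
    rfl
  right_inv g := by
    obtain ⟨α, l, hl⟩ := g
    rfl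

theorem genEquiv_apply (g : D.Gen) (p : D.Point) :
    (D.genEquiv g).2.1 (D.pt p) = g.2 (D.cycleOf g.1 p) := rfl

theorem nt_iff (α : Finset D.Crossing) (p : D.Point) :
    D.cube.Nt α (D.pt p) ↔ D.Nontriv (D.cycleOf α p) := by
  unfold Cube.Nt Nontriv
  have e : ∀ q : D.Point, ((q.1 : ℕ) = 0 ∧ D.cycleOf α q = D.cycleOf α p) ↔
      D.cube.W (D.pt q) ∧ D.cube.E α (D.pt q) (D.pt p) := fun q =>
    and_congr Iff.rfl (D.cycleOf_eq_iff_E α q p)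
  rw [Nat.card_congr (D.pt.subtypeEquiv
    (q := fun x => D.cube.W x ∧ D.cube.E α x (D.pt p)) e)]

theorem deg_genEquiv (g : D.Gen) : D.cube.deg (D.genEquiv g) = D.deg g := by
  have hsurj : Function.Surjective fun x : D.cube.X => D.cycleOf g.1 (D.pt.symm x) :=
    fun z => by
      induction z using Quot.inductionOn with | _ p => ?_
      exact ⟨D.pt p, rfl⟩
  have hrel : ∀ p q : D.cube.X, D.cycleOf g.1 (D.pt.symm p) =
      D.cycleOf g.1 (D.pt.symm q) ↔ D.cube.E g.1 p q := fun p q => by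
    rw [cycleOf_eq_iff_E]; simp only [Equiv.apply_symm_apply]
  have hres := (D.genEquiv g).2.2
  refine Prod.ext ?_ (Prod.ext ?_ ?_)
  · simp only [Cube.deg, Cube.labDeg, deg, hDeg, cube]; rfl
  · simp only [Cube.deg, Cube.labDeg, deg, qDeg]
    have := classSum_eq (E := D.cube.E g.1)
      (F := fun x => labelDeg ((D.genEquiv g).2.1 x)) (fun p q h => congrArg labelDeg (hres p q h)) _ hsurj hrel
        (fun z => labelDeg (g.2 z)) (fun p => rfl)
    change classSum (D.cube.E g.1) _ + _ + (D.nPlus - 2 * D.nMinus) = _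
    rw [this]
    change _ + (g.1.card : ℤ) + _ = _
    ring
  · simp only [Cube.deg, Cube.labDeg, deg, aDeg]
    refine classSum_eq (E := D.cube.E g.1) (fun p q h => ?_) _ hsurj hrel _ (fun p => ?_)
    · have h1 := D.cube.nt_congr h
      have h2 := hres p q h
      change (if D.cube.Nt g.1 p then _ else _) = if D.cube.Nt g.1 q then _ else _
      rw [h2]
      simp only [h1]
    · have := D.nt_iff g.1 (D.pt.symm p)
      rw [Equiv.apply_symm_apply] at this
      change _ = if D.cube.Nt g.1 p then _ else _
      simp only [this]
      rfl

theorem d_genEquiv (g' g : D.Gen) :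
    D.cube.d D.rank (D.genEquiv g') (D.genEquiv g) = D.dKh g' g := by
  rw [Cube.d, dKh, Matrix.of_apply, Matrix.of_apply]
  refine Finset.sum_congr rfl fun c _ => ?_
  unfold edgeCoeff
  have hE : ∀ p q : D.Point, D.cube.E g.1 (D.pt p) (D.pt q) ↔
      D.cycleOf g.1 p = D.cycleOf g.1 q := fun p q => (D.cycleOf_eq_iff_E g.1 p q).symm
  have ea : D.cube.a c = D.pt (D.lowerLeft c) := rfl
  have eb : D.cube.b c = D.pt (D.upperRight c) := rfl
  have es : edgeSign D.rank g.1 c = (-1) ^ (g.1.filter (· < c)).card := by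
    unfold edgeSign
    rfl
  have hall : (∀ p : D.cube.X, ¬ D.cube.E g.1 p (D.cube.a c) → ¬ D.cube.E g.1 p (D.cube.b c) →
      (D.genEquiv g').2.1 p = (D.genEquiv g).2.1 p) ↔
      ∀ p : D.Point, D.cycleOf g.1 p ≠ D.cycleOf g.1 (D.lowerLeft c) →
        D.cycleOf g.1 p ≠ D.cycleOf g.1 (D.upperRight c) →
        g'.2 (D.cycleOf g'.1 p) = g.2 (D.cycleOf g.1 p) := by
    rw [← D.pt.forall_congr_right (q := fun p : D.cube.X =>
      ¬ D.cube.E g.1 p (D.cube.a c) → ¬ D.cube.E g.1 p (D.cube.b c) →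
      (D.genEquiv g').2.1 p = (D.genEquiv g).2.1 p)]
    simp only [ea, eb, hE, genEquiv_apply, ne_eq]
  change (if c ∉ g.1 ∧ g'.1 = insert c g.1 then edgeSign D.rank g.1 c *
    saddleCoeff (D.cube.E g.1) (D.cube.a c) (D.cube.b c) (D.genEquiv g).2.1 (D.genEquiv g').2.1
    else 0) = _
  rw [es]
  by_cases h1 : c ∉ g.1 ∧ g'.1 = insert c g.1
  · rw [if_pos h1]
    unfold saddleCoeff
    by_cases h2 : ∀ p : D.Point, D.cycleOf g.1 p ≠ D.cycleOf g.1 (D.lowerLeft c) →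
        D.cycleOf g.1 p ≠ D.cycleOf g.1 (D.upperRight c) →
        g'.2 (D.cycleOf g'.1 p) = g.2 (D.cycleOf g.1 p)
    · rw [if_pos (hall.2 h2)]
      refine Eq.trans ?_ (if_pos ⟨h1.1, h1.2, h2⟩).symm
      simp only [ea, eb, hE, genEquiv_apply]
    · rw [if_neg (fun h => h2 (hall.1 h)), mul_zero]
      exact (if_neg (fun h => h2 h.2.2)).symm
  · rw [if_neg h1]
    exact (if_neg (fun h => h1 ⟨h.1, h.2.1⟩)).symm

theorem filt_dKh : Filt D.deg D.deg (1, 0, 0) D.dKh := by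
  intro g' g h
  rw [← d_genEquiv] at h
  have := D.cube.filt_d D.rank _ _ h
  rwa [deg_genEquiv, deg_genEquiv] at this

theorem dKh_annular (g' g : D.Gen) (h : D.dKh g' g ≠ 0) :
    D.aDeg g' = D.aDeg g ∨ D.aDeg g' = D.aDeg g + -2 := by
  rw [← d_genEquiv] at h
  have := D.cube.d_annular h
  rwa [deg_genEquiv, deg_genEquiv] at this

theorem dKh_mul_dKh : D.dKh * D.dKh = 0 := by
  have e : D.dKh = (D.cube.d D.rank).submatrix D.genEquiv D.genEquiv := by
    ext g' g
    rw [Matrix.submatrix_apply, d_genEquiv]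
  rw [e, Matrix.submatrix_mul_equiv, Cube.d_mul_d _ D.rank_injective]
  rfl

theorem hEquiv_cubeComplex :
    (D.khComplex D.filt_dKh D.dKh_mul_dKh).HEquiv D.cubeComplex :=
  FComplex.HEquiv.of_signed_equiv (A := D.khComplex D.filt_dKh D.dKh_mul_dKh)
    (B := D.cubeComplex) D.genEquiv (fun _ => 1) (fun _ => one_mul 1)
    D.deg_genEquiv (fun g' g => by
      have : D.cubeComplex.d (D.genEquiv g') (D.genEquiv g) = D.dKh g' g := D.d_genEquiv g' g
      rw [one_mul, one_mul]
      exact this)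

variable {D} {D' : AnnularDiagram}

theorem gradedHomotopyEquivalent_of_cubeComplex (h : D.cubeComplex.HEquiv D'.cubeComplex) :
    GradedHomotopyEquivalent D.homogeneous D.dTilde D'.homogeneous D'.dTilde :=
  gradedHomotopyEquivalent D.dKh_annular D.filt_dKh D.dKh_mul_dKh D'.dKh_annular D'.filt_dKh
    D'.dKh_mul_dKh (D.hEquiv_cubeComplex.trans (h.trans D'.hEquiv_cubeComplex.symm))

end AnnularDiagram

/-! ## Replacement of a part of a stack -/

namespace RWord

open RPiece

/-- Connectivity in a stack whose top is not glued to its bottom. -/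
def LinkConn (w : RWord) : Setoid (ℕ × ℕ) := Relation.EqvGen.setoid w.Link

/-- The points at the bottom and at the top of a stack. -/
def bd (w : RWord) (x : Bool × ℕ) : ℕ × ℕ := (if x.1 then w.length else 0, x.2)

/-- Upward shift of a point. -/
def sh (k : ℕ) (x : ℕ × ℕ) : ℕ × ℕ := (k + x.1, x.2)

theorem Link.linkConn {w : RWord} {x y : ℕ × ℕ} (h : w.Link x y) : w.LinkConn x y :=
  Relation.EqvGen.rel _ _ h

theorem Link.le {w : RWord} {x y : ℕ × ℕ} (h : w.Link x y) : x.1 ≤ w.length ∧ y.1 ≤ w.length := by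
  obtain ⟨m, b, b', s, hs, hx, hy, -⟩ := h
  have := (List.getElem?_eq_some_iff.1 hs).1
  have hb : ∀ b : Bool, b.toNat ≤ 1 := by decide
  have h1 := hb b
  have h2 := hb b'
  omega

theorem link_append_left {p q : RWord} {x y : ℕ × ℕ} (h : p.Link x y) :
    RWord.Link (p ++ q) x y := by
  obtain ⟨m, b, b', s, hs, h⟩ := h
  refine ⟨m, b, b', s, ?_, h⟩
  rw [List.getElem?_append_left (List.getElem?_eq_some_iff.1 hs).1, hs]

theorem link_append_right {p q : RWord} {x y : ℕ × ℕ} (h : q.Link x y) :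
    RWord.Link (p ++ q) (sh p.length x) (sh p.length y) := by
  obtain ⟨m, b, b', s, hs, hx, hy, h⟩ := h
  refine ⟨p.length + m, b, b', s, ?_, ?_, ?_, h⟩
  · rw [List.getElem?_append_right (by omega)]
    simpa using hs
  · simp only [sh]; omega
  · simp only [sh]; omega

theorem link_append {p q : RWord} {x y : ℕ × ℕ} (h : RWord.Link (p ++ q) x y) :
    p.Link x y ∨ ∃ x' y', x = sh p.length x' ∧ y = sh p.length y' ∧ q.Link x' y' := by
  obtain ⟨m, b, b', s, hs, hx, hy, h⟩ := h
  rcases Nat.lt_or_ge m p.length with hm | hm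
  · rw [List.getElem?_append_left hm] at hs
    exact Or.inl ⟨m, b, b', s, hs, hx, hy, h⟩
  · rw [List.getElem?_append_right hm] at hs
    refine Or.inr ⟨(x.1 - p.length, x.2), (y.1 - p.length, y.2), ?_, ?_,
      ⟨m - p.length, b, b', s, hs, ?_, ?_, h⟩⟩
    · exact Prod.ext (by simp only [sh]; omega) rfl
    · exact Prod.ext (by simp only [sh]; omega) rfl
    · simp only; omega
    · simp only; omega

theorem conn_of_linkConn {p u r : RWord} {x y : ℕ × ℕ} (h : u.LinkConn x y) :
    RWord.Conn (p ++ u ++ r) (sh p.length x) (sh p.length y) := by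
  induction h with
  | rel x y h => exact (link_append_left (link_append_right h)).conn
  | refl x => exact Setoid.refl' _ _
  | symm x y _ ih => exact Setoid.symm' _ ih
  | trans x y z _ _ ih1 ih2 => exact Setoid.trans' _ ih1 ih2

/-- The points outside of the part `u` of a stack `p ++ u ++ r`: `false` for those of `p`, `true`
for those of `r`. -/
def outer (p u : RWord) (o : Bool × ℕ × ℕ) : ℕ × ℕ :=
  if o.1 then sh (p.length + u.length) o.2 else o.2

/-- The heights of the points outside. -/
def IsOuter (p r : RWord) (o : Bool × ℕ × ℕ) : Prop :=
  o.2.1 ≤ if o.1 then r.length else p.length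

/-- The points on the boundary of the part `u`. -/
def rim (p : RWord) (x : Bool × ℕ) : Bool × ℕ × ℕ := (x.1, if x.1 then 0 else p.length, x.2)

/-- Adjacency of outer points: inside the outer parts, by gluing the top to the bottom, and through
the part `u`. -/
inductive OuterAdj (p u r : RWord) : Bool × ℕ × ℕ → Bool × ℕ × ℕ → Prop
  | below {x y : ℕ × ℕ} (h : p.Link x y) : OuterAdj p u r (false, x) (false, y)
  | above {x y : ℕ × ℕ} (h : r.Link x y) : OuterAdj p u r (true, x) (true, y)
  | glue (j : ℕ) : OuterAdj p u r (true, r.length, j) (false, 0, j)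
  | inside {x y : Bool × ℕ} (h : u.LinkConn (u.bd x) (u.bd y)) :
      OuterAdj p u r (rim p x) (rim p y)

variable {p u r : RWord}

theorem outer_rim (x : Bool × ℕ) : outer p u (rim p x) = sh p.length (u.bd x) := by
  obtain ⟨b, j⟩ := x
  cases b <;> simp [outer, rim, sh, bd]

theorem isOuter_rim (x : Bool × ℕ) : IsOuter p r (rim p x) := by
  obtain ⟨b, j⟩ := x
  cases b <;> simp [IsOuter, rim]

theorem conn_of_outerAdj {o o' : Bool × ℕ × ℕ} (h : Relation.EqvGen (OuterAdj p u r) o o') :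
    RWord.Conn (p ++ u ++ r) (outer p u o) (outer p u o') := by
  induction h with
  | rel o o' h =>
    cases h with
    | below h => exact (link_append_left (link_append_left h)).conn
    | above h =>
      have := (link_append_right (p := p ++ u) h).conn
      simpa [outer] using this
    | glue j =>
      have := conn_glue (w := p ++ u ++ r) j
      simpa [outer, sh, Nat.add_assoc] using this
    | inside h => rw [outer_rim, outer_rim]; exact conn_of_linkConn h
  | refl x => exact Setoid.refl' _ _
  | symm x y _ ih => exact Setoid.symm' _ ih
  | trans x y z _ _ ih1 ih2 => exact Setoid.trans' _ ih1 ih2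

/-- An arbitrary point is connected to an outer point. -/
def Reach (p u r : RWord) (x : ℕ × ℕ) (o : Bool × ℕ × ℕ) : Prop :=
  (∃ o', IsOuter p r o' ∧ outer p u o' = x ∧ Relation.EqvGen (OuterAdj p u r) o' o) ∨
  ∃ x' z, x = sh p.length x' ∧ x'.1 ≤ u.length ∧ u.LinkConn x' (u.bd z) ∧
    Relation.EqvGen (OuterAdj p u r) (rim p z) o

/-- The outer points that are points of `u` are boundary points of `u`. -/
theorem eq_rim_of_outer_eq {o : Bool × ℕ × ℕ} (ho : IsOuter p r o) {x : ℕ × ℕ}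
    (hx : x.1 ≤ u.length) (h : outer p u o = sh p.length x) :
    ∃ z, o = rim p z ∧ x = u.bd z := by
  obtain ⟨b, k, j⟩ := o
  obtain ⟨k', j'⟩ := x
  cases b <;> simp [outer, sh, IsOuter] at h ho hx
  · refine ⟨(false, j), ?_, ?_⟩
    · simp [rim]; omega
    · simp [bd]; omega
  · refine ⟨(true, j), ?_, ?_⟩
    · simp [rim]; omega
    · simp [bd]; omega

/-- At an outer point the two alternatives of `Reach` give nothing beyond connectivity of outer
points, because the only outer points that belong to `u` are on its rim. -/
theorem Reach.outer {b o : Bool × ℕ × ℕ} (hb : IsOuter p r b) (h : Reach p u r (outer p u b) o) :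
    Relation.EqvGen (OuterAdj p u r) b o := by
  rcases h with ⟨o', ho', he, h⟩ | ⟨x, z, hx, hxu, hc, h⟩
  · suffices Relation.EqvGen (OuterAdj p u r) b o' from this.trans _ _ _ h
    by_cases hbo : b = o'
    · exact hbo ▸ Relation.EqvGen.refl _
    -- If `u` is empty, its bottom and its top are the same line, so a position can have two names
    -- as an outer point; both are then on the rim.
    · have hin : ∃ x : ℕ × ℕ, x.1 ≤ u.length ∧ RWord.outer p u b = sh p.length x := by
        obtain ⟨s, k, j⟩ := b
        obtain ⟨s', k', j'⟩ := o'
        cases s <;> cases s' <;> simp [RWord.outer, sh, IsOuter] at hb ho' he hbo ⊢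
        · omega
        · exact ⟨0, by omega, by omega⟩
        · exact ⟨u.length, by omega, by omega⟩
        · omega
      obtain ⟨x, hxu, hx⟩ := hin
      obtain ⟨z, rfl, h1⟩ := eq_rim_of_outer_eq hb hxu hx
      obtain ⟨z', rfl, h2⟩ := eq_rim_of_outer_eq ho' hxu (he.trans hx)
      exact Relation.EqvGen.rel _ _ (.inside (by rw [← h1, ← h2]))
  · obtain ⟨z', rfl, rfl⟩ := eq_rim_of_outer_eq hb hxu hx
    exact (Relation.EqvGen.rel _ _ (.inside hc)).trans _ _ _ h

theorem Reach.of_outer {b o : Bool × ℕ × ℕ} (hb : IsOuter p r b)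
    (h : Relation.EqvGen (OuterAdj p u r) b o) : Reach p u r (RWord.outer p u b) o :=
  Or.inl ⟨b, hb, rfl, h⟩

theorem Reach.of_outerAdj {a b o : Bool × ℕ × ℕ} (ha : IsOuter p r a) (hb : IsOuter p r b)
    (hab : OuterAdj p u r a b) :
    Reach p u r (RWord.outer p u a) o ↔ Reach p u r (RWord.outer p u b) o :=
  ⟨fun h => .of_outer hb (((Relation.EqvGen.rel _ _ hab).symm _ _).trans _ _ _ (h.outer ha)),
    fun h => .of_outer ha ((Relation.EqvGen.rel _ _ hab).trans _ _ _ (h.outer hb))⟩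

theorem Reach.of_inside {x y : ℕ × ℕ} {o : Bool × ℕ × ℕ} (h : u.Link x y)
    (hx : Reach p u r (sh p.length x) o) : Reach p u r (sh p.length y) o := by
  rcases hx with ⟨o', ho', he, h'⟩ | ⟨x', z, hx, hxu, hc, h'⟩
  · obtain ⟨z, rfl, rfl⟩ := eq_rim_of_outer_eq ho' h.le.1 he
    exact Or.inr ⟨y, z, rfl, h.le.2, h.symm.linkConn, h'⟩
  · obtain rfl : x = x' := by
      simp only [sh, Prod.mk.injEq] at hx
      exact Prod.ext (by omega) hx.2
    exact Or.inr ⟨y, z, rfl, h.le.2, Setoid.trans' _ h.symm.linkConn hc, h'⟩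

theorem Reach.iff_of_gLink {x y : ℕ × ℕ} (h : RWord.GLink (p ++ u ++ r) x y) (o : Bool × ℕ × ℕ) :
    Reach p u r x o ↔ Reach p u r y o := by
  rcases h with h | ⟨hx, rfl⟩
  · rcases link_append h with h | ⟨x', y', rfl, rfl, h'⟩
    · rcases link_append h with h | ⟨x', y', rfl, rfl, h'⟩
      · exact Reach.of_outerAdj (a := (false, x)) (b := (false, y)) h.le.1 h.le.2 (.below h)
      · exact ⟨Reach.of_inside h', Reach.of_inside h'.symm⟩
    · have := Reach.of_outerAdj (a := (true, x')) (b := (true, y')) (o := o) h'.le.1 h'.le.2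
        (.above (p := p) (u := u) h')
      simpa [RWord.outer] using this
  · obtain ⟨k, j⟩ := x
    simp only at hx
    subst hx
    have := Reach.of_outerAdj (o := o) (by simp [IsOuter]) (by simp [IsOuter])
      (OuterAdj.glue (p := p) (u := u) (r := r) j)
    simpa [RWord.outer, sh, Nat.add_assoc] using this

/-- A path between outer points consists of outer steps and of passages through `u` from rim to rim.
Instead of cutting the path, one checks that `Reach` is invariant under each single link. -/
theorem conn_outer_iff {o o' : Bool × ℕ × ℕ} (ho : IsOuter p r o) (ho' : IsOuter p r o') :
    RWord.Conn (p ++ u ++ r) (outer p u o) (outer p u o') ↔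
      Relation.EqvGen (OuterAdj p u r) o o' := by
  refine ⟨fun h => ?_, conn_of_outerAdj⟩
  have key : ∀ x y, RWord.Conn (p ++ u ++ r) x y → ∀ o, Reach p u r x o ↔ Reach p u r y o := by
    intro x y h
    induction h with
    | rel x y h => exact Reach.iff_of_gLink h
    | refl x => exact fun _ => Iff.rfl
    | symm x y _ ih => exact fun o => (ih o).symm
    | trans x y z _ _ ih1 ih2 => exact fun o => (ih1 o).trans (ih2 o)
  exact ((key _ _ h o').2 (.of_outer ho' (Relation.EqvGen.refl _))).outer ho

/-- Two stacks connect their boundary points in the same way. -/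
def SameBd (u u' : RWord) : Prop :=
  ∀ x y, u.LinkConn (u.bd x) (u.bd y) ↔ u'.LinkConn (u'.bd x) (u'.bd y)

theorem conn_outer_congr {u' : RWord} (h : SameBd u u') {o o' : Bool × ℕ × ℕ}
    (ho : IsOuter p r o) (ho' : IsOuter p r o') :
    RWord.Conn (p ++ u ++ r) (outer p u o) (outer p u o') ↔
      RWord.Conn (p ++ u' ++ r) (outer p u' o) (outer p u' o') := by
  rw [conn_outer_iff ho ho', conn_outer_iff ho ho']
  have : OuterAdj p u r = OuterAdj p u' r := by
    funext a b
    refine propext ⟨fun h' => ?_, fun h' => ?_⟩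
    · cases h' with
      | below h => exact .below h
      | above h => exact .above h
      | glue j => exact .glue j
      | inside h' => exact .inside ((h _ _).1 h')
    · cases h' with
      | below h => exact .below h
      | above h => exact .above h
      | glue j => exact .glue j
      | inside h' => exact .inside ((h _ _).2 h')
  rw [this]

/-- Every point of the stack is connected to its boundary. -/
def NoCircle (u : RWord) : Prop :=
  ∀ x : ℕ × ℕ, x.1 ≤ u.length → ∃ z, u.LinkConn x (u.bd z)

/-- The point `y` lies on a closed curve, and every other curve meets the boundary. -/
structure OneCircle (u : RWord) (y : ℕ × ℕ) : Prop where
  le : y.1 ≤ u.length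
  not_conn : ∀ z, ¬ u.LinkConn (u.bd z) y
  cover : ∀ x : ℕ × ℕ, x.1 ≤ u.length → u.LinkConn x y ∨ ∃ z, u.LinkConn x (u.bd z)

theorem exists_outer_or (p u r : RWord) {x : ℕ × ℕ} (hx : x.1 ≤ (p ++ u ++ r).length) :
    (∃ o, IsOuter p r o ∧ outer p u o = x) ∨ ∃ y : ℕ × ℕ, y.1 ≤ u.length ∧ sh p.length y = x := by
  obtain ⟨k, j⟩ := x
  simp only [List.length_append] at hx
  rcases Nat.lt_or_ge k p.length with h1 | h1
  · exact Or.inl ⟨(false, k, j), by simp [IsOuter]; omega, rfl⟩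
  rcases Nat.lt_or_ge (p.length + u.length) k with h2 | h2
  · exact Or.inl ⟨(true, k - (p.length + u.length), j), by simp [IsOuter]; omega, by
      simp [outer, sh]; omega⟩
  · exact Or.inr ⟨(k - p.length, j), by simp; omega, by simp [sh]; omega⟩

theorem NoCircle.exists_outer (hu : u.NoCircle) {x : ℕ × ℕ} (hx : x.1 ≤ (p ++ u ++ r).length) :
    ∃ o, IsOuter p r o ∧ RWord.Conn (p ++ u ++ r) x (outer p u o) := by
  rcases exists_outer_or p u r hx with ⟨o, ho, rfl⟩ | ⟨y, hy, rfl⟩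
  · exact ⟨o, ho, Setoid.refl' _ _⟩
  · obtain ⟨z, hz⟩ := hu y hy
    exact ⟨rim p z, isOuter_rim z, by rw [outer_rim]; exact conn_of_linkConn hz⟩

theorem OneCircle.exists_outer {y : ℕ × ℕ} (hu : u.OneCircle y) {x : ℕ × ℕ}
    (hx : x.1 ≤ (p ++ u ++ r).length) : RWord.Conn (p ++ u ++ r) x (sh p.length y) ∨
      ∃ o, IsOuter p r o ∧ RWord.Conn (p ++ u ++ r) x (outer p u o) := by
  rcases exists_outer_or p u r hx with ⟨o, ho, rfl⟩ | ⟨x, hxu, rfl⟩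
  · exact Or.inr ⟨o, ho, Setoid.refl' _ _⟩
  · rcases hu.cover x hxu with h | ⟨z, hz⟩
    · exact Or.inl (conn_of_linkConn h)
    · exact Or.inr ⟨rim p z, isOuter_rim z, by rw [outer_rim]; exact conn_of_linkConn hz⟩

/-- Lying inside `u` on the local curve of `y` is invariant under all links of the whole stack: a
link can leave `u` only at a boundary point, and the closed curve contains none. -/
theorem OneCircle.not_conn_outer {y : ℕ × ℕ} (hu : u.OneCircle y) {o : Bool × ℕ × ℕ}
    (ho : IsOuter p r o) : ¬ RWord.Conn (p ++ u ++ r) (outer p u o) (sh p.length y) := by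
  have hstep : ∀ x z, RWord.GLink (p ++ u ++ r) x z →
      ((∃ x' : ℕ × ℕ, x = sh p.length x' ∧ x'.1 ≤ u.length ∧ u.LinkConn x' y) ↔
        ∃ x' : ℕ × ℕ, z = sh p.length x' ∧ x'.1 ≤ u.length ∧ u.LinkConn x' y) := by
    have hout : ∀ o, IsOuter p r o →
        ¬ ∃ x' : ℕ × ℕ, outer p u o = sh p.length x' ∧ x'.1 ≤ u.length ∧ u.LinkConn x' y := by
      rintro o ho ⟨x', hx, hxu, hc⟩
      obtain ⟨z, -, rfl⟩ := eq_rim_of_outer_eq ho hxu hx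
      exact hu.not_conn z hc
    have hinj : ∀ a b : ℕ × ℕ, sh p.length a = sh p.length b → a = b := fun a b h => by
      simp only [sh, Prod.mk.injEq] at h
      exact Prod.ext (by omega) h.2
    rintro x z (h | ⟨hx, rfl⟩)
    · rcases link_append h with h | ⟨x', y', rfl, rfl, h'⟩
      · rcases link_append h with h | ⟨x', y', rfl, rfl, h'⟩
        · exact iff_of_false (hout (false, x) h.le.1) (hout (false, z) h.le.2)
        · constructor
          · rintro ⟨x'', he, -, hc⟩
            obtain rfl := hinj _ _ he
            exact ⟨y', rfl, h'.le.2, Setoid.trans' _ h'.symm.linkConn hc⟩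
          · rintro ⟨x'', he, -, hc⟩
            obtain rfl := hinj _ _ he
            exact ⟨x', rfl, h'.le.1, Setoid.trans' _ h'.linkConn hc⟩
      · have h1 := hout (true, x') h'.le.1
        have h2 := hout (true, y') h'.le.2
        simp only [outer, if_true, ← List.length_append] at h1 h2
        exact iff_of_false h1 h2
    · obtain ⟨k, j⟩ := x
      simp only at hx
      subst hx
      have h1 := hout (true, r.length, j) (by simp [IsOuter])
      simp only [outer, if_true, sh, ← List.length_append] at h1
      exact iff_of_false h1 (hout (false, 0, j) (by simp [IsOuter]))
  have key : ∀ x z, RWord.Conn (p ++ u ++ r) x z →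
      ((∃ x' : ℕ × ℕ, x = sh p.length x' ∧ x'.1 ≤ u.length ∧ u.LinkConn x' y) ↔
        ∃ x' : ℕ × ℕ, z = sh p.length x' ∧ x'.1 ≤ u.length ∧ u.LinkConn x' y) := by
    intro x z h
    induction h with
    | rel x y h => exact hstep _ _ h
    | refl x => exact Iff.rfl
    | symm x y _ ih => exact ih.symm
    | trans x y z _ _ ih1 ih2 => exact ih1.trans ih2
  intro h
  obtain ⟨x', hx, hxu, hc⟩ := (key _ _ h).2 ⟨y, rfl, hu.le, Setoid.refl' _ _⟩
  obtain ⟨z, -, rfl⟩ := eq_rim_of_outer_eq ho hxu hx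
  exact hu.not_conn z hc

end RWord

/-! ## Stacks with few strands -/

namespace RWord

open RPiece

/-- The number of strands below the `k`-th slice of a stack on `n` strands. -/
def wd (u : RWord) (n k : ℕ) : ℕ := (u.take k).foldl (fun w s => w - s.2.inn + s.2.out) n

/-- The next point on the curve, where the strands with even numbers go up; the points where the
curve leaves the stack are fixed. -/
def lnxt (u : RWord) (x : ℕ × ℕ) : ℕ × ℕ :=
  if x.2 % 2 = 0 then
    match u[x.1]? with
    | some s => across x.1 s (false, x.2)
    | none => x
  else if x.1 = 0 then x
  else
    match u[x.1 - 1]? with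
    | some s => across (x.1 - 1) s (true, x.2)
    | none => x

/-- The point where the curve through a point leaves a stack with at most twelve points; `none` if
it does not leave the stack. -/
def exit (u : RWord) (x : ℕ × ℕ) : Option (Bool × ℕ) :=
  let y := u.lnxt^[12] x
  if y.2 % 2 = 0 then if y.1 = u.length then some (true, y.2) else none
  else if y.1 = 0 then some (false, y.2) else none

/-- The points of a stack on `n` strands are joined to their exits. -/
structure Checked (u : RWord) (n : ℕ) : Prop where
  fits : ∀ m : Fin u.length, u[m].1 + u[m].2.inn ≤ u.wd n m
  exit_across : ∀ (m : Fin u.length) (b : Bool), ∀ c < u.wd n (m + b.toNat),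
    u.exit (across m u[m] (b, c)) = u.exit (m + b.toNat, c)
  isSome : ∀ s : Bool, ∀ c < u.wd n (if s then u.length else 0), (u.exit (u.bd (s, c))).isSome

instance (u : RWord) (n : ℕ) : Decidable (u.Checked n) :=
  decidable_of_iff ((∀ m : Fin u.length, u[m].1 + u[m].2.inn ≤ u.wd n m) ∧
    (∀ (m : Fin u.length) (b : Bool), ∀ c < u.wd n (m + b.toNat),
      u.exit (across m u[m] (b, c)) = u.exit (m + b.toNat, c)) ∧
    ∀ s : Bool, ∀ c < u.wd n (if s then u.length else 0), (u.exit (u.bd (s, c))).isSome)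
    ⟨fun h => ⟨h.1, h.2.1, h.2.2⟩, fun h => ⟨h.1, h.2, h.3⟩⟩

/-- The two stacks have the same exits on the boundary. -/
def SameExit (u u' : RWord) (n : ℕ) : Prop :=
  u.Checked n ∧ u'.Checked n ∧ u.wd n u.length = u'.wd n u'.length ∧
    ∀ s : Bool, ∀ c < u.wd n (if s then u.length else 0),
      u.exit (u.bd (s, c)) = u'.exit (u'.bd (s, c))

instance (u u' : RWord) (n : ℕ) : Decidable (SameExit u u' n) :=
  inferInstanceAs (Decidable (_ ∧ _))

/-- All points have exits. -/
def AllExit (u : RWord) (n : ℕ) : Prop :=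
  u.Checked n ∧ ∀ k ≤ u.length, ∀ c < u.wd n k, (u.exit (k, c)).isSome

instance (u : RWord) (n : ℕ) : Decidable (u.AllExit n) :=
  inferInstanceAs (Decidable (_ ∧ _))

/-- All points without an exit are on the curve through `y`. -/
def CircleExit (u : RWord) (n : ℕ) (y : ℕ × ℕ) : Prop :=
  u.Checked n ∧ y.1 ≤ u.length ∧ y.2 < u.wd n y.1 ∧ u.exit y = none ∧
    ∀ k ≤ u.length, ∀ c < u.wd n k, (u.exit (k, c)).isSome ∨ ∃ m < 12, u.lnxt^[m] (k, c) = y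

instance (u : RWord) (n : ℕ) (y : ℕ × ℕ) : Decidable (u.CircleExit n y) :=
  inferInstanceAs (Decidable (_ ∧ _))

/-- The stack with `i` additional strands on the left. -/
def shift (i : ℕ) (u : RWord) : RWord := u.map fun s => (i + s.1, s.2)

@[simp] theorem length_shift (i : ℕ) (u : RWord) : (u.shift i).length = u.length := by
  simp [shift]

theorem wd_succ {u : RWord} {m : ℕ} {s : ℕ × RPiece} (hs : u[m]? = some s) (n : ℕ) :
    u.wd n (m + 1) = u.wd n m - s.2.inn + s.2.out := by
  simp [wd, List.take_add_one, hs]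

theorem partner_shift (i a : ℕ) (e : RPiece) (b : Bool) (c : ℕ) :
    partner (i + a) e (b, i + c) = ((partner a e (b, c)).1, i + (partner a e (b, c)).2) := by
  rcases cases_point a e (b, c) with h | ⟨b', t, h⟩ | ⟨b', s, h, he⟩
  · rw [partner_of_lt _ _ h, partner_of_lt _ _ (by simpa using h)]
  · obtain ⟨rfl, rfl⟩ := Prod.mk.inj h
    rw [partner_right, ← Nat.add_assoc, ← Nat.add_assoc, partner_right]
    simp only [Nat.add_assoc]
  · obtain ⟨rfl, rfl⟩ := Prod.mk.inj h
    rw [← Nat.add_assoc]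
    rcases he with rfl | rfl | ⟨rfl, rfl⟩ | ⟨rfl, rfl⟩
    · rw [partner_hor, partner_hor, Nat.add_assoc]
    · rw [partner_vert, partner_vert, Nat.add_assoc]
    · rw [partner_cup, partner_cup, Nat.add_assoc]
    · rw [partner_cap, partner_cap, Nat.add_assoc]

variable {u u' : RWord} {n : ℕ}

theorem linkConn_shift (i : ℕ) {x y : ℕ × ℕ} (h : u.LinkConn x y) :
    (u.shift i).LinkConn (x.1, i + x.2) (y.1, i + y.2) := by
  induction h with
  | rel x y h =>
    obtain ⟨m, b, b', s, hs, hx, hy, h⟩ := h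
    refine Link.linkConn ⟨m, b, b', (i + s.1, s.2), by simp [shift, hs], hx, hy, ?_⟩
    rw [partner_shift, h]
  | refl x => exact Setoid.refl' _ _
  | symm x y _ ih => exact Setoid.symm' _ ih
  | trans x y z _ _ ih1 ih2 => exact Setoid.trans' _ ih1 ih2

theorem linkConn_lnxt (u : RWord) (x : ℕ × ℕ) : u.LinkConn x (u.lnxt x) := by
  unfold lnxt
  split_ifs with h1 h2
  · cases hs : u[x.1]? with
    | none => exact Setoid.refl' _ _
    | some s => exact (link_across hs false x.2).linkConn
  · exact Setoid.refl' _ _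
  · cases hs : u[x.1 - 1]? with
    | none => exact Setoid.refl' _ _
    | some s =>
      have := (link_across hs true x.2).linkConn
      have e : (x.1 - 1 + true.toNat, x.2) = x := Prod.ext (by simp; omega) rfl
      rwa [e] at this

theorem linkConn_iterate (u : RWord) (m : ℕ) (x : ℕ × ℕ) : u.LinkConn x (u.lnxt^[m] x) := by
  induction m with
  | zero => exact Setoid.refl' _ _
  | succ m ih =>
    rw [Function.iterate_succ_apply']
    exact Setoid.trans' _ ih (linkConn_lnxt u _)

theorem linkConn_exit {x : ℕ × ℕ} {z : Bool × ℕ} (h : u.exit x = some z) :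
    u.LinkConn x (u.bd z) := by
  have hc := linkConn_iterate u 12 x
  unfold exit at h
  simp only at h
  generalize u.lnxt^[12] x = y at h hc
  split_ifs at h with h1 h2 h2 <;> cases h
  · have : u.bd (true, y.2) = y := Prod.ext (by simp [bd, h2]) rfl
    rwa [this]
  · have : u.bd (false, y.2) = y := Prod.ext (by simp [bd, h2]) rfl
    rwa [this]

/-- The curve through a point of the stack with `i` additional strands on the left and arbitrarily
many on the right. -/
def curve (u : RWord) (i n : ℕ) (x : ℕ × ℕ) : ℕ ⊕ Option (Bool × ℕ) ⊕ ℕ :=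
  if x.2 < i then .inl x.2
  else if x.2 - i < u.wd n x.1 then .inr (.inl (u.exit (x.1, x.2 - i)))
  else .inr (.inr (x.2 - i - u.wd n x.1))

theorem linkConn_left (i : ℕ) {j k : ℕ} (hj : j < i) (hk : k ≤ u.length) :
    (u.shift i).LinkConn (k, j) (0, j) := by
  induction k with
  | zero => exact Setoid.refl' _ _
  | succ k ih =>
    refine Setoid.trans' _ (Link.linkConn ⟨k, true, false, (i + u[k].1, u[k].2), ?_, rfl, rfl, ?_⟩)
      (ih (by omega))
    · simp [shift]
    · rw [partner_of_lt]
      · rfl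
      · simp only; omega

theorem bd_le (u : RWord) (x : Bool × ℕ) : (u.bd x).1 ≤ u.length := by
  obtain ⟨s, j⟩ := x
  cases s <;> simp [bd]

theorem bd_shift (i : ℕ) (x : Bool × ℕ) : (u.shift i).bd x = u.bd x := by
  simp [bd]

namespace Checked

variable (hu : u.Checked n) (i : ℕ)
include hu

theorem wd_add {m : ℕ} {s : ℕ × RPiece} (hs : u[m]? = some s) (b : Bool) :
    ∃ d, u.wd n (m + b.toNat) = s.1 + (if b then s.2.out else s.2.inn) + d ∧
      u.wd n (m + (!b).toNat) = s.1 + (if b then s.2.inn else s.2.out) + d := by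
  obtain ⟨hm, rfl⟩ := List.getElem?_eq_some_iff.1 hs
  have h1 := hu.fits ⟨m, hm⟩
  have h2 := wd_succ hs n
  simp only [Fin.getElem_fin] at h1
  refine ⟨u.wd n m - u[m].1 - u[m].2.inn, ?_⟩
  cases b <;> simp only [Bool.toNat_false, Bool.toNat_true, Bool.not_false, Bool.not_true,
    Nat.add_zero, if_true, Bool.false_eq_true, if_false, h2] <;> omega

/-- A strand on the left keeps its number, a strand on the right keeps its distance from the right
edge of `u`, and for arcs inside `u` the equality of exits is the finite condition `exit_across`. -/
theorem curve_eq_of_link {x y : ℕ × ℕ} (h : (u.shift i).Link x y) :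
    u.curve i n x = u.curve i n y := by
  obtain ⟨m, b, b', s', hs, hx, hy, h⟩ := h
  obtain ⟨k, j⟩ := x
  obtain ⟨k', j'⟩ := y
  simp only at hx hy h
  subst hx hy
  simp only [shift, List.getElem?_map, Option.map_eq_some_iff] at hs
  obtain ⟨s, hs, rfl⟩ := hs
  simp only at h
  by_cases hj : j < i
  · rw [partner_of_lt _ _ (by simp only; omega)] at h
    obtain ⟨rfl, rfl⟩ := Prod.mk.inj h
    simp [curve, hj]
  obtain ⟨c, rfl⟩ := Nat.exists_eq_add_of_le (not_lt.1 hj)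
  rw [partner_shift] at h
  obtain ⟨rfl, rfl⟩ := Prod.mk.inj h
  obtain ⟨d, hd, hd'⟩ := hu.wd_add hs b
  obtain ⟨hm, rfl⟩ := List.getElem?_eq_some_iff.1 hs
  have hlt : ∀ b c, c < u.wd n (m + b.toNat) →
      (partner u[m].1 u[m].2 (b, c)).2 < u.wd n (m + (partner u[m].1 u[m].2 (b, c)).1.toNat) := by
    intro b c hc
    obtain ⟨d, hd, hd'⟩ := hu.wd_add hs b
    rcases cases_point u[m].1 u[m].2 (b, c) with h | ⟨b', t, h⟩ | ⟨b', s, h, he⟩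
    · rw [partner_of_lt _ _ h]
      simp only at h ⊢
      omega
    · obtain ⟨rfl, rfl⟩ := Prod.mk.inj h
      rw [partner_right]
      simp only
      omega
    · obtain ⟨rfl, rfl⟩ := Prod.mk.inj h
      have hs1 : ∀ s : Bool, s.toNat ≤ 1 := by decide
      have := hs1 s
      have := hs1 (!s)
      generalize u[m].1 = q at *
      generalize u[m].2 = e at *
      rcases he with rfl | rfl | ⟨rfl, rfl⟩ | ⟨rfl, rfl⟩
      · rw [partner_hor]
        cases b <;> simp [inn, out] at hd ⊢ <;> omega
      · rw [partner_vert]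
        cases b <;> simp [inn, out] at hd hd' ⊢ <;> omega
      · rw [partner_cup]
        simp [out] at hd ⊢; omega
      · rw [partner_cap]
        simp [inn] at hd ⊢; omega
  by_cases hc : c < u.wd n (m + b.toNat)
  · have h1 := hlt b c hc
    have h2 := hu.exit_across ⟨m, hm⟩ b c hc
    simp only [curve, Nat.not_lt.2 (Nat.le_add_right i _), if_false, Nat.add_sub_cancel_left,
      hc, h1, if_true]
    rw [← h2]
    rfl
  · obtain ⟨t, rfl⟩ := Nat.exists_eq_add_of_le (not_lt.1 hc)
    have e : partner u[m].1 u[m].2 (b, u.wd n (m + b.toNat) + t) =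
        (!b, u.wd n (m + (!b).toNat) + t) := by
      rw [hd, hd', Nat.add_assoc _ d, Nat.add_assoc _ d, partner_right]
    rw [e]
    simp [curve]

theorem curve_eq {x y : ℕ × ℕ} (h : (u.shift i).LinkConn x y) :
    u.curve i n x = u.curve i n y := by
  induction h with
  | rel x y h => exact hu.curve_eq_of_link i h
  | refl x => rfl
  | symm x y _ ih => exact ih.symm
  | trans x y z _ _ ih1 ih2 => exact ih1.trans ih2

theorem linkConn_right (t : ℕ) {k : ℕ} (hk : k ≤ u.length) :
    (u.shift i).LinkConn (k, i + (u.wd n k + t)) (0, i + (n + t)) := by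
  induction k with
  | zero => exact Setoid.refl' _ _
  | succ k ih =>
    have hs : u[k]? = some u[k] := by simp
    obtain ⟨d, hd, hd'⟩ := hu.wd_add hs true
    refine Setoid.trans' _ ?_ (ih (by omega))
    refine linkConn_shift (x := (k + 1, u.wd n (k + 1) + t)) (y := (k, u.wd n k + t)) i
      (Link.linkConn ⟨k, true, false, u[k], hs, rfl, rfl, ?_⟩)
    change u.wd n (k + 1) = _ at hd
    change u.wd n k = _ at hd'
    simp only
    rw [hd, hd', Nat.add_assoc _ d, Nat.add_assoc _ d, partner_right]
    rfl

/-- Every point whose curve is not closed is connected to the boundary point that is determined by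
its curve. -/
theorem linkConn_of_curve {x y : ℕ × ℕ} (hx : x.1 ≤ u.length) (hy : y.1 ≤ u.length)
    (h : u.curve i n x = u.curve i n y) (hn : u.curve i n x ≠ .inr (.inl none)) :
    (u.shift i).LinkConn x y := by
  have hcases : ∀ x : ℕ × ℕ, x.2 < i ∨ (∃ c < u.wd n x.1, x = (x.1, i + c)) ∨
      ∃ t, x = (x.1, i + (u.wd n x.1 + t)) := by
    rintro ⟨k, j⟩
    by_cases hj : j < i
    · exact Or.inl hj
    obtain ⟨c, rfl⟩ := Nat.exists_eq_add_of_le (not_lt.1 hj)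
    by_cases hc : c < u.wd n k
    · exact Or.inr (Or.inl ⟨c, hc, rfl⟩)
    obtain ⟨t, rfl⟩ := Nat.exists_eq_add_of_le (not_lt.1 hc)
    exact Or.inr (Or.inr ⟨t, rfl⟩)
  have c1 : ∀ k j, j < i → u.curve i n (k, j) = .inl j := fun k j hj => by simp [curve, hj]
  have c2 : ∀ k c, c < u.wd n k → u.curve i n (k, i + c) = .inr (.inl (u.exit (k, c))) :=
    fun k c hc => by simp [curve, hc]
  have c3 : ∀ k t, u.curve i n (k, i + (u.wd n k + t)) = .inr (.inr t) :=
    fun k t => by simp [curve]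
  obtain ⟨k, j⟩ := x
  obtain ⟨k', j'⟩ := y
  simp only at hx hy
  rcases hcases (k, j) with hj | ⟨c, hc, hxc⟩ | ⟨t, hxt⟩
  · rw [c1 _ _ hj] at h
    rcases hcases (k', j') with hj' | ⟨c', hc', hyc⟩ | ⟨t', hyt⟩
    · rw [c1 _ _ hj'] at h
      cases h
      exact Setoid.trans' _ (linkConn_left i hj hx) (Setoid.symm' _ (linkConn_left i hj hy))
    · rw [hyc, c2 _ _ hc'] at h; cases h
    · rw [hyt, c3] at h; cases h
  · rw [hxc, c2 _ _ hc] at h hn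
    rcases hcases (k', j') with hj' | ⟨c', hc', hyc⟩ | ⟨t', hyt⟩
    · rw [c1 _ _ hj'] at h; cases h
    · rw [hyc, c2 _ _ hc'] at h
      rw [hxc, hyc]
      simp only [Sum.inr.injEq, Sum.inl.injEq] at h
      cases he : u.exit (k, c) with
      | none => simp only at he hn; rw [he] at hn; exact absurd rfl hn
      | some z =>
        refine linkConn_shift (x := (k, c)) (y := (k', c')) i
          (Setoid.trans' _ (linkConn_exit he) (Setoid.symm' _ (linkConn_exit ?_)))
        exact h.symm.trans he
    · rw [hyt, c3] at h; cases h
  · rw [hxt, c3] at h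
    rcases hcases (k', j') with hj' | ⟨c', hc', hyc⟩ | ⟨t', hyt⟩
    · rw [c1 _ _ hj'] at h; cases h
    · rw [hyc, c2 _ _ hc'] at h; cases h
    · rw [hyt, c3] at h
      simp only [Sum.inr.injEq] at h
      subst h
      rw [hxt, hyt]
      exact Setoid.trans' _ (hu.linkConn_right i t hx) (Setoid.symm' _ (hu.linkConn_right i t hy))

theorem curve_bd_ne (x : Bool × ℕ) : u.curve i n (u.bd x) ≠ .inr (.inl none) := by
  obtain ⟨s, j⟩ := x
  have key : ∀ k, (j - i < u.wd n k → (u.exit (k, j - i)).isSome) →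
      u.curve i n (k, j) ≠ .inr (.inl none) := by
    intro k hk
    unfold curve
    split_ifs with h1 h2
    · exact fun h => by cases h
    · intro h
      have h3 := hk h2
      simp only [Sum.inr.injEq, Sum.inl.injEq] at h
      rw [h] at h3
      cases h3
    · exact fun h => by cases h
  exact key _ (hu.isSome s (j - i))

theorem linkConn_bd_iff (x y : Bool × ℕ) :
    (u.shift i).LinkConn ((u.shift i).bd x) ((u.shift i).bd y) ↔
      u.curve i n (u.bd x) = u.curve i n (u.bd y) := by
  rw [bd_shift, bd_shift]
  exact ⟨hu.curve_eq i, fun h => hu.linkConn_of_curve i (bd_le u x) (bd_le u y) h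
    (hu.curve_bd_ne i x)⟩

theorem exists_bd {x : ℕ × ℕ} (hx : x.1 ≤ u.length) (hn : u.curve i n x ≠ .inr (.inl none)) :
    ∃ z, (u.shift i).LinkConn x ((u.shift i).bd z) := by
  simp only [bd_shift]
  obtain ⟨k, j⟩ := x
  by_cases hj : j < i
  · exact ⟨(false, j), linkConn_left i hj hx⟩
  obtain ⟨c, rfl⟩ := Nat.exists_eq_add_of_le (not_lt.1 hj)
  by_cases hc : c < u.wd n k
  · have e : u.curve i n (k, i + c) = .inr (.inl (u.exit (k, c))) := by simp [curve, hc]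
    rw [e] at hn
    cases he : u.exit (k, c) with
    | none => rw [he] at hn; exact absurd rfl hn
    | some z =>
      refine ⟨(z.1, i + z.2), ?_⟩
      exact linkConn_shift i (linkConn_exit he)
  obtain ⟨t, rfl⟩ := Nat.exists_eq_add_of_le (not_lt.1 hc)
  exact ⟨(false, i + (n + t)), hu.linkConn_right i t hx⟩

end Checked

/-- This turns a finite computation on `n` strands into a statement for arbitrarily many strands on
both sides: the invariant `curve` determines which boundary points are joined, and it agrees for the
two stacks. -/
theorem SameExit.sameBd (h : SameExit u u' n) (i : ℕ) : SameBd (u.shift i) (u'.shift i) := by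
  obtain ⟨hu, hu', hw, he⟩ := h
  have hc : ∀ x, u.curve i n (u.bd x) = u'.curve i n (u'.bd x) := by
    rintro ⟨s, j⟩
    have e1 : u.wd n (if s then u.length else 0) = u'.wd n (if s then u'.length else 0) := by
      cases s
      · rfl
      · exact hw
    have key : ∀ k k', u.wd n k = u'.wd n k' →
        (j - i < u.wd n k → u.exit (k, j - i) = u'.exit (k', j - i)) →
        u.curve i n (k, j) = u'.curve i n (k', j) := by
      intro k k' e1 e2
      simp only [curve]
      rw [e1] at e2 ⊢
      split_ifs with h1 h2
      · rfl
      · rw [e2 h2]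
      · rfl
    exact key _ _ e1 (he s (j - i))
  intro x y
  rw [hu.linkConn_bd_iff i, hu'.linkConn_bd_iff i, hc, hc]

theorem AllExit.noCircle (h : u.AllExit n) (i : ℕ) : (u.shift i).NoCircle := by
  intro x hx
  rw [length_shift] at hx
  refine h.1.exists_bd i hx ?_
  unfold curve
  split_ifs with h1 h2
  · exact fun h => by cases h
  · have := h.2 x.1 hx (x.2 - i) h2
    intro h
    simp only [Sum.inr.injEq, Sum.inl.injEq] at h
    rw [h] at this
    cases this
  · exact fun h => by cases h

theorem CircleExit.oneCircle {y : ℕ × ℕ} (h : u.CircleExit n y) (i : ℕ) :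
    (u.shift i).OneCircle (y.1, i + y.2) := by
  obtain ⟨hu, h1, h2, h3, h4⟩ := h
  have hy : u.curve i n (y.1, i + y.2) = .inr (.inl none) := by
    simp [curve, h2, h3]
  refine ⟨by simpa using h1, fun z hz => ?_, fun x hx => ?_⟩
  · have := hu.curve_eq i hz
    rw [hy, bd_shift] at this
    exact hu.curve_bd_ne i z this
  · rw [length_shift] at hx
    by_cases hn : u.curve i n x = .inr (.inl none)
    · left
      obtain ⟨k, j⟩ := x
      unfold curve at hn
      split_ifs at hn with h5 h6 <;> simp only [Sum.inr.injEq, Sum.inl.injEq, reduceCtorEq] at hn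
      simp only at h5 h6 hn
      obtain ⟨c, rfl⟩ := Nat.exists_eq_add_of_le (not_lt.1 h5)
      rw [Nat.add_sub_cancel_left] at h6 hn
      rcases h4 k hx c h6 with h7 | ⟨m, -, h7⟩
      · rw [hn] at h7; cases h7
      · have := linkConn_iterate u m (k, c)
        rw [h7] at this
        exact linkConn_shift (x := (k, c)) i this
    · exact Or.inr (hu.exists_bd i hx hn)

end RWord

/-! ## Exchange of distant resolved pieces -/

namespace RWord

open RPiece

theorem linkConn_map {u u' : RWord} (θ : ℕ × ℕ → ℕ × ℕ)
    (h : ∀ x y, u.Link x y → u'.LinkConn (θ x) (θ y)) {x y : ℕ × ℕ} (hxy : u.LinkConn x y) :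
    u'.LinkConn (θ x) (θ y) := by
  induction hxy with
  | rel x y h' => exact h x y h'
  | refl x => exact Setoid.refl' _ _
  | symm x y _ ih => exact Setoid.symm' _ ih
  | trans x y z _ _ ih1 ih2 => exact Setoid.trans' _ ih1 ih2

/-- The number of strands at the bottom (`false`) or at the top (`true`) of a piece. -/
def strands (e : RPiece) (b : Bool) : ℕ := if b then e.out else e.inn

/-- Two distant pieces `S` at position `i` and `T` on its right, separated by `d` strands, `S` being
the lower one if `β` is `true` and the upper one if `β` is `false`. -/
def distant (i d : ℕ) (S T : RPiece) (β : Bool) : RWord :=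
  if β then [(i, S), (i + strands S true + d, T)] else [(i + strands S false + d, T), (i, S)]

section Distant

variable {i d : ℕ} {S T : RPiece} {β : Bool}

theorem length_distant : (distant i d S T β).length = 2 := by cases β <;> rfl

theorem linkConn_distant_left {b b' : Bool} {j j' : ℕ} (h : partner i S (b, j) = (b', j')) :
    (distant i d S T β).LinkConn ((!β).toNat + b.toNat, j) ((!β).toNat + b'.toNat, j') :=
  Link.linkConn ⟨(!β).toNat, b, b', (i, S), by cases β <;> rfl, rfl, rfl, h⟩

theorem linkConn_distant_right {b b' : Bool} {j j' : ℕ}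
    (h : partner (i + strands S β + d) T (b, j) = (b', j')) :
    (distant i d S T β).LinkConn (β.toNat + b.toNat, j) (β.toNat + b'.toNat, j') :=
  Link.linkConn ⟨β.toNat, b, b', (i + strands S β + d, T), by cases β <;> rfl, rfl, rfl, h⟩

theorem link_distant {x y : ℕ × ℕ} (h : (distant i d S T β).Link x y) : ∃ b b' j j',
    (x = ((!β).toNat + b.toNat, j) ∧ y = ((!β).toNat + b'.toNat, j') ∧
      partner i S (b, j) = (b', j')) ∨
    (x = (β.toNat + b.toNat, j) ∧ y = (β.toNat + b'.toNat, j') ∧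
      partner (i + strands S β + d) T (b, j) = (b', j')) := by
  obtain ⟨m, b, b', s, hs, hx, hy, h⟩ := h
  refine ⟨b, b', x.2, y.2, ?_⟩
  have hm := (List.getElem?_eq_some_iff.1 hs).1
  rw [length_distant] at hm
  have hm' : m = (!β).toNat ∨ m = β.toNat := by cases β <;> simp <;> omega
  rcases hm' with rfl | rfl
  · left
    have : s = (i, S) := by
      cases β <;> simpa [distant] using hs.symm
    subst this
    exact ⟨Prod.ext hx rfl, Prod.ext hy rfl, h⟩
  · right
    have : s = (i + strands S β + d, T) := by
      cases β <;> simpa [distant] using hs.symm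
    subst this
    exact ⟨Prod.ext hx rfl, Prod.ext hy rfl, h⟩

/-- The points of a stack of two distant pieces, moved to the boundary. -/
def toBd (i d : ℕ) (S : RPiece) (β : Bool) (x : ℕ × ℕ) : ℕ × ℕ :=
  if x.1 = 1 then
    if x.2 < i + strands S β + d then (2 * β.toNat, x.2)
    else (2 * (!β).toNat, x.2 - strands S β + strands S (!β))
  else x

theorem partner_strands (b : Bool) (t : ℕ) :
    partner i S (b, i + strands S b + t) = (!b, i + strands S (!b) + t) := by
  have := partner_right i S b t
  cases b <;> exact this

/-- In the other stack the slice of `T` is at the other height and begins behind the other end of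
`S`. A point at `T` or to its right is matched with the same point there, after following a vertical
strand beside `S` if necessary. -/
theorem toBd_add (b : Bool) (c : ℕ) :
    (distant i d S T (!β)).LinkConn (toBd i d S β (β.toNat + b.toNat, i + strands S β + d + c))
      ((!β).toNat + b.toNat, i + strands S (!β) + d + c) := by
  by_cases hb : b = β
  · subst hb
    have e : toBd i d S b (b.toNat + b.toNat, i + strands S b + d + c) =
        (b.toNat + b.toNat, i + strands S b + d + c) := by
      cases b <;> rfl
    rw [e]
    have h := linkConn_distant_left (d := d) (T := T) (β := !b)
      (partner_strands (i := i) (S := S) b (d + c))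
    simp only [Bool.not_not, ← Nat.add_assoc] at h
    rwa [Nat.add_comm (!b).toNat]
  · obtain rfl : b = !β := by cases b <;> cases β <;> simp_all
    have e : toBd i d S β (β.toNat + (!β).toNat, i + strands S β + d + c) =
        (2 * (!β).toNat, i + strands S (!β) + d + c) := by
      have h1 : β.toNat + (!β).toNat = 1 := by cases β <;> rfl
      simp only [toBd, h1, if_true]
      rw [if_neg (by omega)]
      congr 1
      omega
    rw [e, two_mul]

theorem toBd_of_lt {b : Bool} {j : ℕ} (hj : j < i + strands S b + d) :
    (distant i d S T (!β)).LinkConn (toBd i d S β ((!β).toNat + b.toNat, j))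
      (β.toNat + b.toNat, j) := by
  by_cases hb : b = β
  · subst hb
    have h1 : (!b).toNat + b.toNat = 1 := by cases b <;> rfl
    have e : toBd i d S b ((!b).toNat + b.toNat, j) = (b.toNat + b.toNat, j) := by
      simp only [toBd, h1, if_true, if_pos hj, two_mul]
    rw [e]
  · obtain rfl : b = !β := by cases b <;> cases β <;> simp_all
    have e : toBd i d S β ((!β).toNat + (!β).toNat, j) = ((!β).toNat + (!β).toNat, j) := by
      cases β <;> rfl
    rw [e]
    have h := linkConn_distant_right (i := i) (d := d) (S := S) (T := T) (β := !β)
      (partner_of_lt (i + strands S (!β) + d) T (x := (!β, j)) hj)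
    simp only [Bool.not_not] at h
    rwa [Nat.add_comm β.toNat]

theorem partner_lt {b b' : Bool} {j j' : ℕ} (h : partner i S (b, j) = (b', j'))
    (hj : j < i + strands S b + d) : j' < i + strands S b' + d := by
  by_contra hn
  obtain ⟨t, rfl⟩ := Nat.exists_eq_add_of_le (not_lt.1 hn)
  have h' := congrArg (partner i S) h
  rw [partner_partner, Nat.add_assoc, partner_strands] at h'
  obtain ⟨rfl, rfl⟩ := Prod.mk.inj h'
  omega

/-- The two stacks have the same bottom and top lines. A point on the line between the slices is
pushed along a vertical strand to one of these, and then every arc of one stack becomes a path in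
the other. -/
theorem linkConn_toBd {x y : ℕ × ℕ} (h : (distant i d S T β).LinkConn x y) :
    (distant i d S T (!β)).LinkConn (toBd i d S β x) (toBd i d S β y) := by
  refine linkConn_map (toBd i d S β) (fun x y hl => ?_) h
  clear h
  obtain ⟨b, b', j, j', ⟨rfl, rfl, h⟩ | ⟨rfl, rfl, h⟩⟩ := link_distant hl
  · by_cases hj : j < i + strands S b + d
    · have h' := linkConn_distant_left (d := d) (T := T) (β := !β) h
      rw [Bool.not_not] at h'
      exact Setoid.trans' _ (Setoid.trans' _ (toBd_of_lt hj) h')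
        (Setoid.symm' _ (toBd_of_lt (partner_lt h hj)))
    · obtain ⟨t, rfl⟩ := Nat.exists_eq_add_of_le (not_lt.1 hj)
      rw [Nat.add_assoc, partner_strands] at h
      obtain ⟨rfl, rfl⟩ := Prod.mk.inj h
      have key : ∀ b : Bool, toBd i d S β ((!β).toNat + b.toNat, i + strands S b + (d + t)) =
          (2 * (!β).toNat, i + strands S (!β) + (d + t)) := by
        intro b
        by_cases hb : b = β
        · subst hb
          have h1 : (!b).toNat + b.toNat = 1 := by cases b <;> rfl
          simp only [toBd, h1, if_true]
          rw [if_neg (by omega)]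
          congr 1
          omega
        · obtain rfl : b = !β := by cases b <;> cases β <;> simp_all
          cases β <;> rfl
      rw [Nat.add_assoc, key, key]
  · by_cases hj : j < i + strands S β + d
    · rw [partner_of_lt (x := (b, j)) _ _ hj] at h
      obtain ⟨rfl, rfl⟩ := Prod.mk.inj h
      have key : ∀ b : Bool, toBd i d S β (β.toNat + b.toNat, j) = (2 * β.toNat, j) := by
        intro b
        by_cases hb : b = β
        · subst hb; cases b <;> rfl
        · obtain rfl : b = !β := by cases b <;> cases β <;> simp_all
          have h1 : β.toNat + (!β).toNat = 1 := by cases β <;> rfl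
          simp only [toBd, h1, if_true, if_pos hj]
      rw [key, key]
    · obtain ⟨c, rfl⟩ := Nat.exists_eq_add_of_le (not_lt.1 hj)
      have h0 := partner_shift (i + strands S β + d) 0 T b c
      rw [Nat.add_zero, h] at h0
      obtain ⟨hb', rfl⟩ := Prod.mk.inj h0
      have h1 := partner_shift (i + strands S (!β) + d) 0 T b c
      rw [Nat.add_zero, ← hb'] at h1
      exact Setoid.trans' _ (Setoid.trans' _ (toBd_add b c) (linkConn_distant_right h1))
        (Setoid.symm' _ (toBd_add b' _))

theorem linkConn_distant_bd {x y : Bool × ℕ}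
    (h : (distant i d S T β).LinkConn ((distant i d S T β).bd x) ((distant i d S T β).bd y)) :
    (distant i d S T (!β)).LinkConn ((distant i d S T (!β)).bd x)
      ((distant i d S T (!β)).bd y) := by
  have e : ∀ x, toBd i d S β ((distant i d S T β).bd x) = (distant i d S T (!β)).bd x := by
    rintro ⟨s, j⟩
    cases s <;> simp [toBd, bd, length_distant]
  have := linkConn_toBd h
  rwa [e, e] at this

theorem sameBd_distant : SameBd (distant i d S T false) (distant i d S T true) :=
  fun _ _ => ⟨linkConn_distant_bd, linkConn_distant_bd⟩

theorem noCircle_distant : (distant i d S T β).NoCircle := by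
  rintro ⟨k, j⟩ hk
  rw [length_distant] at hk
  simp only at hk
  have e0 : (distant i d S T β).bd (false, j) = (0, j) := rfl
  have e2 : ∀ j, (distant i d S T β).bd (true, j) = (2, j) := fun j => by
    simp [bd, length_distant]
  obtain rfl | rfl | rfl : k = 0 ∨ k = 1 ∨ k = 2 := by omega
  · exact ⟨(false, j), Setoid.refl' _ _⟩
  · by_cases hj : j < i + strands S β + d
    · refine ⟨(β, j), ?_⟩
      have := linkConn_distant_right (i := i) (d := d) (S := S) (β := β)
        (partner_of_lt (i + strands S β + d) T (x := (!β, j)) hj)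
      cases β
      · exact this
      · rw [e2]; exact this
    · obtain ⟨t, rfl⟩ := Nat.exists_eq_add_of_le (not_lt.1 hj)
      have h := linkConn_distant_left (d := d) (T := T) (β := β)
        (partner_strands (i := i) (S := S) β (d + t))
      refine ⟨(!β, i + strands S (!β) + (d + t)), ?_⟩
      rw [Nat.add_assoc]
      cases β
      · rw [Bool.not_false, e2]; exact h
      · exact h
  · exact ⟨(true, j), by rw [e2]⟩

end Distant

end RWord

/-! ## Counting crossings of a given sign -/

/-- `1` if the slice is a crossing whose sign is positive (`b = true`) or negative (`b = false`). -/
def Slice.sgn (e : Slice) (s : List Bool) (b : Bool) : ℕ :=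
  match e.kind with
  | .cross o => if (o == decide (s[e.pos]? = s[e.pos + 1]?)) = b then 1 else 0
  | _ => 0

/-- The number of crossings of a given sign in a stack. -/
def signCount : List Slice → List Bool → Bool → ℕ
  | [], _, _ => 0
  | e :: w, s, b => e.sgn s b + signCount w (e.next s) b

theorem runSlices_append (p q : List Slice) (s : List Bool) :
    runSlices (p ++ q) s = runSlices q (runSlices p s) := by
  simp [runSlices]

theorem runSlices_cons (e : Slice) (q : List Slice) (s : List Bool) :
    runSlices (e :: q) s = runSlices q (e.next s) := rfl

theorem signCount_append (p q : List Slice) (s : List Bool) (b : Bool) :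
    signCount (p ++ q) s b = signCount p s b + signCount q (runSlices p s) b := by
  induction p generalizing s with
  | nil => simp [signCount, runSlices]
  | cons e p ih =>
    rw [List.cons_append, signCount, signCount, ih, runSlices_cons, Nat.add_assoc]

theorem signCount_eq_sum (w : List Slice) (s : List Bool) (b : Bool) :
    signCount w s b = ∑ k : Fin w.length, w[k].sgn (runSlices (w.take k) s) b := by
  induction w generalizing s with
  | nil => simp [signCount]
  | cons e w ih =>
    rw [signCount, ih]
    simp only [List.length_cons]
    rw [Fin.sum_univ_succ]
    rfl

namespace AnnularDiagram

variable (D : AnnularDiagram)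

theorem card_crossing {P : D.Crossing → Prop} {b : Bool}
    (hP : ∀ c, P c ↔ D.word[c.1].sgn (D.level c.1) b = 1) :
    Nat.card {c // P c} = signCount D.word D.base b := by
  classical
  have hcross : ∀ k : Fin D.word.length, D.word[k].sgn (D.level k) b = 1 →
      D.word[k].kind.isCross = true := by
    intro k h
    unfold Slice.sgn at h
    cases hk : D.word[k].kind <;> simp only [hk] at h
    · omega
    · omega
    · rfl
  have e : {c // P c} ≃ {k : Fin D.word.length // D.word[k].sgn (D.level k) b = 1} :=
    { toFun := fun c => ⟨c.1.1, (hP _).1 c.2⟩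
      invFun := fun k => ⟨⟨k.1, hcross _ k.2⟩, (hP _).2 k.2⟩
      left_inv := fun _ => rfl
      right_inv := fun _ => rfl }
  rw [Nat.card_congr e, Nat.card_eq_fintype_card, Fintype.card_subtype, Finset.card_filter,
    signCount_eq_sum]
  refine Finset.sum_congr rfl fun k _ => ?_
  change (if D.word[k].sgn (D.level k) b = 1 then 1 else 0) = D.word[k].sgn (D.level k) b
  have : D.word[k].sgn (D.level k) b = 0 ∨ D.word[k].sgn (D.level k) b = 1 := by
    unfold Slice.sgn
    split
    · split_ifs <;> simp
    · simp
  rcases this with h | h <;> rw [h] <;> rfl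

theorem positive_iff (c : D.Crossing) (b : Bool) :
    (b = true ↔ D.Positive c) ↔ D.word[c.1].sgn (D.level c.1) b = 1 := by
  unfold Positive Slice.sgn
  have hc := c.2
  cases hk : D.word[c.1].kind with
  | cup a => rw [hk] at hc; cases hc
  | cap => rw [hk] at hc; cases hc
  | cross o =>
    simp only
    by_cases h : (D.level c.1)[D.word[c.1].pos]? = (D.level c.1)[D.word[c.1].pos + 1]? <;>
      cases o <;> cases b <;> simp only [h] <;> decide

theorem nPlus_eq : D.nPlus = signCount D.word D.base true := by
  unfold nPlus
  rw [D.card_crossing (b := true)]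
  intro c
  rw [← positive_iff]
  simp

theorem nMinus_eq : D.nMinus = signCount D.word D.base false := by
  unfold nMinus
  rw [D.card_crossing (b := false)]
  intro c
  rw [← positive_iff]
  simp

end AnnularDiagram

/-! ## Resolutions of stacks -/

/-- The resolution of a stack of slices. -/
def resolve (ρ : ℕ → Bool) (w : List Slice) : RWord :=
  w.mapIdx fun k s => (s.pos, s.kind.res (ρ k))

@[simp] theorem length_resolve (ρ : ℕ → Bool) (w : List Slice) :
    (resolve ρ w).length = w.length := by
  simp [resolve]

theorem resolve_append (ρ : ℕ → Bool) (p q : List Slice) :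
    resolve ρ (p ++ q) = resolve ρ p ++ resolve (fun k => ρ (p.length + k)) q := by
  simp [resolve, List.mapIdx_append, Nat.add_comm]

theorem resolve_congr {ρ ρ' : ℕ → Bool} {w : List Slice} (h : ∀ k < w.length, ρ k = ρ' k) :
    resolve ρ w = resolve ρ' w := by
  unfold resolve
  refine List.mapIdx_eq_mapIdx_iff.2 fun k hk => ?_
  rw [h k hk]

/-! ## Diagrams that differ in one part of the stack -/

/-- Two diagrams that differ by the replacement of a part `u` of the stack by `u'`. -/
structure Patch (D D' : AnnularDiagram) where
  p : List Slice
  u : List Slice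
  u' : List Slice
  r : List Slice
  hD : D.word = p ++ u ++ r
  hD' : D'.word = p ++ u' ++ r
  base : D'.base = D.base
  run : runSlices u' (runSlices p D.base) = runSlices u (runSlices p D.base)

theorem RWord.Closed.iff_of_conn {w : RWord} {V : ℕ × ℕ → Prop} (hV : w.Closed V) {x y : ℕ × ℕ}
    (h : w.Conn x y) : V x ↔ V y := by
  induction h with
  | rel x y h => exact hV.iff x y h
  | refl x => exact Iff.rfl
  | symm x y _ ih => exact ih.symm
  | trans x y z _ _ ih1 ih2 => exact ih1.trans ih2

namespace Patch

open AnnularDiagram RWord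

variable {D D' : AnnularDiagram} (P : Patch D D') {k : ℕ}

/-- The patch in the opposite direction. -/
def symm : Patch D' D where
  p := P.p
  u := P.u'
  u' := P.u
  r := P.r
  hD := P.hD'
  hD' := P.hD
  base := P.base.symm
  run := by rw [P.base, P.run]

/-- The position of an outer point. -/
def pos (o : Bool × ℕ × ℕ) : ℕ × ℕ :=
  if o.1 then sh (P.p.length + P.u.length) o.2 else o.2

/-- The heights of the outer points. -/
def IsOut (o : Bool × ℕ × ℕ) : Prop := o.2.1 ≤ if o.1 then P.r.length else P.p.length

theorem level_low (hk : k ≤ P.p.length) :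
    D.level k = runSlices (P.p.take k) D.base := by
  unfold level
  rw [P.hD, List.append_assoc, List.take_append_of_le_length hk]

theorem level_high (k : ℕ) : D.level (P.p.length + P.u.length + k) =
    runSlices (P.r.take k) (runSlices P.u (runSlices P.p D.base)) := by
  unfold level
  rw [P.hD, ← List.length_append, List.take_length_add_append, runSlices_append, runSlices_append]

theorem level_pos {o : Bool × ℕ × ℕ} (ho : P.IsOut o) :
    D.level (P.pos o).1 = D'.level (P.symm.pos o).1 := by
  obtain ⟨b, k, j⟩ := o
  cases b
  · have hk : k ≤ P.p.length := ho
    have h1 := P.level_low hk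
    have h2 := P.symm.level_low hk
    change D.level k = D'.level k
    rw [h1, h2, P.base]
    rfl
  · have h1 := P.level_high k
    have h2 := P.symm.level_high k
    change D.level (P.p.length + P.u.length + k) =
      D'.level (P.symm.p.length + P.symm.u.length + k)
    rw [h1, h2, P.base]
    change _ = runSlices (P.r.take k) (runSlices P.u' (runSlices P.p D.base))
    rw [P.run]

theorem pos_le {o : Bool × ℕ × ℕ} (ho : P.IsOut o) : (P.pos o).1 ≤ D.word.length := by
  obtain ⟨b, k, j⟩ := o
  rw [P.hD]
  cases b
  · have hk : k ≤ P.p.length := ho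
    simp [pos]; omega
  · have hk : k ≤ P.r.length := ho
    simp [pos, sh]; omega

theorem valid_pos {o : Bool × ℕ × ℕ} (ho : P.IsOut o) :
    D.Valid (P.pos o) ↔ D'.Valid (P.symm.pos o) := by
  have h1 := P.pos_le ho
  have h2 := P.symm.pos_le ho
  have h3 := P.level_pos ho
  have h4 : (P.pos o).2 = (P.symm.pos o).2 := by
    obtain ⟨b, k, j⟩ := o
    cases b <;> rfl
  unfold Valid
  rw [h3, h4]
  simp [h1, h2]

/-- The points outside of the replaced part. -/
def Out : Type := {o : Bool × ℕ × ℕ // P.IsOut o ∧ D.Valid (P.pos o)}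

/-- The outer points of the first diagram. -/
def left (o : P.Out) : D.cube.X := (⟨P.pos o.1, o.2.2⟩ : {x // D.Valid x})

/-- The outer points of the second diagram. -/
def right (o : P.Out) : D'.cube.X :=
  (⟨P.symm.pos o.1, (P.valid_pos o.2.1).1 o.2.2⟩ : {x // D'.Valid x})

/-- The outer points on the cutting ray. -/
def Ray (o : P.Out) : Prop := o.1.1 = false ∧ o.1.2.1 = 0

instance : Finite P.Out := by
  refine Finite.of_injective (fun o : P.Out => (o.1.1, P.left o)) ?_
  rintro ⟨⟨b, k, j⟩, h⟩ ⟨⟨b', k', j'⟩, h'⟩ he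
  simp only [Prod.mk.injEq] at he
  obtain ⟨rfl, he⟩ := he
  have he := congrArg Subtype.val he
  cases b <;> simp [left, pos, sh] at he ⊢ <;> (obtain ⟨h1, h2⟩ := he; subst h1 h2; rfl)

/-- The resolution of the replaced part. -/
noncomputable def inner (α : Finset D.Crossing) : RWord :=
  resolve (fun k => D.res α (P.p.length + k)) P.u

theorem rword_eq (α : Finset D.Crossing) : D.rword α = resolve (D.res α) P.p ++ P.inner α ++
    resolve (fun k => D.res α (P.p.length + P.u.length + k)) P.r := by
  change resolve _ D.word = _
  rw [P.hD, resolve_append, resolve_append]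
  simp only [List.length_append]
  rfl

theorem length_inner (α : Finset D.Crossing) : (P.inner α).length = P.u.length := by
  simp [inner]

theorem outer_eq_pos (α : Finset D.Crossing) (o : Bool × ℕ × ℕ) :
    outer (resolve (D.res α) P.p) (P.inner α) o = P.pos o := by
  simp [outer, pos, length_inner]

theorem isOuter_iff (ρ ρ' : ℕ → Bool) (o : Bool × ℕ × ℕ) :
    IsOuter (resolve ρ P.p) (resolve ρ' P.r) o ↔ P.IsOut o := by
  simp [IsOuter, IsOut]

/-- The resolutions of the two diagrams agree outside of the replaced part. -/
def Agree (α : Finset D.Crossing) (α' : Finset D'.Crossing) : Prop :=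
  (∀ k < P.p.length, D.res α k = D'.res α' k) ∧
    ∀ k < P.r.length, D.res α (P.p.length + P.u.length + k) =
      D'.res α' (P.p.length + P.u'.length + k)

/-- The outer resolutions are the same and the inner ones join the same boundary points, which is
all that connectivity of outer points depends on. -/
theorem rel_iff {α : Finset D.Crossing} {α' : Finset D'.Crossing} (h : P.Agree α α')
    (hs : SameBd (P.inner α) (P.symm.inner α')) (a b : P.Out) :
    D.cube.E α (P.left a) (P.left b) ↔ D'.cube.E α' (P.right a) (P.right b) := by
  change (D.rword α).Conn (P.pos a.1) (P.pos b.1) ↔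
    (D'.rword α').Conn (P.symm.pos a.1) (P.symm.pos b.1)
  rw [P.rword_eq, P.symm.rword_eq, ← P.outer_eq_pos α, ← P.outer_eq_pos α,
    ← P.symm.outer_eq_pos α', ← P.symm.outer_eq_pos α']
  have e1 : resolve (D'.res α') P.symm.p = resolve (D.res α) P.p :=
    resolve_congr fun k hk => (h.1 k hk).symm
  have e2 : resolve (fun k => D'.res α' (P.symm.p.length + P.symm.u.length + k)) P.symm.r =
      resolve (fun k => D.res α (P.p.length + P.u.length + k)) P.r :=
    resolve_congr fun k hk => (h.2 k hk).symm
  rw [e1, e2]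
  exact conn_outer_congr hs ((P.isOuter_iff _ _ _).2 a.2.1) ((P.isOuter_iff _ _ _).2 b.2.1)

theorem exists_left_of_conn {α : Finset D.Crossing} {x : D.cube.X} {o : Bool × ℕ × ℕ}
    (ho : P.IsOut o) (h : (D.rword α).Conn x.1 (P.pos o)) :
    ∃ o : P.Out, D.cube.E α x (P.left o) :=
  ⟨⟨o, ho, ((D.closed_valid α).iff_of_conn h).1 x.2⟩, h⟩

theorem exists_left_of_noCircle {α : Finset D.Crossing} (h : (P.inner α).NoCircle)
    (x : D.cube.X) : ∃ o : P.Out, D.cube.E α x (P.left o) := by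
  have hx := (D.closed_valid α).le x.1 x.2
  rw [P.rword_eq] at hx
  obtain ⟨o, ho, hc⟩ := h.exists_outer hx
  rw [← P.rword_eq, P.outer_eq_pos] at hc
  exact P.exists_left_of_conn ((P.isOuter_iff _ _ _).1 ho) hc

theorem isolated_of_oneCircle {α : Finset D.Crossing} {y : ℕ × ℕ} (h : (P.inner α).OneCircle y)
    {z : D.cube.X} (hz : z.1 = sh P.p.length y) : Isolated (D.cube.E α) P.left z where
  not_rel o ho := by
    have := h.not_conn_outer ((P.isOuter_iff (D.res α)
      (fun k => D.res α (P.p.length + P.u.length + k)) _).2 o.2.1)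
    rw [← P.rword_eq, P.outer_eq_pos, length_resolve, ← hz] at this
    exact this ho
  cover x := by
    have hx := (D.closed_valid α).le x.1 x.2
    rw [P.rword_eq] at hx
    rcases h.exists_outer hx with hc | ⟨o, ho, hc⟩
    · rw [← P.rword_eq, length_resolve, ← hz] at hc
      exact Or.inl hc
    · rw [← P.rword_eq, P.outer_eq_pos] at hc
      exact Or.inr (P.exists_left_of_conn ((P.isOuter_iff _ _ _).1 ho) hc)

theorem ray_iff (x : D.cube.X) : D.cube.W x ↔ ∃ o, P.Ray o ∧ P.left o = x := by
  constructor
  · intro hx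
    have hx : x.1.1 = 0 := hx
    have e : P.pos (false, x.1) = x.1 := rfl
    refine ⟨⟨(false, x.1), by simp [IsOut, hx], by rw [e]; exact x.2⟩, ⟨rfl, hx⟩, rfl⟩
  · rintro ⟨⟨⟨b, k, j⟩, h⟩, ⟨h1, h2⟩, rfl⟩
    simp only at h1 h2
    subst h1 h2
    rfl

theorem ray_inj (o o' : P.Out) (h : P.Ray o) (h' : P.Ray o') (he : P.left o = P.left o') :
    o = o' := by
  obtain ⟨⟨b, k, j⟩, ho⟩ := o
  obtain ⟨⟨b', k', j'⟩, ho'⟩ := o'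
  obtain ⟨rfl, rfl⟩ := h
  obtain ⟨h1, h2⟩ := h'
  simp only at h1 h2
  subst h1 h2
  have he := congrArg (fun x => x.1.2) he
  have he : j = j' := he
  subst he
  rfl

/-- The view of the first diagram from the outer points, in which the resolutions of the replaced
part may contain a closed curve. -/
def view (circ : Finset D.Crossing → Prop) (y : ℕ × ℕ) (z : (∃ α, circ α) → D.cube.X)
    (hz : ∀ h, (z h).1 = sh P.p.length y) (h0 : ∀ α, ¬ circ α → (P.inner α).NoCircle)
    (h1 : ∀ α, circ α → (P.inner α).OneCircle y) : D.cube.View P.Out P.Ray where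
  φ := P.left
  circ := circ
  y := z
  full α h := P.exists_left_of_noCircle (h0 α h)
  isolated α h := P.isolated_of_oneCircle (h1 α h) (hz _)
  ray := P.ray_iff
  ray_inj := P.ray_inj

/-- The outer points, as outer points of the second diagram. -/
def outSymm (o : P.Out) : P.symm.Out := ⟨o.1, o.2.1, (P.valid_pos o.2.1).1 o.2.2⟩

theorem outSymm_surjective : Function.Surjective P.outSymm := fun o =>
  ⟨⟨o.1, o.2.1, (P.valid_pos o.2.1).2 o.2.2⟩, rfl⟩

/-- The view of the second diagram. -/
def view' (circ : Finset D'.Crossing → Prop) (y : ℕ × ℕ) (z : (∃ α, circ α) → D'.cube.X)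
    (hz : ∀ h, (z h).1 = sh P.p.length y) (h0 : ∀ α, ¬ circ α → (P.symm.inner α).NoCircle)
    (h1 : ∀ α, circ α → (P.symm.inner α).OneCircle y) : D'.cube.View P.Out P.Ray where
  φ := P.right
  circ := circ
  y := z
  full α h x := by
    obtain ⟨o, ho⟩ := P.symm.exists_left_of_noCircle (h0 α h) x
    obtain ⟨o, rfl⟩ := P.outSymm_surjective o
    exact ⟨o, ho⟩
  isolated α h := by
    have := P.symm.isolated_of_oneCircle (h1 α h) (hz ⟨α, h⟩)
    refine ⟨fun o => this.not_rel (P.outSymm o), fun x => ?_⟩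
    rcases this.cover x with hx | ⟨o, ho⟩
    · exact Or.inl hx
    · obtain ⟨o, rfl⟩ := P.outSymm_surjective o
      exact Or.inr ⟨o, ho⟩
  ray x := by
    rw [P.symm.ray_iff]
    constructor
    · rintro ⟨o, ho, h⟩
      obtain ⟨o, rfl⟩ := P.outSymm_surjective o
      exact ⟨o, ho, h⟩
    · rintro ⟨o, ho, h⟩
      exact ⟨P.outSymm o, ho, h⟩
  ray_inj o o' h h' he := by
    have := P.symm.ray_inj (P.outSymm o) (P.outSymm o') h h' he
    exact Subtype.ext (congrArg (fun o : P.symm.Out => o.1) this)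

theorem view_A_eq {circ : Finset D.Crossing → Prop} {y : ℕ × ℕ} {z : (∃ α, circ α) → D.cube.X}
    {hz : ∀ h, (z h).1 = sh P.p.length y} {h0 : ∀ α, ¬ circ α → (P.inner α).NoCircle}
    {h1 : ∀ α, circ α → (P.inner α).OneCircle y}
    {circ' : Finset D'.Crossing → Prop} {y' : ℕ × ℕ} {z' : (∃ α, circ' α) → D'.cube.X}
    {hz' : ∀ h, (z' h).1 = sh P.p.length y'} {h0' : ∀ α, ¬ circ' α → (P.symm.inner α).NoCircle}
    {h1' : ∀ α, circ' α → (P.symm.inner α).OneCircle y'}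
    {α : Finset D.Crossing} {α' : Finset D'.Crossing} (h : P.Agree α α')
    (hs : SameBd (P.inner α) (P.symm.inner α')) :
    (P.view circ y z hz h0 h1).A α = (P.view' circ' y' z' hz' h0' h1').A α' := by
  ext a b
  exact P.rel_iff h hs a b

theorem nPlus_sub : D'.nPlus - D.nPlus = (signCount P.u' (D.level P.p.length) true : ℤ) -
    signCount P.u (D.level P.p.length) true := by
  rw [nPlus_eq, nPlus_eq, P.level_low le_rfl, List.take_length, P.hD, P.hD']
  simp only [signCount_append, runSlices_append, P.base, P.run]
  push_cast
  ring

theorem nMinus_sub : D'.nMinus - D.nMinus = (signCount P.u' (D.level P.p.length) false : ℤ) -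
    signCount P.u (D.level P.p.length) false := by
  rw [nMinus_eq, nMinus_eq, P.level_low le_rfl, List.take_length, P.hD, P.hD']
  simp only [signCount_append, runSlices_append, P.base, P.run]
  push_cast
  ring

/-- The position of a crossing of the second diagram in the first one, where the crossings of the
replaced part are moved by `σ`. -/
def index (σ : ℕ → ℕ) (m : ℕ) : ℕ :=
  if m < P.p.length then m
  else if m < P.p.length + P.u'.length then P.p.length + σ (m - P.p.length)
  else m - P.u'.length + P.u.length

/-- The crossings of `u'` are moved to crossings of `u`. -/
structure IndexMap (σ : ℕ → ℕ) : Prop where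
  lt : ∀ a < P.u'.length, σ a < P.u.length
  inj : ∀ a < P.u'.length, ∀ b < P.u'.length, σ a = σ b → a = b
  cross : ∀ a < P.u'.length, (P.u[σ a]?).map (·.kind.isCross) = (P.u'[a]?).map (·.kind.isCross)

variable {P} {σ : ℕ → ℕ} (hσ : P.IndexMap σ)
include hσ

theorem IndexMap.injective : Function.Injective (P.index σ) := by
  intro a b h
  unfold index at h
  have h1 := hσ.lt (a - P.p.length)
  have h2 := hσ.lt (b - P.p.length)
  have h3 := hσ.inj (a - P.p.length)
  split_ifs at h
  · exact h
  · omega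
  · omega
  · omega
  · have := h3 (by omega) (b - P.p.length) (by omega) (by omega)
    omega
  · omega
  · omega
  · omega
  · omega

omit hσ in
theorem index_low {k : ℕ} (hk : k < P.p.length) : P.index σ k = k := if_pos hk

omit hσ in
theorem index_mid {a : ℕ} (ha : a < P.u'.length) :
    P.index σ (P.p.length + a) = P.p.length + σ a := by
  unfold index
  rw [if_neg (by omega), if_pos (by omega), Nat.add_sub_cancel_left]

omit hσ in
theorem index_high (k : ℕ) :
    P.index σ (P.p.length + P.u'.length + k) = P.p.length + P.u.length + k := by
  unfold index
  rw [if_neg (by omega), if_neg (by omega)]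
  omega

theorem IndexMap.isCross (m : ℕ) : (D.word[P.index σ m]?).map (·.kind.isCross) =
    (D'.word[m]?).map (·.kind.isCross) := by
  rw [P.hD, P.hD']
  rcases Nat.lt_or_ge m P.p.length with h1 | h1
  · rw [index_low h1, List.append_assoc, List.append_assoc, List.getElem?_append_left h1,
      List.getElem?_append_left h1]
  obtain ⟨a, rfl⟩ := Nat.exists_eq_add_of_le h1
  rcases Nat.lt_or_ge a P.u'.length with h2 | h2
  · have := hσ.lt a h2
    rw [index_mid h2, List.append_assoc, List.append_assoc,
      List.getElem?_append_right (by omega : P.p.length ≤ P.p.length + σ a),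
      List.getElem?_append_right (by omega : P.p.length ≤ P.p.length + a),
      List.getElem?_append_left (by omega), List.getElem?_append_left (by omega)]
    simp only [Nat.add_sub_cancel_left]
    exact hσ.cross a h2
  · obtain ⟨k, rfl⟩ := Nat.exists_eq_add_of_le h2
    rw [← Nat.add_assoc, index_high, List.getElem?_append_right (by simp),
      List.getElem?_append_right (by simp)]
    simp

omit hσ in
theorem _root_.AnnularDiagram.isCross_iff (D : AnnularDiagram) (k : ℕ) :
    (D.word[k]?).map (·.kind.isCross) = some true ↔ ∃ c : D.Crossing, (c.1 : ℕ) = k := by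
  constructor
  · intro h
    obtain ⟨s, hs, h⟩ := Option.map_eq_some_iff.1 h
    obtain ⟨hk, rfl⟩ := List.getElem?_eq_some_iff.1 hs
    exact ⟨⟨⟨k, hk⟩, h⟩, rfl⟩
  · rintro ⟨c, rfl⟩
    have := c.2
    simp only [Fin.getElem_fin] at this
    simp [this]

theorem IndexMap.exists_crossing (c : D'.Crossing) :
    ∃ c' : D.Crossing, (c'.1 : ℕ) = P.index σ c.1 := by
  rw [← D.isCross_iff, hσ.isCross, D'.isCross_iff]
  exact ⟨c, rfl⟩

/-- The crossings of the second diagram as crossings of the first one. -/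
noncomputable def IndexMap.emb : D'.Crossing ↪ D.Crossing where
  toFun c := (hσ.exists_crossing c).choose
  inj' c c' h := by
    have h := congrArg (fun c : D.Crossing => (c.1 : ℕ)) h
    simp only [(hσ.exists_crossing c).choose_spec, (hσ.exists_crossing c').choose_spec] at h
    exact Subtype.ext (Fin.ext (hσ.injective h))

theorem IndexMap.emb_val (c : D'.Crossing) : ((hσ.emb c).1 : ℕ) = P.index σ c.1 :=
  (hσ.exists_crossing c).choose_spec

theorem IndexMap.exists_emb_iff (c : D.Crossing) :
    (∃ c', hσ.emb c' = c) ↔ ∃ m, P.index σ m = c.1 := by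
  constructor
  · rintro ⟨c', rfl⟩
    exact ⟨c'.1, (hσ.emb_val c').symm⟩
  · rintro ⟨m, hm⟩
    have h := (D.isCross_iff c.1).2 ⟨c, rfl⟩
    rw [← hm, hσ.isCross, D'.isCross_iff] at h
    obtain ⟨c', rfl⟩ := h
    exact ⟨c', Subtype.ext (Fin.ext ((hσ.emb_val c').trans hm))⟩

theorem IndexMap.res_map (α' : Finset D'.Crossing) (m : ℕ) :
    D.res (α'.map hσ.emb) (P.index σ m) = D'.res α' m := by
  unfold AnnularDiagram.res
  rw [decide_eq_decide]
  constructor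
  · rintro ⟨c, hc, h⟩
    obtain ⟨c', hc', rfl⟩ := Finset.mem_map.1 hc
    rw [hσ.emb_val] at h
    exact ⟨c', hc', hσ.injective h⟩
  · rintro ⟨c', hc', rfl⟩
    exact ⟨hσ.emb c', Finset.mem_map_of_mem _ hc', hσ.emb_val c'⟩

/-- Outside of the replaced part, `index` is just the shift of heights, so the transported set
prescribes the same resolutions there. -/
theorem IndexMap.agree_map (α' : Finset D'.Crossing) : P.Agree (α'.map hσ.emb) α' := by
  refine ⟨fun k hk => ?_, fun k _ => ?_⟩
  · rw [← hσ.res_map, index_low hk]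
  · rw [← hσ.res_map α', index_high]

omit hσ in
theorem Agree.insert {α : Finset D.Crossing} {α' : Finset D'.Crossing} (h : P.Agree α α')
    {c : D.Crossing} {a : ℕ} (ha : a < P.u.length) (hc : (c.1 : ℕ) = P.p.length + a) :
    P.Agree (insert c α) α' := by
  refine ⟨fun k hk => ?_, fun k hk => ?_⟩
  · rw [D.res_insert, if_neg (by omega)]
    exact h.1 k hk
  · rw [D.res_insert, if_neg (by omega)]
    exact h.2 k hk

end Patch

/-! ## Directions and signs in local moves -/

/-- The stack can be put on top of strands with directions `s`. -/
def AdmStack : List Slice → List Bool → Prop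
  | [], _ => True
  | e :: w, s => e.Admissible s ∧ AdmStack w (e.next s)

theorem admStack_append {p q : List Slice} {s : List Bool} :
    AdmStack (p ++ q) s ↔ AdmStack p s ∧ AdmStack q (runSlices p s) := by
  induction p generalizing s with
  | nil => simp [AdmStack, runSlices]
  | cons e p ih => rw [List.cons_append, AdmStack, AdmStack, ih, runSlices_cons, and_assoc]

theorem admStack_of_forall {w : List Slice} {s : List Bool}
    (h : ∀ k (hk : k < w.length), w[k].Admissible (runSlices (w.take k) s)) : AdmStack w s := by
  induction w generalizing s with
  | nil => trivial
  | cons e w ih =>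
    refine ⟨h 0 (by simp), ih fun k hk => ?_⟩
    have := h (k + 1) (by simpa using hk)
    simpa [runSlices_cons] using this

theorem AnnularDiagram.admStack (D : AnnularDiagram) : AdmStack D.word D.base :=
  admStack_of_forall D.admissible

/-- The stack with `i` additional strands on the left. -/
def shiftStack (i : ℕ) (u : List Slice) : List Slice := u.map fun e => ⟨i + e.pos, e.kind⟩

section Shift

variable (A l : List Bool) (e : Slice)

theorem next_shift : Slice.next ⟨A.length + e.pos, e.kind⟩ (A ++ l) = A ++ e.next l := by
  obtain ⟨a, k⟩ := e
  have h1 : ∀ a, (A ++ l).take (A.length + a) = A ++ l.take a := fun a => by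
    simp [List.take_append]
  have h2 : ∀ a, (A ++ l).drop (A.length + a) = l.drop a := fun a => by
    rw [← List.drop_drop, List.drop_left]
  cases k <;> simp only [Slice.next, h1, h2, Nat.add_assoc, List.append_assoc]

theorem getElem?_shift (a : ℕ) : (A ++ l)[A.length + a]? = l[a]? := by
  rw [List.getElem?_append_right (by omega), Nat.add_sub_cancel_left]

theorem sgn_shift (b : Bool) :
    Slice.sgn ⟨A.length + e.pos, e.kind⟩ (A ++ l) b = e.sgn l b := by
  unfold Slice.sgn
  simp only [getElem?_shift, Nat.add_assoc]

theorem admissible_shift :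
    Slice.Admissible ⟨A.length + e.pos, e.kind⟩ (A ++ l) ↔ e.Admissible l := by
  unfold Slice.Admissible
  simp only [getElem?_shift, Nat.add_assoc, List.length_append]
  cases e.kind <;> simp

theorem runSlices_shift (u : List Slice) :
    runSlices (shiftStack A.length u) (A ++ l) = A ++ runSlices u l := by
  induction u generalizing l with
  | nil => rfl
  | cons e u ih =>
    rw [runSlices_cons, ← ih, ← next_shift]
    rfl

theorem signCount_shift (u : List Slice) (b : Bool) :
    signCount (shiftStack A.length u) (A ++ l) b = signCount u l b := by
  induction u generalizing l with
  | nil => rfl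
  | cons e u ih =>
    rw [signCount, ← ih, ← sgn_shift A, ← next_shift]
    rfl

theorem admStack_shift (u : List Slice) :
    AdmStack (shiftStack A.length u) (A ++ l) ↔ AdmStack u l := by
  induction u generalizing l with
  | nil => rfl
  | cons e u ih =>
    rw [AdmStack, ← ih, ← admissible_shift A, ← next_shift]
    rfl

end Shift

/-- The stacks `u` and `u'` lead to the same directions, and `u` has `a` positive and `b` negative
crossings more than `u'`. -/
structure SameRun (u u' : List Slice) (a b : ℕ) (s : List Bool) : Prop where
  run : runSlices u' s = runSlices u s
  pos : signCount u s true = signCount u' s true + a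
  neg : signCount u s false = signCount u' s false + b

/-- Directions and signs only depend on the strands that take part, so the strands on the left can
be cut off. -/
theorem SameRun.shift {e : Slice} {u u' : List Slice} {a b : ℕ}
    (h : ∀ l, AdmStack (e :: u) l → SameRun (e :: u) u' a b l) (i : ℕ) {s : List Bool}
    (hs : AdmStack (shiftStack i (e :: u)) s) :
    SameRun (shiftStack i (e :: u)) (shiftStack i u') a b s := by
  -- Admissibility of the first slice guarantees that there are `i` strands on the left; this is why
  -- the first stack has to be nonempty.
  have hi : i ≤ s.length := by
    have := hs.1.le
    simp only at this
    omega
  obtain ⟨A, l, rfl, rfl⟩ : ∃ A l, s = A ++ l ∧ A.length = i :=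
    ⟨s.take i, s.drop i, (List.take_append_drop i s).symm, by simp [hi]⟩
  have h' := h l ((admStack_shift A l _).1 hs)
  refine ⟨?_, ?_, ?_⟩
  · rw [runSlices_shift, runSlices_shift, h'.run]
  · rw [signCount_shift, signCount_shift, h'.pos]
  · rw [signCount_shift, signCount_shift, h'.neg]

section Local

variable {l : List Bool}

theorem sameRun_zigzag_left (a : Bool) (h : AdmStack [⟨1, .cup a⟩, ⟨0, .cap⟩] l) :
    SameRun [⟨1, .cup a⟩, ⟨0, .cap⟩] [] 0 0 l := by
  rcases l with _ | ⟨x, l⟩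
  · simp [AdmStack, Slice.Admissible] at h
  · simp [AdmStack, Slice.Admissible, Slice.next] at h
    subst h
    constructor <;> simp [runSlices, Slice.next, signCount, Slice.sgn]

theorem sameRun_zigzag_right (a : Bool) (h : AdmStack [⟨0, .cup a⟩, ⟨1, .cap⟩] l) :
    SameRun [⟨0, .cup a⟩, ⟨1, .cap⟩] [] 0 0 l := by
  rcases l with _ | ⟨x, l⟩
  · simp [AdmStack, Slice.Admissible, Slice.next] at h
  · obtain rfl : x = a := by
      simp [AdmStack, Slice.Admissible, Slice.next] at h
      cases a <;> cases x <;> simp_all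
    constructor <;> simp [runSlices, Slice.next, signCount, Slice.sgn]

theorem sameRun_slide_cup (a o : Bool) (h : AdmStack [⟨0, .cup a⟩, ⟨1, .cross o⟩] l) :
    SameRun [⟨0, .cup a⟩, ⟨1, .cross o⟩] [⟨1, .cup a⟩, ⟨0, .cross (!o)⟩] 0 0 l := by
  rcases l with _ | ⟨x, l⟩
  · simp [AdmStack, Slice.Admissible, Slice.next] at h
  · constructor <;> simp [runSlices, Slice.next, signCount, Slice.sgn] <;>
      cases a <;> cases o <;> cases x <;> simp

theorem sameRun_slide_cap (o : Bool) (h : AdmStack [⟨1, .cross o⟩, ⟨0, .cap⟩] l) :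
    SameRun [⟨1, .cross o⟩, ⟨0, .cap⟩] [⟨0, .cross (!o)⟩, ⟨1, .cap⟩] 0 0 l := by
  rcases l with _ | ⟨x, _ | ⟨y, _ | ⟨z, l⟩⟩⟩
  · simp [AdmStack, Slice.Admissible] at h
  · simp [AdmStack, Slice.Admissible] at h
  · simp [AdmStack, Slice.Admissible] at h
  · simp [AdmStack, Slice.Admissible, Slice.next] at h
    subst h
    constructor <;> simp [runSlices, Slice.next, signCount, Slice.sgn] <;>
      cases o <;> cases x <;> cases y <;> simp

/-- Reversing the strand of a kink reverses both directions at its crossing, so the sign depends on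
`o` alone. -/
theorem sameRun_one_right (a o : Bool)
    (h : AdmStack [⟨1, .cup a⟩, ⟨0, .cross o⟩, ⟨1, .cap⟩] l) :
    SameRun [⟨1, .cup a⟩, ⟨0, .cross o⟩, ⟨1, .cap⟩] [] o.toNat (!o).toNat l := by
  rcases l with _ | ⟨x, l⟩
  · simp [AdmStack, Slice.Admissible] at h
  · simp [AdmStack, Slice.Admissible, Slice.next] at h
    subst h
    constructor <;> simp [runSlices, Slice.next, signCount, Slice.sgn] <;> cases o <;> rfl

theorem sameRun_one_left (a o : Bool)
    (h : AdmStack [⟨0, .cup a⟩, ⟨1, .cross o⟩, ⟨0, .cap⟩] l) :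
    SameRun [⟨0, .cup a⟩, ⟨1, .cross o⟩, ⟨0, .cap⟩] [] o.toNat (!o).toNat l := by
  rcases l with _ | ⟨x, l⟩
  · simp [AdmStack, Slice.Admissible, Slice.next] at h
  · simp [AdmStack, Slice.Admissible, Slice.next] at h
    subst h
    constructor <;> simp [runSlices, Slice.next, signCount, Slice.sgn] <;> cases o <;> rfl

theorem sameRun_two (o : Bool) (h : AdmStack [⟨0, .cross o⟩, ⟨0, .cross (!o)⟩] l) :
    SameRun [⟨0, .cross o⟩, ⟨0, .cross (!o)⟩] [] 1 1 l := by
  rcases l with _ | ⟨x, _ | ⟨y, l⟩⟩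
  · simp [AdmStack, Slice.Admissible] at h
  · simp [AdmStack, Slice.Admissible] at h
  · constructor <;> simp [runSlices, Slice.next, signCount, Slice.sgn] <;>
      cases o <;> cases x <;> cases y <;> simp

/-- The same pairs of strands cross on both sides, with the same directions and the same heights,
only in the opposite order. -/
theorem sameRun_three (o₁ o₂ o₃ : Bool)
    (h : AdmStack [⟨0, .cross o₁⟩, ⟨1, .cross o₂⟩, ⟨0, .cross o₃⟩] l) :
    SameRun [⟨0, .cross o₁⟩, ⟨1, .cross o₂⟩, ⟨0, .cross o₃⟩]
      [⟨1, .cross o₃⟩, ⟨0, .cross o₂⟩, ⟨1, .cross o₁⟩] 0 0 l := by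
  rcases l with _ | ⟨x, _ | ⟨y, _ | ⟨z, l⟩⟩⟩
  · simp [AdmStack, Slice.Admissible] at h
  · simp [AdmStack, Slice.Admissible] at h
  · simp [AdmStack, Slice.Admissible, Slice.next] at h
  · constructor
    · simp [runSlices, Slice.next]
    · simp only [signCount, Slice.sgn, Slice.next]
      simp
      ring
    · simp only [signCount, Slice.sgn, Slice.next]
      simp
      ring

theorem next_append {S : PieceKind} {X : List Bool} (hX : X.length = S.inn) (R : List Bool) :
    Slice.next ⟨0, S⟩ (X ++ R) = Slice.next ⟨0, S⟩ X ++ R := by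
  rcases S with a | _ | o
  · simp [Slice.next]
  all_goals
    simp only [PieceKind.inn] at hX
    obtain ⟨x, y, rfl⟩ := List.length_eq_two.1 hX
    simp [Slice.next]

theorem sgn_append {S : PieceKind} {X : List Bool} (hX : X.length = S.inn) (R : List Bool)
    (b : Bool) : Slice.sgn ⟨0, S⟩ (X ++ R) b = Slice.sgn ⟨0, S⟩ X b := by
  rcases S with a | _ | o
  · rfl
  · rfl
  · simp only [PieceKind.inn] at hX
    obtain ⟨x, y, rfl⟩ := List.length_eq_two.1 hX
    simp [Slice.sgn]

theorem length_next_zero {S : PieceKind} {X : List Bool} (hX : X.length = S.inn) :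
    (Slice.next ⟨0, S⟩ X).length = S.out := by
  rcases S with a | _ | o <;> simp only [PieceKind.inn] at hX <;>
    simp [Slice.next, PieceKind.out, hX]

theorem sameRun_exchange (d : ℕ) (S T : PieceKind)
    (h : AdmStack [⟨S.inn + d, T⟩, ⟨0, S⟩] l) :
    SameRun [⟨S.inn + d, T⟩, ⟨0, S⟩] [⟨0, S⟩, ⟨S.out + d, T⟩] 0 0 l := by
  have hl : S.inn + d ≤ l.length := by
    have := h.1.le
    simp only at this
    omega
  -- The strands are divided into those that enter `S`, the `d` strands in between, and the rest, on
  -- which `T` acts.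
  obtain ⟨X, M, Y, rfl, hX, rfl⟩ : ∃ X M Y, l = X ++ (M ++ Y) ∧ X.length = S.inn ∧
      M.length = d := by
    refine ⟨l.take S.inn, (l.drop S.inn).take d, (l.drop S.inn).drop d, ?_, ?_, ?_⟩
    · rw [List.take_append_drop, List.take_append_drop]
    · simp; omega
    · simp; omega
  have hT : ∀ X' : List Bool, Slice.next ⟨X'.length + M.length, T⟩ (X' ++ (M ++ Y)) =
      X' ++ (M ++ Slice.next ⟨0, T⟩ Y) := fun X' => by
    have := next_shift (X' ++ M) Y ⟨0, T⟩
    simpa using this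
  have hTs : ∀ (X' : List Bool) b, Slice.sgn ⟨X'.length + M.length, T⟩ (X' ++ (M ++ Y)) b =
      Slice.sgn ⟨0, T⟩ Y b := fun X' b => by
    have := sgn_shift (X' ++ M) Y ⟨0, T⟩ b
    simpa using this
  have hS := length_next_zero hX
  rw [← hX, ← hS]
  refine ⟨?_, ?_, ?_⟩
  · simp only [runSlices_cons, next_append hX, hT]
  · simp only [signCount, next_append hX, hT, hTs, sgn_append hX]
    omega
  · simp only [signCount, next_append hX, hT, hTs, sgn_append hX]
    omega

end Local

/-! ## Planar isotopies -/

/-- Without additional cycles, the outer points meet all cycles and carry all points of the ray, so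
they can serve as the common points in `Cube.hEquiv_of_match`. -/
theorem Cube.hEquiv_of_view {C C' O : Type} [DecidableEq C] [DecidableEq C'] [Fintype C]
    [Fintype C'] [Finite O] {R : O → Prop} {K : Cube C} {K' : Cube C'} (V : K.View O R)
    (V' : K'.View O R) (hV : ∀ α, ¬ V.circ α) (hV' : ∀ α, ¬ V'.circ α) (e : C ≃ C')
    (hA : ∀ α, V.A α = V'.A (α.map e.toEmbedding)) (hhs : K.hs = K'.hs) (hqs : K.qs = K'.qs)
    (r : C → ℕ) (hr : Function.Injective r) (r' : C' → ℕ) (hr' : Function.Injective r') :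
    (K.complex r hr).HEquiv (K'.complex r' hr') := by
  have hrel : ∀ α o o', K.E α (V.φ o) (V.φ o') ↔
      K'.E (α.map e.toEmbedding) (V'.φ o) (V'.φ o') := fun α o o' => by
    have : V.A α o o' ↔ V'.A (α.map e.toEmbedding) o o' := by rw [hA]
    exact this
  refine K.hEquiv_of_match K' r r' hr hr' e V.φ V'.φ (fun α => ⟨⟨V.full α (hV α),
    V'.full _ (hV' _), hrel α⟩, fun o => ?_⟩) hhs hqs
  rw [V.nt_iff, V'.nt_iff]
  simp only [hrel]

theorem resolve_shiftStack (ρ : ℕ → Bool) (i : ℕ) (u : List Slice) :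
    resolve ρ (shiftStack i u) = (resolve ρ u).shift i := by
  simp only [resolve, shiftStack, RWord.shift]
  refine List.ext_getElem? fun k => ?_
  simp only [List.getElem?_mapIdx, List.getElem?_map, Option.map_map]
  rfl

namespace Patch

open AnnularDiagram RWord

variable {D D' : AnnularDiagram}

/-- The patch of a local move. -/
def ofRun (p u u' r : List Slice) (hbase : D'.base = D.base) (hD : D.word = p ++ u ++ r)
    (hD' : D'.word = p ++ u' ++ r) {a b : ℕ} (h : SameRun u u' a b (runSlices p D.base)) :
    Patch D D' :=
  ⟨p, u, u', r, hD, hD', hbase, h.run⟩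

theorem _root_.AnnularDiagram.admStack_part {p u r : List Slice} (hD : D.word = p ++ u ++ r) :
    AdmStack u (runSlices p D.base) := by
  have := D.admStack
  rw [hD, admStack_append, admStack_append] at this
  exact this.1.2

variable (P : Patch D D')

theorem level_p : D.level P.p.length = runSlices P.p D.base := by
  rw [P.level_low le_rfl, List.take_length]

variable {P} {σ : ℕ → ℕ}

theorem IndexMap.exists_index_iff (hσ : P.IndexMap σ) (k : ℕ) : (∃ m, P.index σ m = k) ↔
    ∀ a < P.u.length, k = P.p.length + a → ∃ b < P.u'.length, σ b = a := by
  constructor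
  · rintro ⟨m, rfl⟩ a ha h
    unfold index at h
    have h1 := hσ.lt (m - P.p.length)
    split_ifs at h
    · omega
    · exact ⟨m - P.p.length, by omega, by omega⟩
    · omega
  · intro h
    rcases Nat.lt_or_ge k P.p.length with h1 | h1
    · exact ⟨k, index_low h1⟩
    obtain ⟨a, rfl⟩ := Nat.exists_eq_add_of_le h1
    rcases Nat.lt_or_ge a P.u.length with h2 | h2
    · obtain ⟨b, hb, rfl⟩ := h a h2 rfl
      exact ⟨P.p.length + b, index_mid hb⟩
    · obtain ⟨t, rfl⟩ := Nat.exists_eq_add_of_le h2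
      exact ⟨P.p.length + P.u'.length + t, by rw [index_high]; omega⟩

theorem word_getElem? (P : Patch D D') {a : ℕ} (ha : a < P.u.length) :
    D.word[P.p.length + a]? = P.u[a]? := by
  rw [P.hD, List.append_assoc, List.getElem?_append_right (by omega),
    List.getElem?_append_left (by omega), Nat.add_sub_cancel_left]

theorem isCross_of_eq (P : Patch D D') (c : D.Crossing) {a : ℕ} (ha : a < P.u.length)
    (hc : (c.1 : ℕ) = P.p.length + a) : (P.u[a]?).map (·.kind.isCross) = some true := by
  rw [← P.word_getElem? ha, ← hc, D.isCross_iff]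
  exact ⟨c, rfl⟩

theorem exists_crossing_of (P : Patch D D') {a : ℕ} (ha : a < P.u.length)
    (h : (P.u[a]?).map (·.kind.isCross) = some true) :
    ∃ c : D.Crossing, (c.1 : ℕ) = P.p.length + a := by
  rw [← P.word_getElem? ha] at h
  exact (D.isCross_iff _).1 h

theorem hs_eq (P : Patch D D') {a b : ℕ} (h : SameRun P.u P.u' a b (runSlices P.p D.base)) :
    D'.cube.hs = D.cube.hs + b := by
  have := P.nMinus_sub
  rw [P.level_p, h.neg] at this
  change - D'.nMinus = - D.nMinus + b
  push_cast at this
  omega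

theorem qs_eq (P : Patch D D') {a b : ℕ} (h : SameRun P.u P.u' a b (runSlices P.p D.base)) :
    D'.cube.qs = D.cube.qs - a + 2 * b := by
  have h1 := P.nMinus_sub
  have h2 := P.nPlus_sub
  rw [P.level_p, h.neg] at h1
  rw [P.level_p, h.pos] at h2
  change D'.nPlus - 2 * D'.nMinus = D.nPlus - 2 * D.nMinus - a + 2 * b
  push_cast at h1 h2
  omega

/-- The view without closed curves. -/
def viewFull (P : Patch D D') (h : ∀ α, (P.inner α).NoCircle) : D.cube.View P.Out P.Ray :=
  P.view (fun _ => False) (0, 0) (fun h => (Exists.elim h fun _ h => h).elim)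
    (fun h => (Exists.elim h fun _ h => h).elim) (fun α _ => h α) (fun _ h => h.elim)

/-- The view of the second diagram without closed curves. -/
def viewFull' (P : Patch D D') (h : ∀ α, (P.symm.inner α).NoCircle) :
    D'.cube.View P.Out P.Ray :=
  P.view' (fun _ => False) (0, 0) (fun h => (Exists.elim h fun _ h => h).elim)
    (fun h => (Exists.elim h fun _ h => h).elim) (fun α _ => h α) (fun _ h => h.elim)

/-- A planar isotopy creates no closed curves and keeps crossings, signs and boundary connections.
So corresponding resolutions look alike from outside of the disc, and at most the order of the
crossings changes. -/
theorem hEquiv_of_sameBd (hσ : P.IndexMap σ)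
    (hsurj : ∀ a < P.u.length, (P.u[a]?).map (·.kind.isCross) = some true →
      ∃ b < P.u'.length, σ b = a)
    (hbd : ∀ ρ ρ' : ℕ → Bool, (∀ a < P.u'.length, ρ' a = ρ (σ a)) →
      SameBd (resolve ρ P.u) (resolve ρ' P.u'))
    (hn : ∀ ρ, (resolve ρ P.u).NoCircle) (hn' : ∀ ρ, (resolve ρ P.u').NoCircle)
    (hs : SameRun P.u P.u' 0 0 (runSlices P.p D.base)) :
    D.cubeComplex.HEquiv D'.cubeComplex := by
  have hbij : Function.Bijective hσ.emb := by
    refine ⟨hσ.emb.injective, fun c => ?_⟩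
    rw [hσ.exists_emb_iff, hσ.exists_index_iff]
    intro a ha hc
    exact hsurj a ha (P.isCross_of_eq c ha hc)
  let e : D'.Crossing ≃ D.Crossing := Equiv.ofBijective _ hbij
  have he : e.toEmbedding = hσ.emb := by ext c; rfl
  refine (Cube.hEquiv_of_view (P.viewFull' fun α => hn' _) (P.viewFull fun α => hn _)
    (fun _ h => h) (fun _ h => h) e (fun α' => ?_) ?_ ?_ _ _ _ _).symm
  · rw [he]
    refine (P.view_A_eq (hσ.agree_map α') (hbd _ _ fun a ha => ?_)).symm
    change D'.res α' (P.p.length + a) = D.res (α'.map hσ.emb) (P.p.length + σ a)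
    rw [← index_mid ha, hσ.res_map]
  · have := P.hs_eq hs
    simpa using this
  · have := P.qs_eq hs
    simpa using this

end Patch

namespace AnnularDiagram

open RWord

variable {D D' : AnnularDiagram} {p r : List Slice} (hbase : D'.base = D.base)
include hbase

theorem hEquiv_exchange (i d : ℕ) (S T : PieceKind)
    (hD : D.word = p ++ [⟨i + S.inn + d, T⟩, ⟨i, S⟩] ++ r)
    (hD' : D'.word = p ++ [⟨i, S⟩, ⟨i + S.out + d, T⟩] ++ r) :
    D.cubeComplex.HEquiv D'.cubeComplex := by
  have hs : SameRun [⟨i + S.inn + d, T⟩, ⟨i, S⟩] [⟨i, S⟩, ⟨i + S.out + d, T⟩] 0 0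
      (runSlices p D.base) := by
    have h := D.admStack_part hD
    have := SameRun.shift (fun l => sameRun_exchange (l := l) d S T) i (s := runSlices p D.base)
    simp only [shiftStack, List.map_cons, List.map_nil, ← Nat.add_assoc, Nat.add_zero] at this
    exact this h
  let P : Patch D D' := .ofRun p _ _ r hbase hD hD' hs
  have e1 : ∀ ρ, resolve ρ P.u = distant i d (S.res (ρ 1)) (T.res (ρ 0)) false := fun ρ => by
    simp only [distant, strands, PieceKind.inn_res]
    rfl
  have e2 : ∀ ρ, resolve ρ P.u' = distant i d (S.res (ρ 0)) (T.res (ρ 1)) true := fun ρ => by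
    simp only [distant, strands, PieceKind.out_res]
    rfl
  -- The exchange reverses the order of the two slices.
  refine Patch.hEquiv_of_sameBd (P := P) (σ := fun a => 1 - a) ⟨?_, ?_, ?_⟩ ?_ ?_ ?_ ?_ hs
  · intro a _
    change 1 - a < 2
    omega
  · intro a ha b hb h
    change a < 2 at ha
    change b < 2 at hb
    omega
  · intro a ha
    change a < 2 at ha
    obtain rfl | rfl : a = 0 ∨ a = 1 := by omega
    · rfl
    · rfl
  · intro a ha _
    change a < 2 at ha
    exact ⟨1 - a, by change 1 - a < 2; omega, by omega⟩
  · intro ρ ρ' h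
    rw [e1, e2, h 0 (by decide : 0 < 2), h 1 (by decide : 1 < 2)]
    exact sameBd_distant
  · intro ρ
    rw [e1]
    exact noCircle_distant
  · intro ρ
    rw [e2]
    exact noCircle_distant

/-- Local moves whose crossings correspond to each other in the order of the stacks, or that involve
no crossings. -/
theorem hEquiv_of_exit {i n : ℕ} {e : Slice} {u u' : List Slice}
    (hD : D.word = p ++ shiftStack i (e :: u) ++ r) (hD' : D'.word = p ++ shiftStack i u' ++ r)
    (hrun : ∀ l, AdmStack (e :: u) l → SameRun (e :: u) u' 0 0 l)
    (hlen : u'.length ≤ (e :: u).length)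
    (hcross : ∀ a < u'.length,
      ((e :: u)[a]?).map (·.kind.isCross) = (u'[a]?).map (·.kind.isCross))
    (hsurj : ∀ a < (e :: u).length,
      ((e :: u)[a]?).map (·.kind.isCross) = some true → a < u'.length)
    (hexit : ∀ ρ ρ', (∀ a < u'.length, ρ' a = ρ a) →
      SameExit (resolve ρ (e :: u)) (resolve ρ' u') n)
    (hall : ∀ ρ, (resolve ρ (e :: u)).AllExit n) (hall' : ∀ ρ, (resolve ρ u').AllExit n) :
    D.cubeComplex.HEquiv D'.cubeComplex := by
  have hs := SameRun.shift hrun i (D.admStack_part hD)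
  let P : Patch D D' := .ofRun p _ _ r hbase hD hD' hs
  have l1 : P.u.length = (e :: u).length := by simp [P, Patch.ofRun, shiftStack]
  have l2 : P.u'.length = u'.length := by simp [P, Patch.ofRun, shiftStack]
  have c1 : ∀ a : ℕ, (P.u[a]?).map (fun s : Slice => s.kind.isCross) =
      ((e :: u)[a]?).map (·.kind.isCross) := fun a => by
    change ((shiftStack i (e :: u))[a]?).map (fun s : Slice => s.kind.isCross) = _
    rw [shiftStack, List.getElem?_map, Option.map_map]
    rfl
  have c2 : ∀ a : ℕ, (P.u'[a]?).map (fun s : Slice => s.kind.isCross) =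
      (u'[a]?).map (·.kind.isCross) := fun a => by
    change ((shiftStack i u')[a]?).map (fun s : Slice => s.kind.isCross) = _
    rw [shiftStack, List.getElem?_map, Option.map_map]
    rfl
  have e1 : ∀ ρ, resolve ρ P.u = (resolve ρ (e :: u)).shift i := fun ρ => resolve_shiftStack ρ i _
  have e2 : ∀ ρ, resolve ρ P.u' = (resolve ρ u').shift i := fun ρ => resolve_shiftStack ρ i _
  refine Patch.hEquiv_of_sameBd (P := P) (σ := fun a => a) ⟨?_, ?_, ?_⟩ ?_ ?_ ?_ ?_ hs
  · intro a ha
    omega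
  · intro a _ b _ h
    exact h
  · intro a ha
    rw [c1, c2]
    exact hcross a (l2 ▸ ha)
  · intro a ha h
    rw [c1] at h
    exact ⟨a, l2 ▸ hsurj a (l1 ▸ ha) h, rfl⟩
  · intro ρ ρ' h
    rw [e1, e2]
    exact (hexit ρ ρ' fun a ha => h a (l2 ▸ ha)).sameBd i
  · intro ρ
    rw [e1]
    exact (hall ρ).noCircle i
  · intro ρ
    rw [e2]
    exact (hall' ρ).noCircle i

theorem hEquiv_zigzag_left (i : ℕ) (a : Bool)
    (hD : D.word = p ++ [⟨i + 1, .cup a⟩, ⟨i, .cap⟩] ++ r) (hD' : D'.word = p ++ [] ++ r) :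
    D.cubeComplex.HEquiv D'.cubeComplex :=
  hEquiv_of_exit hbase (i := i) (n := 1) (e := ⟨1, .cup a⟩) (u := [⟨0, .cap⟩]) (u' := []) hD hD'
    (fun _ => sameRun_zigzag_left a) (by simp) (fun _ h => absurd h (by simp)) (fun b hb h => by
      change b < 2 at hb
      obtain rfl | rfl : b = 0 ∨ b = 1 := by omega
      · cases h
      · cases h)
    (fun _ _ _ => show SameExit [(1, .cup), (0, .cap)] [] 1 by decide)
    (fun _ => show AllExit [(1, .cup), (0, .cap)] 1 by decide)
    (fun _ => show AllExit [] 1 by decide)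

theorem hEquiv_zigzag_right (i : ℕ) (a : Bool)
    (hD : D.word = p ++ [⟨i, .cup a⟩, ⟨i + 1, .cap⟩] ++ r) (hD' : D'.word = p ++ [] ++ r) :
    D.cubeComplex.HEquiv D'.cubeComplex :=
  hEquiv_of_exit hbase (i := i) (n := 1) (e := ⟨0, .cup a⟩) (u := [⟨1, .cap⟩]) (u' := []) hD hD'
    (fun _ => sameRun_zigzag_right a) (by simp) (fun _ h => absurd h (by simp)) (fun b hb h => by
      change b < 2 at hb
      obtain rfl | rfl : b = 0 ∨ b = 1 := by omega
      · cases h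
      · cases h)
    (fun _ _ _ => show SameExit [(0, .cup), (1, .cap)] [] 1 by decide)
    (fun _ => show AllExit [(0, .cup), (1, .cap)] 1 by decide)
    (fun _ => show AllExit [] 1 by decide)

theorem hEquiv_slide_cup (i : ℕ) (a o : Bool)
    (hD : D.word = p ++ [⟨i, .cup a⟩, ⟨i + 1, .cross o⟩] ++ r)
    (hD' : D'.word = p ++ [⟨i + 1, .cup a⟩, ⟨i, .cross (!o)⟩] ++ r) :
    D.cubeComplex.HEquiv D'.cubeComplex := by
  refine hEquiv_of_exit hbase (i := i) (n := 1) (e := ⟨0, .cup a⟩) (u := [⟨1, .cross o⟩])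
    (u' := [⟨1, .cup a⟩, ⟨0, .cross (!o)⟩]) hD hD' (fun _ => sameRun_slide_cup a o) (by simp)
    (fun b hb => ?_) (fun b hb _ => hb) (fun ρ ρ' h => ?_) (fun ρ => ?_) (fun ρ => ?_)
  · change b < 2 at hb
    obtain rfl | rfl : b = 0 ∨ b = 1 := by omega
    · rfl
    · rfl
  -- Of `ρ` only the value at the crossing matters, so finitely many cases are left to be computed.
  · have key : ∀ o x : Bool, SameExit [(0, .cup), (1, PieceKind.res (.cross o) x)]
      [(1, .cup), (0, PieceKind.res (.cross (!o)) x)] 1 := by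
      decide
    have hρ := h 1 (by decide : 1 < 2)
    change SameExit [(0, .cup), (1, PieceKind.res (.cross o) (ρ 1))]
      [(1, .cup), (0, PieceKind.res (.cross (!o)) (ρ' 1))] 1
    rw [hρ]
    exact key o (ρ 1)
  · have key : ∀ o x : Bool, AllExit [(0, .cup), (1, PieceKind.res (.cross o) x)] 1 := by
      decide
    exact key o (ρ 1)
  · have key : ∀ o x : Bool, AllExit [(1, .cup), (0, PieceKind.res (.cross (!o)) x)] 1 := by
      decide
    exact key o (ρ 1)

theorem hEquiv_slide_cap (i : ℕ) (o : Bool)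
    (hD : D.word = p ++ [⟨i + 1, .cross o⟩, ⟨i, .cap⟩] ++ r)
    (hD' : D'.word = p ++ [⟨i, .cross (!o)⟩, ⟨i + 1, .cap⟩] ++ r) :
    D.cubeComplex.HEquiv D'.cubeComplex := by
  refine hEquiv_of_exit hbase (i := i) (n := 3) (e := ⟨1, .cross o⟩) (u := [⟨0, .cap⟩])
    (u' := [⟨0, .cross (!o)⟩, ⟨1, .cap⟩]) hD hD' (fun _ => sameRun_slide_cap o) (by simp)
    (fun b hb => ?_) (fun b hb _ => hb) (fun ρ ρ' h => ?_) (fun ρ => ?_) (fun ρ => ?_)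
  · change b < 2 at hb
    obtain rfl | rfl : b = 0 ∨ b = 1 := by omega
    · rfl
    · rfl
  · have key : ∀ o x : Bool, SameExit [(1, PieceKind.res (.cross o) x), (0, .cap)]
      [(0, PieceKind.res (.cross (!o)) x), (1, .cap)] 3 := by
      decide
    have hρ := h 0 (by decide : 0 < 2)
    change SameExit [(1, PieceKind.res (.cross o) (ρ 0)), (0, .cap)]
      [(0, PieceKind.res (.cross (!o)) (ρ' 0)), (1, .cap)] 3
    rw [hρ]
    exact key o (ρ 0)
  · have key : ∀ o x : Bool, AllExit [(1, PieceKind.res (.cross o) x), (0, .cap)] 3 := by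
      decide
    exact key o (ρ 0)
  · have key : ∀ o x : Bool, AllExit [(0, PieceKind.res (.cross (!o)) x), (1, .cap)] 3 := by
      decide
    exact key o (ρ 0)

end AnnularDiagram

/-! ## The first and the second Reidemeister move -/

namespace AnnularDiagram

theorem res_eq_true_iff (D : AnnularDiagram) (α : Finset D.Crossing) (c : D.Crossing) :
    D.res α c.1 = true ↔ c ∈ α := by
  unfold res
  rw [decide_eq_true_iff]
  constructor
  · rintro ⟨c', hc', h⟩
    have : c' = c := Subtype.ext (Fin.ext h)
    exact this ▸ hc'
  · exact fun h => ⟨c, h, rfl⟩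

theorem res_eq_false_iff (D : AnnularDiagram) (α : Finset D.Crossing) (c : D.Crossing) :
    D.res α c.1 = false ↔ c ∉ α := by
  rw [← res_eq_true_iff, Bool.not_eq_true]

end AnnularDiagram

namespace Patch

open AnnularDiagram RWord

variable {D D' : AnnularDiagram} (P : Patch D D')

theorem IndexMap.of_nil (h : P.u' = []) : P.IndexMap id where
  lt a ha := by simp [h] at ha
  inj a ha := by simp [h] at ha
  cross a ha := by simp [h] at ha

theorem noCircle_nil (ρ : ℕ → Bool) : (resolve ρ []).NoCircle := by
  rintro ⟨k, j⟩ hk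
  have hk : k = 0 := by simpa using hk
  subst hk
  exact ⟨(false, j), Setoid.refl' _ _⟩

/-- The lower left corner of a crossing in the replaced part. -/
theorem valid_lowerLeft {c : D.Crossing} {a : ℕ} {s : Slice} (ha : a < P.u.length)
    (hc : (c.1 : ℕ) = P.p.length + a) (hs : P.u[a]? = some s) :
    D.Valid (sh P.p.length (a, s.pos)) := by
  have h := (D.ptEquiv (D.lowerLeft c)).2
  have hw : D.word[c.1] = s := by
    have := P.word_getElem? ha
    rw [hs, ← hc] at this
    exact (List.getElem?_eq_some_iff.1 this).2
  have e : (D.ptEquiv (D.lowerLeft c)).1 = (c.1.1, D.word[c.1].pos) := rfl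
  rw [e, hw, hc] at h
  exact h

/-- The upper right corner of a crossing in the replaced part. -/
theorem valid_upperRight {c : D.Crossing} {a : ℕ} {s : Slice} (ha : a < P.u.length)
    (hc : (c.1 : ℕ) = P.p.length + a) (hs : P.u[a]? = some s) :
    D.Valid (sh P.p.length (a + 1, s.pos + 1)) := by
  have h := (D.ptEquiv (D.upperRight c)).2
  have hw : D.word[c.1] = s := by
    have := P.word_getElem? ha
    rw [hs, ← hc] at this
    exact (List.getElem?_eq_some_iff.1 this).2
  have e : (D.ptEquiv (D.upperRight c)).1 = (c.1.1 + 1, D.word[c.1].pos + 1) := rfl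
  rw [e, hw, hc] at h
  exact h

/-- A first Reidemeister move removes a crossing whose vertical resolution has a closed curve
through `y`. -/
theorem hEquiv_one {a : ℕ} {o : Bool} {y : ℕ × ℕ} (hu' : P.u' = []) (ha : a < P.u.length)
    (hcross : ∀ b < P.u.length, (P.u[b]?).map (·.kind.isCross) = some true ↔ b = a)
    (hy : D.Valid (sh P.p.length y))
    (hbd : ∀ ρ : ℕ → Bool, ρ a ≠ o → SameBd (resolve ρ P.u) [])
    (hone : ∀ ρ : ℕ → Bool, ρ a ≠ o → (resolve ρ P.u).OneCircle y)
    (hnone : ∀ ρ : ℕ → Bool, ρ a = o → (resolve ρ P.u).NoCircle)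
    (hs : SameRun P.u P.u' o.toNat (!o).toNat (runSlices P.p D.base)) :
    D.cubeComplex.HEquiv D'.cubeComplex := by
  obtain ⟨c, hc⟩ := P.exists_crossing_of ha ((hcross a ha).2 rfl)
  have hσ := IndexMap.of_nil P hu'
  have hl : P.u'.length = 0 := by rw [hu']; rfl
  have he : ∀ x, (∃ z, hσ.emb z = x) ↔ x ≠ c := by
    intro x
    rw [hσ.exists_emb_iff, hσ.exists_index_iff]
    constructor
    · rintro h rfl
      obtain ⟨b, hb, -⟩ := h a ha hc
      omega
    · intro h b hb hx
      have := (hcross b hb).1 (P.isCross_of_eq x hb hx)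
      subst this
      exact absurd (Subtype.ext (Fin.ext (hx.trans hc.symm))) h
  have hn' : ∀ α', (P.symm.inner α').NoCircle := fun α' => by
    change (resolve _ P.u').NoCircle
    rw [hu']
    exact noCircle_nil _
  have hi' : ∀ α', P.symm.inner α' = [] := fun α' => by
    change resolve _ P.u' = []
    rw [hu']
    rfl
  have hhs := P.hs_eq hs
  have hqs := P.qs_eq hs
  -- The circle arises from the two vertical arcs. These are the `1`-resolution of the crossing if
  -- `o` is `false` (a negative kink) and the `0`-resolution if `o` is `true` (a positive kink).
  cases o
  · refine Cube.reidemeister_one_split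
      (P.view (fun α => c ∈ α) y (fun _ => (⟨_, hy⟩ : {x // D.Valid x})) (fun _ => rfl)
        (fun α h => hnone _ ?_) (fun α h => hone _ ?_))
      (P.viewFull' hn') (fun _ h => h) hσ.emb c he (fun _ => Iff.rfl) (fun α' => ?_) ?_ ?_ _ _ _ _
    · rw [← hc]; exact (D.res_eq_false_iff α c).2 h
    · rw [← hc, (D.res_eq_true_iff α c).2 h]; decide
    · refine P.view_A_eq ((hσ.agree_map α').insert ha hc) ?_
      rw [hi']
      refine hbd _ ?_
      rw [← hc, (D.res_eq_true_iff _ c).2 (Finset.mem_insert_self _ _)]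
      decide
    · simpa using hhs
    · simpa using hqs
  · refine Cube.reidemeister_one_merge
      (P.view (fun α => c ∉ α) y (fun _ => (⟨_, hy⟩ : {x // D.Valid x})) (fun _ => rfl)
        (fun α h => hnone _ ?_) (fun α h => hone _ ?_))
      (P.viewFull' hn') (fun _ h => h) hσ.emb c he (fun _ => Iff.rfl) (fun α' => ?_) ?_ ?_ _ _ _ _
    · rw [← hc]; exact (D.res_eq_true_iff α c).2 (not_not.1 h)
    · rw [← hc, (D.res_eq_false_iff α c).2 h]; decide
    · refine P.view_A_eq (hσ.agree_map α') ?_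
      rw [hi']
      refine hbd _ ?_
      rw [← hc, (D.res_eq_false_iff _ c).2 fun h => ?_]
      · decide
      · obtain ⟨z, -, hz⟩ := Finset.mem_map.1 h
        exact (he c).1 ⟨z, hz⟩ rfl
    · simpa using hhs
    · simpa using hqs

/-- A second Reidemeister move removes two crossings, of which `a` is horizontally resolved if it is
in the set and `b` if it is not in the set. -/
theorem hEquiv_two {a b : ℕ} {y : ℕ × ℕ} (hu' : P.u' = []) (ha : a < P.u.length)
    (hb : b < P.u.length) (hab : a ≠ b)
    (hcross : ∀ k < P.u.length, (P.u[k]?).map (·.kind.isCross) = some true ↔ k = a ∨ k = b)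
    (hy : D.Valid (sh P.p.length y))
    (hbd : ∀ ρ : ℕ → Bool, ρ a = false → ρ b = true → SameBd (resolve ρ P.u) [])
    (hone : ∀ ρ : ℕ → Bool, ρ a = true → ρ b = false → (resolve ρ P.u).OneCircle y)
    (hnone : ∀ ρ : ℕ → Bool, ¬ (ρ a = true ∧ ρ b = false) → (resolve ρ P.u).NoCircle)
    (hs : SameRun P.u P.u' 1 1 (runSlices P.p D.base)) :
    D.cubeComplex.HEquiv D'.cubeComplex := by
  obtain ⟨c', hc'⟩ := P.exists_crossing_of ha ((hcross a ha).2 (Or.inl rfl))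
  obtain ⟨c, hc⟩ := P.exists_crossing_of hb ((hcross b hb).2 (Or.inr rfl))
  have hcc : c ≠ c' := fun h => by rw [h] at hc; omega
  have hσ := IndexMap.of_nil P hu'
  have hl : P.u'.length = 0 := by rw [hu']; rfl
  have he : ∀ x, (∃ z, hσ.emb z = x) ↔ x ≠ c ∧ x ≠ c' := by
    intro x
    rw [hσ.exists_emb_iff, hσ.exists_index_iff]
    constructor
    · refine fun h => ⟨?_, ?_⟩
      · rintro rfl
        obtain ⟨k, hk, -⟩ := h b hb hc
        omega
      · rintro rfl
        obtain ⟨k, hk, -⟩ := h a ha hc'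
        omega
    · rintro ⟨h1, h2⟩ k hk hx
      rcases (hcross k hk).1 (P.isCross_of_eq x hk hx) with rfl | rfl
      · exact absurd (Subtype.ext (Fin.ext (hx.trans hc'.symm))) h2
      · exact absurd (Subtype.ext (Fin.ext (hx.trans hc.symm))) h1
  have hn' : ∀ α', (P.symm.inner α').NoCircle := fun α' => by
    change (resolve _ P.u').NoCircle
    rw [hu']
    exact noCircle_nil _
  have hhs := P.hs_eq hs
  have hqs := P.qs_eq hs
  refine Cube.reidemeister_two
    (P.view (fun α => c' ∈ α ∧ c ∉ α) y (fun _ => (⟨_, hy⟩ : {x // D.Valid x})) (fun _ => rfl)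
      (fun α h => hnone _ ?_) (fun α h => hone _ ?_ ?_))
    (P.viewFull' hn') (fun _ h => h) hσ.emb c c' hcc he (fun _ => Iff.rfl) (fun α' => ?_) ?_ ?_
    _ _ _ _
  · rwa [← hc, ← hc', D.res_eq_true_iff, D.res_eq_false_iff]
  · rw [← hc', D.res_eq_true_iff]; exact h.1
  · rw [← hc, D.res_eq_false_iff]; exact h.2
  · refine P.view_A_eq ((hσ.agree_map α').insert hb hc) ?_
    have hi' : P.symm.inner α' = [] := by
      change resolve _ P.u' = []
      rw [hu']
      rfl
    rw [hi']
    refine hbd _ ?_ ?_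
    · rw [← hc', D.res_eq_false_iff]
      intro h
      rcases Finset.mem_insert.1 h with h | h
      · exact hcc h.symm
      · obtain ⟨z, -, hz⟩ := Finset.mem_map.1 h
        exact ((he c').1 ⟨z, hz⟩).2 rfl
    · rw [← hc, D.res_eq_true_iff]
      exact Finset.mem_insert_self _ _
  · simpa using hhs
  · rw [hqs]; push_cast; ring

end Patch

namespace AnnularDiagram

open RWord

variable {D D' : AnnularDiagram} {p r : List Slice} (hbase : D'.base = D.base)
include hbase

theorem hEquiv_one_right (i : ℕ) (a o : Bool)
    (hD : D.word = p ++ [⟨i + 1, .cup a⟩, ⟨i, .cross o⟩, ⟨i + 1, .cap⟩] ++ r)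
    (hD' : D'.word = p ++ [] ++ r) : D.cubeComplex.HEquiv D'.cubeComplex := by
  have hs := SameRun.shift (fun l => sameRun_one_right (l := l) a o) i (D.admStack_part hD)
  let P : Patch D D' := .ofRun p _ _ r hbase hD hD' hs
  have hr : ∀ ρ, resolve ρ P.u =
      shift i [(1, .cup), (0, PieceKind.res (.cross o) (ρ 1)), (1, .cap)] := fun ρ => rfl
  have hcross : ∀ b < P.u.length,
      (P.u[b]?).map (fun s : Slice => s.kind.isCross) = some true ↔ b = 1 := by
    intro b hb
    change b < 3 at hb
    obtain rfl | rfl | rfl : b = 0 ∨ b = 1 ∨ b = 2 := by omega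
    · exact iff_of_false (fun h => by cases h) (by decide)
    · exact iff_of_true rfl rfl
    · exact iff_of_false (fun h => by cases h) (by decide)
  have ha : 1 < P.u.length := show 1 < 3 by decide
  obtain ⟨c, hc⟩ := P.exists_crossing_of ha ((hcross 1 ha).2 rfl)
  have k1 : ∀ o x : Bool, x ≠ o →
      SameExit [(1, .cup), (0, PieceKind.res (.cross o) x), (1, .cap)] [] 1 := by decide
  have k2 : ∀ o x : Bool, x ≠ o →
      CircleExit [(1, .cup), (0, PieceKind.res (.cross o) x), (1, .cap)] 1 (2, 1) := by decide
  have k3 : ∀ o x : Bool, x = o →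
      AllExit [(1, .cup), (0, PieceKind.res (.cross o) x), (1, .cap)] 1 := by decide
  exact P.hEquiv_one (a := 1) (o := o) (y := (2, i + 1)) rfl ha hcross
    (P.valid_upperRight ha hc rfl) (fun ρ h => hr ρ ▸ (k1 o _ h).sameBd i)
    (fun ρ h => hr ρ ▸ (k2 o _ h).oneCircle i) (fun ρ h => hr ρ ▸ (k3 o _ h).noCircle i) hs

theorem hEquiv_one_left (i : ℕ) (a o : Bool)
    (hD : D.word = p ++ [⟨i, .cup a⟩, ⟨i + 1, .cross o⟩, ⟨i, .cap⟩] ++ r)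
    (hD' : D'.word = p ++ [] ++ r) : D.cubeComplex.HEquiv D'.cubeComplex := by
  have hs := SameRun.shift (fun l => sameRun_one_left (l := l) a o) i (D.admStack_part hD)
  let P : Patch D D' := .ofRun p _ _ r hbase hD hD' hs
  have hr : ∀ ρ, resolve ρ P.u =
      shift i [(0, .cup), (1, PieceKind.res (.cross o) (ρ 1)), (0, .cap)] := fun ρ => rfl
  have hcross : ∀ b < P.u.length,
      (P.u[b]?).map (fun s : Slice => s.kind.isCross) = some true ↔ b = 1 := by
    intro b hb
    change b < 3 at hb
    obtain rfl | rfl | rfl : b = 0 ∨ b = 1 ∨ b = 2 := by omega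
    · exact iff_of_false (fun h => by cases h) (by decide)
    · exact iff_of_true rfl rfl
    · exact iff_of_false (fun h => by cases h) (by decide)
  have ha : 1 < P.u.length := show 1 < 3 by decide
  obtain ⟨c, hc⟩ := P.exists_crossing_of ha ((hcross 1 ha).2 rfl)
  have k1 : ∀ o x : Bool, x ≠ o →
      SameExit [(0, .cup), (1, PieceKind.res (.cross o) x), (0, .cap)] [] 1 := by decide
  have k2 : ∀ o x : Bool, x ≠ o →
      CircleExit [(0, .cup), (1, PieceKind.res (.cross o) x), (0, .cap)] 1 (1, 1) := by decide
  have k3 : ∀ o x : Bool, x = o →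
      AllExit [(0, .cup), (1, PieceKind.res (.cross o) x), (0, .cap)] 1 := by decide
  exact P.hEquiv_one (a := 1) (o := o) (y := (1, i + 1)) rfl ha hcross
    (P.valid_lowerLeft ha hc rfl) (fun ρ h => hr ρ ▸ (k1 o _ h).sameBd i)
    (fun ρ h => hr ρ ▸ (k2 o _ h).oneCircle i) (fun ρ h => hr ρ ▸ (k3 o _ h).noCircle i) hs

theorem hEquiv_two (i : ℕ) (o : Bool)
    (hD : D.word = p ++ [⟨i, .cross o⟩, ⟨i, .cross (!o)⟩] ++ r) (hD' : D'.word = p ++ [] ++ r) :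
    D.cubeComplex.HEquiv D'.cubeComplex := by
  have hs := SameRun.shift (fun l => sameRun_two (l := l) o) i (D.admStack_part hD)
  let P : Patch D D' := .ofRun p _ _ r hbase hD hD' hs
  have hr : ∀ ρ, resolve ρ P.u = shift i [(0, PieceKind.res (.cross o) (ρ 0)),
      (0, PieceKind.res (.cross (!o)) (ρ 1))] := fun ρ => rfl
  have h0 : 0 < P.u.length := show 0 < 2 by decide
  have h1 : 1 < P.u.length := show 1 < 2 by decide
  have hcross : ∀ b < P.u.length,
      (P.u[b]?).map (fun s : Slice => s.kind.isCross) = some true ↔ b = 0 ∨ b = 1 := by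
    intro b hb
    change b < 2 at hb
    obtain rfl | rfl : b = 0 ∨ b = 1 := by omega
    · exact iff_of_true rfl (by decide)
    · exact iff_of_true rfl (by decide)
  obtain ⟨c, hc⟩ := P.exists_crossing_of h1 ((hcross 1 h1).2 (Or.inr rfl))
  have hy : D.Valid (sh P.p.length (1, i + 0)) := P.valid_lowerLeft h1 hc rfl
  have k1 : ∀ o x x' : Bool, x ≠ o → x' = o → SameExit [(0, PieceKind.res (.cross o) x),
      (0, PieceKind.res (.cross (!o)) x')] [] 2 := by decide
  have k2 : ∀ o x x' : Bool, x = o → x' ≠ o → CircleExit [(0, PieceKind.res (.cross o) x),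
      (0, PieceKind.res (.cross (!o)) x')] 2 (1, 0) := by decide
  have k3 : ∀ o x x' : Bool, ¬ (x = o ∧ x' ≠ o) → AllExit [(0, PieceKind.res (.cross o) x),
      (0, PieceKind.res (.cross (!o)) x')] 2 := by decide
  -- The circle occurs if both crossings are resolved horizontally. As they have opposite types, one
  -- of them is then in the set and the other is not; `o` decides which. Both are vertical in the
  -- opposite corner, where the strands pass straight through.
  cases o
  · refine P.hEquiv_two (a := 1) (b := 0) (y := (1, i + 0)) rfl h1 h0 (by decide)
      (fun k hk => (hcross k hk).trans or_comm) hy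
      (fun ρ h h' => hr ρ ▸ (k1 false _ _ ?_ ?_).sameBd i)
      (fun ρ h h' => hr ρ ▸ (k2 false _ _ ?_ ?_).oneCircle i)
      (fun ρ h => hr ρ ▸ (k3 false _ _ ?_).noCircle i) hs
    · rw [h']; decide
    · exact h
    · exact h'
    · rw [h]; decide
    · simp only [ne_eq, Bool.not_eq_false]
      tauto
  · refine P.hEquiv_two (a := 0) (b := 1) (y := (1, i + 0)) rfl h0 h1 (by decide) hcross hy
      (fun ρ h h' => hr ρ ▸ (k1 true _ _ ?_ ?_).sameBd i)
      (fun ρ h h' => hr ρ ▸ (k2 true _ _ ?_ ?_).oneCircle i)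
      (fun ρ h => hr ρ ▸ (k3 true _ _ ?_).noCircle i) hs
    · rw [h]; decide
    · exact h'
    · exact h
    · rw [h']; decide
    · simp only [ne_eq, Bool.not_eq_true]
      tauto

end AnnularDiagram

/-! ## The third Reidemeister move -/

namespace Cube

variable {C C' O : Type} [DecidableEq C] [DecidableEq C'] {R : O → Prop}

/-- A cube with renamed crossings. -/
def reindex (K : Cube C') (e : C' ≃ C) : Cube C where
  X := K.X
  E α := K.E (α.map e.symm.toEmbedding)
  a c := K.a (e.symm c)
  b c := K.b (e.symm c)
  W := K.W
  hs := K.hs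
  qs := K.qs
  saddle α c hc := by
    rw [Finset.map_insert]
    exact K.saddle _ _ (by simpa using hc)

theorem hEquiv_reindex [Fintype C] [Fintype C'] (K : Cube C') (e : C' ≃ C) (r : C → ℕ)
    (hr : Function.Injective r) (r' : C' → ℕ) (hr' : Function.Injective r') :
    (K.complex r' hr').HEquiv ((K.reindex e).complex r hr) := by
  have hE : ∀ α : Finset C', (K.reindex e).E (α.map e.toEmbedding) = K.E α := fun α => by
    change K.E ((α.map e.toEmbedding).map e.symm.toEmbedding) = K.E α
    rw [Finset.map_map]
    simp
  refine K.hEquiv_of_match (K.reindex e) r' r hr' hr e (O := K.X) id id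
    (fun α => ⟨⟨fun x => ⟨x, (K.E α).refl x⟩, fun x => ⟨x, ?_⟩, fun x y => ?_⟩, fun x => ?_⟩)
    rfl rfl
  · rw [hE]; exact (K.E α).refl x
  · rw [hE]; rfl
  · change Odd (Nat.card {y : K.X // K.W y ∧ K.E α y x}) ↔ Odd (Nat.card {y : K.X // K.W y ∧
      K.E ((α.map e.toEmbedding).map e.symm.toEmbedding) y x})
    rw [show (α.map e.toEmbedding).map e.symm.toEmbedding = α by rw [Finset.map_map]; simp]

/-- A view of a cube with renamed crossings. -/
def View.reindex {K : Cube C'} (V : K.View O R) (e : C' ≃ C) : (K.reindex e).View O R where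
  φ := V.φ
  circ α := V.circ (α.map e.symm.toEmbedding)
  y h := V.y (h.elim fun _ h => ⟨_, h⟩)
  full _ h := V.full _ h
  isolated _ h := V.isolated _ h
  ray := V.ray
  ray_inj := V.ray_inj

end Cube

namespace Patch

open AnnularDiagram RWord Cube

variable {D D' : AnnularDiagram} (P : Patch D D') {a b t : ℕ}

/-- A third Reidemeister move reverses the order of three crossings: if the crossing `t` is
horizontally resolved, then there is a closed curve if `a` is in the set and `b` is not; if `t` is
vertically resolved, then `a` and `b` exchange their roles. -/
theorem hEquiv_three {o : Bool} {y y' : ℕ × ℕ} (hu : P.u.length = 3)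
    (hu' : P.u'.length = 3) (hcu : ∀ k < 3, (P.u[k]?).map (·.kind.isCross) = some true)
    (hcu' : ∀ k < 3, (P.u'[k]?).map (·.kind.isCross) = some true)
    (ha : a < 3) (hb : b < 3) (ht : t < 3) (hab : a ≠ b) (hat : a ≠ t) (hbt : b ≠ t)
    (hy : D.Valid (sh P.p.length y)) (hy' : D'.Valid (sh P.p.length y'))
    (hone : ∀ ρ : ℕ → Bool, ρ t = o → ρ a = true → ρ b = false → (resolve ρ P.u).OneCircle y)
    (hone' : ∀ ρ : ℕ → Bool, ρ t = o → ρ a = true → ρ b = false →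
      (resolve (fun k => ρ (2 - k)) P.u').OneCircle y')
    (hnone : ∀ ρ : ℕ → Bool, ¬ (ρ t = o ∧ ρ a = true ∧ ρ b = false) →
      (resolve ρ P.u).NoCircle)
    (hnone' : ∀ ρ : ℕ → Bool, ¬ (ρ t = o ∧ ρ a = true ∧ ρ b = false) →
      (resolve (fun k => ρ (2 - k)) P.u').NoCircle)
    (hbd : ∀ ρ ρ' : ℕ → Bool, ρ t = ρ' t → (ρ t = o → ρ b = true ∧ ρ a = false ∧ ρ' b = true ∧
      ρ' a = false) → (ρ t ≠ o → ρ b = ρ' a ∧ ρ a = ρ' b) →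
      SameBd (resolve ρ P.u) (resolve (fun k => ρ' (2 - k)) P.u'))
    (hs : SameRun P.u P.u' 0 0 (runSlices P.p D.base)) :
    D.cubeComplex.HEquiv D'.cubeComplex := by
  -- The crossing of the same two strands is at the opposite height of the stack after the move.
  have hσ : P.IndexMap fun k => 2 - k := by
    refine ⟨fun k _ => by omega, fun k hk l hl h => by omega, fun k hk => ?_⟩
    rw [hcu (2 - k) (by omega), hcu' k (by omega)]
  have hbij : Function.Bijective hσ.emb := by
    refine ⟨hσ.emb.injective, fun c => ?_⟩
    rw [hσ.exists_emb_iff, hσ.exists_index_iff]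
    intro k hk _
    exact ⟨2 - k, by omega, by omega⟩
  let e : D'.Crossing ≃ D.Crossing := Equiv.ofBijective _ hbij
  have he : ∀ β : Finset D.Crossing, (β.map e.symm.toEmbedding).map hσ.emb = β := fun β => by
    have : hσ.emb = e.toEmbedding := by ext c; rfl
    rw [this, Finset.map_map]
    simp
  have hres : ∀ (β : Finset D.Crossing) (k : ℕ), k < 3 →
      D'.res (β.map e.symm.toEmbedding) (P.p.length + k) = D.res β (P.p.length + (2 - k)) := by
    intro β k hk
    have := hσ.res_map (β.map e.symm.toEmbedding) (P.p.length + k)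
    rw [he, index_mid (by omega)] at this
    exact this.symm
  have hinner : ∀ β : Finset D.Crossing, P.symm.inner (β.map e.symm.toEmbedding) =
      resolve (fun k => D.res β (P.p.length + (2 - k))) P.u' := by
    intro β
    refine resolve_congr fun k hk => ?_
    exact hres β k (by have : P.symm.u.length = 3 := hu'; omega)
  obtain ⟨c', hc'⟩ := P.exists_crossing_of (by omega) (hcu a ha)
  obtain ⟨c, hc⟩ := P.exists_crossing_of (by omega) (hcu b hb)
  obtain ⟨c₃, hc₃⟩ := P.exists_crossing_of (by omega) (hcu t ht)
  have hcond : ∀ α, ThirdCond c₃ o α ↔ D.res α (P.p.length + t) = o := by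
    intro α
    rw [← hc₃, ThirdCond, ← D.res_eq_true_iff]
    cases D.res α c₃.1 <;> cases o <;> simp
  have hcirc : ∀ α, (ThirdCond c₃ o α ∧ c' ∈ α ∧ c ∉ α) ↔ (D.res α (P.p.length + t) = o ∧
      D.res α (P.p.length + a) = true ∧ D.res α (P.p.length + b) = false) := by
    intro α
    rw [hcond, ← hc', ← hc, D.res_eq_true_iff, D.res_eq_false_iff]
  have hcc : ∀ α' : Finset D'.Crossing,
      (α'.map e.toEmbedding).map e.symm.toEmbedding = α' := fun α' => by
    rw [Finset.map_map]
    simp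
  -- The abstract move compares two cubes on the same set of crossings, so the second cube is
  -- renamed along `e` first.
  refine (Cube.reidemeister_three (K' := D'.cube.reindex e)
    (P.view (fun α => ThirdCond c₃ o α ∧ c' ∈ α ∧ c ∉ α) y
      (fun _ => (⟨_, hy⟩ : {x // D.Valid x})) (fun _ => rfl)
      (fun α h => hnone _ fun h' => h ((hcirc α).2 h'))
      (fun α h => hone _ ((hcirc α).1 h).1 ((hcirc α).1 h).2.1 ((hcirc α).1 h).2.2))
    ((P.view' (fun α' => ThirdCond c₃ o (α'.map e.toEmbedding) ∧ c' ∈ α'.map e.toEmbedding ∧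
      c ∉ α'.map e.toEmbedding) y' (fun _ => (⟨_, hy'⟩ : {x // D'.Valid x})) (fun _ => rfl)
      (fun α h => ?_) (fun α h => ?_)).reindex e) (c := c) (c' := c') (c₃ := c₃) (o := o)
      ?_ ?_ ?_ (fun _ => Iff.rfl) (fun α => ?_) (fun α β h => ?_) ?_ ?_ D.rank D.rank D.rank_injective
      D.rank_injective).trans
      (Cube.hEquiv_reindex _ _ _ _ _ _).symm
  · rw [← hcc α, hinner]
    exact hnone' (fun k => D.res (α.map e.toEmbedding) (P.p.length + k))
      fun h' => h ((hcirc _).2 h')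
  · rw [← hcc α, hinner]
    have h := (hcirc _).1 h
    exact hone' (fun k => D.res (α.map e.toEmbedding) (P.p.length + k)) h.1 h.2.1 h.2.2
  · rintro rfl; omega
  · rintro rfl; omega
  · rintro rfl; omega
  · change ThirdCond c₃ o ((α.map e.symm.toEmbedding).map e.toEmbedding) ∧ _ ∧ _ ↔ _
    have : (α.map e.symm.toEmbedding).map e.toEmbedding = α := by
      rw [Finset.map_map]
      simp
    rw [this]
  · obtain ⟨h1, h2⟩ := h
    have hout : ∀ k, k ≠ P.p.length + a → k ≠ P.p.length + b → D.res α k = D.res β k := by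
      intro k hka hkb
      unfold AnnularDiagram.res
      rw [decide_eq_decide]
      refine exists_congr fun x => and_congr_left fun hx => h1 x ?_ ?_
      · rintro rfl; omega
      · rintro rfl; omega
    ext x z
    refine P.rel_iff ?_ ?_ x z
    · have hagr := hσ.agree_map (β.map e.symm.toEmbedding)
      rw [he] at hagr
      refine ⟨fun k hk => ?_, fun k hk => ?_⟩
      · rw [hout k (by omega) (by omega)]; exact hagr.1 k hk
      · rw [hout _ (by omega) (by omega)]; exact hagr.2 k hk
    · rw [hinner]
      refine hbd (fun k => D.res α (P.p.length + k)) (fun k => D.res β (P.p.length + k))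
        (hout _ (by omega) (by omega)) (fun h => ?_) (fun h => ?_)
      · rw [if_pos ((hcond α).2 h)] at h2
        simp only [← hc, ← hc', D.res_eq_true_iff, D.res_eq_false_iff]
        exact ⟨h2.1, h2.2.1, h2.2.2⟩
      · rw [if_neg (fun h' => h ((hcond α).1 h'))] at h2
        simp only [← hc, ← hc']
        simp only [Bool.eq_iff_iff, D.res_eq_true_iff]
        exact h2
  · have := P.hs_eq hs
    simp only [Nat.cast_zero, add_zero] at this
    exact this.symm
  · have := P.qs_eq hs
    simp only [Nat.cast_zero, sub_zero, mul_zero, add_zero] at this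
    exact this.symm

end Patch

namespace AnnularDiagram

open RWord

variable {D D' : AnnularDiagram} {p r : List Slice}

/-- The resolutions of three crossings, which are horizontal where `x` is `true`. -/
def lowFirst (x₁ x₂ x₃ : Bool) : RWord :=
  [(0, PieceKind.res (.cross true) x₁), (1, PieceKind.res (.cross true) x₂),
    (0, PieceKind.res (.cross true) x₃)]

/-- The resolutions of the three crossings after a third Reidemeister move. -/
def highFirst (x₁ x₂ x₃ : Bool) : RWord :=
  [(1, PieceKind.res (.cross true) x₃), (0, PieceKind.res (.cross true) x₂),
    (1, PieceKind.res (.cross true) x₁)]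

/-- Connectivity depends only on whether a resolution is horizontal, so the finite checks need just
one type of crossing. -/
theorem res_cross (o x : Bool) :
    PieceKind.res (.cross o) x = PieceKind.res (.cross true) (x == o) := by
  cases o <;> cases x <;> rfl

theorem circleExit_three : CircleExit (lowFirst true false true) 3 (2, 0) ∧
    CircleExit (highFirst true false true) 3 (2, 1) := by decide +kernel

theorem allExit_three : ∀ x₁ x₂ x₃ : Bool, ¬ (x₁ = true ∧ x₂ = false ∧ x₃ = true) →
    AllExit (lowFirst x₁ x₂ x₃) 3 ∧ AllExit (highFirst x₁ x₂ x₃) 3 := by decide +kernel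

/-- Here the last crossing plays the part of the third one. If it is horizontal, only the remaining
corner of the face is compared; if it is vertical, the other two crossings can be exchanged. -/
theorem sameExit_three_right : ∀ x₁ x₂ x₃ z₁ z₂ : Bool,
    (x₃ = true → x₁ = false ∧ x₂ = true ∧ z₁ = false ∧ z₂ = true) →
    (x₃ = false → x₁ = z₂ ∧ x₂ = z₁) →
    SameExit (lowFirst x₁ x₂ x₃) (highFirst z₁ z₂ x₃) 3 := by decide +kernel

theorem sameExit_three_left : ∀ x₁ x₂ x₃ z₂ z₃ : Bool,
    (x₁ = true → x₃ = false ∧ x₂ = true ∧ z₃ = false ∧ z₂ = true) →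
    (x₁ = false → x₃ = z₂ ∧ x₂ = z₃) →
    SameExit (lowFirst x₁ x₂ x₃) (highFirst x₁ z₂ z₃) 3 := by decide +kernel

theorem hEquiv_three (hbase : D'.base = D.base) (i : ℕ) (o₁ o₂ o₃ : Bool)
    (ho : o₂ = o₁ ∨ o₂ = o₃)
    (hD : D.word = p ++ [⟨i, .cross o₁⟩, ⟨i + 1, .cross o₂⟩, ⟨i, .cross o₃⟩] ++ r)
    (hD' : D'.word = p ++ [⟨i + 1, .cross o₃⟩, ⟨i, .cross o₂⟩, ⟨i + 1, .cross o₁⟩] ++ r) :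
    D.cubeComplex.HEquiv D'.cubeComplex := by
  have hs := SameRun.shift (fun l => sameRun_three (l := l) o₁ o₂ o₃) i (D.admStack_part hD)
  let P : Patch D D' := .ofRun p _ _ r hbase hD hD' hs
  have hr : ∀ ρ, resolve ρ P.u = shift i (lowFirst (ρ 0 == o₁) (ρ 1 == o₂) (ρ 2 == o₃)) := by
    intro ρ
    simp only [lowFirst, ← res_cross]
    rfl
  have hr' : ∀ ρ : ℕ → Bool, resolve (fun k => ρ (2 - k)) P.u' =
      shift i (highFirst (ρ 0 == o₁) (ρ 1 == o₂) (ρ 2 == o₃)) := by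
    intro ρ
    simp only [highFirst, ← res_cross]
    rfl
  have hcu : ∀ k < 3, (P.u[k]?).map (fun s : Slice => s.kind.isCross) = some true := by
    intro b hb
    obtain rfl | rfl | rfl : b = 0 ∨ b = 1 ∨ b = 2 := by omega
    · rfl
    · rfl
    · rfl
  have hcu' : ∀ k < 3, (P.u'[k]?).map (fun s : Slice => s.kind.isCross) = some true := by
    intro b hb
    obtain rfl | rfl | rfl : b = 0 ∨ b = 1 ∨ b = 2 := by omega
    · rfl
    · rfl
    · rfl
  have h2 : 2 < P.u.length := show 2 < 3 by decide
  obtain ⟨c, hc⟩ := P.exists_crossing_of h2 (hcu 2 (by decide))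
  have hy : D.Valid (sh P.p.length (2, i + 0)) := P.valid_lowerLeft h2 hc rfl
  have h2' : 2 < P.symm.u.length := show 2 < 3 by decide
  obtain ⟨c', hc'⟩ := P.symm.exists_crossing_of h2' (hcu' 2 (by decide))
  have hy' : D'.Valid (sh P.p.length (2, i + 1)) := P.symm.valid_lowerLeft h2' hc' rfl
  have hone : ∀ ρ : ℕ → Bool, ρ 0 = o₁ → ρ 1 ≠ o₂ → ρ 2 = o₃ →
      (resolve ρ P.u).OneCircle (2, i + 0) ∧
      (resolve (fun k => ρ (2 - k)) P.u').OneCircle (2, i + 1) := fun ρ h1 h2 h3 => by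
    rw [hr, hr']
    rw [beq_iff_eq.2 h1, beq_eq_false_iff_ne.2 h2, beq_iff_eq.2 h3]
    exact ⟨circleExit_three.1.oneCircle i, circleExit_three.2.oneCircle i⟩
  have hnone : ∀ ρ : ℕ → Bool, ¬ (ρ 0 = o₁ ∧ ρ 1 ≠ o₂ ∧ ρ 2 = o₃) →
      (resolve ρ P.u).NoCircle ∧ (resolve (fun k => ρ (2 - k)) P.u').NoCircle := fun ρ h => by
    rw [hr, hr']
    have := allExit_three (ρ 0 == o₁) (ρ 1 == o₂) (ρ 2 == o₃) (by simpa using h)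
    exact ⟨this.1.noCircle i, this.2.noCircle i⟩
  -- The circle needs the middle crossing vertical and the outer two horizontal. The outer crossing
  -- that has the type of the middle one forms the face with it, so that the circle is at a corner
  -- with one crossing in the set and one outside; the other outer crossing is the third one. The
  -- common type decides which crossing of the face is in the set.
  rcases ho with rfl | rfl
  · have hbd : ∀ ρ ρ' : ℕ → Bool, ρ 2 = ρ' 2 →
        (ρ 2 = o₃ → ρ 0 ≠ o₂ ∧ ρ 1 = o₂ ∧ ρ' 0 ≠ o₂ ∧ ρ' 1 = o₂) →
        (ρ 2 ≠ o₃ → ρ 0 = ρ' 1 ∧ ρ 1 = ρ' 0) →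
        SameBd (resolve ρ P.u) (resolve (fun k => ρ' (2 - k)) P.u') := fun ρ ρ' h1 h2 h3 => by
      rw [hr, hr', ← h1]
      exact (sameExit_three_right _ _ _ _ _ (by simpa using h2) (by grind)).sameBd i
    cases o₂
    · refine P.hEquiv_three (a := 1) (b := 0) (t := 2) (o := o₃) rfl rfl hcu hcu'
        (by omega) (by omega) (by omega) (by omega) (by omega) (by omega) hy hy'
        (fun ρ h1 h2 h3 => (hone ρ h3 (by simp [h2]) h1).1)
        (fun ρ h1 h2 h3 => (hone ρ h3 (by simp [h2]) h1).2)
        (fun ρ h => (hnone ρ ?_).1) (fun ρ h => (hnone ρ ?_).2)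
        (fun ρ ρ' h1 h2 h3 => hbd ρ ρ' h1 ?_ ?_) hs <;> grind
    · refine P.hEquiv_three (a := 0) (b := 1) (t := 2) (o := o₃) rfl rfl hcu hcu'
        (by omega) (by omega) (by omega) (by omega) (by omega) (by omega) hy hy'
        (fun ρ h1 h2 h3 => (hone ρ h2 (by simp [h3]) h1).1)
        (fun ρ h1 h2 h3 => (hone ρ h2 (by simp [h3]) h1).2)
        (fun ρ h => (hnone ρ ?_).1) (fun ρ h => (hnone ρ ?_).2)
        (fun ρ ρ' h1 h2 h3 => hbd ρ ρ' h1 ?_ ?_) hs <;> grind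
  · have hbd : ∀ ρ ρ' : ℕ → Bool, ρ 0 = ρ' 0 →
        (ρ 0 = o₁ → ρ 2 ≠ o₂ ∧ ρ 1 = o₂ ∧ ρ' 2 ≠ o₂ ∧ ρ' 1 = o₂) →
        (ρ 0 ≠ o₁ → ρ 2 = ρ' 1 ∧ ρ 1 = ρ' 2) →
        SameBd (resolve ρ P.u) (resolve (fun k => ρ' (2 - k)) P.u') := fun ρ ρ' h1 h2 h3 => by
      rw [hr, hr', ← h1]
      exact (sameExit_three_left _ _ _ _ _ (by simpa using h2) (by grind)).sameBd i
    cases o₂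
    · refine P.hEquiv_three (a := 1) (b := 2) (t := 0) (o := o₁) rfl rfl hcu hcu'
        (by omega) (by omega) (by omega) (by omega) (by omega) (by omega) hy hy'
        (fun ρ h1 h2 h3 => (hone ρ h1 (by simp [h2]) h3).1)
        (fun ρ h1 h2 h3 => (hone ρ h1 (by simp [h2]) h3).2)
        (fun ρ h => (hnone ρ ?_).1) (fun ρ h => (hnone ρ ?_).2)
        (fun ρ ρ' h1 h2 h3 => hbd ρ ρ' h1 ?_ ?_) hs <;> grind
    · refine P.hEquiv_three (a := 2) (b := 1) (t := 0) (o := o₁) rfl rfl hcu hcu'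
        (by omega) (by omega) (by omega) (by omega) (by omega) (by omega) hy hy'
        (fun ρ h1 h2 h3 => (hone ρ h1 (by simp [h3]) h2).1)
        (fun ρ h1 h2 h3 => (hone ρ h1 (by simp [h3]) h2).2)
        (fun ρ h => (hnone ρ ?_).1) (fun ρ h => (hnone ρ ?_).2)
        (fun ρ ρ' h1 h2 h3 => hbd ρ ρ' h1 ?_ ?_) hs <;> grind

end AnnularDiagram

/-! ## Rotation of the annulus -/

namespace RWord

/-- The height of a point after the first `a` of `a + b` slices have been moved to the top. -/
def rot (a b k : ℕ) : ℕ := if k < a then b + k else k - a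

variable {u v : RWord}

/-- At the cut, `rot` chooses height `0`, which is glued to the top of the rotated stack; so up to
connectivity both names of that line can be used. -/
theorem conn_rot_low {k : ℕ} (hk : k ≤ u.length) (j : ℕ) :
    (v ++ u).Conn (rot u.length v.length k, j) (v.length + k, j) := by
  unfold rot
  split_ifs with h
  · exact Setoid.refl' _ _
  · obtain rfl : k = u.length := by omega
    have := conn_glue (w := v ++ u) j
    rw [List.length_append] at this
    rw [Nat.sub_self]
    exact Setoid.symm' _ this

theorem conn_rot {x y : ℕ × ℕ} (h : (u ++ v).Conn x y) :
    (v ++ u).Conn (rot u.length v.length x.1, x.2) (rot u.length v.length y.1, y.2) := by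
  induction h with
  | refl x => exact Setoid.refl' _ _
  | symm x y _ ih => exact Setoid.symm' _ ih
  | trans x y z _ _ ih1 ih2 => exact Setoid.trans' _ ih1 ih2
  | rel x y h =>
    obtain ⟨k, j⟩ := x
    obtain ⟨k', j'⟩ := y
    rcases h with ⟨m, b, b', s, hs, hx, hy, h⟩ | ⟨hx, hy⟩
    · simp only at hx hy h
      subst hx hy
      have hb : b.toNat ≤ 1 := Bool.toNat_le b
      have hb' : b'.toNat ≤ 1 := Bool.toNat_le b'
      by_cases hm : m < u.length
      · refine Setoid.trans' _ (conn_rot_low (by omega) j) (Setoid.trans' _ ?_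
          (Setoid.symm' _ (conn_rot_low (by omega) j')))
        rw [List.getElem?_append_left hm] at hs
        refine Link.conn ⟨v.length + m, b, b', s, ?_, by simp only; omega, by simp only; omega, h⟩
        rw [List.getElem?_append_right (by omega), Nat.add_sub_cancel_left, hs]
      · rw [List.getElem?_append_right (by omega)] at hs
        have hm' : m - u.length < v.length := (List.getElem?_eq_some_iff.1 hs).1
        simp only [rot, if_neg (show ¬ m + b.toNat < u.length by omega),
          if_neg (show ¬ m + b'.toNat < u.length by omega)]
        refine Link.conn ⟨m - u.length, b, b', s, ?_, by simp only; omega, by simp only; omega, h⟩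
        rw [List.getElem?_append_left hm', hs]
    · simp only [List.length_append, Prod.mk.injEq] at hx hy
      obtain ⟨rfl, rfl⟩ := hy
      subst hx
      refine Setoid.trans' _ ?_ (Setoid.symm' _ (conn_rot_low (Nat.zero_le _) _))
      simp only [rot, if_neg (show ¬ u.length + v.length < u.length by omega),
        Nat.add_sub_cancel_left, Nat.add_zero]
      exact Setoid.refl' _ _

theorem conn_rot_rot {k : ℕ} (hk : k ≤ u.length + v.length) (j : ℕ) :
    (u ++ v).Conn (rot v.length u.length (rot u.length v.length k), j) (k, j) := by
  by_cases h : k < u.length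
  · simp only [rot, if_pos h, if_neg (show ¬ v.length + k < v.length by omega),
      Nat.add_sub_cancel_left]
    exact Setoid.refl' _ _
  · have := conn_rot_low (u := v) (v := u) (k := k - u.length) (by omega) j
    rw [Nat.add_sub_cancel' (by omega)] at this
    simpa only [rot, if_neg h] using this

theorem conn_rot_iff {x y : ℕ × ℕ} (hx : x.1 ≤ u.length + v.length)
    (hy : y.1 ≤ u.length + v.length) :
    (v ++ u).Conn (rot u.length v.length x.1, x.2) (rot u.length v.length y.1, y.2) ↔
      (u ++ v).Conn x y :=
  ⟨fun h => Setoid.trans' _ (Setoid.symm' _ (conn_rot_rot hx _))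
    (Setoid.trans' _ (conn_rot h) (conn_rot_rot hy _)), conn_rot⟩

end RWord

namespace AnnularDiagram

open RWord

open scoped Classical

/-! ### Parity of the intersection of a cycle with horizontal lines -/

section Parity

variable (D : AnnularDiagram)

/-- The points of a cycle on a horizontal line. -/
noncomputable def onLine (α : Finset D.Crossing) (x : ℕ × ℕ) (k : ℕ) : Set {x // D.Valid x} :=
  {y | y.1.1 = k ∧ (D.rword α).Conn y.1 x}

/-- The arcs of a slice pair off the points of a cycle on its two boundary lines. This is an
involution without fixed points, so the total number of these points is even. -/
theorem odd_onLine_succ (α : Finset D.Crossing) (x : ℕ × ℕ) {k : ℕ} (hk : k < D.word.length) :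
    Odd (D.onLine α x (k + 1)).ncard ↔ Odd (D.onLine α x k).ncard := by
  have hs : (D.rword α)[k]? = some (D.word[k].pos, D.word[k].kind.res (D.res α k)) := by
    rw [getElem?_rword, List.getElem?_eq_getElem hk]
    rfl
  set s := (D.word[k].pos, D.word[k].kind.res (D.res α k))
  have hdis : Disjoint (D.onLine α x k) (D.onLine α x (k + 1)) := by
    rw [Set.disjoint_left]
    rintro y ⟨h1, -⟩ ⟨h2, -⟩
    omega
  have hU := Set.ncard_union_eq hdis
  have hform : ∀ y ∈ D.onLine α x k ∪ D.onLine α x (k + 1),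
      ∃ b : Bool, decide (y.1.1 = k + 1) = b ∧ y.1 = (k + b.toNat, y.1.2) ∧
        (D.rword α).Conn y.1 x := by
    rintro ⟨⟨m, j⟩, hy⟩ (⟨rfl, h⟩ | ⟨rfl, h⟩)
    · exact ⟨false, by simp, rfl, h⟩
    · exact ⟨true, by simp, rfl, h⟩
  let f : ℕ × ℕ → ℕ × ℕ := fun y => across k s (decide (y.1 = k + 1), y.2)
  have hf : ∀ y ∈ D.onLine α x k ∪ D.onLine α x (k + 1), D.Valid (f y.1) ∧
      (f y.1).1 = k + (s.2.partner s.1 (decide (y.1.1 = k + 1), y.1.2)).1.toNat ∧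
      (D.rword α).Conn (f y.1) x ∧ f (f y.1) = y.1 ∧ f y.1 ≠ y.1 := by
    intro y hy
    obtain ⟨b, hb, hy1, hc⟩ := hform y hy
    have hl := link_across hs b y.1.2
    have hfy : f y.1 = across k s (b, y.1.2) := by simp only [f, hb]
    have hl' : (D.rword α).Conn (f y.1) y.1 := by
      rw [hfy, hy1]; exact Setoid.symm' _ hl.conn
    refine ⟨((D.closed_valid α).iff_of_conn hl').2 y.2, rfl, Setoid.trans' _ hl' hc, ?_, ?_⟩
    · rw [hfy]
      have e : ∀ z : Bool × ℕ, f (k + z.1.toNat, z.2) = across k s z := by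
        rintro ⟨_ | _, j⟩ <;> simp [f]
      change f (k + (s.2.partner s.1 (b, y.1.2)).1.toNat, (s.2.partner s.1 (b, y.1.2)).2) = _
      rw [e, across, RPiece.partner_partner, hy1]
    · rw [hfy, hy1]
      intro h
      refine RPiece.partner_ne s.1 s.2 (b, y.1.2) ?_
      have h1 := congrArg Prod.fst h
      have h2 := congrArg Prod.snd h
      simp only [across] at h1 h2
      refine Prod.ext ?_ h2
      have := Nat.add_left_cancel h1
      revert this
      cases b <;> cases (RPiece.partner s.1 s.2 (_, y.1.2)).1 <;> simp
  have hsum : ∑ y ∈ (D.onLine α x k ∪ D.onLine α x (k + 1)).toFinite.toFinset, (1 : ZMod 2) = 0 := by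
    refine Finset.sum_involution (fun y hy => ⟨f y.1, (hf y (by simpa using hy)).1⟩)
      (fun _ _ => by decide) (fun y hy _ h => ?_) (fun y hy => ?_) (fun y hy => ?_)
    · exact (hf y (by simpa using hy)).2.2.2.2 (congrArg Subtype.val h)
    · obtain ⟨h1, h2, h3, -, -⟩ := hf y (by simpa using hy)
      rw [Set.Finite.mem_toFinset]
      have hb : ∀ b : Bool, (f y.1).1 = k + b.toNat → (f y.1).1 = k ∨ (f y.1).1 = k + 1 := by
        rintro (_ | _) h
        exacts [Or.inl h, Or.inr h]
      exact (hb _ h2).imp (fun h => ⟨h, h3⟩) fun h => ⟨h, h3⟩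
    · exact Subtype.ext (hf y (by simpa using hy)).2.2.2.1
  rw [Finset.sum_const, nsmul_eq_mul, mul_one, ZMod.natCast_eq_zero_iff_even,
    ← Set.ncard_eq_toFinset_card, hU, Nat.even_add] at hsum
  rw [← Nat.not_even_iff_odd, ← Nat.not_even_iff_odd, hsum]

/-- The parity of the number of points of a cycle on a horizontal line is the same for all lines. -/
theorem odd_onLine (α : Finset D.Crossing) (x : ℕ × ℕ) {k : ℕ} (hk : k ≤ D.word.length) :
    Odd (D.onLine α x k).ncard ↔ Odd (D.onLine α x 0).ncard := by
  induction k with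
  | zero => rfl
  | succ k ih => rw [D.odd_onLine_succ α x hk, ih (Nat.le_of_lt hk)]

theorem nt_iff_onLine (α : Finset D.Crossing) (x : D.cube.X) :
    D.cube.Nt α x ↔ Odd (D.onLine α x.1 0).ncard := Iff.rfl

end Parity

/-! ### Invariance under rotation -/

section Rotate

variable {D D' : AnnularDiagram} {p r : List Slice}

theorem rot_lt (hD : D.word = p ++ r) (hD' : D'.word = r ++ p) {k : ℕ} (hk : k < D.word.length) :
    rot p.length r.length k < D'.word.length := by
  rw [hD, List.length_append] at hk
  rw [hD', List.length_append]
  unfold rot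
  split_ifs <;> omega

theorem getElem?_rot (hD : D.word = p ++ r) (hD' : D'.word = r ++ p) {k : ℕ}
    (hk : k < D.word.length) : D'.word[rot p.length r.length k]? = D.word[k]? := by
  rw [hD, List.length_append] at hk
  rw [hD', hD]
  unfold rot
  split_ifs with h
  · rw [List.getElem?_append_right (by omega), Nat.add_sub_cancel_left, List.getElem?_append_left h]
  · rw [List.getElem?_append_left (by omega), List.getElem?_append_right (by omega)]

/-- The crossing of the rotated diagram that corresponds to a crossing. -/
def rotCrossing (hD : D.word = p ++ r) (hD' : D'.word = r ++ p) (c : D.Crossing) : D'.Crossing :=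
  ⟨⟨rot p.length r.length c.1, rot_lt hD hD' c.1.2⟩, by
    have h := getElem?_rot hD hD' c.1.2
    have hc := c.2
    rw [List.getElem?_eq_getElem (rot_lt hD hD' c.1.2), List.getElem?_eq_getElem c.1.2,
      Option.some.injEq] at h
    simp only [Fin.getElem_fin] at hc ⊢
    rw [h, hc]⟩

theorem rotCrossing_rotCrossing (hD : D.word = p ++ r) (hD' : D'.word = r ++ p) (c : D.Crossing) :
    rotCrossing hD' hD (rotCrossing hD hD' c) = c := by
  refine Subtype.ext (Fin.ext ?_)
  have hc : (c.1 : ℕ) < p.length + r.length := by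
    rw [← List.length_append, ← hD]; exact c.1.2
  change rot r.length p.length (rot p.length r.length c.1) = c.1
  unfold rot
  split_ifs <;> omega

/-- The bijection of the crossings of a diagram with those of the rotated diagram. -/
def rotEquiv (hD : D.word = p ++ r) (hD' : D'.word = r ++ p) : D.Crossing ≃ D'.Crossing where
  toFun := rotCrossing hD hD'
  invFun := rotCrossing hD' hD
  left_inv := rotCrossing_rotCrossing hD hD'
  right_inv := rotCrossing_rotCrossing hD' hD

theorem res_rot (hD : D.word = p ++ r) (hD' : D'.word = r ++ p) (α : Finset D.Crossing) {k : ℕ}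
    (hk : k < D.word.length) :
    D'.res (α.map (rotEquiv hD hD').toEmbedding) (rot p.length r.length k) = D.res α k := by
  unfold res
  rw [decide_eq_decide]
  constructor
  · rintro ⟨c, hc, h⟩
    obtain ⟨c, hc', rfl⟩ := Finset.mem_map.1 hc
    refine ⟨c, hc', ?_⟩
    have h : rot p.length r.length c.1 = rot p.length r.length k := h
    have hc : (c.1 : ℕ) < p.length + r.length := by
      rw [← List.length_append, ← hD]; exact c.1.2
    rw [hD, List.length_append] at hk
    unfold rot at h
    split_ifs at h <;> omega
  · rintro ⟨c, hc, rfl⟩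
    exact ⟨_, Finset.mem_map_of_mem _ hc, rfl⟩

theorem rword_rot (hD : D.word = p ++ r) (hD' : D'.word = r ++ p) (α : Finset D.Crossing) :
    D.rword α = resolve (D.res α) p ++ resolve (fun k => D.res α (p.length + k)) r ∧
    D'.rword (α.map (rotEquiv hD hD').toEmbedding) =
      resolve (fun k => D.res α (p.length + k)) r ++ resolve (D.res α) p := by
  constructor
  · change resolve _ D.word = _
    rw [hD, resolve_append]
  · change resolve _ D'.word = _
    have hl : D.word.length = p.length + r.length := by rw [hD, List.length_append]
    rw [hD', resolve_append]
    congr 1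
    · refine resolve_congr fun k hk => ?_
      rw [← res_rot hD hD' α (by omega)]
      simp [rot]
    · refine resolve_congr fun k hk => ?_
      rw [← res_rot hD hD' α (by omega), rot, if_pos hk]

theorem level_rot_low (hD : D.word = p ++ r) (hD' : D'.word = r ++ p)
    (hbase : D'.base = runSlices p D.base) {k : ℕ} (hk : k ≤ p.length) :
    D'.level (r.length + k) = D.level k := by
  have hc := D.closed
  unfold level
  rw [hD, runSlices_append] at hc
  rw [hD, hD', List.take_length_add_append, List.take_append_of_le_length hk, runSlices_append,
    hbase, hc]

theorem level_rot_high (hD : D.word = p ++ r) (hD' : D'.word = r ++ p)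
    (hbase : D'.base = runSlices p D.base) {k : ℕ} (hk : k ≤ r.length) :
    D'.level k = D.level (p.length + k) := by
  unfold level
  rw [hD, hD', List.take_length_add_append, List.take_append_of_le_length hk, runSlices_append,
    hbase]

theorem valid_rot (hD : D.word = p ++ r) (hD' : D'.word = r ++ p)
    (hbase : D'.base = runSlices p D.base) {x : ℕ × ℕ} (hx : D.Valid x) :
    D'.Valid (rot p.length r.length x.1, x.2) := by
  obtain ⟨h1, h2⟩ := hx
  rw [hD, List.length_append] at h1
  unfold Valid rot
  rw [hD', List.length_append]
  split_ifs with h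
  · exact ⟨by simp only; omega, by simpa only [level_rot_low hD hD' hbase h.le] using h2⟩
  · refine ⟨by simp only; omega, ?_⟩
    simp only
    rw [level_rot_high hD hD' hbase (by omega), Nat.add_sub_cancel' (by omega)]
    exact h2

theorem base_rot (hD : D.word = p ++ r) (hbase : D'.base = runSlices p D.base) :
    D.base = runSlices r D'.base := by
  have hc := D.closed
  rw [hD, runSlices_append] at hc
  rw [hbase, hc]

/-- Rotation identifies the curves of all resolutions and preserves the signs of the crossings. It
permutes the order of the crossings, which `Cube.hEquiv_of_match` allows, and it moves the cutting
ray. -/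
theorem hEquiv_rotate (hD : D.word = p ++ r) (hD' : D'.word = r ++ p)
    (hbase : D'.base = runSlices p D.base) : D.cubeComplex.HEquiv D'.cubeComplex := by
  have hlen : D.word.length = p.length + r.length := by rw [hD, List.length_append]
  have hlen' : D'.word.length = r.length + p.length := by rw [hD', List.length_append]
  let ψ : D.cube.X → D'.cube.X := fun x =>
    (⟨_, valid_rot hD hD' hbase x.2⟩ : {x // D'.Valid x})
  have hrel : ∀ (α : Finset D.Crossing) (x y : ℕ × ℕ), D.Valid x → D.Valid y →
      ((D'.rword (α.map (rotEquiv hD hD').toEmbedding)).Conn (rot p.length r.length x.1, x.2)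
        (rot p.length r.length y.1, y.2) ↔ (D.rword α).Conn x y) := by
    intro α x y hx hy
    obtain ⟨h1, h2⟩ := rword_rot hD hD' α
    have := conn_rot_iff (u := resolve (D.res α) p)
      (v := resolve (fun k => D.res α (p.length + k)) r) (x := x) (y := y)
      (by simpa [← hlen] using hx.1) (by simpa [← hlen] using hy.1)
    rw [h1, h2]
    simpa only [length_resolve] using this
  refine D.cube.hEquiv_of_match D'.cube D.rank D'.rank D.rank_injective D'.rank_injective
    (rotEquiv hD hD') id ψ (fun α => ⟨⟨fun x => ⟨x, (D.cube.E α).refl x⟩, fun x => ?_,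
      fun x y => (hrel α _ _ x.2 y.2).symm⟩, fun x => ?_⟩) ?_ ?_
  · refine ⟨(⟨_, valid_rot hD' hD (base_rot hD hbase) x.2⟩ : {x // D.Valid x}), ?_⟩
    change (D'.rword _).Conn x.1
      (rot p.length r.length (rot r.length p.length x.1.1), x.1.2)
    have := conn_rot_rot (u := resolve (fun k => D.res α (p.length + k)) r)
      (v := resolve (D.res α) p) (k := x.1.1) (by simpa [← hlen'] using x.2.1) x.1.2
    rw [(rword_rot hD hD' α).2]
    simp only [length_resolve] at this
    exact Setoid.symm' _ this
  -- The new cutting ray is the old line at height `p.length`. It gives the same notion of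
  -- nontrivial cycle because all lines give the same parity.
  · rw [nt_iff_onLine, nt_iff_onLine, ← D.odd_onLine α _ (show p.length ≤ _ by omega)]
    refine iff_of_eq (congrArg Odd ?_)
    refine Set.ncard_congr (fun y _ => ψ y) (fun y hy => ?_) (fun y z hy hz h => ?_) (fun z hz => ?_)
    · refine ⟨?_, (hrel α _ _ y.2 x.2).2 hy.2⟩
      change rot p.length r.length y.1.1 = 0
      rw [hy.1]
      simp [rot]
    · refine Subtype.ext (Prod.ext (hy.1.trans hz.1.symm) ?_)
      exact congrArg (fun t => t.1.2) h
    · obtain ⟨⟨k, j⟩, hv⟩ := z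
      obtain ⟨rfl, hz⟩ := hz
      have hv' : D.Valid (p.length, j) := by
        refine ⟨by simp only; omega, ?_⟩
        have := hv.2
        simp only at this
        rwa [level_rot_high hD hD' hbase (Nat.zero_le _)] at this
      have e : rot p.length r.length p.length = 0 := by simp [rot]
      refine ⟨⟨_, hv'⟩, ⟨rfl, (hrel α _ _ hv' x.2).1 ?_⟩, ?_⟩
      · simp only [e]
        exact hz
      · refine Subtype.ext (Prod.ext e rfl)
  · change - D.nMinus = - D'.nMinus
    rw [nMinus_eq, nMinus_eq, hD, hD', signCount_append, signCount_append, ← hbase,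
      ← base_rot hD hbase, Nat.add_comm]
  · change D.nPlus - 2 * D.nMinus = D'.nPlus - 2 * D'.nMinus
    rw [nMinus_eq, nMinus_eq, nPlus_eq, nPlus_eq, hD, hD']
    simp only [signCount_append, ← hbase, ← base_rot hD hbase]
    push_cast
    ring

end Rotate

/-! ## Invariance -/

theorem hEquiv_of_localMove {D D' : AnnularDiagram} {p u u' r : List Slice} (h : LocalMove u u')
    (hbase : D'.base = D.base) (hD : D.word = p ++ u ++ r) (hD' : D'.word = p ++ u' ++ r) :
    D.cubeComplex.HEquiv D'.cubeComplex := by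
  cases h with
  | exchange i d S T => exact hEquiv_exchange hbase i d S T hD hD'
  | zigzag_left i a => exact hEquiv_zigzag_left hbase i a hD hD'
  | zigzag_right i a => exact hEquiv_zigzag_right hbase i a hD hD'
  | slide_cup i a o => exact hEquiv_slide_cup hbase i a o hD hD'
  | slide_cap i o => exact hEquiv_slide_cap hbase i o hD hD'
  | reidemeister_one_right i a o => exact hEquiv_one_right hbase i a o hD hD'
  | reidemeister_one_left i a o => exact hEquiv_one_left hbase i a o hD hD'
  | reidemeister_two i o => exact hEquiv_two hbase i o hD hD'
  | reidemeister_three i o₁ o₂ o₃ h => exact hEquiv_three hbase i o₁ o₂ o₃ h hD hD'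

theorem hEquiv_of_isotopic {D D' : AnnularDiagram} (h : D.Isotopic D') :
    D.cubeComplex.HEquiv D'.cubeComplex := by
  induction h with
  | rel D D' h =>
    cases h with
    | localMove p u u' r h hbase hD hD' => exact hEquiv_of_localMove h hbase hD hD'
    | rotate p r hD hD' hbase => exact hEquiv_rotate hD hD' hbase
  | refl D => exact D.cube.hEquiv_rank D.rank D.rank D.rank_injective D.rank_injective
  | symm D D' _ ih => exact ih.symm
  | trans D D' D'' _ _ ih₁ ih₂ => exact ih₁.trans ih₂

end AnnularDiagram

theorem mainTheorem2 :
    (∀ D : AnnularDiagram,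
      D.dKh = D.dKhPart 0 + D.dKhPart (-2) ∧ IsGradedComplex D.homogeneous D.dTilde) ∧
    (∀ D D' : AnnularDiagram, D.Isotopic D' →
      GradedHomotopyEquivalent D.homogeneous D.dTilde D'.homogeneous D'.dTilde) :=
  ⟨fun D => ⟨AnnularDiagram.dKh_eq_add D.dKh_annular,
    AnnularDiagram.isGradedComplex D.dKh_annular D.filt_dKh D.dKh_mul_dKh⟩,
    fun _ _ h => AnnularDiagram.gradedHomotopyEquivalent_of_cubeComplex
      (AnnularDiagram.hEquiv_of_isotopic h)⟩
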